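/- **Setting.** Let $n\ge 1$ and let $(X,\omega,J,\Omega)$ be a Calabi--Yau manifold of complex dimension $n$: $(X,J,\omega)$ is Kähler with metric $g=\omega(\cdot,J\cdot)$ and $\Omega$ is a holomorphic $n$-form with $(-1)^{n(n-1)/2}(\tfrac{i}{2})^n\,\Omega\wedge\overline\Omega=\tfrac{1}{n!}\omega^n$ (so $g$ is Ricci flat). Let $L$ be a compact smooth $n$-manifold with (possibly empty) smooth boundary, whose boundary components are $C_1,\dots,C_d$, and let $\Lambda_1,\dots,\Lambda_d\subset X$ be pairwise disjoint embedded Lagrangian submanifolds. $\mathrm{Diff}(L)$ is the group of diffeomorphisms of $L$ that map each boundary component into itself. An immersion $h:L\to X$ is *free* if $\psi\in\mathrm{Diff}(L)$ and $h\circ\psi=h$ imply $\psi=\mathrm{id}$, and *Lagrangian* if $h^*\omega=0$. A smooth map $h:L\to X$ *has boundary conditions* $\Lambda_1,\dots,\Lambda_d$ if, for every $i$ and every $p\in C_i$, $h(p)\in\Lambda_i$ and $dh(T_pL)\not\subset T_{h(p)}\Lambda_i$. $A^1_D(L)$ is the space of smooth $1$-forms on $L$ whose pullback to $\partial L$ vanishes,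 with the $C^1$ topology. Let $f:L\to X$ be a free Lagrangian immersion with boundary conditions $\Lambda_1,\dots,\Lambda_d$. Let $a:L\to\mathbb R$ be a smooth function such that the bundle $E\subset f^*TX$, $E_p=(a(p)+J)\,df(T_pL)$, satisfies $\dim(E_p\cap T_{f(p)}\Lambda_i)=1$ for all $p\in C_i$, $1\le i\le d$, and let $\Phi:E\to T^*L$ be the isomorphism $\Phi(V)=\omega(V,df(\cdot))$. Let $\nabla^\Lambda$ be a smooth affine connection on $X$ for which $\Lambda_1,\dots,\Lambda_d$ are geodesic submanifolds (a geodesic starting tangentially to $\Lambda_i$ stays in $\Lambda_i$ for a short time), and let $\exp^\Lambda$ be its exponential map. For $\theta\in A^1_D(L)$ put $$f_\theta(p)=\exp^\Lambda_{f(p)}\big(\Phi^{-1}(\theta_p)\big),\qquad p\in L,$$ whenever the exponential is defined for all $p$. **Claim.** There is an open neighborhood $\mathcal N$ of $0$ in $A^1_D(L)$ such that: (i) for every $\theta\in\mathcal N$, $f_\theta$ is defined and is a free (smooth) immersion with boundary conditions $\Lambda_1,\dots,\Lambda_d$. Moreover $f_0=f$, and for every $\theta\in A^1_D(L)$ and $p\in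 L$ the curve $t\mapsto f_{t\theta}(p)$ is differentiable at $t=0$, and $$f^*\Big(i_{\frac{d}{dt}\big|_{t=0}f_{t\theta}}\,\omega\Big)=\theta .$$ (ii) Conversely, there is a $C^1$-neighborhood $\mathcal U$ of $f$ in $C^\infty(L,X)$ such that every $f_1\in\mathcal U$ with boundary conditions $\Lambda_1,\dots,\Lambda_d$ is of the form $f_1=f_\theta\circ\varphi$ for some $\theta\in\mathcal N$ and some $\varphi\in\mathrm{Diff}(L)$. -/

import Mathlib

open Set Filter Topology Bundle Manifold
open scoped ContDiff

noncomputable section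

namespace LagBdry

/-! ### Velocities, tangent spaces of subsets, embedded submanifolds, differential forms -/

section General

variable {E : Type*} [NormedAddCommGroup E] [NormedSpace ℝ E]
  {H : Type*} [TopologicalSpace H] (I : ModelWithCorners ℝ E H)
  {M : Type*} [TopologicalSpace M] [ChartedSpace H M]

/-- The velocity vector `γ'(t)` of a curve, as a point of the tangent bundle. -/
def velocity (γ : ℝ → M) (t : ℝ) : TangentBundle I M :=
  tangentMap 𝓘(ℝ, ℝ) I γ ⟨t, (1 : ℝ)⟩

/-- The tangent space at `x` of a subset `S` of `M`: the span of the velocities at `x` of smooth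
curves lying in `S`.  For `S` an embedded submanifold (or the boundary of `M`) the span is
superfluous and this is the usual tangent space. -/
def tangentOf (S : Set M) (x : M) : Submodule ℝ (TangentSpace I x) :=
  Submodule.span ℝ {v | ∃ γ : ℝ → M, ContMDiffAt 𝓘(ℝ, ℝ) I ∞ γ 0 ∧ (∀ᶠ t in 𝓝 0, γ t ∈ S) ∧
    velocity I γ 0 = ⟨x, v⟩}

/-- A differential `k`-form `α` on `M` with values in `F`, read in the preferred chart at `x₀`:
the pullback of `α` under the inverse of the chart. -/
def formInChart {F : Type*} [NormedAddCommGroup F] [NormedSpace ℝ F] {k : ℕ}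
    (α : ∀ x : M, TangentSpace I x [⋀^Fin k]→L[ℝ] F) (x₀ : M) (y : E) : E [⋀^Fin k]→L[ℝ] F :=
  (α ((extChartAt I x₀).symm y)).compContinuousLinearMap
    (mfderivWithin 𝓘(ℝ, E) I (extChartAt I x₀).symm (range I) y)

/-- Smoothness of a differential form: its coefficients in charts are smooth. -/
def IsSmoothForm {F : Type*} [NormedAddCommGroup F] [NormedSpace ℝ F] {k : ℕ}
    (α : ∀ x : M, TangentSpace I x [⋀^Fin k]→L[ℝ] F) : Prop :=
  ∀ x₀ : M, ContDiffOn ℝ ∞ (formInChart I α x₀) (extChartAt I x₀).target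

/-- `dα = 0`, the exterior derivative being computed in charts. -/
def IsClosedForm {F : Type*} [NormedAddCommGroup F] [NormedSpace ℝ F] {k : ℕ}
    (α : ∀ x : M, TangentSpace I x [⋀^Fin k]→L[ℝ] F) : Prop :=
  ∀ x₀ : M, ∀ y ∈ (extChartAt I x₀).target,
    extDerivWithin (formInChart I α x₀) (range I) y = 0

end General

/-- `S` is an embedded (not necessarily closed) `k`-dimensional smooth submanifold of the
`m`-manifold `X`: near each of its points there is a slice chart. -/
def IsEmbeddedSubmanifold (m : ℕ) {X : Type*} [TopologicalSpace X]
    [ChartedSpace (EuclideanSpace ℝ (Fin m)) X] (k : ℕ) (S : Set X) : Prop :=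
  ∀ x ∈ S, ∃ φ ∈ IsManifold.maximalAtlas (𝓡 m) ∞ X, x ∈ φ.source ∧
    ∃ W : Submodule ℝ (EuclideanSpace ℝ (Fin m)), Module.finrank ℝ W = k ∧
      φ.source ∩ S = φ.source ∩ φ ⁻¹' (W : Set (EuclideanSpace ℝ (Fin m)))

/-! ### Calabi--Yau manifolds -/

/-- A Calabi--Yau structure on a real `2n`-manifold `X`: an integrable almost complex structure
`J`, a Kähler form `ω`, and a holomorphic (that is, `J`-complex multilinear and closed) `n`-form
`Ω` of constant length, normalized so that
`(-1)^(n(n-1)/2) (i/2)^n Ω ∧ conj Ω = ω^n / n!`; as an equation of top-degree forms the latter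
says `|Ω(e₁, …, eₙ)| = 1` for each unitary frame.  Ricci flatness of the Kähler metric
`g = ω(·, J ·)` is a consequence. -/
structure CalabiYau (n : ℕ) (X : Type*) [TopologicalSpace X]
    [ChartedSpace (EuclideanSpace ℝ (Fin (2 * n))) X] [IsManifold (𝓡 (2 * n)) ∞ X] where
  J : ∀ x : X, TangentSpace (𝓡 (2 * n)) x →L[ℝ] TangentSpace (𝓡 (2 * n)) x
  J_smooth : ContMDiff (𝓡 (2 * n)) ((𝓡 (2 * n)).prod
      𝓘(ℝ, EuclideanSpace ℝ (Fin (2 * n)) →L[ℝ] EuclideanSpace ℝ (Fin (2 * n)))) ∞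
    (fun x ↦ TotalSpace.mk' (EuclideanSpace ℝ (Fin (2 * n)) →L[ℝ] EuclideanSpace ℝ (Fin (2 * n)))
      (E := fun x : X ↦ TangentSpace (𝓡 (2 * n)) x →L[ℝ] TangentSpace (𝓡 (2 * n)) x) x (J x))
  J_sq : ∀ x v, J x (J x v) = -v
  /-- the Nijenhuis tensor of `J` vanishes -/
  J_integrable : ∀ V W : (∀ x : X, TangentSpace (𝓡 (2 * n)) x),
    ContMDiff (𝓡 (2 * n)) (𝓡 (2 * n)).tangent ∞ (fun x ↦ (⟨x, V x⟩ : TangentBundle _ X)) →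
    ContMDiff (𝓡 (2 * n)) (𝓡 (2 * n)).tangent ∞ (fun x ↦ (⟨x, W x⟩ : TangentBundle _ X)) →
    ∀ x, VectorField.mlieBracket (𝓡 (2 * n)) (fun y ↦ J y (V y)) (fun y ↦ J y (W y)) x
      - J x (VectorField.mlieBracket (𝓡 (2 * n)) (fun y ↦ J y (V y)) W x)
      - J x (VectorField.mlieBracket (𝓡 (2 * n)) V (fun y ↦ J y (W y)) x)
      - VectorField.mlieBracket (𝓡 (2 * n)) V W x = 0
  omega : ∀ x : X, TangentSpace (𝓡 (2 * n)) x [⋀^Fin 2]→L[ℝ] ℝ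
  omega_smooth : IsSmoothForm (𝓡 (2 * n)) omega
  omega_closed : IsClosedForm (𝓡 (2 * n)) omega
  omega_J : ∀ x v w, omega x ![J x v, J x w] = omega x ![v, w]
  omega_pos : ∀ x v, v ≠ 0 → 0 < omega x ![v, J x v]
  Omega : ∀ x : X, TangentSpace (𝓡 (2 * n)) x [⋀^Fin n]→L[ℝ] ℂ
  Omega_smooth : IsSmoothForm (𝓡 (2 * n)) Omega
  Omega_closed : IsClosedForm (𝓡 (2 * n)) Omega
  Omega_J : ∀ x (v : Fin n → TangentSpace (𝓡 (2 * n)) x) (i : Fin n),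
    Omega x (Function.update v i (J x (v i))) = Complex.I * Omega x v
  Omega_norm : ∀ x (e : Fin n → TangentSpace (𝓡 (2 * n)) x),
    (∀ i j, omega x ![e i, J x (e j)] = if i = j then 1 else 0) → (∀ i j, omega x ![e i, e j] = 0) →
    ‖Omega x e‖ = 1

section Omega

variable {n : ℕ} {X : Type*} [TopologicalSpace X]
  [ChartedSpace (EuclideanSpace ℝ (Fin (2 * n))) X] [IsManifold (𝓡 (2 * n)) ∞ X]
  (K : CalabiYau n X)

namespace CalabiYau

lemma omega_add_left (x : X) (v v' w : TangentSpace (𝓡 (2 * n)) x) :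
    K.omega x ![v + v', w] = K.omega x ![v, w] + K.omega x ![v', w] :=
  (K.omega x).toContinuousMultilinearMap.cons_add ![w] v v'

lemma omega_smul_left (x : X) (c : ℝ) (v w : TangentSpace (𝓡 (2 * n)) x) :
    K.omega x ![c • v, w] = c * K.omega x ![v, w] :=
  (K.omega x).toContinuousMultilinearMap.cons_smul ![w] c v

lemma omega_swap (x : X) (v w : TangentSpace (𝓡 (2 * n)) x) :
    K.omega x ![v, w] = - K.omega x ![w, v] := by
  have h := (K.omega x).map_swap ![w, v] (i := 0) (j := 1) (by decide)
  have h2 : (![w, v] ∘ ⇑(Equiv.swap (0 : Fin 2) 1)) = ![v, w] := by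
    ext i
    fin_cases i <;> rfl
  rw [h2] at h
  exact h

lemma omega_self (x : X) (v : TangentSpace (𝓡 (2 * n)) x) : K.omega x ![v, v] = 0 := by
  have h := K.omega_swap x v v
  linarith

lemma omega_add_right (x : X) (v w w' : TangentSpace (𝓡 (2 * n)) x) :
    K.omega x ![v, w + w'] = K.omega x ![v, w] + K.omega x ![v, w'] := by
  rw [omega_swap, omega_add_left, K.omega_swap x w, K.omega_swap x w']
  ring

lemma omega_smul_right (x : X) (c : ℝ) (v w : TangentSpace (𝓡 (2 * n)) x) :
    K.omega x ![v, c • w] = c * K.omega x ![v, w] := by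
  rw [omega_swap, omega_smul_left, K.omega_swap x w]
  ring

/-- `ω((c + J) u, u) ≠ 0` for `u ≠ 0`. -/
lemma eq_zero_of_omega_rotate (x : X) (c : ℝ) (u : TangentSpace (𝓡 (2 * n)) x)
    (h : K.omega x ![c • u + K.J x u, u] = 0) : u = 0 := by
  by_contra hu
  have h1 := K.omega_pos x u hu
  rw [omega_add_left, omega_smul_left, omega_self, K.omega_swap x (K.J x u) u] at h
  linarith

end CalabiYau

end Omega

/-! ### Affine connections: geodesics, exponential map, geodesic submanifolds -/

section Connection

variable {m : ℕ} {X : Type*} [TopologicalSpace X]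
  [ChartedSpace (EuclideanSpace ℝ (Fin m)) X] [IsManifold (𝓡 m) ∞ X]
  (D : CovariantDerivative (𝓡 m) (EuclideanSpace ℝ (Fin m))
    (TangentSpace (𝓡 m) : X → Type _))

/-- The Christoffel symbol `Γ(v, w)` of the connection at the point `y`, in the preferred chart at
`x₀`: the coordinates of `∇_v w̄`, where `w̄` is the vector field with constant coordinates `w`. -/
def christoffel (x₀ y : X) (v w : EuclideanSpace ℝ (Fin m)) : EuclideanSpace ℝ (Fin m) :=
  letI e := trivializationAt (EuclideanSpace ℝ (Fin m)) (TangentSpace (𝓡 m) : X → Type _) x₀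
  (e ⟨y, D (fun z ↦ e.symm z w) y (e.symm y v)⟩).2

/-- `γ` is a geodesic on the open set `s` of times: in every chart, `u'' + Γ(u', u') = 0`. -/
def IsGeodesicOn (γ : ℝ → X) (s : Set ℝ) : Prop :=
  IsOpen s ∧ ContMDiffOn 𝓘(ℝ, ℝ) (𝓡 m) 2 γ s ∧
    ∀ x₀ : X, ∀ t ∈ s, γ t ∈ (extChartAt (𝓡 m) x₀).source →
      iteratedDeriv 2 (fun r ↦ extChartAt (𝓡 m) x₀ (γ r)) t +
        christoffel D x₀ (γ t) (deriv (fun r ↦ extChartAt (𝓡 m) x₀ (γ r)) t)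
          (deriv (fun r ↦ extChartAt (𝓡 m) x₀ (γ r)) t) = 0

/-- `y = exp_x(v)`: a geodesic with initial velocity `v ∈ T_x X` exists up to time `1` and is at
`y` at that time. -/
def IsExp (x : X) (v : TangentSpace (𝓡 m) x) (y : X) : Prop :=
  ∃ (γ : ℝ → X) (s : Set ℝ), Icc 0 1 ⊆ s ∧ IsGeodesicOn D γ s ∧
    velocity (𝓡 m) γ 0 = ⟨x, v⟩ ∧ γ 1 = y

open Classical in
/-- The exponential map of the connection (with value `x` where it is not defined). -/
def expMap (x : X) (v : TangentSpace (𝓡 m) x) : X :=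
  if h : ∃ y, IsExp D x v y then h.choose else x

/-- `S` is a geodesic submanifold: geodesics starting tangentially to `S` stay in `S` (for a
short time). -/
def IsGeodesicSubmanifold (S : Set X) : Prop :=
  ∀ x ∈ S, ∀ v ∈ tangentOf (𝓡 m) S x, ∀ (γ : ℝ → X) (s : Set ℝ), (0 : ℝ) ∈ s →
    IsGeodesicOn D γ s → velocity (𝓡 m) γ 0 = ⟨x, v⟩ → ∀ᶠ t in 𝓝 (0 : ℝ), γ t ∈ S

end Connection

/-! ### The `C¹` topology -/

/-- The `C¹` topology on the space of smooth maps: the topology induced by `f ↦ Tf` from the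
compact-open topology on the continuous maps `TM → TN`. -/
@[reducible] def c1Topology {E : Type*} [NormedAddCommGroup E] [NormedSpace ℝ E]
    {H : Type*} [TopologicalSpace H] (I : ModelWithCorners ℝ E H)
    (M : Type*) [TopologicalSpace M] [ChartedSpace H M] [IsManifold I ∞ M]
    {E' : Type*} [NormedAddCommGroup E'] [NormedSpace ℝ E']
    {H' : Type*} [TopologicalSpace H'] (I' : ModelWithCorners ℝ E' H')
    (N : Type*) [TopologicalSpace N] [ChartedSpace H' N] [IsManifold I' ∞ N] :
    TopologicalSpace C^∞⟮I, M; I', N⟯ :=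
  TopologicalSpace.induced
    (fun f ↦ (⟨tangentMap I I' f, f.contMDiff.continuous_tangentMap (by simp)⟩ :
      C(TangentBundle I M, TangentBundle I' N)))
    inferInstance

section Source

variable (n : ℕ) [NeZero n] (L : Type*) [TopologicalSpace L]
  [ChartedSpace (EuclideanHalfSpace n) L] [IsManifold (𝓡∂ n) ∞ L]

/-! ### One-forms on a manifold with boundary -/

/-- Smooth `1`-forms on `L`. -/
abbrev OneForm : Type _ :=
  Cₛ^∞⟮𝓡∂ n; EuclideanSpace ℝ (Fin n) →L[ℝ] ℝ, fun p : L ↦ TangentSpace (𝓡∂ n) p →L[ℝ] ℝ⟯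

/-- `A¹_D(L)`: smooth `1`-forms whose pullback to `∂L` is zero. -/
def DirichletOneForm : Submodule ℝ (OneForm n L) where
  carrier := {θ | ∀ p ∈ (𝓡∂ n).boundary L, ∀ Y ∈ tangentOf (𝓡∂ n) ((𝓡∂ n).boundary L) p,
    θ p Y = 0}
  add_mem' := by
    intro θ η hθ hη p hp Y hY
    have h : (θ + η) p Y = θ p Y + η p Y := rfl
    rw [h, hθ p hp Y hY, hη p hp Y hY, add_zero]
  zero_mem' := fun _ _ _ _ ↦ rfl
  smul_mem' := by
    intro c θ hθ p hp Y hY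
    have h : (c • θ) p Y = c • θ p Y := rfl
    rw [h, hθ p hp Y hY, smul_zero]

/-- The `C¹` topology on `A¹_D(L)`, a form being regarded as a smooth map `L → T*L`. -/
instance : TopologicalSpace (DirichletOneForm n L) :=
  TopologicalSpace.induced
    (fun θ ↦ (⟨fun p ↦ TotalSpace.mk' (EuclideanSpace ℝ (Fin n) →L[ℝ] ℝ) p (θ.1 p),
        θ.1.contMDiff⟩ :
      C^∞⟮𝓡∂ n, L; (𝓡∂ n).prod 𝓘(ℝ, EuclideanSpace ℝ (Fin n) →L[ℝ] ℝ),
        TotalSpace (EuclideanSpace ℝ (Fin n) →L[ℝ] ℝ)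
          (fun p : L ↦ TangentSpace (𝓡∂ n) p →L[ℝ] ℝ)⟯))
    (c1Topology _ _ _ _)

/-! ### Diffeomorphisms, boundary components -/

/-- `Diff(L)`: diffeomorphisms of `L` mapping each boundary component into itself. -/
def Diff : Set (L ≃ₘ^∞⟮𝓡∂ n, 𝓡∂ n⟯ L) :=
  {ψ | ∀ p ∈ (𝓡∂ n).boundary L,
    MapsTo ψ (connectedComponentIn ((𝓡∂ n).boundary L) p)
      (connectedComponentIn ((𝓡∂ n).boundary L) p)}

variable {L}

/-- `C₁, …, C_d` is an ordering, without repetition, of the connected components of `∂L`. -/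
def IsBoundaryOrdering {d : ℕ} (C : Fin d → Set L) : Prop :=
  Function.Injective C ∧
    range C = connectedComponentIn ((𝓡∂ n).boundary L) '' (𝓡∂ n).boundary L

end Source

/-! ### Lagrangian immersions with boundary conditions -/

section Immersions

variable {n : ℕ} [NeZero n]
  {L : Type*} [TopologicalSpace L] [ChartedSpace (EuclideanHalfSpace n) L]
  [IsManifold (𝓡∂ n) ∞ L]
  {X : Type*} [TopologicalSpace X]
  [ChartedSpace (EuclideanSpace ℝ (Fin (2 * n))) X] [IsManifold (𝓡 (2 * n)) ∞ X]

variable (n) in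
/-- The differential `df_p : T_p L → T_{f(p)} X`. -/
abbrev diff (f : L → X) (p : L) :
    TangentSpace (𝓡∂ n) p →L[ℝ] TangentSpace (𝓡 (2 * n)) (f p) :=
  mfderiv (𝓡∂ n) (𝓡 (2 * n)) f p

variable (n) in
/-- Smooth maps with injective differential. -/
def IsImm (f : L → X) : Prop :=
  ContMDiff (𝓡∂ n) (𝓡 (2 * n)) ∞ f ∧ ∀ p, Function.Injective (diff n f p)

variable (n) in
/-- `f` has trivial stabilizer under reparametrization by `Diff(L)`. -/
def IsFree (f : L → X) : Prop :=
  ∀ ψ ∈ Diff n L, f ∘ ψ = f → ∀ p, ψ p = p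

variable (n) in
/-- `f` has boundary condition `Λ₁, …, Λ_d`. -/
def HasBoundaryCondition {d : ℕ} (C : Fin d → Set L) (Λ : Fin d → Set X) (f : L → X) : Prop :=
  (∀ i, ∀ p ∈ C i, f p ∈ Λ i) ∧
  ∀ i, ∀ p ∈ C i, ¬ (diff n f p).range ≤ tangentOf (𝓡 (2 * n)) (Λ i) (f p)

namespace CalabiYau

variable (K : CalabiYau n X)

/-- Embedded Lagrangian submanifolds: of half the dimension, with `ω` vanishing on tangent
vectors. -/
def IsLagrangianSubmanifold (S : Set X) : Prop :=
  IsEmbeddedSubmanifold (2 * n) n S ∧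
    ∀ x ∈ S, ∀ v ∈ tangentOf (𝓡 (2 * n)) S x, ∀ w ∈ tangentOf (𝓡 (2 * n)) S x,
      K.omega x ![v, w] = 0

/-- Lagrangian immersions: `f^* ω = 0`. -/
def IsLagrangianImm (f : L → X) : Prop :=
  IsImm n f ∧ ∀ p Y Z, K.omega (f p) ![diff n f p Y, diff n f p Z] = 0

/-- The fibre `E_p = (a(p) + J) df(T_p L)`. -/
def E (f : L → X) (a : L → ℝ) (p : L) : Submodule ℝ (TangentSpace (𝓡 (2 * n)) (f p)) :=
  ((a p • ContinuousLinearMap.id ℝ (TangentSpace (𝓡 (2 * n)) (f p)) + K.J (f p)).comp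
    (diff n f p)).range

/-- The contraction `Φ : E_p → T_p^* L`, `Φ(V)(Y) = (f^* i_V ω)(Y) = ω(V, df(Y))`. -/
def Φlin (f : L → X) (a : L → ℝ) (p : L) :
    K.E f a p →ₗ[ℝ] Module.Dual ℝ (TangentSpace (𝓡∂ n) p) :=
  LinearMap.mk₂ ℝ (fun V Y ↦ K.omega (f p) ![(V : TangentSpace (𝓡 (2 * n)) (f p)), diff n f p Y])
    (fun V V' Y ↦ K.omega_add_left _ _ _ _)
    (fun c V Y ↦ K.omega_smul_left _ _ _ _)
    (fun V Y Y' ↦ by rw [map_add, omega_add_right])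
    (fun c V Y ↦ by rw [map_smul, omega_smul_right, smul_eq_mul])

lemma Φlin_bijective {f : L → X} (hf : K.IsLagrangianImm f) (a : L → ℝ) (p : L) :
    Function.Bijective (K.Φlin f a p) := by
  have : FiniteDimensional ℝ (TangentSpace (𝓡 (2 * n)) (f p)) :=
    inferInstanceAs (FiniteDimensional ℝ (EuclideanSpace ℝ (Fin (2 * n))))
  have : FiniteDimensional ℝ (TangentSpace (𝓡∂ n) p) :=
    inferInstanceAs (FiniteDimensional ℝ (EuclideanSpace ℝ (Fin n)))
  have key : ∀ Y : TangentSpace (𝓡∂ n) p,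
      K.omega (f p) ![a p • diff n f p Y + K.J (f p) (diff n f p Y), diff n f p Y] = 0 → Y = 0 := by
    intro Y h
    apply hf.1.2 p
    rw [K.eq_zero_of_omega_rotate _ _ _ h, map_zero]
  have hinj : Function.Injective (K.Φlin f a p) := by
    rw [injective_iff_map_eq_zero]
    rintro ⟨V, Y, rfl⟩ h
    have h1 : Y = 0 := key Y (LinearMap.congr_fun h Y)
    subst h1
    exact Subtype.ext (map_zero _)
  refine ⟨hinj, (LinearMap.injective_iff_surjective_of_finrank_eq_finrank ?_).1 hinj⟩
  rw [Subspace.dual_finrank_eq]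
  apply LinearMap.finrank_range_of_inj
  rw [injective_iff_map_eq_zero]
  intro Y h
  apply key Y
  have h' : a p • diff n f p Y + K.J (f p) (diff n f p Y) = 0 := h
  rw [h', ← zero_smul ℝ (0 : TangentSpace (𝓡 (2 * n)) (f p)), omega_smul_left, zero_mul]

/-- The isomorphism `Φ : E_p ≃ T_p^* L`. -/
def Φ {f : L → X} (hf : K.IsLagrangianImm f) (a : L → ℝ) (p : L) :
    K.E f a p ≃ₗ[ℝ] Module.Dual ℝ (TangentSpace (𝓡∂ n) p) :=
  LinearEquiv.ofBijective (K.Φlin f a p) (K.Φlin_bijective hf a p)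

/-- The vector field `Φ⁻¹θ` along `f`. -/
def field {f : L → X} (hf : K.IsLagrangianImm f) (a : L → ℝ) (θ : OneForm n L) (p : L) :
    TangentSpace (𝓡 (2 * n)) (f p) :=
  ((K.Φ hf a p).symm (θ p : TangentSpace (𝓡∂ n) p →ₗ[ℝ] ℝ) : K.E f a p)

/-- The deformation `f_θ = exp(Φ⁻¹θ) ∘ f`. -/
def deform (D : CovariantDerivative (𝓡 (2 * n)) (EuclideanSpace ℝ (Fin (2 * n)))
      (TangentSpace (𝓡 (2 * n)) : X → Type _))
    {f : L → X} (hf : K.IsLagrangianImm f) (a : L → ℝ) (θ : OneForm n L) (p : L) : X :=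
  expMap D (f p) (K.field hf a θ p)

end CalabiYau

end Immersions

end LagBdry

end

open Set Filter Topology Bundle Manifold
open scoped ContDiff

set_option synthInstance.maxHeartbeats 200000
set_option linter.unusedSectionVars false

namespace LagBdry

section InverseSmooth

variable {E F G : Type*} [NormedAddCommGroup E] [NormedSpace ℝ E] [NormedAddCommGroup F]
  [NormedSpace ℝ F] [NormedAddCommGroup G] [NormedSpace ℝ G]

/-- If `Φ ∘ g = h` and `Φ` has invertible derivative, then `g` is differentiable. -/
lemma hasFDerivWithinAt_of_comp_eq {Φ : E → F} {s : Set E} {g : G → E} {h : G → F} {t : Set G}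
    {y : G} {A : E ≃L[ℝ] F} {h' : G →L[ℝ] F} (hΦ : HasFDerivWithinAt Φ (A : E →L[ℝ] F) s (g y))
    (hg : ContinuousWithinAt g t y) (hst : MapsTo g t s) (hh : HasFDerivWithinAt h h' t y)
    (hy : y ∈ t) (hcomp : ∀ z ∈ t, Φ (g z) = h z) :
    HasFDerivWithinAt g ((A.symm : F →L[ℝ] E).comp h') t y := by
  have hlim : Tendsto g (𝓝[t] y) (𝓝[s] (g y)) :=
    tendsto_nhdsWithin_iff.2 ⟨hg, eventually_mem_nhdsWithin.mono hst⟩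
  have h1 := hΦ.isLittleO.comp_tendsto hlim
  have h2 : (fun z ↦ A (g z - g y) - (h z - h y)) =o[𝓝[t] y] fun z ↦ g z - g y := by
    refine (h1.neg_left).congr' ?_ EventuallyEq.rfl
    filter_upwards [eventually_mem_nhdsWithin] with z hz
    simp [hcomp z hz, hcomp y hy]
  have h3 : (fun z ↦ (g z - g y) - A.symm (h z - h y)) =o[𝓝[t] y] fun z ↦ g z - g y := by
    refine ((A.symm : F →L[ℝ] E).isBigO_comp _ _).trans_isLittleO h2 |>.congr_left ?_
    intro z
    simp
  have h4 : (fun z ↦ g z - g y) =O[𝓝[t] y] fun z ↦ z - y := by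
    have h5 : (fun z ↦ g z - g y) =O[𝓝[t] y] fun z ↦ A.symm (h z - h y) := by
      have := h3.right_isBigO_sub
      simpa using this
    refine h5.trans (((A.symm : F →L[ℝ] E).isBigO_comp _ _).trans ?_)
    exact hh.isBigO_sub
  have h6 : (fun z ↦ A.symm (h z - h y - h' (z - y))) =o[𝓝[t] y] fun z ↦ z - y :=
    ((A.symm : F →L[ℝ] E).isBigO_comp _ _).trans_isLittleO hh.isLittleO
  refine HasFDerivWithinAt.of_isLittleO (((h3.trans_isBigO h4).add h6).congr_left ?_)
  intro z
  simp

/-- Regularity of solutions `g` of `Φ ∘ g = h`. -/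
lemma contDiffOn_of_comp_eq [CompleteSpace E] {Φ : E → F} {s : Set E} {g : G → E} {h : G → F}
    {t : Set G} (hs : UniqueDiffOn ℝ s) (ht : UniqueDiffOn ℝ t) (hΦ : ContDiffOn ℝ ∞ Φ s)
    (hinv : ∀ x ∈ s, (fderivWithin ℝ Φ s x).IsInvertible)
    (hg : ContinuousOn g t) (hst : MapsTo g t s) (hh : ContDiffOn ℝ ∞ h t)
    (hcomp : ∀ z ∈ t, Φ (g z) = h z) : ContDiffOn ℝ ∞ g t := by
  have hder : ∀ y ∈ t, HasFDerivWithinAt g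
      ((fderivWithin ℝ Φ s (g y)).inverse.comp (fderivWithin ℝ h t y)) t y := by
    intro y hy
    obtain ⟨A, hA⟩ := hinv (g y) (hst hy)
    have h1 : HasFDerivWithinAt Φ (A : E →L[ℝ] F) s (g y) := by
      rw [hA]
      exact (hΦ.differentiableOn (by simp) _ (hst hy)).hasFDerivWithinAt
    have := hasFDerivWithinAt_of_comp_eq h1 (hg y hy) hst
      (hh.differentiableOn (by simp) y hy).hasFDerivWithinAt hy hcomp
    rwa [← hA, ContinuousLinearMap.inverse_equiv]
  have hΦ' : ContDiffOn ℝ ∞ (fderivWithin ℝ Φ s) s := hΦ.fderivWithin hs (by simp)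
  have hh' : ContDiffOn ℝ ∞ (fderivWithin ℝ h t) t := hh.fderivWithin ht (by simp)
  rw [contDiffOn_infty]
  intro k
  induction k with
  | zero => exact contDiffOn_zero.2 hg
  | succ k ih =>
    rw [Nat.cast_succ, contDiffOn_succ_iff_fderivWithin ht]
    refine ⟨fun y hy ↦ (hder y hy).differentiableWithinAt, by simp, ?_⟩
    have h1 : ContDiffOn ℝ k (fun y ↦ (fderivWithin ℝ Φ s (g y)).inverse.comp
        (fderivWithin ℝ h t y)) t := by
      refine ContDiffOn.clm_comp ?_ (hh'.of_le (by exact_mod_cast le_top))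
      intro y hy
      obtain ⟨A, hA⟩ := hinv (g y) (hst hy)
      have h2 := contDiffAt_map_inverse (𝕜 := ℝ) (n := k) A
      rw [hA] at h2
      exact h2.comp_contDiffWithinAt y
        (((hΦ'.of_le (by exact_mod_cast le_top)).comp ih hst) y hy)
    exact h1.congr fun y hy ↦ (hder y hy).fderivWithin (ht y hy)

end InverseSmooth

section Nemytskii

universe u

variable {K : Type*} [TopologicalSpace K] [CompactSpace K]
  {Z W : Type u} [NormedAddCommGroup Z] [NormedSpace ℝ Z] [NormedAddCommGroup W] [NormedSpace ℝ W]

set_option synthInstance.maxHeartbeats 200000 in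
/-- Pointwise application of a continuous family of linear maps. -/
noncomputable def pointwiseApply (K : Type*) (Z W : Type u) [TopologicalSpace K] [CompactSpace K]
    [NormedAddCommGroup Z] [NormedSpace ℝ Z] [NormedAddCommGroup W] [NormedSpace ℝ W] :
    C(K, Z →L[ℝ] W) →L[ℝ] C(K, Z) →L[ℝ] C(K, W) :=
  LinearMap.mkContinuous₂ (E := C(K, Z →L[ℝ] W)) (F := C(K, Z)) (G := C(K, W))
    (LinearMap.mk₂ ℝ (fun (A : C(K, Z →L[ℝ] W)) (u : C(K, Z)) ↦
        (⟨fun k ↦ A k (u k), A.continuous.clm_apply u.continuous⟩ : C(K, W)))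
      (fun _ _ _ ↦ by ext; simp) (fun _ _ _ ↦ by ext; simp) (fun _ _ _ ↦ by ext; simp)
      (fun _ _ _ ↦ by ext; simp)) 1
    (fun A u ↦ by
      rw [ContinuousMap.norm_le _ (by positivity)]
      intro k
      simp only [one_mul]
      exact ((A k).le_opNorm _).trans
        (mul_le_mul (A.norm_coe_le_norm k) (u.norm_coe_le_norm k) (by positivity) (by positivity)))

set_option synthInstance.maxHeartbeats 200000 in
@[simp] lemma pointwiseApply_apply (A : C(K, Z →L[ℝ] W)) (u : C(K, Z)) (k : K) :
    pointwiseApply K Z W A u k = A k (u k) := rfl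

set_option synthInstance.maxHeartbeats 200000 in
lemma hasFDerivAt_postcomp {V : Z → W} {V' : Z → Z →L[ℝ] W} (hV : Continuous V)
    (hV' : Continuous V') (hd : ∀ z, HasFDerivAt V (V' z) z) (u : C(K, Z)) :
    HasFDerivAt (fun u : C(K, Z) ↦ (ContinuousMap.mk V hV).comp u)
      (pointwiseApply K Z W ((ContinuousMap.mk V' hV').comp u)) u := by
  rw [hasFDerivAt_iff_isLittleO, Asymptotics.isLittleO_iff]
  intro c hc
  have hcont : Continuous fun u : C(K, Z) ↦ (ContinuousMap.mk V' hV').comp u :=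
    ContinuousMap.continuous_postcomp _
  obtain ⟨δ, hδ, hball⟩ := (Metric.continuousAt_iff (α := C(K, Z)) (β := C(K, Z →L[ℝ] W))).1
    (hcont.continuousAt (x := u)) c hc
  filter_upwards [Metric.ball_mem_nhds u hδ] with v hv
  rw [ContinuousMap.norm_le _ (by positivity)]
  intro k
  have hseg : ∀ x ∈ segment ℝ (u k) (v k), ‖V' x - V' (u k)‖ ≤ c := by
    rintro x ⟨a, b, ha, hb, hab, rfl⟩
    have h1 : dist (a • u + b • v) u < δ := by
      have : a • u + b • v - u = b • (v - u) := by
        rw [← eq_sub_iff_add_eq] at hab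
        rw [hab]; module
      rw [dist_eq_norm, this, norm_smul, Real.norm_of_nonneg hb]
      rw [Metric.mem_ball, dist_eq_norm] at hv
      nlinarith [norm_nonneg (v - u)]
    have h2 := hball h1
    have h3 := (ContinuousMap.dist_apply_le_dist k).trans h2.le
    rw [dist_eq_norm] at h3
    exact h3
  have h3 := (convex_segment (u k) (v k)).norm_image_sub_le_of_norm_hasFDerivWithin_le'
    (𝕜 := ℝ) (f := V) (f' := V') (φ := V' (u k)) (C := c) (fun x _ ↦ (hd x).hasFDerivWithinAt) hseg
    (left_mem_segment ℝ _ _) (right_mem_segment ℝ _ _)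
  exact h3.trans (mul_le_mul_of_nonneg_left ((v - u).norm_coe_le_norm k) hc.le)

set_option synthInstance.maxHeartbeats 200000 in
lemma contDiff_postcomp {V : Z → W} (hV : ContDiff ℝ ∞ V) :
    ContDiff ℝ ∞ (fun u : C(K, Z) ↦ (ContinuousMap.mk V hV.continuous).comp u) := by
  rw [contDiff_infty]
  intro k
  induction k generalizing W with
  | zero => exact contDiff_zero.2 (ContinuousMap.continuous_postcomp _)
  | succ k ih =>
    have hV' : ContDiff ℝ ∞ (fderiv ℝ V) := hV.fderiv_right (by simp)
    rw [Nat.cast_succ, contDiff_succ_iff_hasFDerivAt]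
    exact ⟨fun u ↦ pointwiseApply K Z W ((ContinuousMap.mk _ hV'.continuous).comp u),
      ContDiff.continuousLinearMap_comp (pointwiseApply K Z W) (ih hV'), fun u ↦
      hasFDerivAt_postcomp hV.continuous hV'.continuous
        (fun z ↦ (hV.differentiable (by simp) z).hasFDerivAt) u⟩

end Nemytskii

end LagBdry

namespace LagBdry

section Volterra

variable (Z : Type*) [NormedAddCommGroup Z] [NormedSpace ℝ Z]

/-- Constant curves. -/
noncomputable def constCurve : Z →L[ℝ] C(Icc (-1 : ℝ) 2, Z) :=
  LinearMap.mkContinuous (F := C(Icc (-1 : ℝ) 2, Z))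
    { toFun := fun a ↦ ContinuousMap.const _ a
      map_add' := fun _ _ ↦ rfl
      map_smul' := fun _ _ ↦ rfl } 1
    (fun a ↦ by
      rw [ContinuousMap.norm_le _ (by positivity)]
      intro t
      simp only [one_mul]
      exact le_rfl)

@[simp] lemma constCurve_apply (a : Z) (t) : constCurve Z a t = a := rfl

lemma continuous_extend_curve {Z : Type*} [TopologicalSpace Z] (u : C(Icc (-1 : ℝ) 2, Z)) :
    Continuous fun s : ℝ ↦ u (projIcc (-1 : ℝ) 2 (by norm_num) s) :=
  u.continuous.comp continuous_projIcc

/-- Integration from `0` of curves. -/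
noncomputable def volterra [CompleteSpace Z] : C(Icc (-1 : ℝ) 2, Z) →L[ℝ] C(Icc (-1 : ℝ) 2, Z) :=
  LinearMap.mkContinuous (E := C(Icc (-1 : ℝ) 2, Z)) (F := C(Icc (-1 : ℝ) 2, Z))
    { toFun := fun u ↦ ⟨fun t ↦ ∫ s in (0 : ℝ)..t, u (projIcc (-1 : ℝ) 2 (by norm_num) s),
        (intervalIntegral.continuous_primitive
          (fun a b ↦ (continuous_extend_curve u).intervalIntegrable a b) 0).comp
          continuous_subtype_val⟩
      map_add' := fun u v ↦ by
        ext t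
        exact intervalIntegral.integral_add ((continuous_extend_curve u).intervalIntegrable _ _)
          ((continuous_extend_curve v).intervalIntegrable _ _)
      map_smul' := fun c u ↦ by
        ext t
        exact intervalIntegral.integral_smul _ _ } 2
    (fun u ↦ by
      rw [ContinuousMap.norm_le _ (by positivity)]
      intro t
      have h := intervalIntegral.norm_integral_le_of_norm_le_const (a := 0) (b := (t : ℝ))
        (f := fun s ↦ u (projIcc (-1 : ℝ) 2 (by norm_num) s)) (C := ‖u‖)
        (fun s _ ↦ u.norm_coe_le_norm _)
      refine h.trans ?_
      rw [mul_comm]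
      refine mul_le_mul_of_nonneg_right ?_ (norm_nonneg _)
      rw [sub_zero, abs_le]
      exact ⟨by linarith [t.2.1], t.2.2⟩)

end Volterra

section Geodesic

variable {E : Type*} [NormedAddCommGroup E] [NormedSpace ℝ E]

/-- The geodesic vector field. -/
noncomputable def spray (B : E → E →L[ℝ] E →L[ℝ] E) (z : E × E) : E × E := (z.2, -B z.1 z.2 z.2)

lemma contDiffOn_spray {B : E → E →L[ℝ] E →L[ℝ] E} {U : Set E} (hB : ContDiffOn ℝ ∞ B U) :
    ContDiffOn ℝ ∞ (spray B) (U ×ˢ univ) := by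
  have h : ContDiffOn ℝ ∞ (fun z : E × E ↦ B z.1) (U ×ˢ univ) :=
    hB.comp contDiffOn_fst fun z hz ↦ hz.1
  exact contDiffOn_snd.prodMk ((h.clm_apply contDiffOn_snd).clm_apply contDiffOn_snd).neg

lemma hasFDerivAt_spray {B : E → E →L[ℝ] E →L[ℝ] E} {y : E} (hB : DifferentiableAt ℝ B y) :
    HasFDerivAt (spray B) ((ContinuousLinearMap.inl ℝ E E).comp (ContinuousLinearMap.snd ℝ E E))
      (y, 0) := by
  have h1 : HasFDerivAt (fun z : E × E ↦ B z.1)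
      ((fderiv ℝ B y).comp (ContinuousLinearMap.fst ℝ E E)) (y, 0) :=
    HasFDerivAt.comp (g := B) (f := Prod.fst) (y, (0 : E)) hB.hasFDerivAt
      (hasFDerivAt_fst (𝕜 := ℝ) (p := (y, (0 : E))))
  have h2 := ((h1.clm_apply (hasFDerivAt_snd (p := (y, (0 : E))))).clm_apply
    (hasFDerivAt_snd (p := (y, (0 : E))))).neg
  refine ((hasFDerivAt_snd (𝕜 := ℝ) (p := (y, (0 : E)))).prodMk h2).congr_fderiv ?_
  ext <;> simp

/-- A globally smooth field which is the geodesic vector field near `(y, 0)`. -/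
lemma exists_contDiff_eq_spray [FiniteDimensional ℝ E] {B : E → E →L[ℝ] E →L[ℝ] E} {y₀ : E}
    {U : Set E} (hU : IsOpen U) (hy : y₀ ∈ U) (hB : ContDiffOn ℝ ∞ B U) :
    ∃ V : E × E → E × E, ContDiff ℝ ∞ V ∧ V =ᶠ[𝓝 (y₀, 0)] spray B := by
  have hopen : IsOpen (U ×ˢ (univ : Set E)) := hU.prod isOpen_univ
  obtain ⟨r, hr, hball⟩ := Metric.isOpen_iff.1 hopen (y₀, 0) ⟨hy, mem_univ _⟩
  let ρ : ContDiffBump ((y₀, 0) : E × E) := ⟨r / 3, r / 2, by positivity, by linarith⟩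
  refine ⟨fun z ↦ ρ z • spray B z, ?_, ?_⟩
  · rw [contDiff_iff_contDiffAt]
    intro z
    by_cases hz : z ∈ U ×ˢ (univ : Set E)
    · exact ρ.contDiff.contDiffAt.smul
        ((contDiffOn_spray hB).contDiffAt (hopen.mem_nhds hz))
    · have hz' : z ∈ (Metric.closedBall ((y₀, 0) : E × E) (r / 2))ᶜ := fun h ↦
        hz (hball (Metric.closedBall_subset_ball (by linarith) h))
      have hev : (fun z ↦ ρ z • spray B z) =ᶠ[𝓝 z] fun _ ↦ 0 := by
        filter_upwards [Metric.isClosed_closedBall.isOpen_compl.mem_nhds hz'] with w hw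
        rw [ρ.zero_of_le_dist, zero_smul]
        exact (not_le.1 (by simpa using! hw)).le
      exact contDiffAt_const.congr_of_eventuallyEq hev
  · filter_upwards [ρ.eventuallyEq_one] with z hz
    simp [hz]

/-- The linearization of the geodesic vector field at a stationary point. -/
noncomputable def sprayLin (E : Type*) [NormedAddCommGroup E] [NormedSpace ℝ E] :
    E × E →L[ℝ] E × E :=
  (ContinuousLinearMap.inl ℝ E E).comp (ContinuousLinearMap.snd ℝ E E)

lemma sprayLin_sprayLin (z : E × E) : sprayLin E (sprayLin E z) = 0 := by
  simp [sprayLin]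

/-- The linearized integral operator `h ↦ ∫₀ N h`. -/
noncomputable def volterraLin (E : Type*) [NormedAddCommGroup E] [NormedSpace ℝ E]
    [CompleteSpace E] : C(Icc (-1 : ℝ) 2, E × E) →L[ℝ] C(Icc (-1 : ℝ) 2, E × E) :=
  (volterra (E × E)).comp (pointwiseApply _ _ _ (ContinuousMap.const _ (sprayLin E)))

lemma volterraLin_apply [CompleteSpace E] (h : C(Icc (-1 : ℝ) 2, E × E)) (t : Icc (-1 : ℝ) 2) :
    volterraLin E h t =
      ∫ s in (0 : ℝ)..t, sprayLin E (h (projIcc (-1 : ℝ) 2 (by norm_num) s)) := rfl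

lemma volterraLin_sq [CompleteSpace E] (h : C(Icc (-1 : ℝ) 2, E × E)) :
    volterraLin E (volterraLin E h) = 0 := by
  ext1 t
  rw [volterraLin_apply]
  have : ∀ s : Icc (-1 : ℝ) 2, sprayLin E (volterraLin E h s) = 0 := by
    intro s
    rw [volterraLin_apply, ← ContinuousLinearMap.intervalIntegral_comp_comm]
    · simp [sprayLin_sprayLin]
    · exact ((sprayLin E).continuous.comp (continuous_extend_curve h)).intervalIntegrable _ _
  simp [this]

/-- The derivative of `(z, u) ↦ (z, u - z - ∫₀ V(u))` at a stationary point. -/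
noncomputable def pathEquiv (E : Type*) [NormedAddCommGroup E] [NormedSpace ℝ E]
    [CompleteSpace E] :
    ((E × E) × C(Icc (-1 : ℝ) 2, E × E)) ≃L[ℝ] ((E × E) × C(Icc (-1 : ℝ) 2, E × E)) :=
  ContinuousLinearEquiv.equivOfInverse
    ((ContinuousLinearMap.fst ℝ _ _).prod
      ((ContinuousLinearMap.snd ℝ _ _) - (constCurve (E × E)).comp (ContinuousLinearMap.fst ℝ _ _)
        - (volterraLin E).comp (ContinuousLinearMap.snd ℝ _ _)))
    ((ContinuousLinearMap.fst ℝ _ _).prod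
      ((ContinuousLinearMap.id ℝ _ + volterraLin E).comp
        (ContinuousLinearMap.snd ℝ _ _ +
          (constCurve (E × E)).comp (ContinuousLinearMap.fst ℝ _ _))))
    (by
      rintro ⟨a, h⟩
      refine Prod.ext rfl ?_
      simp only [ContinuousLinearMap.prod_apply, ContinuousLinearMap.coe_fst',
        ContinuousLinearMap.coe_comp, Function.comp_apply, add_apply,
        ContinuousLinearMap.coe_snd', sub_apply, ContinuousLinearMap.id_apply,
        map_sub, map_add, volterraLin_sq]
      abel)
    (by
      rintro ⟨a, h⟩
      refine Prod.ext rfl ?_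
      simp only [ContinuousLinearMap.prod_apply, ContinuousLinearMap.coe_fst',
        ContinuousLinearMap.coe_comp, Function.comp_apply, add_apply,
        ContinuousLinearMap.coe_snd', sub_apply, ContinuousLinearMap.id_apply,
        map_add, volterraLin_sq]
      abel)

lemma pathEquiv_symm_snd [CompleteSpace E] (a : E × E) (k : C(Icc (-1 : ℝ) 2, E × E)) :
    ((pathEquiv E).symm (a, k)).2 = (k + constCurve _ a) + volterraLin E (k + constCurve _ a) :=
  rfl

/-- Smooth dependence of short geodesics on their initial data. -/
lemma exists_solution_curve [FiniteDimensional ℝ E] {V : E × E → E × E} {y₀ : E}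
    (hV : ContDiff ℝ ∞ V) (hV0 : V (y₀, 0) = 0) (hV' : HasFDerivAt V (sprayLin E) (y₀, 0)) :
    ∃ S : E × E → C(Icc (-1 : ℝ) 2, E × E), (∀ᶠ z in 𝓝 (y₀, 0), ContDiffAt ℝ ∞ S z) ∧
      HasFDerivAt S ((ContinuousLinearMap.id ℝ _ + volterraLin E).comp (constCurve (E × E)))
        (y₀, 0) ∧
      S (y₀, 0) = constCurve _ (y₀, 0) ∧
      (∀ᶠ z in 𝓝 (y₀, 0), V z = 0 → S z = constCurve _ z) ∧
      ∀ᶠ z in 𝓝 (y₀, 0), ∀ t, S z t = z + ∫ s in (0 : ℝ)..t,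
        V (S z (projIcc (-1 : ℝ) 2 (by norm_num) s)) := by
  have : CompleteSpace E := FiniteDimensional.complete ℝ E
  set C := C(Icc (-1 : ℝ) 2, E × E)
  let z₀ : E × E := (y₀, 0)
  let G : (E × E) × C → (E × E) × C := fun p ↦
    (p.1, p.2 - constCurve _ p.1 - volterra _ ((ContinuousMap.mk V hV.continuous).comp p.2))
  have hG : ContDiff ℝ ∞ G :=
    contDiff_fst.prodMk ((contDiff_snd.sub ((constCurve (E × E)).contDiff.comp contDiff_fst)).sub
      ((volterra (E × E)).contDiff.comp ((contDiff_postcomp hV).comp contDiff_snd)))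
  let p₀ : (E × E) × C := (z₀, constCurve _ z₀)
  have hG0 : G p₀ = (z₀, 0) := by
    refine Prod.ext rfl ?_
    have : (ContinuousMap.mk V hV.continuous).comp (constCurve _ z₀) = 0 := by
      ext1 t
      exact hV0
    simp only [G, p₀]
    rw [this, map_zero, sub_self, sub_zero]
  have hG' : HasFDerivAt G (pathEquiv E : _ →L[ℝ] _) p₀ := by
    have h1 := hasFDerivAt_postcomp (K := Icc (-1 : ℝ) 2) hV.continuous
      (hV.continuous_fderiv (by simp)) (fun z ↦ (hV.differentiable (by simp) z).hasFDerivAt)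
      (constCurve _ z₀)
    have h2 := ((volterra (E × E)).hasFDerivAt).comp p₀
      (HasFDerivAt.comp (f := Prod.snd) p₀ h1 (hasFDerivAt_snd (𝕜 := ℝ) (p := p₀)))
    have h3 : HasFDerivAt G _ p₀ := hasFDerivAt_fst.prodMk ((hasFDerivAt_snd.sub
      ((constCurve (E × E)).hasFDerivAt.comp p₀ hasFDerivAt_fst)).sub h2)
    refine h3.congr_fderiv ?_
    have h4 : (ContinuousMap.mk (fderiv ℝ V) (hV.continuous_fderiv (by simp))).comp
        (constCurve _ z₀) = ContinuousMap.const _ (sprayLin E) := by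
      ext1 t
      exact hV'.fderiv
    rw [h4]
    rfl
  let Ψ := hG.contDiffAt.toOpenPartialHomeomorph G hG' (by simp)
  have hΨ : ∀ p, Ψ p = G p := fun p ↦ rfl
  have hp₀ : p₀ ∈ Ψ.source := hG.contDiffAt.mem_toOpenPartialHomeomorph_source hG' (by simp)
  have htar : (z₀, (0 : C)) ∈ Ψ.target := by
    rw [← hG0]
    exact Ψ.map_source hp₀
  have hsymm0 : Ψ.symm (z₀, 0) = p₀ := by
    rw [← hG0]
    exact Ψ.left_inv hp₀
  have hι : Continuous fun z : E × E ↦ (z, (0 : C)) := by fun_prop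
  have htarget : ∀ᶠ z in 𝓝 z₀, (z, (0 : C)) ∈ Ψ.target :=
    hι.continuousAt.eventually (Ψ.open_target.mem_nhds htar)
  refine ⟨fun z ↦ (Ψ.symm (z, 0)).2, ?_, ?_, ?_, ?_, ?_⟩
  · have h1 : ∀ᶠ p in 𝓝 p₀, (fderiv ℝ G p).IsInvertible := by
      have h2 : ContinuousAt (fderiv ℝ G) p₀ := (hG.continuous_fderiv (by simp)).continuousAt
      refine h2.eventually ?_
      rw [hG'.fderiv]
      exact ContinuousLinearEquiv.nhds _
    have h2 : ContinuousAt (fun z : E × E ↦ Ψ.symm (z, (0 : C))) z₀ :=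
      (Ψ.continuousAt_symm htar).comp (f := fun z ↦ (z, (0 : C))) hι.continuousAt
    have h3 : ∀ᶠ z in 𝓝 z₀, (fderiv ℝ G (Ψ.symm (z, 0))).IsInvertible := by
      refine h2.eventually (p := fun q ↦ (fderiv ℝ G q).IsInvertible) ?_
      change ∀ᶠ q in 𝓝 (Ψ.symm (z₀, 0)), (fderiv ℝ G q).IsInvertible
      rw [hsymm0]
      exact h1
    filter_upwards [h3, htarget] with z hz hzt
    obtain ⟨A, hA⟩ := hz
    have h4 : ContDiffAt ℝ ∞ Ψ.symm (z, (0 : C)) := by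
      refine Ψ.contDiffAt_symm (f₀' := A) hzt ?_ hG.contDiffAt
      rw [hA]
      exact (hG.differentiable (by simp) _).hasFDerivAt
    exact contDiffAt_snd.comp _ (h4.comp z (contDiff_id.prodMk contDiff_const).contDiffAt)
  · have h1 : HasFDerivAt Ψ.symm ((pathEquiv E).symm : _ →L[ℝ] _) (z₀, (0 : C)) := by
      refine Ψ.hasFDerivAt_symm htar ?_
      rw [hsymm0]
      exact hG'
    have h2 : HasFDerivAt (fun z : E × E ↦ (z, (0 : C)))
        ((ContinuousLinearMap.id ℝ _).prod 0) z₀ := (hasFDerivAt_id _).prodMk (hasFDerivAt_const _ _)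
    have h3 := (hasFDerivAt_snd (𝕜 := ℝ) (p := Ψ.symm (z₀, (0 : C)))).comp z₀ (h1.comp z₀ h2)
    refine h3.congr_fderiv ?_
    refine ContinuousLinearMap.ext fun a ↦ ?_
    change ((pathEquiv E).symm (a, 0)).2 = _
    rw [pathEquiv_symm_snd, zero_add]
    rfl
  · change (Ψ.symm (z₀, 0)).2 = _
    rw [hsymm0]
  · have h1 : Continuous fun z : E × E ↦ (z, constCurve _ z) := by fun_prop
    have h2 : ∀ᶠ z in 𝓝 z₀, (z, constCurve _ z) ∈ Ψ.source :=
      h1.continuousAt.eventually (Ψ.open_source.mem_nhds hp₀)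
    filter_upwards [h2] with z hz hVz
    have h3 : G (z, constCurve _ z) = (z, 0) := by
      refine Prod.ext rfl ?_
      have : (ContinuousMap.mk V hV.continuous).comp (constCurve _ z) = 0 := by
        ext1 t
        exact hVz
      simp only [G]
      rw [this, map_zero, sub_self, sub_zero]
    have h4 := Ψ.left_inv hz
    rw [hΨ, h3] at h4
    rw [h4]
  · filter_upwards [htarget] with z hz t
    have h1 : G (Ψ.symm (z, 0)) = (z, 0) := Ψ.right_inv hz
    have h2 : (Ψ.symm (z, 0)).1 = z := congrArg (fun p ↦ p.1) h1
    have h3 : (Ψ.symm (z, 0)).2 - constCurve _ (Ψ.symm (z, 0)).1 - volterra _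
      ((ContinuousMap.mk V hV.continuous).comp (Ψ.symm (z, 0)).2) = 0 := congrArg (fun p ↦ p.2) h1
    rw [h2, sub_sub, sub_eq_zero] at h3
    have h4 := congrArg (fun u : C ↦ u t) h3
    exact h4

/-- Solutions of the geodesic equation with small initial velocity. -/
lemma exists_expCoord [FiniteDimensional ℝ E] {B : E → E →L[ℝ] E →L[ℝ] E} {y₀ : E}
    {U : Set E} (hU : IsOpen U) (hy : y₀ ∈ U) (hB : ContDiffOn ℝ ∞ B U) :
    ∃ Ex : E × E → E, (∀ᶠ z in 𝓝 (y₀, 0), ContDiffAt ℝ ∞ Ex z) ∧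
      HasFDerivAt Ex (ContinuousLinearMap.fst ℝ E E + ContinuousLinearMap.snd ℝ E E) (y₀, 0) ∧
      (∀ᶠ y in 𝓝 y₀, Ex (y, 0) = y) ∧
      ∀ N ∈ 𝓝 y₀, ∀ᶠ z in 𝓝 (y₀, 0), ∃ q : ℝ → E × E, q 0 = z ∧ (q 1).1 = Ex z ∧
        ∀ t ∈ Ioo (-1 : ℝ) 2, HasDerivAt q (spray B (q t)) t ∧ (q t).1 ∈ N := by
  have : CompleteSpace E := FiniteDimensional.complete ℝ E
  obtain ⟨V, hV, hVB⟩ := exists_contDiff_eq_spray hU hy hB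
  have hV0 : V (y₀, 0) = 0 := by rw [hVB.self_of_nhds]; simp [spray]
  have hV' : HasFDerivAt V (sprayLin E) (y₀, 0) :=
    (hasFDerivAt_spray ((hB.contDiffAt (hU.mem_nhds hy)).differentiableAt
      (by simp))).congr_of_eventuallyEq hVB
  obtain ⟨S, hS1, hS2, hS3, hS4, hS5⟩ := exists_solution_curve hV hV0 hV'
  let one : Icc (-1 : ℝ) 2 := ⟨1, by norm_num⟩
  let ev : C(Icc (-1 : ℝ) 2, E × E) →L[ℝ] E :=
    (ContinuousLinearMap.fst ℝ E E).comp (ContinuousMap.evalCLM ℝ one)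
  have hev : ∀ u, ev u = (u one).1 := fun u ↦ rfl
  refine ⟨fun z ↦ ev (S z), ?_, ?_, ?_, ?_⟩
  · filter_upwards [hS1] with z hz
    exact ev.contDiff.contDiffAt.comp z hz
  · refine (ev.hasFDerivAt.comp (y₀, (0 : E)) hS2).congr_fderiv ?_
    refine ContinuousLinearMap.ext fun a ↦ ?_
    change (constCurve (E × E) a one + volterraLin E (constCurve (E × E) a) one).1 = a.1 + a.2
    rw [volterraLin_apply]
    simp [sprayLin, one]
  · have h1 : ContinuousAt (fun y : E ↦ (y, (0 : E))) y₀ := by fun_prop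
    filter_upwards [h1.eventually hS4, h1.eventually hVB] with y h2 h3
    rw [h2 (by rw [h3]; simp [spray])]
    rfl
  · intro N hN
    obtain ⟨O, hO, hO1, hO2⟩ := mem_nhds_iff.1 (Filter.inter_mem hVB (prod_mem_nhds hN univ_mem))
    have h1 : ∀ᶠ z in 𝓝 (y₀, (0 : E)), ∀ t, S z t ∈ O := by
      have hc : ContinuousAt S (y₀, (0 : E)) := hS2.continuousAt
      obtain ⟨δ, hδ, hball⟩ := Metric.isOpen_iff.1 hO1 _ hO2
      filter_upwards [hc.eventually (Metric.ball_mem_nhds _ hδ)] with z hz t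
      apply hball
      rw [hS3] at hz
      exact (ContinuousMap.dist_apply_le_dist (f := S z) (g := constCurve _ (y₀, 0)) t).trans_lt hz
    filter_upwards [h1, hS5] with z hz1 hz5
    let w : ℝ → E × E := fun s ↦ V (S z (projIcc (-1 : ℝ) 2 (by norm_num) s))
    have hw : Continuous w := hV.continuous.comp (continuous_extend_curve _)
    let q : ℝ → E × E := fun t ↦ z + ∫ s in (0 : ℝ)..t, w s
    have hq : ∀ t : Icc (-1 : ℝ) 2, q t = S z t := fun t ↦ (hz5 t).symm
    refine ⟨q, by simp [q], ?_, ?_⟩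
    · have := hq one
      rw [hev, ← this]
    · intro t ht
      have ht' : t ∈ Icc (-1 : ℝ) 2 := Ioo_subset_Icc_self ht
      have h2 : HasDerivAt q (w t) t :=
        (intervalIntegral.integral_hasDerivAt_right (hw.intervalIntegrable _ _)
          (hw.stronglyMeasurableAtFilter _ _) hw.continuousAt).const_add z
      have h3 : q t = S z ⟨t, ht'⟩ := hq ⟨t, ht'⟩
      have h4 : w t = V (q t) := by
        rw [h3]
        simp only [w]
        rw [projIcc_of_mem _ ht']
      have h5 := hO (hz1 ⟨t, ht'⟩)
      rw [← h3] at h5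
      refine ⟨?_, h5.2.1⟩
      rw [h4] at h2
      rwa [h5.1] at h2

end Geodesic

end LagBdry

namespace LagBdry

section TangentCoordinates

variable {E : Type*} [NormedAddCommGroup E] [NormedSpace ℝ E]
  {H : Type*} [TopologicalSpace H] {I : ModelWithCorners ℝ E H}
  {M : Type*} [TopologicalSpace M] [ChartedSpace H M] [IsManifold I ∞ M]
  {E' : Type*} [NormedAddCommGroup E'] [NormedSpace ℝ E']
  {H' : Type*} [TopologicalSpace H'] {I' : ModelWithCorners ℝ E' H'}
  {N : Type*} [TopologicalSpace N] [ChartedSpace H' N] [IsManifold I' ∞ N]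

lemma tangentCoordChange_symm_apply {x y z : M} (hx : z ∈ (extChartAt I x).source)
    (hy : z ∈ (extChartAt I y).source) (v : E) :
    tangentCoordChange I y x z (tangentCoordChange I x y z v) = v := by
  rw [tangentCoordChange_comp ⟨⟨hx, hy⟩, hx⟩, tangentCoordChange_self hx]

variable (I I') in
/-- The derivative of a map as a linear map between the model spaces. -/
noncomputable def mfderivModel (g : M → N) (p : M) : E →L[ℝ] E' := mfderiv I I' g p

/-- The derivative of a map read in charts. -/
lemma hasFDerivWithinAt_chartRep {g : M → N} {p p₀ : M} {y₀ : N}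
    (hg : MDifferentiableAt I I' g p) (hp : p ∈ (extChartAt I p₀).source)
    (hy : g p ∈ (extChartAt I' y₀).source) :
    HasFDerivWithinAt (extChartAt I' y₀ ∘ g ∘ (extChartAt I p₀).symm)
      ((tangentCoordChange I' (g p) y₀ (g p)).comp
        ((mfderivModel I I' g p).comp (tangentCoordChange I p₀ p p)))
      (range I) (extChartAt I p₀ p) := by
  have hpp := mem_extChartAt_source (I := I) p
  have hgg := mem_extChartAt_source (I := I') (g p)
  have h1 := hasFDerivWithinAt_tangentCoordChange (I := I) (x := p₀) (y := p) (z := p) ⟨hp, hpp⟩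
  have e1 : (extChartAt I p ∘ (extChartAt I p₀).symm) (extChartAt I p₀ p) = extChartAt I p p := by
    rw [Function.comp_apply, (extChartAt I p₀).left_inv hp]
  have h2 : HasFDerivWithinAt (extChartAt I' (g p) ∘ g ∘ (extChartAt I p).symm)
      (mfderivModel I I' g p) (range I)
      ((extChartAt I p ∘ (extChartAt I p₀).symm) (extChartAt I p₀ p)) := by
    rw [e1]
    exact hg.hasMFDerivAt.2
  have h3 := hasFDerivWithinAt_tangentCoordChange (I := I') (x := g p) (y := y₀) (z := g p)
    ⟨hgg, hy⟩
  have e2 : (extChartAt I' (g p) ∘ g ∘ (extChartAt I p).symm)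
      ((extChartAt I p ∘ (extChartAt I p₀).symm) (extChartAt I p₀ p)) = extChartAt I' (g p) (g p) := by
    rw [e1]
    simp only [Function.comp_apply]
    rw [(extChartAt I p).left_inv hpp]
  rw [← e2] at h3
  have hmaps : MapsTo (extChartAt I' (g p) ∘ g ∘ (extChartAt I p).symm) (range I) (range I') := by
    intro z _
    simp only [Function.comp_apply, extChartAt_coe]
    exact mem_range_self _
  have hmaps' : MapsTo (extChartAt I p ∘ (extChartAt I p₀).symm) (range I) (range I) := by
    intro z _
    simp only [Function.comp_apply, extChartAt_coe]
    exact mem_range_self _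
  have h4 := (h3.comp _ h2 hmaps).comp _ h1 hmaps'
  refine h4.congr_of_eventuallyEq ?_ ?_
  · have hsymm : Tendsto (extChartAt I p₀).symm (𝓝[range I] (extChartAt I p₀ p)) (𝓝 p) := by
      have := (continuousAt_extChartAt_symm' hp).tendsto
      rw [(extChartAt I p₀).left_inv hp] at this
      exact this.mono_left nhdsWithin_le_nhds
    filter_upwards [hsymm.eventually (extChartAt_source_mem_nhds (I := I) p),
      hsymm.eventually (hg.continuousAt.eventually (extChartAt_source_mem_nhds (I := I') (g p)))]
      with z hz1 hz2
    simp only [Function.comp_apply]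
    rw [(extChartAt I p).left_inv hz1, (extChartAt I' (g p)).left_inv hz2]
  · simp only [Function.comp_apply]
    rw [(extChartAt I p₀).left_inv hp, (extChartAt I p).left_inv hpp,
      (extChartAt I' (g p)).left_inv hgg]

lemma tangentCoordChange_mfderiv {g : M → N} {p p₀ : M} {y₀ : N}
    (hg : MDifferentiableAt I I' g p) (hp : p ∈ (extChartAt I p₀).source)
    (hy : g p ∈ (extChartAt I' y₀).source) (v : E) :
    tangentCoordChange I' (g p) y₀ (g p) ((mfderivModel I I' g p) v) =
      fderivWithin ℝ (extChartAt I' y₀ ∘ g ∘ (extChartAt I p₀).symm) (range I) (extChartAt I p₀ p)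
        (tangentCoordChange I p p₀ p v) := by
  have hu : UniqueDiffWithinAt ℝ (range I) (extChartAt I p₀ p) := by
    apply I.uniqueDiffOn
    rw [extChartAt_coe]
    exact mem_range_self _
  rw [(hasFDerivWithinAt_chartRep hg hp hy).fderivWithin hu]
  simp only [ContinuousLinearMap.comp_apply]
  rw [tangentCoordChange_symm_apply (mem_extChartAt_source p) hp]

lemma velocity_eq_iff {γ : ℝ → M} {t : ℝ} (hγ : MDifferentiableAt 𝓘(ℝ, ℝ) I γ t) {x x₀ : M}
    (hx : x ∈ (extChartAt I x₀).source) (v : E) :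
    velocity I γ t = ⟨x, v⟩ ↔ γ t = x ∧
      HasDerivAt (fun s ↦ extChartAt I x₀ (γ s)) (tangentCoordChange I x x₀ x v) t := by
  have key : γ t ∈ (extChartAt I x₀).source → HasDerivAt (fun s ↦ extChartAt I x₀ (γ s))
      (tangentCoordChange I (γ t) x₀ (γ t) ((mfderivModel 𝓘(ℝ, ℝ) I γ t) 1)) t := by
    intro h
    have := hasFDerivWithinAt_chartRep (p₀ := t) hγ (mem_extChartAt_source t) h
    rw [ModelWithCorners.range_eq_univ, hasFDerivWithinAt_univ] at this
    have h2 := this.hasDerivAt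
    have h3 : tangentCoordChange 𝓘(ℝ, ℝ) t t t (1 : ℝ) = 1 :=
      tangentCoordChange_self (mem_extChartAt_source t)
    have h4 : ((tangentCoordChange I (γ t) x₀ (γ t)).comp
        ((mfderivModel 𝓘(ℝ, ℝ) I γ t).comp (tangentCoordChange 𝓘(ℝ, ℝ) t t t))) 1 =
        tangentCoordChange I (γ t) x₀ (γ t) ((mfderivModel 𝓘(ℝ, ℝ) I γ t) 1) := by
      rw [ContinuousLinearMap.comp_apply, ContinuousLinearMap.comp_apply, h3]
    rw [← h4]
    exact h2
  constructor
  · intro h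
    have h1 : γ t = x := congrArg (fun w : TangentBundle I M ↦ w.1) h
    subst h1
    refine ⟨rfl, ?_⟩
    have h2 : (mfderivModel 𝓘(ℝ, ℝ) I γ t) 1 = v := by
      exact TotalSpace.mk_inj.1 (show (⟨γ t, mfderivModel 𝓘(ℝ, ℝ) I γ t 1⟩ : TangentBundle I M) =
        ⟨γ t, v⟩ from h)
    rw [← h2]
    exact key hx
  · rintro ⟨rfl, h⟩
    have h1 := h.unique (key hx)
    have h2 := congrArg (tangentCoordChange I x₀ (γ t) (γ t)) h1
    rw [tangentCoordChange_symm_apply (mem_extChartAt_source _) hx,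
      tangentCoordChange_symm_apply (mem_extChartAt_source _) hx] at h2
    rw [h2]
    rfl

end TangentCoordinates

section Christoffel

variable {m : ℕ} {X : Type*} [TopologicalSpace X]
  [ChartedSpace (EuclideanSpace ℝ (Fin m)) X] [IsManifold (𝓡 m) ∞ X]

/-- The vector field with constant coordinates `w` in the preferred chart at `x₀`. -/
noncomputable def coordField (x₀ : X) (w : EuclideanSpace ℝ (Fin m)) (z : X) :
    TangentSpace (𝓡 m) z :=
  (trivializationAt (EuclideanSpace ℝ (Fin m)) (TangentSpace (𝓡 m) : X → Type _) x₀).symm z w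

lemma coordField_eq {x₀ z : X} (hz : z ∈ (extChartAt (𝓡 m) x₀).source)
    (w : EuclideanSpace ℝ (Fin m)) :
    coordField x₀ w z = tangentCoordChange (𝓡 m) x₀ z z w := by
  rw [extChartAt_source] at hz
  have h := DFunLike.congr_fun (TangentBundle.symmL_trivializationAt_eq_core (I := 𝓡 m) hz) w
  have h' := (trivializationAt (EuclideanSpace ℝ (Fin m))
    (TangentSpace (𝓡 m) : X → Type _) x₀).symmL_apply (R := ℝ) hz w
  exact h'.symm.trans h

lemma contMDiffOn_coordField (x₀ : X) (w : EuclideanSpace ℝ (Fin m)) :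
    ContMDiffOn (𝓡 m) (𝓡 m).tangent ∞
      (fun z ↦ (⟨z, coordField x₀ w z⟩ : TangentBundle (𝓡 m) X)) (extChartAt (𝓡 m) x₀).source := by
  set e := trivializationAt (EuclideanSpace ℝ (Fin m)) (TangentSpace (𝓡 m) : X → Type _) x₀
  have hbase : (extChartAt (𝓡 m) x₀).source = e.baseSet := by
    rw [extChartAt_source]
    rfl
  rw [hbase]
  refine (e.contMDiffOn_section_baseSet_iff (IB := 𝓡 m) (s := coordField x₀ w)).2 ?_
  refine (contMDiffOn_const (c := w)).congr fun y hy ↦ ?_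
  exact congrArg Prod.snd (e.apply_mk_symm hy w)

lemma christoffel_eq (D : CovariantDerivative (𝓡 m) (EuclideanSpace ℝ (Fin m))
    (TangentSpace (𝓡 m) : X → Type _)) {x₀ y : X} (hy : y ∈ (extChartAt (𝓡 m) x₀).source)
    (v w : EuclideanSpace ℝ (Fin m)) :
    christoffel D x₀ y v w = tangentCoordChange (𝓡 m) y x₀ y
      (D (coordField x₀ w) y (tangentCoordChange (𝓡 m) x₀ y y v)) := by
  rw [← coordField_eq hy]
  rfl

lemma mdifferentiableAt_coordField {x₀ y : X} (hy : y ∈ (extChartAt (𝓡 m) x₀).source)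
    (w : EuclideanSpace ℝ (Fin m)) :
    MDifferentiableAt (𝓡 m) (𝓡 m).tangent
      (fun z ↦ (⟨z, coordField x₀ w z⟩ : TangentBundle (𝓡 m) X)) y :=
  ((contMDiffOn_coordField x₀ w).contMDiffAt
    ((isOpen_extChartAt_source (I := 𝓡 m) x₀).mem_nhds hy)).mdifferentiableAt (by simp)

variable (D : CovariantDerivative (𝓡 m) (EuclideanSpace ℝ (Fin m))
    (TangentSpace (𝓡 m) : X → Type _))

/-- The Christoffel symbol is linear in the differentiated field. -/
lemma exists_linear_christoffel {x₀ y : X} (hy : y ∈ (extChartAt (𝓡 m) x₀).source) :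
    ∃ T : EuclideanSpace ℝ (Fin m) →ₗ[ℝ] EuclideanSpace ℝ (Fin m) →L[ℝ] EuclideanSpace ℝ (Fin m),
      ∀ v w, T w v = christoffel D x₀ y v w := by
  have hadd : ∀ w w' : EuclideanSpace ℝ (Fin m), D (coordField x₀ (w + w')) y =
      D (coordField x₀ w) y + D (coordField x₀ w') y := by
    intro w w'
    rw [← D.isCovariantDerivativeOnUniv.add (mdifferentiableAt_coordField hy w)
      (mdifferentiableAt_coordField hy w')]
    refine D.isCovariantDerivativeOnUniv.congr_of_eventuallyEq
      (mdifferentiableAt_coordField hy _) (mdifferentiableAt_add_section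
        (mdifferentiableAt_coordField hy w) (mdifferentiableAt_coordField hy w')) univ_mem ?_
    filter_upwards [(isOpen_extChartAt_source (I := 𝓡 m) x₀).mem_nhds hy] with z hz
    rw [Pi.add_apply, coordField_eq hz, coordField_eq hz, coordField_eq hz]
    exact map_add _ _ _
  have hsmul : ∀ (c : ℝ) (w : EuclideanSpace ℝ (Fin m)), D (coordField x₀ (c • w)) y =
      c • D (coordField x₀ w) y := by
    intro c w
    rw [← D.isCovariantDerivativeOnUniv.smul_const c (mdifferentiableAt_coordField hy w)]
    refine D.isCovariantDerivativeOnUniv.congr_of_eventuallyEq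
      (mdifferentiableAt_coordField hy _) (mdifferentiableAt_coordField hy w).smul_const_section
      univ_mem ?_
    filter_upwards [(isOpen_extChartAt_source (I := 𝓡 m) x₀).mem_nhds hy] with z hz
    rw [Pi.smul_apply, coordField_eq hz, coordField_eq hz]
    exact map_smul _ _ _
  let P : EuclideanSpace ℝ (Fin m) → (EuclideanSpace ℝ (Fin m) →L[ℝ] EuclideanSpace ℝ (Fin m)) :=
    fun w ↦ (tangentCoordChange (𝓡 m) y x₀ y).comp
      ((D (coordField x₀ w) y : EuclideanSpace ℝ (Fin m) →L[ℝ] EuclideanSpace ℝ (Fin m)).comp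
        (tangentCoordChange (𝓡 m) x₀ y y))
  refine ⟨⟨⟨P, fun w w' ↦ ?_⟩, fun c w ↦ ?_⟩, fun v w ↦ (christoffel_eq D hy v w).symm⟩
  · ext1 v
    change tangentCoordChange (𝓡 m) y x₀ y (D (coordField x₀ (w + w')) y _) = _
    rw [hadd]
    exact map_add (tangentCoordChange (𝓡 m) y x₀ y) _ _
  · ext1 v
    change tangentCoordChange (𝓡 m) y x₀ y (D (coordField x₀ (c • w)) y _) = _
    rw [hsmul]
    exact map_smul (tangentCoordChange (𝓡 m) y x₀ y) _ _

/-- Smoothness of the Christoffel symbols of a smooth connection. -/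
lemma exists_contDiffOn_christoffel [T2Space X] (hD : D.ContMDiffCovariantDerivative ∞) (x₀ : X) :
    ∃ U : Set (EuclideanSpace ℝ (Fin m)), IsOpen U ∧ extChartAt (𝓡 m) x₀ x₀ ∈ U ∧
      U ⊆ (extChartAt (𝓡 m) x₀).target ∧
      ∃ B : EuclideanSpace ℝ (Fin m) → EuclideanSpace ℝ (Fin m) →L[ℝ]
          EuclideanSpace ℝ (Fin m) →L[ℝ] EuclideanSpace ℝ (Fin m),
        ContDiffOn ℝ ∞ B U ∧ ∀ η ∈ U, ∀ v w,
          christoffel D x₀ ((extChartAt (𝓡 m) x₀).symm η) v w = B η v w := by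
  let V := EuclideanSpace ℝ (Fin m)
  let b := EuclideanSpace.basisFun (Fin m) ℝ
  let ρ : SmoothBumpFunction (𝓡 m) x₀ := Classical.arbitrary _
  let σ : Fin m → ∀ z : X, TangentSpace (𝓡 m) z := fun j ↦ (ρ : X → ℝ) • coordField x₀ (b j)
  have hσ : ∀ j, ContMDiff (𝓡 m) (𝓡 m).tangent ∞
      (fun z ↦ (⟨z, σ j z⟩ : TangentBundle (𝓡 m) X)) := fun j ↦
    ContMDiffOn.smul_section_of_tsupport ρ.contMDiff.contMDiffOn
      (isOpen_extChartAt_source (I := 𝓡 m) x₀) ρ.tsupport_subset_extChartAt_source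
      (contMDiffOn_coordField x₀ (b j))
  set e := trivializationAt (V →L[ℝ] V)
    (fun z : X ↦ TangentSpace (𝓡 m) z →L[ℝ] TangentSpace (𝓡 m) z) x₀ with he
  have hbase : e.baseSet = (extChartAt (𝓡 m) x₀).source := by
    rw [extChartAt_source, he, hom_trivializationAt_baseSet]
    exact inter_self _
  have hDσ : ∀ j, ContMDiffOn (𝓡 m) 𝓘(ℝ, V →L[ℝ] V) ∞
      (fun z ↦ (e ⟨z, D (σ j) z⟩).2) e.baseSet := by
    intro j
    have h1 := hD.contMDiff.contMDiff (σ := σ j) (by simpa using (hσ j).contMDiffOn)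
    exact (e.contMDiffOn_section_baseSet_iff (IB := 𝓡 m) (s := fun z ↦ D (σ j) z)).1
      (h1.mono (subset_univ _))
  let A : Fin m → V → (V →L[ℝ] V) := fun j η ↦
    (e ⟨(extChartAt (𝓡 m) x₀).symm η, D (σ j) ((extChartAt (𝓡 m) x₀).symm η)⟩).2
  have hA : ∀ j, ContDiffOn ℝ ∞ (A j) (extChartAt (𝓡 m) x₀).target := by
    intro j
    rw [← contMDiffOn_iff_contDiffOn]
    refine (hDσ j).comp (contMDiffOn_extChartAt_symm x₀) fun η hη ↦ ?_
    rw [mem_preimage, hbase]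
    exact (extChartAt (𝓡 m) x₀).map_target hη
  let O : Set X := {y | ∀ᶠ z in 𝓝 y, ρ z = 1}
  have hO : IsOpen O := isOpen_setOfPred_eventually_nhds
  refine ⟨(extChartAt (𝓡 m) x₀).target ∩ (extChartAt (𝓡 m) x₀).symm ⁻¹' O,
    (continuousOn_extChartAt_symm x₀).isOpen_inter_preimage (isOpen_extChartAt_target x₀) hO,
    ⟨mem_extChartAt_target x₀, ?_⟩, inter_subset_left,
    fun η ↦ ∑ j, (ContinuousLinearMap.smulRightL ℝ V V (EuclideanSpace.proj j)).comp (A j η),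
      ?_, ?_⟩
  · change ∀ᶠ z in 𝓝 ((extChartAt (𝓡 m) x₀).symm (extChartAt (𝓡 m) x₀ x₀)), ρ z = 1
    rw [extChartAt_to_inv]
    exact ρ.eventuallyEq_one
  · exact ContDiffOn.sum fun j _ ↦ contDiffOn_const.clm_comp ((hA j).mono inter_subset_left)
  · rintro η ⟨hη, hηO⟩ v w
    set y := (extChartAt (𝓡 m) x₀).symm η
    have hy : y ∈ (extChartAt (𝓡 m) x₀).source := (extChartAt (𝓡 m) x₀).map_target hη
    obtain ⟨T, hT⟩ := exists_linear_christoffel D hy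
    have hAj : ∀ j, A j η v = christoffel D x₀ y v (b j) := by
      intro j
      have hloc : D (σ j) y = D (coordField x₀ (b j)) y := by
        refine D.isCovariantDerivativeOnUniv.congr_of_eventuallyEq
          ((hσ j).mdifferentiable (by simp) y) (mdifferentiableAt_coordField hy _) univ_mem ?_
        filter_upwards [hηO] with z hz
        change ρ z • coordField x₀ (b j) z = coordField x₀ (b j) z
        rw [hz, one_smul]
      rw [christoffel_eq D hy]
      change (e ⟨y, D (σ j) y⟩).2 v = _
      rw [hloc, he, hom_trivializationAt_apply]
      change ContinuousLinearMap.inCoordinates V (TangentSpace (𝓡 m)) V (TangentSpace (𝓡 m)) x₀ y x₀ y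
        (D (coordField x₀ (b j)) y) v = _
      have hy' : y ∈ (chartAt V x₀).source := by rwa [extChartAt_source] at hy
      rw [ContinuousLinearMap.inCoordinates,
        TangentBundle.continuousLinearMapAt_trivializationAt_eq_core hy',
        TangentBundle.symmL_trivializationAt_eq_core hy']
      rfl
    rw [← hT v w]
    conv_lhs => rw [← b.sum_repr w]
    rw [map_sum]
    simp only [map_smul, sum_apply, smul_apply, ContinuousLinearMap.comp_apply]
    refine Finset.sum_congr rfl fun j _ ↦ ?_
    rw [hT, ← hAj]
    rfl

end Christoffel

end LagBdry

namespace LagBdry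

section ChristoffelChange

variable {m : ℕ} {X : Type*} [TopologicalSpace X]
  [ChartedSpace (EuclideanSpace ℝ (Fin m)) X] [IsManifold (𝓡 m) ∞ X]
  (D : CovariantDerivative (𝓡 m) (EuclideanSpace ℝ (Fin m))
    (TangentSpace (𝓡 m) : X → Type _))

lemma covariantDerivative_sum {ι : Type*} (s : Finset ι) {c : ι → X → ℝ}
    {σ : ι → ∀ z : X, TangentSpace (𝓡 m) z} {y : X}
    (hc : ∀ j, MDifferentiableAt (𝓡 m) 𝓘(ℝ, ℝ) (c j) y)
    (hσ : ∀ j, MDifferentiableAt (𝓡 m) (𝓡 m).tangent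
      (fun z ↦ (⟨z, σ j z⟩ : TangentBundle (𝓡 m) X)) y) :
    D (fun z ↦ ∑ j ∈ s, c j z • σ j z) y =
      ∑ j ∈ s, (c j y • D (σ j) y + (mvfderiv (𝓡 m) (c j) y).smulRight (σ j y)) := by
  classical
  induction s using Finset.induction_on with
  | empty =>
    simp only [Finset.sum_empty]
    exact D.isCovariantDerivativeOnUniv.zero
  | insert i s hi ih =>
    simp only [Finset.sum_insert hi]
    rw [← ih, ← D.isCovariantDerivativeOnUniv.leibniz (hσ i) (hc i)]
    exact D.isCovariantDerivativeOnUniv.add ((hc i).smul_section (hσ i))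
      (MDifferentiableAt.sum_section fun j _ ↦ (hc j).smul_section (hσ j))

lemma contDiffAt_chartChange {x₀ x₁ y : X} (h0 : y ∈ (extChartAt (𝓡 m) x₀).source)
    (h1 : y ∈ (extChartAt (𝓡 m) x₁).source) :
    ContDiffAt ℝ ∞ (extChartAt (𝓡 m) x₁ ∘ (extChartAt (𝓡 m) x₀).symm) (extChartAt (𝓡 m) x₀ y) := by
  have h' : extChartAt (𝓡 m) x₀ y ∈
      ((extChartAt (𝓡 m) x₀).symm ≫ (extChartAt (𝓡 m) x₁)).source := by
    rw [PartialEquiv.trans_source'', PartialEquiv.symm_symm, PartialEquiv.symm_target]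
    exact mem_image_of_mem _ ⟨h0, h1⟩
  have := contDiffWithinAt_ext_coord_change (I := 𝓡 m) (n := ∞) x₁ x₀ h'
  rwa [ModelWithCorners.range_eq_univ, contDiffWithinAt_univ] at this

lemma tangentCoordChange_eq_fderiv {x₀ x₁ y : X} :
    tangentCoordChange (𝓡 m) x₀ x₁ y =
      fderiv ℝ (extChartAt (𝓡 m) x₁ ∘ (extChartAt (𝓡 m) x₀).symm) (extChartAt (𝓡 m) x₀ y) := by
  rw [tangentCoordChange_def, ModelWithCorners.range_eq_univ, fderivWithin_univ]

/-- Transformation law of the Christoffel symbols under a change of charts. -/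
lemma christoffel_change {x₀ x₁ y : X} (h0 : y ∈ (extChartAt (𝓡 m) x₀).source)
    (h1 : y ∈ (extChartAt (𝓡 m) x₁).source) (v : EuclideanSpace ℝ (Fin m)) :
    tangentCoordChange (𝓡 m) x₀ x₁ y (christoffel D x₀ y v v) =
      fderiv ℝ (fderiv ℝ (extChartAt (𝓡 m) x₁ ∘ (extChartAt (𝓡 m) x₀).symm))
        (extChartAt (𝓡 m) x₀ y) v v +
      christoffel D x₁ y (tangentCoordChange (𝓡 m) x₀ x₁ y v)
        (tangentCoordChange (𝓡 m) x₀ x₁ y v) := by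
  let V := EuclideanSpace ℝ (Fin m)
  let b := EuclideanSpace.basisFun (Fin m) ℝ
  set τ : V → V := extChartAt (𝓡 m) x₁ ∘ (extChartAt (𝓡 m) x₀).symm with hτ
  have hyy := mem_extChartAt_source (I := 𝓡 m) y
  have hτd : ContDiffAt ℝ ∞ τ (extChartAt (𝓡 m) x₀ y) := contDiffAt_chartChange h0 h1
  have hτd' : DifferentiableAt ℝ (fderiv ℝ τ) (extChartAt (𝓡 m) x₀ y) :=
    (hτd.fderiv_right (m := 1) (by norm_cast)).differentiableAt (by simp)
  let c : Fin m → X → ℝ := fun j z ↦ fderiv ℝ τ (extChartAt (𝓡 m) x₀ z) v j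
  have hnear : ∀ᶠ z in 𝓝 y, coordField x₀ v z = ∑ j, c j z • coordField x₁ (b j) z := by
    filter_upwards [(isOpen_extChartAt_source (I := 𝓡 m) x₀).mem_nhds h0,
      (isOpen_extChartAt_source (I := 𝓡 m) x₁).mem_nhds h1] with z hz0 hz1
    have e1 : coordField x₀ v z =
        tangentCoordChange (𝓡 m) x₁ z z (tangentCoordChange (𝓡 m) x₀ x₁ z v) := by
      rw [coordField_eq hz0, tangentCoordChange_comp ⟨⟨hz0, hz1⟩, mem_extChartAt_source z⟩]
    rw [e1]
    conv_lhs => rw [← b.sum_repr (tangentCoordChange (𝓡 m) x₀ x₁ z v), map_sum]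
    refine Finset.sum_congr rfl fun j _ ↦ ?_
    rw [map_smul, coordField_eq hz1, tangentCoordChange_eq_fderiv]
    rfl
  have hcd : ∀ j, HasFDerivAt (c j ∘ (extChartAt (𝓡 m) x₀).symm)
      ((EuclideanSpace.proj j : V →L[ℝ] ℝ).comp
        ((fderiv ℝ (fderiv ℝ τ) (extChartAt (𝓡 m) x₀ y)).flip v)) (extChartAt (𝓡 m) x₀ y) := by
    intro j
    have h2 : HasFDerivAt (fun η ↦ fderiv ℝ τ η v j) _ (extChartAt (𝓡 m) x₀ y) :=
      (EuclideanSpace.proj j : V →L[ℝ] ℝ).hasFDerivAt.comp _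
        (hτd'.hasFDerivAt.clm_apply (hasFDerivAt_const v _))
    refine (h2.congr_fderiv ?_).congr_of_eventuallyEq ?_
    · ext w
      simp
    · filter_upwards [(isOpen_extChartAt_target x₀).mem_nhds
        ((extChartAt (𝓡 m) x₀).map_source h0)] with η hη
      simp only [c, Function.comp_apply, (extChartAt (𝓡 m) x₀).right_inv hη]
  have hc : ∀ j, MDifferentiableAt (𝓡 m) 𝓘(ℝ, ℝ) (c j) y := by
    intro j
    have h2 : MDifferentiableAt (𝓡 m) 𝓘(ℝ, ℝ)
        ((fun η ↦ fderiv ℝ τ η v j) ∘ extChartAt (𝓡 m) x₀) y := by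
      have h3 : DifferentiableAt ℝ (fun η ↦ fderiv ℝ τ η v j) (extChartAt (𝓡 m) x₀ y) :=
        (EuclideanSpace.proj j : V →L[ℝ] ℝ).differentiableAt.comp _
          (hτd'.clm_apply (differentiableAt_const v))
      have h4 : MDifferentiableAt (𝓡 m) 𝓘(ℝ, V) (extChartAt (𝓡 m) x₀) y :=
        mdifferentiableAt_extChartAt (by rwa [extChartAt_source] at h0)
      exact h3.mdifferentiableAt.comp y h4
    exact h2
  have hmv : ∀ j, mvfderiv (𝓡 m) (c j) y (tangentCoordChange (𝓡 m) x₀ y y v) =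
      fderiv ℝ (fderiv ℝ τ) (extChartAt (𝓡 m) x₀ y) v v j := by
    intro j
    have h2 := hasFDerivWithinAt_chartRep (p₀ := x₀) (y₀ := c j y) (hc j) h0
      (mem_extChartAt_source _)
    rw [ModelWithCorners.range_eq_univ, hasFDerivWithinAt_univ] at h2
    have h3 := DFunLike.congr_fun (h2.unique (hcd j)) v
    have h4 : tangentCoordChange 𝓘(ℝ, ℝ) (c j y) (c j y) (c j y)
        (mfderivModel (𝓡 m) 𝓘(ℝ, ℝ) (c j) y (tangentCoordChange (𝓡 m) x₀ y y v)) =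
        fderiv ℝ (fderiv ℝ τ) (extChartAt (𝓡 m) x₀ y) v v j := h3
    rw [tangentCoordChange_self (mem_extChartAt_source _)] at h4
    exact h4
  have hD1 : D (coordField x₀ v) y = ∑ j, (c j y • D (coordField x₁ (b j)) y +
      (mvfderiv (𝓡 m) (c j) y).smulRight (coordField x₁ (b j) y)) := by
    rw [← covariantDerivative_sum D Finset.univ hc fun j ↦ mdifferentiableAt_coordField h1 _]
    exact D.isCovariantDerivativeOnUniv.congr_of_eventuallyEq (mdifferentiableAt_coordField h0 _)
      (MDifferentiableAt.sum_section fun j _ ↦ (hc j).smul_section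
        (mdifferentiableAt_coordField h1 _)) univ_mem hnear
  obtain ⟨T, hT⟩ := exists_linear_christoffel D h1
  set u : V := tangentCoordChange (𝓡 m) x₀ x₁ y v with hu
  have hcu : ∀ j, c j y = u j := by
    intro j
    rw [hu, tangentCoordChange_eq_fderiv]
  let tc : V →L[ℝ] V := tangentCoordChange (𝓡 m) y x₁ y
  let S₀ : V →L[ℝ] V := D (coordField x₀ v) y
  let S : Fin m → V →L[ℝ] V := fun j ↦ D (coordField x₁ (b j)) y
  let w : Fin m → V := fun j ↦ coordField x₁ (b j) y
  let l : Fin m → V →L[ℝ] ℝ := fun j ↦ mvfderiv (𝓡 m) (c j) y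
  let v₀ : V := tangentCoordChange (𝓡 m) x₀ y y v
  have hv₀ : v₀ = tangentCoordChange (𝓡 m) x₁ y y u := by
    rw [hu, tangentCoordChange_comp ⟨⟨h0, h1⟩, hyy⟩]
  have hw : ∀ j, tc (w j) = b j := by
    intro j
    have : w j = tangentCoordChange (𝓡 m) x₁ y y (b j) := coordField_eq h1 _
    rw [this]
    exact tangentCoordChange_symm_apply h1 hyy _
  have hl : ∀ j, l j v₀ = fderiv ℝ (fderiv ℝ τ) (extChartAt (𝓡 m) x₀ y) v v j := hmv
  have hS₀ : S₀ = ∑ j, (c j y • S j + (l j).smulRight (w j)) := hD1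
  have hS : ∀ j, tc (S j v₀) = christoffel D x₁ y u (b j) := by
    intro j
    rw [hv₀]
    exact (christoffel_eq D h1 u (b j)).symm
  have e2 : tangentCoordChange (𝓡 m) x₀ x₁ y (christoffel D x₀ y v v) = tc (S₀ v₀) := by
    have : christoffel D x₀ y v v = tangentCoordChange (𝓡 m) y x₀ y (S₀ v₀) :=
      christoffel_eq D h0 v v
    rw [this]
    exact tangentCoordChange_comp ⟨⟨hyy, h0⟩, h1⟩
  have e3 : tc (S₀ v₀) = ∑ j, (u j • christoffel D x₁ y u (b j) +
        (fderiv ℝ (fderiv ℝ τ) (extChartAt (𝓡 m) x₀ y) v v j) • b j) := by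
    rw [hS₀, sum_apply, map_sum]
    refine Finset.sum_congr rfl fun j _ ↦ ?_
    rw [add_apply, smul_apply, ContinuousLinearMap.smulRight_apply, map_add, map_smul, map_smul,
      hw, hS, hl, hcu]
  rw [e2, e3, Finset.sum_add_distrib, add_comm]
  refine congrArg₂ _ ?_ ?_
  · exact b.sum_repr (fderiv ℝ (fderiv ℝ τ) (extChartAt (𝓡 m) x₀ y) v v)
  · have hTu : T u = ∑ j, u j • T (b j) := by
      conv_lhs => rw [← b.sum_repr u, map_sum]
      refine Finset.sum_congr rfl fun j _ ↦ ?_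
      rw [map_smul]
      rfl
    rw [← hT, hTu, sum_apply]
    refine Finset.sum_congr rfl fun j _ ↦ ?_
    rw [smul_apply, hT]

end ChristoffelChange

end LagBdry

namespace LagBdry

section Geodesics

variable {m : ℕ} {X : Type*} [TopologicalSpace X]
  [ChartedSpace (EuclideanSpace ℝ (Fin m)) X] [IsManifold (𝓡 m) ∞ X]
  {D : CovariantDerivative (𝓡 m) (EuclideanSpace ℝ (Fin m))
    (TangentSpace (𝓡 m) : X → Type _)}

/-- `B` represents the Christoffel symbols in the preferred chart at `x₀` over the open set `U`. -/
structure IsChristoffelRep (D : CovariantDerivative (𝓡 m) (EuclideanSpace ℝ (Fin m))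
    (TangentSpace (𝓡 m) : X → Type _)) (x₀ : X) (U : Set (EuclideanSpace ℝ (Fin m)))
    (B : EuclideanSpace ℝ (Fin m) → EuclideanSpace ℝ (Fin m) →L[ℝ]
      EuclideanSpace ℝ (Fin m) →L[ℝ] EuclideanSpace ℝ (Fin m)) : Prop where
  isOpen : IsOpen U
  mem : extChartAt (𝓡 m) x₀ x₀ ∈ U
  subset : U ⊆ (extChartAt (𝓡 m) x₀).target
  contDiffOn : ContDiffOn ℝ ∞ B U
  eq : ∀ η ∈ U, ∀ v w, christoffel D x₀ ((extChartAt (𝓡 m) x₀).symm η) v w = B η v w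

lemma IsGeodesicOn.mdifferentiableAt {γ : ℝ → X} {s : Set ℝ} (h : IsGeodesicOn D γ s) {t : ℝ}
    (ht : t ∈ s) : MDifferentiableAt 𝓘(ℝ, ℝ) (𝓡 m) γ t :=
  (h.2.1.contMDiffAt (h.1.mem_nhds ht)).mdifferentiableAt (by simp)

lemma IsGeodesicOn.continuousAt {γ : ℝ → X} {s : Set ℝ} (h : IsGeodesicOn D γ s) {t : ℝ}
    (ht : t ∈ s) : ContinuousAt γ t := (h.mdifferentiableAt ht).continuousAt

lemma IsGeodesicOn.contDiffAt_chart {γ : ℝ → X} {s : Set ℝ} (h : IsGeodesicOn D γ s) {t : ℝ}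
    (ht : t ∈ s) {x₀ : X} (hx : γ t ∈ (extChartAt (𝓡 m) x₀).source) :
    ContDiffAt ℝ 2 (fun r ↦ extChartAt (𝓡 m) x₀ (γ r)) t := by
  have h1 : ContMDiffAt 𝓘(ℝ, ℝ) (𝓡 m) 2 γ t := h.2.1.contMDiffAt (h.1.mem_nhds ht)
  have h2 : ContMDiffAt (𝓡 m) 𝓘(ℝ, EuclideanSpace ℝ (Fin m)) 2 (extChartAt (𝓡 m) x₀) (γ t) :=
    (contMDiffAt_extChartAt' (n := ∞) (by rwa [extChartAt_source] at hx)).of_le (by norm_cast)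
  exact (h2.comp t h1).contDiffAt

lemma IsGeodesicOn.comp_add {γ : ℝ → X} {s : Set ℝ} (h : IsGeodesicOn D γ s) (t₀ : ℝ) :
    IsGeodesicOn D (fun t ↦ γ (t + t₀)) ((fun t ↦ t + t₀) ⁻¹' s) := by
  refine ⟨h.1.preimage (by fun_prop), ?_, ?_⟩
  · refine h.2.1.comp (ContDiff.contMDiff (by fun_prop)).contMDiffOn (fun t ht ↦ ht)
  · intro x₀ t ht hx
    have := h.2.2 x₀ (t + t₀) ht hx
    rw [iteratedDeriv_comp_add_const (f := fun r ↦ extChartAt (𝓡 m) x₀ (γ r)),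
      deriv_comp_add_const (fun r ↦ extChartAt (𝓡 m) x₀ (γ r))]
    exact this

lemma IsGeodesicOn.hasDerivAt_spray {γ : ℝ → X} {s : Set ℝ} (h : IsGeodesicOn D γ s) {x₀ : X}
    {U : Set (EuclideanSpace ℝ (Fin m))} {B} (hB : IsChristoffelRep D x₀ U B) {t : ℝ}
    (ht : t ∈ s) (hx : γ t ∈ (extChartAt (𝓡 m) x₀).source)
    (hU : extChartAt (𝓡 m) x₀ (γ t) ∈ U) :
    HasDerivAt (fun r ↦ (extChartAt (𝓡 m) x₀ (γ r), deriv (fun r ↦ extChartAt (𝓡 m) x₀ (γ r)) r))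
      (spray B (extChartAt (𝓡 m) x₀ (γ t), deriv (fun r ↦ extChartAt (𝓡 m) x₀ (γ r)) t)) t := by
  have h1 := h.contDiffAt_chart ht hx
  have h2 : HasDerivAt (fun r ↦ extChartAt (𝓡 m) x₀ (γ r))
    (deriv (fun r ↦ extChartAt (𝓡 m) x₀ (γ r)) t) t := (h1.differentiableAt (by simp)).hasDerivAt
  have h3 : DifferentiableAt ℝ (deriv (fun r ↦ extChartAt (𝓡 m) x₀ (γ r))) t := by
    have h4 : ContDiffAt ℝ 1 (deriv (fun r ↦ extChartAt (𝓡 m) x₀ (γ r))) t := by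
      have : ContDiffAt ℝ 1 (fun r ↦ fderiv ℝ (fun r ↦ extChartAt (𝓡 m) x₀ (γ r)) r 1) t :=
        (h1.fderiv_right (m := 1) (by norm_num)).clm_apply contDiffAt_const
      exact this
    exact h4.differentiableAt (by simp)
  have h5 := h.2.2 x₀ t ht hx
  rw [iteratedDeriv_succ, iteratedDeriv_one] at h5
  have h6 := hB.eq _ hU (deriv (fun r ↦ extChartAt (𝓡 m) x₀ (γ r)) t)
    (deriv (fun r ↦ extChartAt (𝓡 m) x₀ (γ r)) t)
  rw [(extChartAt (𝓡 m) x₀).left_inv hx] at h6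
  rw [h6] at h5
  have h7 := h3.hasDerivAt
  rw [eq_neg_of_add_eq_zero_left h5] at h7
  exact h2.prodMk h7

lemma isGeodesicOn_of_spray {x₀ : X} {U : Set (EuclideanSpace ℝ (Fin m))} {B}
    (hB : IsChristoffelRep D x₀ U B) {s : Set ℝ} (hs : IsOpen s)
    {q : ℝ → EuclideanSpace ℝ (Fin m) × EuclideanSpace ℝ (Fin m)}
    (hq : ∀ t ∈ s, HasDerivAt q (spray B (q t)) t) (hU : ∀ t ∈ s, (q t).1 ∈ U) :
    IsGeodesicOn D (fun t ↦ (extChartAt (𝓡 m) x₀).symm (q t).1) s := by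
  have hq1 : ∀ t ∈ s, HasDerivAt (fun t ↦ (q t).1) (q t).2 t := fun t ht ↦ (hq t ht).fst
  have hq2 : ∀ t ∈ s, HasDerivAt (fun t ↦ (q t).2) (-B (q t).1 (q t).2 (q t).2) t :=
    fun t ht ↦ (hq t ht).snd
  have hqc : ContinuousOn q s := fun t ht ↦ (hq t ht).continuousAt.continuousWithinAt
  have c2 : ContDiffOn ℝ 1 (fun t ↦ (q t).2) s := by
    rw [show (1 : WithTop ℕ∞) = 0 + 1 by norm_num, contDiffOn_succ_iff_deriv_of_isOpen hs]
    refine ⟨fun t ht ↦ (hq2 t ht).differentiableAt.differentiableWithinAt, by simp, ?_⟩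
    rw [contDiffOn_zero]
    have hBc : ContinuousOn (fun t ↦ B (q t).1) s :=
      hB.contDiffOn.continuousOn.comp (continuous_fst.comp_continuousOn hqc) hU
    have h2c : ContinuousOn (fun t ↦ (q t).2) s := continuous_snd.comp_continuousOn hqc
    exact ((hBc.clm_apply h2c).clm_apply h2c).neg.congr fun t ht ↦ (hq2 t ht).deriv
  have c1 : ContDiffOn ℝ 2 (fun t ↦ (q t).1) s := by
    rw [show (2 : WithTop ℕ∞) = 1 + 1 by norm_num, contDiffOn_succ_iff_deriv_of_isOpen hs]
    refine ⟨fun t ht ↦ (hq1 t ht).differentiableAt.differentiableWithinAt, by simp, ?_⟩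
    exact c2.congr fun t ht ↦ (hq1 t ht).deriv
  refine ⟨hs, ?_, ?_⟩
  · exact ((contMDiffOn_extChartAt_symm (I := 𝓡 m) (n := ∞) x₀).of_le (by norm_cast)).comp
      (contMDiffOn_iff_contDiffOn.2 c1) fun t ht ↦ hB.subset (hU t ht)
  · intro x₁ t ht hx
    set y := (extChartAt (𝓡 m) x₀).symm (q t).1 with hy
    have hy0 : y ∈ (extChartAt (𝓡 m) x₀).source :=
      (extChartAt (𝓡 m) x₀).map_target (hB.subset (hU t ht))
    have hyq : extChartAt (𝓡 m) x₀ y = (q t).1 :=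
      (extChartAt (𝓡 m) x₀).right_inv (hB.subset (hU t ht))
    set τ := extChartAt (𝓡 m) x₁ ∘ (extChartAt (𝓡 m) x₀).symm with hτ
    have hτd : ContDiffAt ℝ ∞ τ (q t).1 := by
      rw [← hyq]
      exact contDiffAt_chartChange hy0 hx
    have hev : ∀ᶠ r in 𝓝 t, HasDerivAt (fun r ↦ τ (q r).1) (fderiv ℝ τ (q r).1 (q r).2) r := by
      have h1 : ∀ᶠ η in 𝓝 (q t).1, ContDiffAt ℝ 1 τ η :=
        (hτd.of_le (by norm_cast)).eventually (by simp)
      filter_upwards [((hq1 t ht).continuousAt).eventually h1, hs.mem_nhds ht] with r hr hrs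
      exact (hr.differentiableAt (by simp)).hasFDerivAt.comp_hasDerivAt r (hq1 r hrs)
    have hd1 : deriv (fun r ↦ τ (q r).1) t = tangentCoordChange (𝓡 m) x₀ x₁ y (q t).2 := by
      rw [hev.self_of_nhds.deriv, tangentCoordChange_eq_fderiv, hyq]
    have hτd' : DifferentiableAt ℝ (fderiv ℝ τ) (q t).1 :=
      (hτd.fderiv_right (m := 1) (by norm_cast)).differentiableAt (by simp)
    have hd2 : HasDerivAt (fun r ↦ fderiv ℝ τ (q r).1 (q r).2)
        (fderiv ℝ (fderiv ℝ τ) (q t).1 (q t).2 (q t).2 +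
          fderiv ℝ τ (q t).1 (-B (q t).1 (q t).2 (q t).2)) t := by
      have ha : HasDerivAt (fun r ↦ fderiv ℝ τ (q r).1)
          (fderiv ℝ (fderiv ℝ τ) (q t).1 (q t).2) t :=
        HasFDerivAt.comp_hasDerivAt (f := fun r ↦ (q r).1) t hτd'.hasFDerivAt (hq1 t ht)
      exact HasDerivAt.clm_apply ha (hq2 t ht)
    have hd2' : iteratedDeriv 2 (fun r ↦ τ (q r).1) t =
        fderiv ℝ (fderiv ℝ τ) (q t).1 (q t).2 (q t).2 +
          fderiv ℝ τ (q t).1 (-B (q t).1 (q t).2 (q t).2) := by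
      rw [iteratedDeriv_succ, iteratedDeriv_one, ← hd2.deriv]
      exact EventuallyEq.deriv_eq (hev.mono fun r hr ↦ hr.deriv)
    have hch := christoffel_change D hy0 hx (q t).2
    rw [← hτ, hyq] at hch
    have hB2 := hB.eq _ (hU t ht) (q t).2 (q t).2
    rw [← hy] at hB2
    rw [hB2] at hch
    change iteratedDeriv 2 (fun r ↦ τ (q r).1) t + christoffel D x₁ y
      (deriv (fun r ↦ τ (q r).1) t) (deriv (fun r ↦ τ (q r).1) t) = 0
    rw [hd2', hd1, map_neg, ← hyq, ← tangentCoordChange_eq_fderiv, hyq, hch]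
    abel

lemma velocity_eq_velocity_iff {γ₁ γ₂ : ℝ → X} {t : ℝ}
    (h1 : MDifferentiableAt 𝓘(ℝ, ℝ) (𝓡 m) γ₁ t) (h2 : MDifferentiableAt 𝓘(ℝ, ℝ) (𝓡 m) γ₂ t)
    {x₀ : X} (hx : γ₁ t ∈ (extChartAt (𝓡 m) x₀).source) :
    velocity (𝓡 m) γ₁ t = velocity (𝓡 m) γ₂ t ↔ γ₁ t = γ₂ t ∧
      deriv (fun r ↦ extChartAt (𝓡 m) x₀ (γ₁ r)) t =
        deriv (fun r ↦ extChartAt (𝓡 m) x₀ (γ₂ r)) t := by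
  have k1 := ((velocity_eq_iff h1 hx (mfderivModel 𝓘(ℝ, ℝ) (𝓡 m) γ₁ t 1)).1 rfl).2
  constructor
  · intro h
    have h' : velocity (𝓡 m) γ₂ t = ⟨γ₁ t, mfderivModel 𝓘(ℝ, ℝ) (𝓡 m) γ₁ t 1⟩ := h.symm.trans rfl
    obtain ⟨a, b⟩ := (velocity_eq_iff h2 hx _).1 h'
    exact ⟨a.symm, k1.deriv.trans b.deriv.symm⟩
  · rintro ⟨ha, hb⟩
    have k2 := ((velocity_eq_iff h2 (ha ▸ hx) (mfderivModel 𝓘(ℝ, ℝ) (𝓡 m) γ₂ t 1)).1 rfl).2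
    rw [k2.deriv, k1.deriv] at hb
    have h' : velocity (𝓡 m) γ₂ t = ⟨γ₁ t, mfderivModel 𝓘(ℝ, ℝ) (𝓡 m) γ₁ t 1⟩ := by
      refine (velocity_eq_iff h2 hx _).2 ⟨ha.symm, ?_⟩
      rw [hb]
      exact k2
    exact Eq.trans rfl h'.symm

lemma IsGeodesicOn.continuousAt_chart_deriv {γ : ℝ → X} {s : Set ℝ} (h : IsGeodesicOn D γ s) {t : ℝ}
    (ht : t ∈ s) {x₀ : X} (hx : γ t ∈ (extChartAt (𝓡 m) x₀).source) :
    ContinuousAt (deriv (fun r ↦ extChartAt (𝓡 m) x₀ (γ r))) t := by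
  have h1 := h.contDiffAt_chart ht hx
  have : ContDiffAt ℝ 1 (fun r ↦ fderiv ℝ (fun r ↦ extChartAt (𝓡 m) x₀ (γ r)) r 1) t :=
    (h1.fderiv_right (m := 1) (by norm_num)).clm_apply contDiffAt_const
  exact this.continuousAt

lemma exists_isChristoffelRep [T2Space X] (hD : D.ContMDiffCovariantDerivative ∞) (x₀ : X) :
    ∃ U B, IsChristoffelRep D x₀ U B := by
  obtain ⟨U, h1, h2, h3, B, h4, h5⟩ := exists_contDiffOn_christoffel D hD x₀
  exact ⟨U, B, h1, h2, h3, h4, h5⟩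

/-- Geodesics with the same velocity at some time agree nearby. -/
lemma IsGeodesicOn.eventually_velocity_eq [T2Space X] (hD : D.ContMDiffCovariantDerivative ∞)
    {γ₁ γ₂ : ℝ → X} {s₁ s₂ : Set ℝ} (h1 : IsGeodesicOn D γ₁ s₁) (h2 : IsGeodesicOn D γ₂ s₂)
    {t : ℝ} (ht1 : t ∈ s₁) (ht2 : t ∈ s₂) (h : velocity (𝓡 m) γ₁ t = velocity (𝓡 m) γ₂ t) :
    ∀ᶠ r in 𝓝 t, velocity (𝓡 m) γ₁ r = velocity (𝓡 m) γ₂ r := by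
  obtain ⟨U, B, hB⟩ := exists_isChristoffelRep hD (γ₁ t)
  set x₀ := γ₁ t with hx₀
  have hx1 : γ₁ t ∈ (extChartAt (𝓡 m) x₀).source := mem_extChartAt_source _
  obtain ⟨ha, hb⟩ := (velocity_eq_velocity_iff (h1.mdifferentiableAt ht1)
    (h2.mdifferentiableAt ht2) hx1).1 h
  have hx2 : γ₂ t ∈ (extChartAt (𝓡 m) x₀).source := ha ▸ hx1
  have hsrc : ∀ {γ : ℝ → X} {s : Set ℝ}, IsGeodesicOn D γ s → t ∈ s → γ t = x₀ →
      ∀ᶠ r in 𝓝 t, r ∈ s ∧ γ r ∈ (extChartAt (𝓡 m) x₀).source ∧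
        extChartAt (𝓡 m) x₀ (γ r) ∈ U := by
    intro γ s hγ hts hγt
    have hc := hγ.continuousAt hts
    have h5 : ∀ᶠ y in 𝓝 (γ t), y ∈ (extChartAt (𝓡 m) x₀).source ∧ extChartAt (𝓡 m) x₀ y ∈ U := by
      rw [hγt]
      exact Filter.inter_mem (extChartAt_source_mem_nhds (I := 𝓡 m) x₀)
        ((continuousAt_extChartAt (I := 𝓡 m) x₀).eventually (hB.isOpen.mem_nhds hB.mem))
    filter_upwards [hγ.1.mem_nhds hts, hc.eventually h5] with r ha hb using ⟨ha, hb⟩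
  have ev1 := hsrc h1 ht1 rfl
  have ev2 := hsrc h2 ht2 (ha.symm.trans hx₀.symm)
  set u₁ := fun r ↦ (extChartAt (𝓡 m) x₀ (γ₁ r), deriv (fun r ↦ extChartAt (𝓡 m) x₀ (γ₁ r)) r)
  set u₂ := fun r ↦ (extChartAt (𝓡 m) x₀ (γ₂ r), deriv (fun r ↦ extChartAt (𝓡 m) x₀ (γ₂ r)) r)
  have hu : u₁ t = u₂ t := Prod.ext (congrArg (extChartAt (𝓡 m) x₀) ha) hb
  have hcd : ContDiffAt ℝ 1 (spray B) (u₁ t) := by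
    have hm : u₁ t ∈ U ×ˢ (univ : Set (EuclideanSpace ℝ (Fin m))) := ⟨hB.mem, mem_univ _⟩
    exact ((contDiffOn_spray hB.contDiffOn).contDiffAt
      ((hB.isOpen.prod isOpen_univ).mem_nhds hm)).of_le (by norm_cast)
  obtain ⟨Kc, S, hS, hLip⟩ := hcd.exists_lipschitzOnWith
  have d1 : ∀ᶠ r in 𝓝 t, HasDerivAt u₁ (spray B (u₁ r)) r ∧ u₁ r ∈ S := by
    have hd := ev1.mono fun r hr ↦ h1.hasDerivAt_spray hB hr.1 hr.2.1 hr.2.2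
    exact hd.and (hd.self_of_nhds.continuousAt.eventually hS)
  have d2 : ∀ᶠ r in 𝓝 t, HasDerivAt u₂ (spray B (u₂ r)) r ∧ u₂ r ∈ S := by
    have hd := ev2.mono fun r hr ↦ h2.hasDerivAt_spray hB hr.1 hr.2.1 hr.2.2
    rw [hu] at hS
    exact hd.and (hd.self_of_nhds.continuousAt.eventually hS)
  have heq := ODE_solution_unique_of_eventually (v := fun _ ↦ spray B) (s := fun _ ↦ S)
    (Eventually.of_forall fun _ ↦ hLip) d1 d2 hu
  filter_upwards [heq, ev1, ev2] with r hr e1 e2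
  refine (velocity_eq_velocity_iff (h1.mdifferentiableAt e1.1) (h2.mdifferentiableAt e2.1)
    e1.2.1).2 ⟨?_, congrArg Prod.snd hr⟩
  exact (extChartAt (𝓡 m) x₀).injOn e1.2.1 e2.2.1 (congrArg Prod.fst hr)

/-- Uniqueness of geodesics. -/
lemma IsGeodesicOn.eqOn_Icc [T2Space X] (hD : D.ContMDiffCovariantDerivative ∞)
    {γ₁ γ₂ : ℝ → X} {s₁ s₂ : Set ℝ} (h1 : IsGeodesicOn D γ₁ s₁) (h2 : IsGeodesicOn D γ₂ s₂)
    {b : ℝ} (hs1 : Icc 0 b ⊆ s₁) (hs2 : Icc 0 b ⊆ s₂)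
    (h : velocity (𝓡 m) γ₁ 0 = velocity (𝓡 m) γ₂ 0) : EqOn γ₁ γ₂ (Icc 0 b) := by
  have key : Icc 0 b ⊆ {t | velocity (𝓡 m) γ₁ t = velocity (𝓡 m) γ₂ t} := by
    refine IsClosed.Icc_subset_of_forall_mem_nhdsWithin ?_ h ?_
    · refine isClosed_of_closure_subset fun t ht ↦ ?_
      have htI : t ∈ Icc 0 b := isClosed_Icc.closure_subset (closure_mono inter_subset_right ht)
      refine ⟨?_, htI⟩
      have hc1 := h1.continuousAt (hs1 htI)
      have hc2 := h2.continuousAt (hs2 htI)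
      have hfr : ∃ᶠ r in 𝓝 t, r ∈ {t | velocity (𝓡 m) γ₁ t = velocity (𝓡 m) γ₂ t} ∩ Icc 0 b :=
        mem_closure_iff_frequently.1 ht
      have e0 : γ₁ t = γ₂ t := by
        refine isClosed_diagonal.mem_of_frequently_of_tendsto
          (X := X × X) (f := fun r ↦ (γ₁ r, γ₂ r)) (hfr.mono fun r hr ↦ ?_) (hc1.prodMk hc2)
        exact congrArg (fun w : TangentBundle (𝓡 m) X ↦ w.1) hr.1
      have hx : γ₁ t ∈ (extChartAt (𝓡 m) (γ₁ t)).source := mem_extChartAt_source _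
      refine (velocity_eq_velocity_iff (h1.mdifferentiableAt (hs1 htI))
        (h2.mdifferentiableAt (hs2 htI)) hx).2 ⟨e0, ?_⟩
      refine isClosed_diagonal.mem_of_frequently_of_tendsto
        (X := EuclideanSpace ℝ (Fin m) × EuclideanSpace ℝ (Fin m)) (f := fun r ↦ (deriv (fun r ↦ extChartAt (𝓡 m) (γ₁ t) (γ₁ r)) r,
          deriv (fun r ↦ extChartAt (𝓡 m) (γ₁ t) (γ₂ r)) r)) ?_
        ((h1.continuousAt_chart_deriv (hs1 htI) hx).prodMk
          (h2.continuousAt_chart_deriv (hs2 htI) (e0 ▸ hx)))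
      refine (hfr.and_eventually
        (hc1.eventually (extChartAt_source_mem_nhds (I := 𝓡 m) (γ₁ t)))).mono fun r hr ↦ ?_
      exact ((velocity_eq_velocity_iff (h1.mdifferentiableAt (hs1 hr.1.2))
        (h2.mdifferentiableAt (hs2 hr.1.2)) hr.2).1 hr.1.1).2
    · rintro t ⟨ht, htI⟩
      exact nhdsWithin_le_nhds (h1.eventually_velocity_eq hD h2 (hs1 (Ico_subset_Icc_self htI))
        (hs2 (Ico_subset_Icc_self htI)) ht)
  exact fun t ht ↦ congrArg (fun w : TangentBundle (𝓡 m) X ↦ w.1) (key ht)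

lemma IsExp.unique [T2Space X] (hD : D.ContMDiffCovariantDerivative ∞) {x : X}
    {v : TangentSpace (𝓡 m) x} {y y' : X} (h : IsExp D x v y) (h' : IsExp D x v y') : y = y' := by
  obtain ⟨γ, s, hs, hγ, h0, rfl⟩ := h
  obtain ⟨γ', s', hs', hγ', h0', rfl⟩ := h'
  exact hγ.eqOn_Icc hD hγ' hs hs' (h0.trans h0'.symm) ⟨zero_le_one, le_rfl⟩

lemma IsExp.expMap_eq [T2Space X] (hD : D.ContMDiffCovariantDerivative ∞) {x : X}
    {v : TangentSpace (𝓡 m) x} {y : X} (h : IsExp D x v y) : expMap D x v = y := by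
  have hex : ∃ y, IsExp D x v y := ⟨y, h⟩
  rw [expMap, dif_pos hex]
  exact hex.choose_spec.unique hD h

/-- The exponential map in a chart. -/
theorem exists_chart_exp [T2Space X] (hD : D.ContMDiffCovariantDerivative ∞) (x₀ : X) :
    ∃ Ex : EuclideanSpace ℝ (Fin m) × EuclideanSpace ℝ (Fin m) → EuclideanSpace ℝ (Fin m),
      (∀ᶠ z in 𝓝 (extChartAt (𝓡 m) x₀ x₀, (0 : EuclideanSpace ℝ (Fin m))), ContDiffAt ℝ ∞ Ex z) ∧
      HasFDerivAt Ex (ContinuousLinearMap.fst ℝ _ _ + ContinuousLinearMap.snd ℝ _ _)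
        (extChartAt (𝓡 m) x₀ x₀, (0 : EuclideanSpace ℝ (Fin m))) ∧
      (∀ᶠ y in 𝓝 (extChartAt (𝓡 m) x₀ x₀), Ex (y, 0) = y) ∧
      ∀ N ∈ 𝓝 x₀, ∀ᶠ z in 𝓝 (extChartAt (𝓡 m) x₀ x₀, (0 : EuclideanSpace ℝ (Fin m))),
        z.1 ∈ (extChartAt (𝓡 m) x₀).target ∧ Ex z ∈ (extChartAt (𝓡 m) x₀).target ∧
        ∃ γ : ℝ → X, IsGeodesicOn D γ (Ioo (-1) 2) ∧
          velocity (𝓡 m) γ 0 = ⟨(extChartAt (𝓡 m) x₀).symm z.1,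
            tangentCoordChange (𝓡 m) x₀ ((extChartAt (𝓡 m) x₀).symm z.1)
              ((extChartAt (𝓡 m) x₀).symm z.1) z.2⟩ ∧
          γ 1 = (extChartAt (𝓡 m) x₀).symm (Ex z) ∧ ∀ t ∈ Ioo (-1 : ℝ) 2, γ t ∈ N := by
  obtain ⟨U, B, hB⟩ := exists_isChristoffelRep hD x₀
  obtain ⟨Ex, k1, k2, k3, k4⟩ := exists_expCoord hB.isOpen hB.mem hB.contDiffOn
  refine ⟨Ex, k1, k2, k3, fun N hN ↦ ?_⟩
  have hN' : U ∩ (extChartAt (𝓡 m) x₀).symm ⁻¹' N ∈ 𝓝 (extChartAt (𝓡 m) x₀ x₀) := by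
    refine inter_mem (hB.isOpen.mem_nhds hB.mem) ?_
    refine (continuousAt_extChartAt_symm (I := 𝓡 m) x₀).preimage_mem_nhds ?_
    rwa [extChartAt_to_inv]
  filter_upwards [k4 _ hN'] with z hz
  obtain ⟨q, hq0, hq1, hq⟩ := hz
  have m0 : (0 : ℝ) ∈ Ioo (-1 : ℝ) 2 := by constructor <;> norm_num
  have m1 : (1 : ℝ) ∈ Ioo (-1 : ℝ) 2 := by constructor <;> norm_num
  have t0 : z.1 ∈ (extChartAt (𝓡 m) x₀).target := by
    have := (hq 0 m0).2.1
    rw [hq0] at this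
    exact hB.subset this
  have hg := isGeodesicOn_of_spray hB isOpen_Ioo (fun t ht ↦ (hq t ht).1) fun t ht ↦ (hq t ht).2.1
  refine ⟨t0, hq1 ▸ hB.subset (hq 1 m1).2.1, _, hg, ?_, ?_, fun t ht ↦ (hq t ht).2.2⟩
  · have hs := (extChartAt (𝓡 m) x₀).map_target t0
    refine (velocity_eq_iff (hg.mdifferentiableAt m0) hs _).2 ⟨by rw [hq0], ?_⟩
    rw [tangentCoordChange_symm_apply hs (mem_extChartAt_source _)]
    have hd : HasDerivAt (fun t ↦ (q t).1) (spray B (q 0)).1 0 := (hq 0 m0).1.fst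
    have h2 : (spray B (q 0)).1 = z.2 := by rw [hq0]; rfl
    rw [h2] at hd
    refine hd.congr_of_eventuallyEq ?_
    filter_upwards [isOpen_Ioo.mem_nhds m0] with t ht
    exact (extChartAt (𝓡 m) x₀).right_inv (hB.subset (hq t ht).2.1)
  · rw [hq1]

end Geodesics

end LagBdry

namespace LagBdry

section Linear

variable {V : Type*} [NormedAddCommGroup V] [NormedSpace ℝ V] [FiniteDimensional ℝ V]

lemma deriv_mem_of_eventually_mem {W : Submodule ℝ V} {g : ℝ → V} {g' : V} {t : ℝ}
    (hd : HasDerivAt g g' t) (h : ∀ᶠ r in 𝓝 t, g r ∈ W) : g' ∈ W := by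
  have hW : IsClosed (W : Set V) := W.closed_of_finiteDimensional
  refine hW.mem_of_tendsto (hasDerivAt_iff_tendsto_slope.1 hd)
    (nhdsWithin_le_nhds (h.mono fun r hr ↦ ?_))
  exact W.smul_mem _ (W.sub_mem hr h.self_of_nhds)

lemma isInvertible_of_comp_eq_id {A B : V →L[ℝ] V} (h : B.comp A = .id ℝ V) : A.IsInvertible := by
  refine ContinuousLinearMap.IsInvertible.of_inverse (g := B) ?_ h
  have h1 : (B : V →ₗ[ℝ] V) * (A : V →ₗ[ℝ] V) = 1 := by
    ext v
    exact DFunLike.congr_fun h v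
  have h2 := mul_eq_one_comm.1 h1
  ext v
  exact LinearMap.congr_fun h2 v

end Linear

section Slices

variable {m : ℕ} {X : Type*} [TopologicalSpace X]
  [ChartedSpace (EuclideanSpace ℝ (Fin m)) X] [IsManifold (𝓡 m) ∞ X]

/-- A map straightening the subset `S` near `x₀`, in the coordinates of the preferred chart. -/
structure IsSlice (S : Set X) (x₀ : X) (O : Set (EuclideanSpace ℝ (Fin m)))
    (σ : EuclideanSpace ℝ (Fin m) → EuclideanSpace ℝ (Fin m))
    (W : Submodule ℝ (EuclideanSpace ℝ (Fin m))) : Prop where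
  isOpen : IsOpen O
  mem : extChartAt (𝓡 m) x₀ x₀ ∈ O
  subset : O ⊆ (extChartAt (𝓡 m) x₀).target
  contDiffOn : ContDiffOn ℝ ∞ σ O
  invertible : ∀ y ∈ O, (fderiv ℝ σ y).IsInvertible
  injOn : InjOn σ O
  mem_iff : ∀ y ∈ O, ((extChartAt (𝓡 m) x₀).symm y ∈ S ↔ σ y ∈ W)

lemma IsEmbeddedSubmanifold.exists_isSlice {k : ℕ} {S : Set X} (hS : IsEmbeddedSubmanifold m k S)
    {x₀ : X} (hx : x₀ ∈ S) : ∃ O σ W, IsSlice (m := m) S x₀ O σ W ∧ Module.finrank ℝ W = k := by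
  obtain ⟨φ, hφ, hxφ, W, hW, hSW⟩ := hS x₀ hx
  set χ := extChartAt (𝓡 m) x₀ with hχ
  have hO : IsOpen (χ.target ∩ χ.symm ⁻¹' φ.source) :=
    (continuousOn_extChartAt_symm x₀).isOpen_inter_preimage (isOpen_extChartAt_target x₀)
      φ.open_source
  have hsm : ContDiffOn ℝ ∞ (φ ∘ χ.symm) (χ.target ∩ χ.symm ⁻¹' φ.source) := by
    rw [← contMDiffOn_iff_contDiffOn]
    exact (contMDiffOn_of_mem_maximalAtlas hφ).comp
      ((contMDiffOn_extChartAt_symm x₀).mono inter_subset_left) fun y hy ↦ hy.2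
  refine ⟨χ.target ∩ χ.symm ⁻¹' φ.source, φ ∘ χ.symm, W, ⟨hO, ⟨mem_extChartAt_target x₀, ?_⟩,
    inter_subset_left, hsm, ?_, ?_, ?_⟩, hW⟩
  · rw [mem_preimage, hχ, extChartAt_to_inv]
    exact hxφ
  · rintro y hy
    have h1 : HasFDerivAt (φ ∘ χ.symm) (fderiv ℝ (φ ∘ χ.symm) y) y :=
      ((hsm.contDiffAt (hO.mem_nhds hy)).differentiableAt (by simp)).hasFDerivAt
    have hz : φ (χ.symm y) ∈ φ.target := φ.map_source hy.2
    have h2 : ContMDiffAt 𝓘(ℝ, EuclideanSpace ℝ (Fin m)) 𝓘(ℝ, EuclideanSpace ℝ (Fin m)) ∞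
        (χ ∘ φ.symm) ((φ ∘ χ.symm) y) := by
      have h3 : ContMDiffAt (𝓡 m) 𝓘(ℝ, EuclideanSpace ℝ (Fin m)) ∞ χ (φ.symm (φ (χ.symm y))) := by
        rw [φ.left_inv hy.2]
        refine contMDiffAt_extChartAt' ?_
        have := χ.map_target hy.1
        rwa [hχ, extChartAt_source] at this
      exact h3.comp _ ((contMDiffOn_symm_of_mem_maximalAtlas hφ).contMDiffAt
        (φ.open_target.mem_nhds hz))
    have h4 : HasFDerivAt (χ ∘ φ.symm) (fderiv ℝ (χ ∘ φ.symm) ((φ ∘ χ.symm) y)) ((φ ∘ χ.symm) y) :=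
      (h2.contDiffAt.differentiableAt (by simp)).hasFDerivAt
    have h5 := HasFDerivAt.comp (g := χ ∘ φ.symm) (f := φ ∘ χ.symm) y h4 h1
    refine isInvertible_of_comp_eq_id (h5.unique ((hasFDerivAt_id y).congr_of_eventuallyEq ?_))
    filter_upwards [hO.mem_nhds hy] with z hz
    simp only [Function.comp_apply, id]
    rw [φ.left_inv hz.2, χ.right_inv hz.1]
  · intro y hy z hz h
    exact χ.symm.injOn hy.1 hz.1 (φ.injOn hy.2 hz.2 h)
  · rintro y ⟨hy, hyφ⟩
    have h : χ.symm y ∈ φ.source ∩ S ↔ χ.symm y ∈ φ.source ∩ φ ⁻¹' W := by rw [hSW]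
    exact ⟨fun h1 ↦ (h.1 ⟨hyφ, h1⟩).2, fun h1 ↦ (h.2 ⟨hyφ, h1⟩).2⟩

variable {S : Set X} {x₀ : X} {O : Set (EuclideanSpace ℝ (Fin m))}
  {σ : EuclideanSpace ℝ (Fin m) → EuclideanSpace ℝ (Fin m)}
  {W : Submodule ℝ (EuclideanSpace ℝ (Fin m))}

lemma IsSlice.differentiableAt (hs : IsSlice S x₀ O σ W) {y} (hy : y ∈ O) :
    HasFDerivAt σ (fderiv ℝ σ y) y :=
  ((hs.contDiffOn.contDiffAt (hs.isOpen.mem_nhds hy)).differentiableAt (by simp)).hasFDerivAt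

lemma IsSlice.mem_iff' (hs : IsSlice S x₀ O σ W) {x : X}
    (hx : x ∈ (extChartAt (𝓡 m) x₀).source) (hy : extChartAt (𝓡 m) x₀ x ∈ O) :
    x ∈ S ↔ σ (extChartAt (𝓡 m) x₀ x) ∈ W := by
  have := hs.mem_iff _ hy
  rwa [(extChartAt (𝓡 m) x₀).left_inv hx] at this

lemma IsSlice.tangentOf_iff (hs : IsSlice S x₀ O σ W) {x : X}
    (hx : x ∈ (extChartAt (𝓡 m) x₀).source) (hy : extChartAt (𝓡 m) x₀ x ∈ O) (hxS : x ∈ S)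
    (v : EuclideanSpace ℝ (Fin m)) : (v : TangentSpace (𝓡 m) x) ∈ tangentOf (𝓡 m) S x ↔
      fderiv ℝ σ (extChartAt (𝓡 m) x₀ x) (tangentCoordChange (𝓡 m) x x₀ x v) ∈ W := by
  set χ := extChartAt (𝓡 m) x₀ with hχ
  let P : EuclideanSpace ℝ (Fin m) →L[ℝ] EuclideanSpace ℝ (Fin m) :=
    (fderiv ℝ σ (χ x)).comp (tangentCoordChange (𝓡 m) x x₀ x)
  constructor
  · intro hv
    have hle : tangentOf (𝓡 m) S x ≤ (W.comap (P : EuclideanSpace ℝ (Fin m) →ₗ[ℝ] _) :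
        Submodule ℝ (TangentSpace (𝓡 m) x)) := by
      refine Submodule.span_le.2 ?_
      rintro w ⟨γ, hγ, hγS, hγv⟩
      obtain ⟨h0, hd⟩ := (velocity_eq_iff (hγ.mdifferentiableAt (by simp)) hx w).1 hγv
      have hy0 : χ (γ 0) ∈ O := by rw [h0]; exact hy
      have hd2 : HasDerivAt (fun r ↦ σ (χ (γ r))) (fderiv ℝ σ (χ (γ 0))
          (tangentCoordChange (𝓡 m) x x₀ x w)) 0 :=
        HasFDerivAt.comp_hasDerivAt (f := fun r ↦ χ (γ r)) 0 (hs.differentiableAt hy0) hd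
      rw [h0] at hd2
      refine deriv_mem_of_eventually_mem hd2 ?_
      have hsrc : ∀ᶠ r in 𝓝 0, γ r ∈ χ.source := by
        refine hγ.continuousAt.eventually ?_
        rw [h0]
        exact (isOpen_extChartAt_source (I := 𝓡 m) x₀).mem_nhds hx
      filter_upwards [hγS, hd.continuousAt.eventually (hs.isOpen.mem_nhds hy0), hsrc]
        with r h1 h2 h3
      exact (hs.mem_iff' h3 h2).1 h1
    exact hle hv
  · intro hv
    set w := tangentCoordChange (𝓡 m) x x₀ x v with hw
    obtain ⟨A, hA⟩ := hs.invertible _ hy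
    have hcd : ContDiffAt ℝ ∞ σ (χ x) := hs.contDiffOn.contDiffAt (hs.isOpen.mem_nhds hy)
    have hfd : HasFDerivAt σ (A : EuclideanSpace ℝ (Fin m) →L[ℝ] EuclideanSpace ℝ (Fin m)) (χ x) := by
      rw [hA]
      exact hs.differentiableAt hy
    set g := hcd.localInverse hfd (by simp) with hg
    have hg0 : g (σ (χ x)) = χ x := hcd.localInverse_apply_image hfd (by simp)
    have hgc : ContDiffAt ℝ ∞ g (σ (χ x)) := hcd.to_localInverse hfd (by simp)
    have hst := hcd.hasStrictFDerivAt' hfd (by simp)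
    have hgr : ∀ᶠ z in 𝓝 (σ (χ x)), σ (g z) = z := hst.eventually_right_inverse
    have hgd : HasFDerivAt g (A.symm : EuclideanSpace ℝ (Fin m) →L[ℝ] EuclideanSpace ℝ (Fin m))
        (σ (χ x)) := hst.to_localInverse.hasFDerivAt
    let l : ℝ → EuclideanSpace ℝ (Fin m) := fun t ↦ σ (χ x) + t • A w
    have hl : ContDiff ℝ ∞ l := by fun_prop
    have hl0 : l 0 = σ (χ x) := by simp [l]
    have hld : HasDerivAt l (A w) 0 := by
      simpa [l] using ((hasDerivAt_id (0 : ℝ)).smul_const (A w)).const_add (σ (χ x))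
    have hAw : A w ∈ W := by
      have : A w = fderiv ℝ σ (χ x) w := by rw [← hA]; rfl
      rw [this]
      exact hv
    have hgl : ContDiffAt ℝ ∞ (fun t ↦ g (l t)) 0 :=
      ContDiffAt.comp (g := g) 0 (by rw [hl0]; exact hgc) hl.contDiffAt
    have hgl0 : g (l 0) = χ x := by rw [hl0, hg0]
    have hgO : ∀ᶠ t in 𝓝 0, g (l t) ∈ O :=
      hgl.continuousAt.eventually (hs.isOpen.mem_nhds (show g (l 0) ∈ O by rw [hgl0]; exact hy))
    have hglw : HasDerivAt (fun t ↦ g (l t)) w 0 := by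
      have : HasDerivAt (fun t ↦ g (l t)) (A.symm (A w)) 0 :=
        HasFDerivAt.comp_hasDerivAt (l := g) (f := l)
          (l' := (A.symm : EuclideanSpace ℝ (Fin m) →L[ℝ] EuclideanSpace ℝ (Fin m))) 0
          (by rw [hl0]; exact hgd) hld
      rwa [A.symm_apply_apply] at this
    have hsm : ContMDiffAt 𝓘(ℝ, ℝ) (𝓡 m) ∞ (fun t ↦ χ.symm (g (l t))) 0 := by
      have h1 : ContMDiffAt 𝓘(ℝ, EuclideanSpace ℝ (Fin m)) (𝓡 m) ∞ χ.symm (g (l 0)) :=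
        (contMDiffOn_extChartAt_symm x₀).contMDiffAt
          ((isOpen_extChartAt_target x₀).mem_nhds (hs.subset (by rw [hgl0]; exact hy)))
      exact h1.comp (0 : ℝ) hgl.contMDiffAt
    refine Submodule.subset_span ⟨fun t ↦ χ.symm (g (l t)), hsm, ?_, ?_⟩
    · have hlt : ∀ᶠ t in 𝓝 0, σ (g (l t)) = l t :=
        hl.continuous.continuousAt.eventually (by rw [hl0]; exact hgr)
      filter_upwards [hgO, hlt] with t ht1 ht2
      rw [hs.mem_iff _ ht1, ht2]
      exact W.add_mem ((hs.mem_iff' hx hy).1 hxS) (W.smul_mem _ hAw)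
    · refine (velocity_eq_iff (hsm.mdifferentiableAt (by simp)) hx v).2 ⟨?_, ?_⟩
      · rw [hgl0, χ.left_inv hx]
      · refine hglw.congr_of_eventuallyEq ?_
        filter_upwards [hgO] with t ht
        exact χ.right_inv (hs.subset ht)

/-- A geodesic that starts tangentially to a geodesic submanifold stays in it as long as it stays
in the domain of a slice chart. -/
lemma IsSlice.geodesic_mem (hs : IsSlice S x₀ O σ W)
    {D : CovariantDerivative (𝓡 m) (EuclideanSpace ℝ (Fin m)) (TangentSpace (𝓡 m) : X → Type _)}
    (hDS : IsGeodesicSubmanifold D S) {γ : ℝ → X} {s : Set ℝ} (hγ : IsGeodesicOn D γ s) {b : ℝ}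
    (hb : Icc 0 b ⊆ s)
    (hsrc : ∀ t ∈ s, γ t ∈ (extChartAt (𝓡 m) x₀).source ∧ extChartAt (𝓡 m) x₀ (γ t) ∈ O)
    (h0 : γ 0 ∈ S) (hv : ∃ v ∈ tangentOf (𝓡 m) S (γ 0), velocity (𝓡 m) γ 0 = ⟨γ 0, v⟩) :
    ∀ t ∈ Icc 0 b, γ t ∈ S := by
  set χ := extChartAt (𝓡 m) x₀ with hχ
  have hdiff : ∀ t ∈ s, HasDerivAt (fun r ↦ χ (γ r)) (deriv (fun r ↦ χ (γ r)) t) t := fun t ht ↦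
    ((hγ.contDiffAt_chart ht (hsrc t ht).1).differentiableAt (by simp)).hasDerivAt
  have hdσ : ∀ t ∈ s, HasDerivAt (fun r ↦ σ (χ (γ r)))
      (fderiv ℝ σ (χ (γ t)) (deriv (fun r ↦ χ (γ r)) t)) t := fun t ht ↦
    HasFDerivAt.comp_hasDerivAt (f := fun r ↦ χ (γ r)) t (hs.differentiableAt (hsrc t ht).2)
      (hdiff t ht)
  let A : Set ℝ := {t | σ (χ (γ t)) ∈ W ∧ fderiv ℝ σ (χ (γ t)) (deriv (fun r ↦ χ (γ r)) t) ∈ W}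
  have hWc : IsClosed (W : Set (EuclideanSpace ℝ (Fin m))) := W.closed_of_finiteDimensional
  have key : Icc 0 b ⊆ A := by
    rcases lt_or_ge b 0 with hb0 | hb0
    · rw [Icc_eq_empty (not_le.2 hb0)]
      exact empty_subset _
    refine IsClosed.Icc_subset_of_forall_mem_nhdsWithin ?_ ?_ ?_
    · refine isClosed_of_closure_subset fun t ht ↦ ?_
      have htI : t ∈ Icc 0 b := isClosed_Icc.closure_subset (closure_mono inter_subset_right ht)
      refine ⟨?_, htI⟩
      have hfr : ∃ᶠ r in 𝓝 t, r ∈ A ∩ Icc 0 b := mem_closure_iff_frequently.1 ht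
      have hts := hb htI
      refine ⟨hWc.mem_of_frequently_of_tendsto (hfr.mono fun r hr ↦ hr.1.1)
        (hdσ t hts).continuousAt, hWc.mem_of_frequently_of_tendsto (hfr.mono fun r hr ↦ hr.1.2) ?_⟩
      have hc1 : ContinuousAt (fun r ↦ fderiv ℝ σ (χ (γ r))) t := by
        refine ContinuousAt.comp (g := fderiv ℝ σ) (f := fun r ↦ χ (γ r)) ?_ (hdiff t hts).continuousAt
        exact ((hs.contDiffOn.contDiffAt (hs.isOpen.mem_nhds (hsrc t hts).2)).fderiv_right
          (m := 0) (by simp)).continuousAt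
      exact hc1.clm_apply (hγ.continuousAt_chart_deriv hts (hsrc t hts).1)
    · obtain ⟨v, hv, hvel⟩ := hv
      have h0s : (0 : ℝ) ∈ s := hb ⟨le_rfl, hb0⟩
      obtain ⟨-, hd⟩ := (velocity_eq_iff (hγ.mdifferentiableAt h0s) (hsrc 0 h0s).1 v).1 hvel
      refine ⟨(hs.mem_iff' (hsrc 0 h0s).1 (hsrc 0 h0s).2).1 h0, ?_⟩
      rw [hd.deriv]
      exact (hs.tangentOf_iff (hsrc 0 h0s).1 (hsrc 0 h0s).2 h0 v).1 hv
    · rintro t ⟨htA, htI⟩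
      refine nhdsWithin_le_nhds ?_
      have hts := hb (Ico_subset_Icc_self htI)
      have hmem : γ t ∈ S := (hs.mem_iff' (hsrc t hts).1 (hsrc t hts).2).2 htA.1
      have hg' := hγ.comp_add t
      have h0' : (0 : ℝ) ∈ (fun r ↦ r + t) ⁻¹' s := by simpa using hts
      have hz : γ (0 + t) = γ t := by rw [zero_add]
      obtain ⟨u, hu⟩ : ∃ u : EuclideanSpace ℝ (Fin m), tangentCoordChange (𝓡 m) (γ t) x₀ (γ t) u =
          deriv (fun r ↦ χ (γ r)) t :=
        ⟨_, tangentCoordChange_symm_apply (hsrc t hts).1 (mem_extChartAt_source (γ t)) _⟩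
      have hvel : velocity (𝓡 m) (fun r ↦ γ (r + t)) 0 = ⟨γ t, u⟩ := by
        refine (velocity_eq_iff (hg'.mdifferentiableAt h0') (hsrc t hts).1 u).2 ⟨hz, ?_⟩
        rw [hu]
        exact HasDerivAt.comp_add_const (f := fun r ↦ χ (γ r)) 0 t (by rw [zero_add]; exact hdiff t hts)
      have hut : (u : TangentSpace (𝓡 m) (γ t)) ∈ tangentOf (𝓡 m) S (γ t) := by
        rw [hs.tangentOf_iff (hsrc t hts).1 (hsrc t hts).2 hmem, hu]
        exact htA.2
      have hev := hDS _ hmem u hut _ _ h0' hg' hvel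
      have hev2 : ∀ᶠ r in 𝓝 t, γ r ∈ S := by
        have hsub : Tendsto (fun r ↦ r - t) (𝓝 t) (𝓝 0) := by
          have : ContinuousAt (fun r : ℝ ↦ r - t) t := by fun_prop
          simpa [ContinuousAt] using this
        filter_upwards [hsub.eventually hev] with r hr
        simpa using hr
      have hev3 : ∀ᶠ r in 𝓝 t, r ∈ s ∧ σ (χ (γ r)) ∈ W := by
        filter_upwards [hev2, hγ.1.mem_nhds hts] with r h1 h2
        exact ⟨h2, (hs.mem_iff' (hsrc r h2).1 (hsrc r h2).2).1 h1⟩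
      filter_upwards [hev3.eventually_nhds] with r hr
      exact ⟨hr.self_of_nhds.2,
        deriv_mem_of_eventually_mem (hdσ r hr.self_of_nhds.1) (hr.mono fun _ h ↦ h.2)⟩
  exact fun t ht ↦ (hs.mem_iff' (hsrc t (hb ht)).1 (hsrc t (hb ht)).2).2 (key ht).1

end Slices

section Boundary

variable {n : ℕ} [NeZero n] {L : Type*} [TopologicalSpace L]
  [ChartedSpace (EuclideanHalfSpace n) L] [IsManifold (𝓡∂ n) ∞ L]

lemma extChartAt_zero_nonneg (p₀ p : L) : 0 ≤ extChartAt (𝓡∂ n) p₀ p 0 := by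
  have h : extChartAt (𝓡∂ n) p₀ p ∈ range (𝓡∂ n) := by
    rw [extChartAt_coe]
    exact mem_range_self _
  rwa [range_modelWithCornersEuclideanHalfSpace] at h

lemma mem_boundary_iff {p₀ p : L} (hp : p ∈ (extChartAt (𝓡∂ n) p₀).source) :
    p ∈ (𝓡∂ n).boundary L ↔ extChartAt (𝓡∂ n) p₀ p 0 = 0 := by
  have hp' : p ∈ (chartAt (EuclideanHalfSpace n) p₀).source := by rwa [extChartAt_source] at hp
  have h1 : extChartAt (𝓡∂ n) p₀ p ∈ (extChartAt (𝓡∂ n) p₀).target :=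
    (extChartAt (𝓡∂ n) p₀).map_source hp
  have h2 : p ∈ (𝓡∂ n).boundary L ↔ ¬ (𝓡∂ n).IsInteriorPoint p := by
    rw [← ModelWithCorners.compl_interior]
    rfl
  rw [h2, (𝓡∂ n).isInteriorPoint_iff_of_mem_atlas (n := ∞) (by simp)
    (chart_mem_atlas _ p₀) hp']
  have h3 : extChartAt (𝓡∂ n) p₀ p ∈ interior (extChartAt (𝓡∂ n) p₀).target ↔
      extChartAt (𝓡∂ n) p₀ p ∈ interior (range (𝓡∂ n)) := by
    refine ⟨fun h ↦ interior_mono (extChartAt_target_subset_range (I := 𝓡∂ n) p₀) h, fun h ↦ ?_⟩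
    have h4 : (extChartAt (𝓡∂ n) p₀).target ∈ 𝓝[range (𝓡∂ n)] (extChartAt (𝓡∂ n) p₀ p) :=
      extChartAt_target_mem_nhdsWithin' hp
    rw [nhdsWithin_eq_nhds.2 (mem_interior_iff_mem_nhds.1 h)] at h4
    exact mem_interior_iff_mem_nhds.2 h4
  change ¬ (extChartAt (𝓡∂ n) p₀ p ∈ interior (extChartAt (𝓡∂ n) p₀).target) ↔ _
  rw [h3, interior_range_modelWithCornersEuclideanHalfSpace]
  change ¬ (0 < extChartAt (𝓡∂ n) p₀ p 0) ↔ _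
  have := extChartAt_zero_nonneg (n := n) p₀ p
  constructor
  · intro h
    linarith [not_lt.1 h]
  · intro h
    rw [h]
    exact lt_irrefl 0

lemma tangentOf_boundary_iff {p₀ p : L} (hp : p ∈ (extChartAt (𝓡∂ n) p₀).source)
    (hpb : p ∈ (𝓡∂ n).boundary L) (v : EuclideanSpace ℝ (Fin n)) :
    (v : TangentSpace (𝓡∂ n) p) ∈ tangentOf (𝓡∂ n) ((𝓡∂ n).boundary L) p ↔
      tangentCoordChange (𝓡∂ n) p p₀ p v 0 = 0 := by
  set c := extChartAt (𝓡∂ n) p₀ with hc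
  let pr : EuclideanSpace ℝ (Fin n) →L[ℝ] ℝ := EuclideanSpace.proj 0
  let P : EuclideanSpace ℝ (Fin n) →L[ℝ] ℝ := pr.comp (tangentCoordChange (𝓡∂ n) p p₀ p)
  constructor
  · intro hv
    have hle : tangentOf (𝓡∂ n) ((𝓡∂ n).boundary L) p ≤
        (LinearMap.ker (P : EuclideanSpace ℝ (Fin n) →ₗ[ℝ] ℝ) :
          Submodule ℝ (TangentSpace (𝓡∂ n) p)) := by
      refine Submodule.span_le.2 ?_
      rintro w ⟨γ, hγ, hγS, hγv⟩
      obtain ⟨h0, hd⟩ := (velocity_eq_iff (hγ.mdifferentiableAt (by simp)) hp w).1 hγv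
      have hd2 : HasDerivAt (fun r ↦ pr (c (γ r))) (pr (tangentCoordChange (𝓡∂ n) p p₀ p w)) 0 :=
        HasFDerivAt.comp_hasDerivAt (f := fun r ↦ c (γ r)) 0 pr.hasFDerivAt hd
      have hsrc : ∀ᶠ r in 𝓝 0, γ r ∈ c.source := by
        refine hγ.continuousAt.eventually ?_
        rw [h0]
        exact (isOpen_extChartAt_source (I := 𝓡∂ n) p₀).mem_nhds hp
      have hz : (fun r ↦ pr (c (γ r))) =ᶠ[𝓝 0] fun _ ↦ 0 := by
        filter_upwards [hγS, hsrc] with r h1 h2 using (mem_boundary_iff h2).1 h1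
      exact hd2.unique ((hasDerivAt_const (0 : ℝ) (0 : ℝ)).congr_of_eventuallyEq hz)
    exact hle hv
  · intro hv
    set w := tangentCoordChange (𝓡∂ n) p p₀ p v with hw
    let l : ℝ → EuclideanSpace ℝ (Fin n) := fun t ↦ c p + t • w
    have hl : ContDiff ℝ ∞ l := by fun_prop
    have hl0 : l 0 = c p := by simp [l]
    have hld : HasDerivAt l w 0 := by
      simpa [l] using ((hasDerivAt_id (0 : ℝ)).smul_const w).const_add (c p)
    have hlz : ∀ t, l t 0 = 0 := by
      intro t
      have h1 : c p 0 = 0 := (mem_boundary_iff hp).1 hpb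
      simp [l, h1, hv]
    have hlt : ∀ᶠ t in 𝓝 0, l t ∈ c.target := by
      have h1 : c.target ∈ 𝓝[range (𝓡∂ n)] (l 0) := by
        rw [hl0]
        exact extChartAt_target_mem_nhdsWithin' hp
      have h2 : Tendsto l (𝓝 0) (𝓝[range (𝓡∂ n)] (l 0)) := by
        refine tendsto_nhdsWithin_iff.2 ⟨hl.continuous.continuousAt, Eventually.of_forall fun t ↦ ?_⟩
        rw [range_modelWithCornersEuclideanHalfSpace]
        exact (hlz t).ge
      exact h2.eventually h1
    have hsm : ContMDiffAt 𝓘(ℝ, ℝ) (𝓡∂ n) ∞ (fun t ↦ c.symm (l t)) 0 := by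
      have h1 : ContMDiffWithinAt 𝓘(ℝ, EuclideanSpace ℝ (Fin n)) (𝓡∂ n) ∞ c.symm c.target (l 0) :=
        contMDiffOn_extChartAt_symm p₀ _ hlt.self_of_nhds
      have h2 := h1.comp (0 : ℝ) ((hl.contMDiff 0).contMDiffWithinAt (s := l ⁻¹' c.target))
        (mapsTo_preimage _ _)
      exact h2.contMDiffAt hlt
    refine Submodule.subset_span ⟨fun t ↦ c.symm (l t), hsm, ?_, ?_⟩
    · filter_upwards [hlt] with t ht
      rw [mem_boundary_iff (c.map_target ht), ← hc, c.right_inv ht]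
      exact hlz t
    · refine (velocity_eq_iff (hsm.mdifferentiableAt (by simp)) hp v).2 ⟨?_, ?_⟩
      · rw [hl0, c.left_inv hp]
      · refine hld.congr_of_eventuallyEq ?_
        filter_upwards [hlt] with t ht
        exact c.right_inv ht

end Boundary

end LagBdry

namespace LagBdry

section Tensors

variable {n : ℕ} {X : Type*} [TopologicalSpace X]
  [ChartedSpace (EuclideanSpace ℝ (Fin (2 * n))) X] [IsManifold (𝓡 (2 * n)) ∞ X]
  (K : CalabiYau n X)

namespace CalabiYau

/-- The complex structure as an endomorphism of the model space. -/
noncomputable def JModel (x : X) :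
    EuclideanSpace ℝ (Fin (2 * n)) →L[ℝ] EuclideanSpace ℝ (Fin (2 * n)) := K.J x

/-- The Kähler form as a bilinear form on the model space. -/
noncomputable def omegaModel (x : X) :
    EuclideanSpace ℝ (Fin (2 * n)) →L[ℝ] EuclideanSpace ℝ (Fin (2 * n)) →L[ℝ] ℝ :=
  LinearMap.toContinuousLinearMap
    ((LinearMap.toContinuousLinearMap : (EuclideanSpace ℝ (Fin (2 * n)) →ₗ[ℝ] ℝ) ≃ₗ[ℝ] _).toLinearMap ∘ₗ
      LinearMap.mk₂ ℝ (fun v w : EuclideanSpace ℝ (Fin (2 * n)) ↦ K.omega x ![v, w])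
        (K.omega_add_left x) (K.omega_smul_left x) (K.omega_add_right x)
        (fun c v w ↦ K.omega_smul_right x c v w))

lemma omegaModel_apply (x : X) (v w : EuclideanSpace ℝ (Fin (2 * n))) :
    K.omegaModel x v w = K.omega x ![v, w] := rfl

/-- The Kähler form in the preferred chart at `x₀`. -/
noncomputable def omegaChart (x₀ : X) (y : EuclideanSpace ℝ (Fin (2 * n))) :
    EuclideanSpace ℝ (Fin (2 * n)) →L[ℝ] EuclideanSpace ℝ (Fin (2 * n)) →L[ℝ] ℝ :=
  (K.omegaModel ((extChartAt (𝓡 (2 * n)) x₀).symm y)).bilinearComp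
    (tangentCoordChange (𝓡 (2 * n)) x₀ ((extChartAt (𝓡 (2 * n)) x₀).symm y)
      ((extChartAt (𝓡 (2 * n)) x₀).symm y))
    (tangentCoordChange (𝓡 (2 * n)) x₀ ((extChartAt (𝓡 (2 * n)) x₀).symm y)
      ((extChartAt (𝓡 (2 * n)) x₀).symm y))

/-- The complex structure in the preferred chart at `x₀`. -/
noncomputable def JChart (x₀ : X) (y : EuclideanSpace ℝ (Fin (2 * n))) :
    EuclideanSpace ℝ (Fin (2 * n)) →L[ℝ] EuclideanSpace ℝ (Fin (2 * n)) :=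
  (tangentCoordChange (𝓡 (2 * n)) ((extChartAt (𝓡 (2 * n)) x₀).symm y) x₀
      ((extChartAt (𝓡 (2 * n)) x₀).symm y)).comp
    ((K.JModel ((extChartAt (𝓡 (2 * n)) x₀).symm y)).comp
    (tangentCoordChange (𝓡 (2 * n)) x₀ ((extChartAt (𝓡 (2 * n)) x₀).symm y)
      ((extChartAt (𝓡 (2 * n)) x₀).symm y)))

lemma omegaChart_apply {x₀ x : X} (hx : x ∈ (extChartAt (𝓡 (2 * n)) x₀).source)
    (v w : EuclideanSpace ℝ (Fin (2 * n))) :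
    K.omegaChart x₀ (extChartAt (𝓡 (2 * n)) x₀ x)
      (tangentCoordChange (𝓡 (2 * n)) x x₀ x v) (tangentCoordChange (𝓡 (2 * n)) x x₀ x w) =
      K.omegaModel x v w := by
  simp only [omegaChart, ContinuousLinearMap.bilinearComp_apply]
  rw [(extChartAt (𝓡 (2 * n)) x₀).left_inv hx,
    tangentCoordChange_symm_apply (mem_extChartAt_source x) hx,
    tangentCoordChange_symm_apply (mem_extChartAt_source x) hx]

lemma JChart_apply {x₀ x : X} (hx : x ∈ (extChartAt (𝓡 (2 * n)) x₀).source)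
    (v : EuclideanSpace ℝ (Fin (2 * n))) :
    K.JChart x₀ (extChartAt (𝓡 (2 * n)) x₀ x) (tangentCoordChange (𝓡 (2 * n)) x x₀ x v) =
      tangentCoordChange (𝓡 (2 * n)) x x₀ x (K.JModel x v) := by
  simp only [JChart, ContinuousLinearMap.comp_apply]
  rw [(extChartAt (𝓡 (2 * n)) x₀).left_inv hx,
    tangentCoordChange_symm_apply (mem_extChartAt_source x) hx]

lemma contDiffOn_JChart (x₀ : X) :
    ContDiffOn ℝ ∞ (K.JChart x₀) (extChartAt (𝓡 (2 * n)) x₀).target := by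
  let V := EuclideanSpace ℝ (Fin (2 * n))
  set e := trivializationAt (V →L[ℝ] V)
    (fun z : X ↦ TangentSpace (𝓡 (2 * n)) z →L[ℝ] TangentSpace (𝓡 (2 * n)) z) x₀ with he
  have hbase : e.baseSet = (extChartAt (𝓡 (2 * n)) x₀).source := by
    rw [extChartAt_source, he, hom_trivializationAt_baseSet]
    exact inter_self _
  have h1 : ContMDiffOn (𝓡 (2 * n)) 𝓘(ℝ, V →L[ℝ] V) ∞ (fun z ↦ (e ⟨z, K.J z⟩).2) e.baseSet :=
    (e.contMDiffOn_section_baseSet_iff (IB := 𝓡 (2 * n)) (s := fun z ↦ K.J z)).1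
      (K.J_smooth.contMDiffOn)
  rw [← contMDiffOn_iff_contDiffOn]
  refine (h1.comp (contMDiffOn_extChartAt_symm x₀) fun η hη ↦ ?_).congr fun y hy ↦ ?_
  · rw [mem_preimage, hbase]
    exact (extChartAt (𝓡 (2 * n)) x₀).map_target hη
  · have hx := (extChartAt (𝓡 (2 * n)) x₀).map_target hy
    rw [extChartAt_source] at hx
    rw [Function.comp_apply, he, hom_trivializationAt_apply]
    change _ = ContinuousLinearMap.inCoordinates V (TangentSpace (𝓡 (2 * n))) V
      (TangentSpace (𝓡 (2 * n))) x₀ _ x₀ _ (K.J _)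
    rw [ContinuousLinearMap.inCoordinates,
      TangentBundle.continuousLinearMapAt_trivializationAt_eq_core hx,
      TangentBundle.symmL_trivializationAt_eq_core hx]
    rfl

lemma contDiffOn_omegaChart (x₀ : X) :
    ContDiffOn ℝ ∞ (K.omegaChart x₀) (extChartAt (𝓡 (2 * n)) x₀).target := by
  let V := EuclideanSpace ℝ (Fin (2 * n))
  refine contDiffOn_clm_apply.2 fun v ↦ contDiffOn_clm_apply.2 fun w ↦ ?_
  have h1 := (ContinuousAlternatingMap.apply ℝ V ℝ ![v, w]).contDiff.comp_contDiffOn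
    (K.omega_smooth x₀)
  refine h1.congr fun y hy ↦ ?_
  have hx := (extChartAt (𝓡 (2 * n)) x₀).map_target hy
  have hx' := hx
  rw [extChartAt_source] at hx'
  set x := (extChartAt (𝓡 (2 * n)) x₀).symm y with hxdef
  have hder : ∀ u : V, tangentCoordChange (𝓡 (2 * n)) x₀ x x u =
      mfderivWithin 𝓘(ℝ, V) (𝓡 (2 * n)) (extChartAt (𝓡 (2 * n)) x₀).symm
        (range (𝓡 (2 * n))) y u := by
    intro u
    have e1 := DFunLike.congr_fun (TangentBundle.symmL_trivializationAt_eq_core (I := 𝓡 (2 * n)) hx') u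
    have e2 := DFunLike.congr_fun (TangentBundle.symmL_trivializationAt (I := 𝓡 (2 * n)) hx') u
    have e3 : extChartAt (𝓡 (2 * n)) x₀ x = y := (extChartAt (𝓡 (2 * n)) x₀).right_inv hy
    rw [e3] at e2
    exact e1.symm.trans e2
  simp only [Function.comp_apply, omegaChart, ContinuousLinearMap.bilinearComp_apply]
  rw [← hxdef, omegaModel_apply, hder, hder]
  change _ = K.omega x _
  congr 1
  funext i
  fin_cases i <;> rfl

lemma omegaModel_eq_zero_of_rotate (x : X) (c : ℝ) (u : EuclideanSpace ℝ (Fin (2 * n)))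
    (h : K.omegaModel x (c • u + K.JModel x u) u = 0) : u = 0 :=
  K.eq_zero_of_omega_rotate x c u h

end CalabiYau

end Tensors

section Representation

variable {E : Type*} [NormedAddCommGroup E] [NormedSpace ℝ E]
  {H : Type*} [TopologicalSpace H] (I : ModelWithCorners ℝ E H)
  {M : Type*} [TopologicalSpace M] [ChartedSpace H M] [IsManifold I ∞ M]
  {E' : Type*} [NormedAddCommGroup E'] [NormedSpace ℝ E']
  {H' : Type*} [TopologicalSpace H'] (I' : ModelWithCorners ℝ E' H')
  {N : Type*} [TopologicalSpace N] [ChartedSpace H' N] [IsManifold I' ∞ N]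

/-- A map read in the preferred charts at `p₀` and `y₀`. -/
noncomputable def chartRep (p₀ : M) (y₀ : N) (g : M → N) : E → E' :=
  extChartAt I' y₀ ∘ g ∘ (extChartAt I p₀).symm

variable {I I'}

lemma chartRep_apply {p₀ : M} {y₀ : N} {g : M → N} {p : M} (hp : p ∈ (extChartAt I p₀).source) :
    chartRep I I' p₀ y₀ g (extChartAt I p₀ p) = extChartAt I' y₀ (g p) := by
  simp only [chartRep, Function.comp_apply, (extChartAt I p₀).left_inv hp]

/-- The domain where a map can be read in the charts. -/
def chartDom (I : ModelWithCorners ℝ E H) (I' : ModelWithCorners ℝ E' H') (p₀ : M) (y₀ : N)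
    (g : M → N) : Set E :=
  (extChartAt I p₀).target ∩ (extChartAt I p₀).symm ⁻¹' (g ⁻¹' (extChartAt I' y₀).source)

lemma contDiffOn_chartRep {p₀ : M} {y₀ : N} {g : M → N} (hg : ContMDiff I I' ∞ g) :
    ContDiffOn ℝ ∞ (chartRep I I' p₀ y₀ g) (chartDom I I' p₀ y₀ g) := by
  rw [← contMDiffOn_iff_contDiffOn]
  have h1 : ContMDiffOn 𝓘(ℝ, E) I ∞ (extChartAt I p₀).symm (chartDom I I' p₀ y₀ g) :=
    (contMDiffOn_extChartAt_symm p₀).mono inter_subset_left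
  have h2 : ContMDiffOn I' 𝓘(ℝ, E') ∞ (extChartAt I' y₀) (extChartAt I' y₀).source := by
    rw [extChartAt_source]
    exact contMDiffOn_extChartAt
  exact h2.comp (hg.comp_contMDiffOn h1) fun x hx ↦ hx.2

lemma chartDom_mem_nhdsWithin {p₀ : M} {y₀ : N} {g : M → N} (hg : Continuous g) {x : E}
    (hx : x ∈ chartDom I I' p₀ y₀ g) : chartDom I I' p₀ y₀ g ∈ 𝓝[range I] x := by
  have h1 := extChartAt_target_mem_nhdsWithin' ((extChartAt I p₀).map_target hx.1)
  rw [(extChartAt I p₀).right_inv hx.1] at h1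
  have h2 : ContinuousWithinAt (extChartAt I p₀).symm (extChartAt I p₀).target x :=
    continuousOn_extChartAt_symm p₀ x hx.1
  have h3 := h2.preimage_mem_nhdsWithin
    (((isOpen_extChartAt_source (I := I') y₀).preimage hg).mem_nhds hx.2)
  refine inter_mem h1 ?_
  exact nhdsWithin_le_of_mem h1 h3

lemma contDiffOn_fderivWithin_chartRep {p₀ : M} {y₀ : N} {g : M → N} (hg : ContMDiff I I' ∞ g) :
    ContDiffOn ℝ ∞ (fderivWithin ℝ (chartRep I I' p₀ y₀ g) (range I)) (chartDom I I' p₀ y₀ g) := by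
  intro x hx
  have hxr : x ∈ range I := extChartAt_target_subset_range p₀ hx.1
  have hmem := chartDom_mem_nhdsWithin hg.continuous hx
  have h1 : ContDiffWithinAt ℝ ∞ (chartRep I I' p₀ y₀ g) (range I) x :=
    (contDiffOn_chartRep hg x hx).mono_of_mem_nhdsWithin hmem
  have h2 := h1.fderivWithin_right (m := ∞) I.uniqueDiffOn (by simp) hxr
  exact h2.mono fun z hz ↦ extChartAt_target_subset_range p₀ hz.1

lemma fderivWithin_chartRep_apply {g : M → N} {p p₀ : M} {y₀ : N}
    (hg : MDifferentiableAt I I' g p) (hp : p ∈ (extChartAt I p₀).source)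
    (hy : g p ∈ (extChartAt I' y₀).source) (v : E) :
    fderivWithin ℝ (chartRep I I' p₀ y₀ g) (range I) (extChartAt I p₀ p)
        (tangentCoordChange I p p₀ p v) =
      tangentCoordChange I' (g p) y₀ (g p) ((mfderivModel I I' g p) v) :=
  (tangentCoordChange_mfderiv hg hp hy v).symm

end Representation

section Field

variable {n : ℕ} [NeZero n]
  {L : Type*} [TopologicalSpace L] [ChartedSpace (EuclideanHalfSpace n) L]
  [IsManifold (𝓡∂ n) ∞ L]
  {X : Type*} [TopologicalSpace X]
  [ChartedSpace (EuclideanSpace ℝ (Fin (2 * n))) X] [IsManifold (𝓡 (2 * n)) ∞ X]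
  (K : CalabiYau n X)

/-- The coefficients of a covector in the preferred chart at `p₀`. -/
noncomputable def covectorChart (p₀ p : L) (α : EuclideanSpace ℝ (Fin n) →L[ℝ] ℝ) :
    EuclideanSpace ℝ (Fin n) →L[ℝ] ℝ :=
  α.comp (tangentCoordChange (𝓡∂ n) p₀ p p)

/-- The covector of a one-form at a point, on the model space. -/
noncomputable def formModel (θ : OneForm n L) (p : L) : EuclideanSpace ℝ (Fin n) →L[ℝ] ℝ := θ p

/-- A one-form read in the preferred chart at `p₀`. -/
noncomputable def formRep (p₀ : L) (θ : OneForm n L) (x : EuclideanSpace ℝ (Fin n)) :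
    EuclideanSpace ℝ (Fin n) →L[ℝ] ℝ :=
  covectorChart p₀ ((extChartAt (𝓡∂ n) p₀).symm x) (formModel θ ((extChartAt (𝓡∂ n) p₀).symm x))

lemma formRep_apply {p₀ p : L} (hp : p ∈ (extChartAt (𝓡∂ n) p₀).source) (θ : OneForm n L) :
    formRep p₀ θ (extChartAt (𝓡∂ n) p₀ p) = covectorChart p₀ p (formModel θ p) := by
  rw [formRep, (extChartAt (𝓡∂ n) p₀).left_inv hp]

lemma covector_trivializationAt {p₀ p : L} (hp : p ∈ (extChartAt (𝓡∂ n) p₀).source)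
    (α : EuclideanSpace ℝ (Fin n) →L[ℝ] ℝ) :
    (trivializationAt (EuclideanSpace ℝ (Fin n) →L[ℝ] ℝ)
      (fun p : L ↦ TangentSpace (𝓡∂ n) p →L[ℝ] ℝ) p₀ ⟨p, α⟩).2 = covectorChart p₀ p α := by
  rw [extChartAt_source] at hp
  ext v
  have h := DFunLike.congr_fun (TangentBundle.symmL_trivializationAt_eq_core (I := 𝓡∂ n) hp) v
  have h' : α ((trivializationAt (EuclideanSpace ℝ (Fin n)) (TangentSpace (𝓡∂ n) : L → Type _)
      p₀).symmL ℝ p v) = α (tangentCoordChange (𝓡∂ n) p₀ p p v) := congrArg α h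
  refine Eq.trans ?_ h'
  rw [hom_trivializationAt_apply]
  exact DFunLike.congr_fun (Bundle.Trivial.continuousLinearMapAt_trivialization ℝ L ℝ p) _

lemma contDiffOn_formRep (p₀ : L) (θ : OneForm n L) :
    ContDiffOn ℝ ∞ (formRep p₀ θ) (extChartAt (𝓡∂ n) p₀).target := by
  set e := trivializationAt (EuclideanSpace ℝ (Fin n) →L[ℝ] ℝ)
      (fun p : L ↦ TangentSpace (𝓡∂ n) p →L[ℝ] ℝ) p₀ with he
  have hbase : e.baseSet = (extChartAt (𝓡∂ n) p₀).source := by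
    rw [extChartAt_source, he, hom_trivializationAt_baseSet]
    exact inter_univ _
  have h1 : ContMDiffOn (𝓡∂ n) 𝓘(ℝ, EuclideanSpace ℝ (Fin n) →L[ℝ] ℝ) ∞
      (fun z ↦ (e ⟨z, θ z⟩).2) e.baseSet :=
    (e.contMDiffOn_section_baseSet_iff (IB := 𝓡∂ n) (s := fun z ↦ θ z)).1 (θ.contMDiff.contMDiffOn)
  rw [← contMDiffOn_iff_contDiffOn]
  refine (h1.comp (contMDiffOn_extChartAt_symm p₀) fun η hη ↦ ?_).congr fun y hy ↦ ?_
  · rw [mem_preimage, hbase]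
    exact (extChartAt (𝓡∂ n) p₀).map_target hη
  · exact (covector_trivializationAt ((extChartAt (𝓡∂ n) p₀).map_target hy) (formModel θ _)).symm

namespace CalabiYau

/-- `(a + J) ∘ df` in charts. -/
noncomputable def rotChart (f : L → X) (a : L → ℝ) (p₀ : L) (x : EuclideanSpace ℝ (Fin n)) :
    EuclideanSpace ℝ (Fin n) →L[ℝ] EuclideanSpace ℝ (Fin (2 * n)) :=
  (a ((extChartAt (𝓡∂ n) p₀).symm x) • ContinuousLinearMap.id ℝ _ +
    K.JChart (f p₀) (chartRep (𝓡∂ n) (𝓡 (2 * n)) p₀ (f p₀) f x)).comp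
    (fderivWithin ℝ (chartRep (𝓡∂ n) (𝓡 (2 * n)) p₀ (f p₀) f) (range (𝓡∂ n)) x)

/-- `(Y, Z) ↦ ω((a + J) df Y, df Z)` in charts. -/
noncomputable def pairChart (f : L → X) (a : L → ℝ) (p₀ : L) (x : EuclideanSpace ℝ (Fin n)) :
    EuclideanSpace ℝ (Fin n) →L[ℝ] EuclideanSpace ℝ (Fin n) →L[ℝ] ℝ :=
  ((ContinuousLinearMap.compL ℝ (EuclideanSpace ℝ (Fin n)) (EuclideanSpace ℝ (Fin (2 * n))) ℝ).flip
    (fderivWithin ℝ (chartRep (𝓡∂ n) (𝓡 (2 * n)) p₀ (f p₀) f) (range (𝓡∂ n)) x)).comp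
    ((K.omegaChart (f p₀) (chartRep (𝓡∂ n) (𝓡 (2 * n)) p₀ (f p₀) f x)).comp (K.rotChart f a p₀ x))

/-- `Φ⁻¹` in charts. -/
noncomputable def invChart (f : L → X) (a : L → ℝ) (p₀ : L) (x : EuclideanSpace ℝ (Fin n)) :
    (EuclideanSpace ℝ (Fin n) →L[ℝ] ℝ) →L[ℝ] EuclideanSpace ℝ (Fin (2 * n)) :=
  (K.rotChart f a p₀ x).comp (K.pairChart f a p₀ x).inverse

variable {K} {f : L → X} (hf : K.IsLagrangianImm f) {a : L → ℝ}

include hf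

lemma mdifferentiableAt_imm (p : L) : MDifferentiableAt (𝓡∂ n) (𝓡 (2 * n)) f p :=
  hf.1.1.mdifferentiable (by simp) p

lemma rotChart_apply {p₀ p : L} (hp : p ∈ (extChartAt (𝓡∂ n) p₀).source)
    (hy : f p ∈ (extChartAt (𝓡 (2 * n)) (f p₀)).source) (Y : EuclideanSpace ℝ (Fin n)) :
    K.rotChart f a p₀ (extChartAt (𝓡∂ n) p₀ p) (tangentCoordChange (𝓡∂ n) p p₀ p Y) =
      tangentCoordChange (𝓡 (2 * n)) (f p) (f p₀) (f p)
        (a p • mfderivModel (𝓡∂ n) (𝓡 (2 * n)) f p Y +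
          K.JModel (f p) (mfderivModel (𝓡∂ n) (𝓡 (2 * n)) f p Y)) := by
  simp only [rotChart, ContinuousLinearMap.comp_apply, add_apply, smul_apply,
    ContinuousLinearMap.id_apply]
  rw [fderivWithin_chartRep_apply (mdifferentiableAt_imm hf p) hp hy, chartRep_apply hp,
    K.JChart_apply hy, (extChartAt (𝓡∂ n) p₀).left_inv hp, map_add, map_smul]

lemma pairChart_apply {p₀ p : L} (hp : p ∈ (extChartAt (𝓡∂ n) p₀).source)
    (hy : f p ∈ (extChartAt (𝓡 (2 * n)) (f p₀)).source) (Y Z : EuclideanSpace ℝ (Fin n)) :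
    K.pairChart f a p₀ (extChartAt (𝓡∂ n) p₀ p) (tangentCoordChange (𝓡∂ n) p p₀ p Y)
      (tangentCoordChange (𝓡∂ n) p p₀ p Z) =
      K.omegaModel (f p) (a p • mfderivModel (𝓡∂ n) (𝓡 (2 * n)) f p Y +
          K.JModel (f p) (mfderivModel (𝓡∂ n) (𝓡 (2 * n)) f p Y))
        (mfderivModel (𝓡∂ n) (𝓡 (2 * n)) f p Z) := by
  simp only [pairChart, ContinuousLinearMap.comp_apply, ContinuousLinearMap.flip_apply,
    ContinuousLinearMap.compL_apply]
  rw [rotChart_apply hf hp hy, fderivWithin_chartRep_apply (mdifferentiableAt_imm hf p) hp hy,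
    chartRep_apply hp, K.omegaChart_apply hy]

lemma pairChart_invertible {p₀ p : L} (hp : p ∈ (extChartAt (𝓡∂ n) p₀).source)
    (hy : f p ∈ (extChartAt (𝓡 (2 * n)) (f p₀)).source) :
    (K.pairChart f a p₀ (extChartAt (𝓡∂ n) p₀ p)).IsInvertible := by
  have hinj : Function.Injective (K.pairChart f a p₀ (extChartAt (𝓡∂ n) p₀ p)) := by
    rw [injective_iff_map_eq_zero]
    intro Yc hYc
    set Y := tangentCoordChange (𝓡∂ n) p₀ p p Yc with hY
    have hYc' : tangentCoordChange (𝓡∂ n) p p₀ p Y = Yc :=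
      tangentCoordChange_symm_apply hp (mem_extChartAt_source p) Yc
    have h1 := pairChart_apply (a := a) hf hp hy Y Y
    rw [hYc', hYc, zero_apply] at h1
    have h2 := K.omegaModel_eq_zero_of_rotate _ _ _ h1.symm
    have h3 : Y = 0 := hf.1.2 p (h2.trans (map_zero (mfderivModel (𝓡∂ n) (𝓡 (2 * n)) f p)).symm)
    rw [← hYc', h3, map_zero]
  have hdim : Module.finrank ℝ (EuclideanSpace ℝ (Fin n)) =
      Module.finrank ℝ (EuclideanSpace ℝ (Fin n) →L[ℝ] ℝ) := by
    rw [(LinearMap.toContinuousLinearMap :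
      (EuclideanSpace ℝ (Fin n) →ₗ[ℝ] ℝ) ≃ₗ[ℝ] _).symm.finrank_eq]
    exact (Subspace.dual_finrank_eq (K := ℝ) (V := EuclideanSpace ℝ (Fin n))).symm
  exact ⟨(LinearEquiv.ofInjectiveOfFinrankEq _ hinj hdim).toContinuousLinearEquiv, by ext; rfl⟩

/-- `Φ⁻¹α` for a covector `α`. -/
noncomputable def covectorField (a : L → ℝ) (p : L)
    (α : TangentSpace (𝓡∂ n) p →L[ℝ] ℝ) : TangentSpace (𝓡 (2 * n)) (f p) :=
  ((K.Φ hf a p).symm (α : TangentSpace (𝓡∂ n) p →ₗ[ℝ] ℝ) : K.E f a p)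

lemma omega_covectorField (p : L) (α : TangentSpace (𝓡∂ n) p →L[ℝ] ℝ)
    (Z : TangentSpace (𝓡∂ n) p) :
    K.omega (f p) ![covectorField hf a p α, diff n f p Z] = α Z :=
  LinearMap.congr_fun ((K.Φ hf a p).apply_symm_apply (α : TangentSpace (𝓡∂ n) p →ₗ[ℝ] ℝ)) Z

/-- The field `Φ⁻¹α` in charts. -/
lemma covectorField_chart {p₀ p : L} (hp : p ∈ (extChartAt (𝓡∂ n) p₀).source)
    (hy : f p ∈ (extChartAt (𝓡 (2 * n)) (f p₀)).source) (α : TangentSpace (𝓡∂ n) p →L[ℝ] ℝ) :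
    tangentCoordChange (𝓡 (2 * n)) (f p) (f p₀) (f p) (covectorField hf a p α) =
      K.invChart f a p₀ (extChartAt (𝓡∂ n) p₀ p) (covectorChart p₀ p α) := by
  obtain ⟨Y, hY⟩ := ((K.Φ hf a p).symm (α : TangentSpace (𝓡∂ n) p →ₗ[ℝ] ℝ)).2
  let Y' : EuclideanSpace ℝ (Fin n) := Y
  have hY' : a p • mfderivModel (𝓡∂ n) (𝓡 (2 * n)) f p Y' +
      K.JModel (f p) (mfderivModel (𝓡∂ n) (𝓡 (2 * n)) f p Y') = covectorField hf a p α := hY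
  have h1 : K.pairChart f a p₀ (extChartAt (𝓡∂ n) p₀ p) (tangentCoordChange (𝓡∂ n) p p₀ p Y') =
      covectorChart p₀ p α := by
    ext Zc
    set Z := tangentCoordChange (𝓡∂ n) p₀ p p Zc with hZ
    have hZc' : tangentCoordChange (𝓡∂ n) p p₀ p Z = Zc :=
      tangentCoordChange_symm_apply hp (mem_extChartAt_source p) Zc
    rw [← hZc', pairChart_apply hf hp hy, hY', hZc']
    exact omega_covectorField hf p α Z
  rw [← h1, invChart, ContinuousLinearMap.comp_apply]
  obtain ⟨M, hM⟩ := pairChart_invertible (a := a) hf hp hy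
  rw [← hM, ContinuousLinearMap.inverse_equiv]
  change _ = K.rotChart f a p₀ (extChartAt (𝓡∂ n) p₀ p) (M.symm (M _))
  rw [M.symm_apply_apply, rotChart_apply hf hp hy, hY']

/-- `Φ⁻¹` in charts inverts the pairing with the tangent vectors of the immersion. -/
lemma omegaChart_invChart {p₀ p : L} (hp : p ∈ (extChartAt (𝓡∂ n) p₀).source)
    (hy : f p ∈ (extChartAt (𝓡 (2 * n)) (f p₀)).source) (ζ : EuclideanSpace ℝ (Fin n) →L[ℝ] ℝ)
    (Z : EuclideanSpace ℝ (Fin n)) :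
    K.omegaChart (f p₀) (extChartAt (𝓡 (2 * n)) (f p₀) (f p))
      (K.invChart f a p₀ (extChartAt (𝓡∂ n) p₀ p) ζ)
      (fderivWithin ℝ (chartRep (𝓡∂ n) (𝓡 (2 * n)) p₀ (f p₀) f) (range (𝓡∂ n))
        (extChartAt (𝓡∂ n) p₀ p) Z) = ζ Z := by
  obtain ⟨M, hM⟩ := pairChart_invertible (a := a) hf hp hy
  have h1 : K.pairChart f a p₀ (extChartAt (𝓡∂ n) p₀ p)
      ((K.pairChart f a p₀ (extChartAt (𝓡∂ n) p₀ p)).inverse ζ) Z = ζ Z := by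
    rw [← hM, ContinuousLinearMap.inverse_equiv]
    change M (M.symm ζ) Z = ζ Z
    rw [M.apply_symm_apply]
  rw [← h1, ← chartRep_apply hp]
  rfl

lemma contDiffOn_rotChart (ha : ContMDiff (𝓡∂ n) 𝓘(ℝ, ℝ) ∞ a) (p₀ : L) :
    ContDiffOn ℝ ∞ (K.rotChart f a p₀) (chartDom (𝓡∂ n) (𝓡 (2 * n)) p₀ (f p₀) f) := by
  have h1 : ContDiffOn ℝ ∞ (fun x ↦ a ((extChartAt (𝓡∂ n) p₀).symm x))
      (chartDom (𝓡∂ n) (𝓡 (2 * n)) p₀ (f p₀) f) := by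
    rw [← contMDiffOn_iff_contDiffOn]
    exact ha.comp_contMDiffOn ((contMDiffOn_extChartAt_symm p₀).mono inter_subset_left)
  have h2 := contDiffOn_chartRep (I := 𝓡∂ n) (I' := 𝓡 (2 * n)) (p₀ := p₀) (y₀ := f p₀) hf.1.1
  have h3 := (K.contDiffOn_JChart (f p₀)).comp h2 fun x hx ↦
    (extChartAt (𝓡 (2 * n)) (f p₀)).map_source hx.2
  exact ((h1.smul contDiffOn_const).add h3).clm_comp (contDiffOn_fderivWithin_chartRep hf.1.1)

lemma contDiffOn_invChart (ha : ContMDiff (𝓡∂ n) 𝓘(ℝ, ℝ) ∞ a) (p₀ : L) :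
    ContDiffOn ℝ ∞ (K.invChart f a p₀) (chartDom (𝓡∂ n) (𝓡 (2 * n)) p₀ (f p₀) f) := by
  have h1 := contDiffOn_rotChart hf ha p₀
  have h2 := contDiffOn_chartRep (I := 𝓡∂ n) (I' := 𝓡 (2 * n)) (p₀ := p₀) (y₀ := f p₀) hf.1.1
  have h3 := (K.contDiffOn_omegaChart (f p₀)).comp h2 fun x hx ↦
    (extChartAt (𝓡 (2 * n)) (f p₀)).map_source hx.2
  have h4 : ContDiffOn ℝ ∞ (K.pairChart f a p₀) (chartDom (𝓡∂ n) (𝓡 (2 * n)) p₀ (f p₀) f) :=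
    ((ContinuousLinearMap.contDiff _).comp_contDiffOn
      (contDiffOn_fderivWithin_chartRep hf.1.1)).clm_comp (h3.clm_comp h1)
  refine h1.clm_comp fun x hx ↦ ?_
  have hp := (extChartAt (𝓡∂ n) p₀).map_target hx.1
  have hinv := pairChart_invertible (a := a) hf hp hx.2
  rw [(extChartAt (𝓡∂ n) p₀).right_inv hx.1] at hinv
  obtain ⟨M, hM⟩ := hinv
  have h5 : ContDiffAt ℝ ∞ ContinuousLinearMap.inverse (K.pairChart f a p₀ x) := by
    rw [← hM]
    exact contDiffAt_map_inverse M
  exact h5.comp_contDiffWithinAt x (h4 x hx)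

end CalabiYau

end Field

end LagBdry

namespace LagBdry

/-- The Euclidean model space. -/
abbrev Model (n : ℕ) : Type := EuclideanSpace ℝ (Fin n)

/-- Covectors on the model space. -/
abbrev CoModel (n : ℕ) : Type := EuclideanSpace ℝ (Fin n) →L[ℝ] ℝ

section HalfSpace

variable {n : ℕ} [NeZero n]

lemma mem_range_halfSpace {x : Model n} : x ∈ range (𝓡∂ n) ↔ 0 ≤ x 0 := by
  rw [range_modelWithCornersEuclideanHalfSpace]
  rfl

lemma convex_range_halfSpace : Convex ℝ (range (𝓡∂ n)) := by
  intro x hx y hy a b ha hb _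
  rw [mem_range_halfSpace] at hx hy ⊢
  simp only [PiLp.add_apply, PiLp.smul_apply, smul_eq_mul]
  positivity

/-- The covectors vanishing on the boundary hyperplane. -/
def IsConormal (ζ : CoModel n) : Prop := ∀ w : Model n, w 0 = 0 → ζ w = 0

/-- The coordinate transverse to the boundary. -/
noncomputable def normalCoord (n : ℕ) [NeZero n] : CoModel n := EuclideanSpace.proj 0

lemma normalCoord_apply (x : Model n) : normalCoord n x = x 0 := rfl

lemma isConormal_iff {ζ : CoModel n} : IsConormal ζ ↔ ∃ s : ℝ, ζ = s • normalCoord n := by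
  constructor
  · intro h
    refine ⟨ζ (EuclideanSpace.single 0 1), ?_⟩
    ext x
    have h1 := h (x - x 0 • EuclideanSpace.single 0 1) (by simp)
    rw [map_sub, map_smul, sub_eq_zero] at h1
    rw [h1, smul_apply, normalCoord_apply, smul_eq_mul, smul_eq_mul, mul_comm]
  · rintro ⟨s, rfl⟩ w hw
    rw [smul_apply, normalCoord_apply, hw, smul_zero]

lemma finrank_ker_normalCoord :
    Module.finrank ℝ (LinearMap.ker (normalCoord n : Model n →ₗ[ℝ] ℝ)) + 1 = n := by
  have h1 := LinearMap.finrank_range_add_finrank_ker (normalCoord n : Model n →ₗ[ℝ] ℝ)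
  have h2 : LinearMap.range (normalCoord n : Model n →ₗ[ℝ] ℝ) = ⊤ := by
    rw [LinearMap.range_eq_top]
    intro s
    exact ⟨s • EuclideanSpace.single 0 1, by
      change (s • EuclideanSpace.single 0 1 : Model n) 0 = s
      simp⟩
  rw [h2, finrank_top, Module.finrank_self, finrank_euclideanSpace_fin] at h1
  omega

/-- The half ball. -/
def halfBall (x₀ : Model n) (r : ℝ) : Set (Model n) := range (𝓡∂ n) ∩ Metric.ball x₀ r

lemma convex_halfBall (x₀ : Model n) (r : ℝ) : Convex ℝ (halfBall x₀ r) :=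
  convex_range_halfSpace.inter (convex_ball x₀ r)

/-- The ambient domain of the local models: half space times covectors. -/
def halfProd (n : ℕ) [NeZero n] : Set (Model n × CoModel n) := range (𝓡∂ n) ×ˢ univ

/-- The domain of a local model. -/
def modelDom (x₀ : Model n) (r : ℝ) : Set (Model n × CoModel n) :=
  halfBall x₀ r ×ˢ Metric.ball 0 r

lemma modelDom_eq (x₀ : Model n) (r : ℝ) :
    modelDom x₀ r = halfProd n ∩ Metric.ball (x₀, 0) r := by
  ext z
  simp only [modelDom, halfProd, halfBall, mem_prod, mem_inter_iff, mem_univ, and_true,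
    ← ball_prod_same]
  tauto

lemma convex_modelDom (x₀ : Model n) (r : ℝ) : Convex ℝ (modelDom x₀ r) :=
  (convex_halfBall x₀ r).prod (convex_ball 0 r)

lemma uniqueDiffOn_halfProd : UniqueDiffOn ℝ (halfProd n) :=
  (𝓡∂ n).uniqueDiffOn.prod uniqueDiffOn_univ

lemma exists_modelDom_of_eventually {x₀ : Model n} {P : Model n × CoModel n → Prop}
    (h : ∀ᶠ z in 𝓝[halfProd n] (x₀, 0), P z) :
    ∃ R > 0, ∀ r ≤ R, ∀ z ∈ modelDom x₀ r, P z := by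
  rw [eventually_nhdsWithin_iff, Metric.eventually_nhds_iff_ball] at h
  obtain ⟨R, hR, h⟩ := h
  refine ⟨R, hR, fun r hr z hz ↦ ?_⟩
  rw [modelDom_eq] at hz
  exact h z (Metric.ball_subset_ball hr hz.2) hz.1

end HalfSpace

section Components

variable {n : ℕ} [NeZero n] {d : ℕ} {L : Type*} [TopologicalSpace L]
  [ChartedSpace (EuclideanHalfSpace n) L] [IsManifold (𝓡∂ n) ∞ L]
  {C : Fin d → Set L}

lemma IsBoundaryOrdering.mem_boundary (hC : IsBoundaryOrdering n C) {i : Fin d} {p : L}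
    (hp : p ∈ C i) : p ∈ (𝓡∂ n).boundary L := by
  obtain ⟨q, hq, hqi⟩ : C i ∈ connectedComponentIn ((𝓡∂ n).boundary L) '' (𝓡∂ n).boundary L := by
    rw [← hC.2]
    exact mem_range_self i
  rw [← hqi] at hp
  exact connectedComponentIn_subset _ _ hp

lemma IsBoundaryOrdering.eq_component (hC : IsBoundaryOrdering n C) {i : Fin d} {p : L}
    (hp : p ∈ C i) : C i = connectedComponentIn ((𝓡∂ n).boundary L) p := by
  obtain ⟨q, hq, hqi⟩ : C i ∈ connectedComponentIn ((𝓡∂ n).boundary L) '' (𝓡∂ n).boundary L := by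
    rw [← hC.2]
    exact mem_range_self i
  rw [← hqi] at hp ⊢
  exact connectedComponentIn_eq hp

lemma IsBoundaryOrdering.exists_mem (hC : IsBoundaryOrdering n C) {p : L}
    (hp : p ∈ (𝓡∂ n).boundary L) : ∃ i, p ∈ C i := by
  have h : connectedComponentIn ((𝓡∂ n).boundary L) p ∈ range C := by
    rw [hC.2]
    exact mem_image_of_mem _ hp
  obtain ⟨i, hi⟩ := h
  refine ⟨i, ?_⟩
  rw [hi]
  exact mem_connectedComponentIn hp

/-- Boundary points in a half ball of a chart lie in the same boundary component. -/
lemma mem_component_of_halfBall {p₀ p q : L} {x₀ : Model n} {r : ℝ}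
    (hsub : halfBall x₀ r ⊆ (extChartAt (𝓡∂ n) p₀).target)
    (hp : p ∈ (extChartAt (𝓡∂ n) p₀).source) (hq : q ∈ (extChartAt (𝓡∂ n) p₀).source)
    (hpr : extChartAt (𝓡∂ n) p₀ p ∈ halfBall x₀ r) (hqr : extChartAt (𝓡∂ n) p₀ q ∈ halfBall x₀ r)
    (hpb : p ∈ (𝓡∂ n).boundary L) (hqb : q ∈ (𝓡∂ n).boundary L) :
    q ∈ connectedComponentIn ((𝓡∂ n).boundary L) p := by
  let T : Set (Model n) := halfBall x₀ r ∩ {x | x 0 = 0}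
  have hT : Convex ℝ T := by
    refine (convex_halfBall x₀ r).inter ?_
    intro x hx y hy a b _ _ _
    have hx' : x 0 = 0 := hx
    have hy' : y 0 = 0 := hy
    change (a • x + b • y) 0 = 0
    simp [hx', hy']
  have hTt : T ⊆ (extChartAt (𝓡∂ n) p₀).target := inter_subset_left.trans hsub
  have hpre : IsPreconnected ((extChartAt (𝓡∂ n) p₀).symm '' T) :=
    hT.isPreconnected.image _ ((continuousOn_extChartAt_symm p₀).mono hTt)
  have hmem : ∀ {q : L}, q ∈ (extChartAt (𝓡∂ n) p₀).source →
      extChartAt (𝓡∂ n) p₀ q ∈ halfBall x₀ r → q ∈ (𝓡∂ n).boundary L →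
      q ∈ (extChartAt (𝓡∂ n) p₀).symm '' T := fun {q} h1 h2 h3 ↦
    ⟨_, ⟨h2, (mem_boundary_iff h1).1 h3⟩, (extChartAt (𝓡∂ n) p₀).left_inv h1⟩
  refine hpre.subset_connectedComponentIn (hmem hp hpr hpb) ?_ (hmem hq hqr hqb)
  rintro _ ⟨x, hx, rfl⟩
  rw [mem_boundary_iff ((extChartAt (𝓡∂ n) p₀).map_target (hTt hx)),
    (extChartAt (𝓡∂ n) p₀).right_inv (hTt hx)]
  exact hx.2

lemma eventually_halfBall_subset_target (p₀ : L) :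
    ∃ R > 0, ∀ r ≤ R, halfBall (extChartAt (𝓡∂ n) p₀ p₀) r ⊆ (extChartAt (𝓡∂ n) p₀).target := by
  have h := extChartAt_target_mem_nhdsWithin (I := 𝓡∂ n) p₀
  rw [Metric.mem_nhdsWithin_iff] at h
  obtain ⟨R, hR, h⟩ := h
  exact ⟨R, hR, fun r hr x hx ↦ h ⟨Metric.ball_subset_ball hr hx.2, hx.1⟩⟩

/-- Small half balls meet at most the boundary component of their centre. -/
lemma IsBoundaryOrdering.exists_component_radius (hC : IsBoundaryOrdering n C) (p₀ : L) :
    ∃ R > 0, ∀ r ≤ R, ∀ i, ∀ p ∈ C i, p ∈ (extChartAt (𝓡∂ n) p₀).source →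
      extChartAt (𝓡∂ n) p₀ p ∈ halfBall (extChartAt (𝓡∂ n) p₀ p₀) r → p₀ ∈ C i := by
  by_cases hp₀ : p₀ ∈ (𝓡∂ n).boundary L
  · obtain ⟨R, hR, h⟩ := eventually_halfBall_subset_target (n := n) p₀
    refine ⟨R, hR, fun r hr i p hp hps hpr ↦ ?_⟩
    have hr0 : 0 < r := (norm_nonneg _).trans_lt (mem_ball_iff_norm.1 hpr.2)
    rw [hC.eq_component hp]
    refine mem_component_of_halfBall (h r hr) hps (mem_extChartAt_source p₀) hpr
      ⟨?_, Metric.mem_ball_self hr0⟩ (hC.mem_boundary hp) hp₀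
    rw [extChartAt_coe]
    exact mem_range_self _
  · have h0 : 0 < extChartAt (𝓡∂ n) p₀ p₀ 0 := by
      refine (extChartAt_zero_nonneg p₀ p₀).lt_of_ne fun h ↦ hp₀ ?_
      exact (mem_boundary_iff (mem_extChartAt_source p₀)).2 h.symm
    refine ⟨extChartAt (𝓡∂ n) p₀ p₀ 0, h0, fun r hr i p hp hps hpr ↦ ?_⟩
    exfalso
    have h1 := (mem_boundary_iff hps).1 (hC.mem_boundary hp)
    have h2 := mem_ball_iff_norm.1 hpr.2
    have h3 := PiLp.norm_apply_le (extChartAt (𝓡∂ n) p₀ p - extChartAt (𝓡∂ n) p₀ p₀) 0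
    rw [PiLp.sub_apply, h1, zero_sub, norm_neg, Real.norm_eq_abs, abs_of_pos h0] at h3
    linarith

end Components

section LocalModel

variable {n : ℕ} [NeZero n] {d : ℕ}
  {X : Type*} [TopologicalSpace X]
  [ChartedSpace (EuclideanSpace ℝ (Fin (2 * n))) X] [IsManifold (𝓡 (2 * n)) ∞ X]
  {K : CalabiYau n X}
  {L : Type*} [TopologicalSpace L]
  [ChartedSpace (EuclideanHalfSpace n) L] [IsManifold (𝓡∂ n) ∞ L]

/-- The data of a Lagrangian immersion with boundary on Lagrangian submanifolds that are geodesic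
for a connection. -/
structure DeformationData (K : CalabiYau n X) (C : Fin d → Set L) (Λ : Fin d → Set X)
    (D : CovariantDerivative (𝓡 (2 * n)) (EuclideanSpace ℝ (Fin (2 * n)))
      (TangentSpace (𝓡 (2 * n)) : X → Type _)) (f : L → X) (a : L → ℝ) : Prop where
  ordering : IsBoundaryOrdering n C
  lagrangian : ∀ i, K.IsLagrangianSubmanifold (Λ i)
  smooth : D.ContMDiffCovariantDerivative ∞
  geodesic : ∀ i, IsGeodesicSubmanifold D (Λ i)
  imm : K.IsLagrangianImm f
  free : IsFree n f
  boundary : HasBoundaryCondition n C Λ f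
  smooth_angle : ContMDiff (𝓡∂ n) 𝓘(ℝ, ℝ) ∞ a
  angle : ∀ i, ∀ p ∈ C i, Module.finrank ℝ
      (K.E f a p ⊓ tangentOf (𝓡 (2 * n)) (Λ i) (f p) :
        Submodule ℝ (TangentSpace (𝓡 (2 * n)) (f p))) = 1

variable {C : Fin d → Set L} {Λ : Fin d → Set X}
    {D : CovariantDerivative (𝓡 (2 * n)) (EuclideanSpace ℝ (Fin (2 * n)))
      (TangentSpace (𝓡 (2 * n)) : X → Type _)} {f : L → X} {a : L → ℝ}

namespace DeformationData

variable (S : DeformationData K C Λ D f a)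
include S

/-- The coordinate derivative of `f` takes boundary directions to directions tangent to `Λ i`. -/
lemma boundary_direction {i : Fin d} {p₀ p : L} {O σ W}
    (hs : IsSlice (m := 2 * n) (Λ i) (f p₀) O σ W) (hpC : p ∈ C i)
    (hp : p ∈ (extChartAt (𝓡∂ n) p₀).source)
    (hy : f p ∈ (extChartAt (𝓡 (2 * n)) (f p₀)).source)
    (hO : extChartAt (𝓡 (2 * n)) (f p₀) (f p) ∈ O) {w : Model n} (hw : w 0 = 0) :
    fderiv ℝ σ (extChartAt (𝓡 (2 * n)) (f p₀) (f p))
      (fderivWithin ℝ (chartRep (𝓡∂ n) (𝓡 (2 * n)) p₀ (f p₀) f) (range (𝓡∂ n))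
        (extChartAt (𝓡∂ n) p₀ p) w) ∈ W := by
  set c := extChartAt (𝓡∂ n) p₀ with hc
  set χ := extChartAt (𝓡 (2 * n)) (f p₀) with hχ
  set fc := chartRep (𝓡∂ n) (𝓡 (2 * n)) p₀ (f p₀) f with hfc
  have hpb := S.ordering.mem_boundary hpC
  have hp0 : c p 0 = 0 := (mem_boundary_iff hp).1 hpb
  have hpr : c p ∈ range (𝓡∂ n) := mem_range_halfSpace.2 hp0.ge
  have hdom : c p ∈ chartDom (𝓡∂ n) (𝓡 (2 * n)) p₀ (f p₀) f :=
    ⟨c.map_source hp, by rw [mem_preimage, mem_preimage, c.left_inv hp]; exact hy⟩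
  have hfcd : HasFDerivWithinAt fc (fderivWithin ℝ fc (range (𝓡∂ n)) (c p)) (range (𝓡∂ n)) (c p) :=
    (((contDiffOn_chartRep S.imm.1.1 _ hdom).mono_of_mem_nhdsWithin
      (chartDom_mem_nhdsWithin S.imm.1.1.continuous hdom)).differentiableWithinAt
      (by simp)).hasFDerivWithinAt
  let l : ℝ → Model n := fun t ↦ c p + t • w
  have hl0 : l 0 = c p := by simp [l]
  have hld : HasDerivAt l w 0 := by
    simpa [l] using ((hasDerivAt_id (0 : ℝ)).smul_const w).const_add (c p)
  have hlz : ∀ t, l t 0 = 0 := fun t ↦ by simp [l, hp0, hw]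
  have hlr : ∀ t, l t ∈ range (𝓡∂ n) := fun t ↦ mem_range_halfSpace.2 (hlz t).ge
  have hfl : HasDerivAt (fun t ↦ fc (l t)) (fderivWithin ℝ fc (range (𝓡∂ n)) (c p) w) 0 := by
    rw [← hl0] at hfcd
    have := HasFDerivWithinAt.comp_hasDerivWithinAt (f := l) (s := univ) 0 hfcd
      hld.hasDerivWithinAt (fun t _ ↦ hlr t)
    rw [hasDerivWithinAt_univ, hl0] at this
    exact this
  have hfl0 : fc (l 0) = χ (f p) := by rw [hl0, hfc, chartRep_apply hp]
  have hσ : HasDerivAt (fun t ↦ σ (fc (l t))) (fderiv ℝ σ (χ (f p))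
      (fderivWithin ℝ fc (range (𝓡∂ n)) (c p) w)) 0 :=
    HasFDerivAt.comp_hasDerivAt (l := σ) (f := fun t ↦ fc (l t)) (l' := fderiv ℝ σ (χ (f p))) 0
      (by rw [hfl0]; exact hs.differentiableAt hO) hfl
  refine deriv_mem_of_eventually_mem hσ ?_
  obtain ⟨R, hR, hRt⟩ : ∃ R > 0, halfBall (c p) R ⊆ chartDom (𝓡∂ n) (𝓡 (2 * n)) p₀ (f p₀) f := by
    have h := chartDom_mem_nhdsWithin S.imm.1.1.continuous hdom
    rw [Metric.mem_nhdsWithin_iff] at h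
    obtain ⟨R, hR, h⟩ := h
    exact ⟨R, hR, fun x hx ↦ h ⟨hx.2, hx.1⟩⟩
  have hlc : ∀ᶠ t in 𝓝 0, l t ∈ Metric.ball (c p) R :=
    hld.continuousAt.eventually (by rw [hl0]; exact Metric.ball_mem_nhds _ hR)
  filter_upwards [hlc, hfl.continuousAt.eventually
    (hs.isOpen.mem_nhds (show fc (l 0) ∈ O by rw [hfl0]; exact hO))] with t ht htO
  have htd : l t ∈ chartDom (𝓡∂ n) (𝓡 (2 * n)) p₀ (f p₀) f := hRt ⟨hlr t, ht⟩
  have hsrc := c.map_target htd.1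
  have hC : c.symm (l t) ∈ C i := by
    rw [S.ordering.eq_component hpC]
    refine mem_component_of_halfBall (p₀ := p₀) (x₀ := c p) (r := R)
      (hRt.trans inter_subset_left) hp hsrc ⟨hpr, Metric.mem_ball_self hR⟩ ?_ hpb ?_
    · rw [← hc, c.right_inv htd.1]
      exact ⟨hlr t, ht⟩
    · rw [mem_boundary_iff hsrc, ← hc, c.right_inv htd.1]
      exact hlz t
  have hΛ := S.boundary.1 i _ hC
  exact (hs.mem_iff' htd.2 htO).1 hΛ

/-- `Φ⁻¹` takes conormal covectors to vectors tangent to `Λ i`. -/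
lemma invChart_mem_tangentOf {i : Fin d} {p₀ p : L} {O σ W}
    (hs : IsSlice (m := 2 * n) (Λ i) (f p₀) O σ W) (hpC : p ∈ C i)
    (hp : p ∈ (extChartAt (𝓡∂ n) p₀).source)
    (hy : f p ∈ (extChartAt (𝓡 (2 * n)) (f p₀)).source)
    (hO : extChartAt (𝓡 (2 * n)) (f p₀) (f p) ∈ O) {ζ : CoModel n} (hζ : IsConormal ζ) :
    fderiv ℝ σ (extChartAt (𝓡 (2 * n)) (f p₀) (f p))
      (K.invChart f a p₀ (extChartAt (𝓡∂ n) p₀ p) ζ) ∈ W := by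
  have hfΛ : f p ∈ Λ i := S.boundary.1 i p hpC
  obtain ⟨⟨v₀, hv₀⟩, hv₀0, -⟩ := finrank_eq_one_iff'.1 (S.angle i p hpC)
  obtain ⟨Y₀, hY₀⟩ := hv₀.1
  let Y : Model n := Y₀
  have hY : a p • mfderivModel (𝓡∂ n) (𝓡 (2 * n)) f p Y +
      K.JModel (f p) (mfderivModel (𝓡∂ n) (𝓡 (2 * n)) f p Y) = v₀ := hY₀
  set ζ₀ := K.pairChart f a p₀ (extChartAt (𝓡∂ n) p₀ p) (tangentCoordChange (𝓡∂ n) p p₀ p Y)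
    with hζ₀
  have hinv : K.invChart f a p₀ (extChartAt (𝓡∂ n) p₀ p) ζ₀ =
      tangentCoordChange (𝓡 (2 * n)) (f p) (f p₀) (f p) v₀ := by
    obtain ⟨M, hM⟩ := CalabiYau.pairChart_invertible (a := a) S.imm hp hy
    rw [CalabiYau.invChart, ContinuousLinearMap.comp_apply, hζ₀, ← hM,
      ContinuousLinearMap.inverse_equiv]
    change K.rotChart f a p₀ (extChartAt (𝓡∂ n) p₀ p) (M.symm (M _)) = _
    rw [M.symm_apply_apply, CalabiYau.rotChart_apply S.imm hp hy, hY]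
  have hmem : fderiv ℝ σ (extChartAt (𝓡 (2 * n)) (f p₀) (f p))
      (tangentCoordChange (𝓡 (2 * n)) (f p) (f p₀) (f p) v₀) ∈ W :=
    (hs.tangentOf_iff hy hO hfΛ _).1 hv₀.2
  have hcon : IsConormal ζ₀ := by
    intro w hw
    have hd := S.boundary_direction hs hpC hp hy hO hw
    set Z := tangentCoordChange (𝓡∂ n) p₀ p p w with hZ
    have hZw : tangentCoordChange (𝓡∂ n) p p₀ p Z = w :=
      tangentCoordChange_symm_apply hp (mem_extChartAt_source p) w
    rw [← hZw, fderivWithin_chartRep_apply (CalabiYau.mdifferentiableAt_imm S.imm p) hp hy] at hd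
    have hd' := (hs.tangentOf_iff hy hO hfΛ _).2 hd
    rw [hζ₀, ← hZw, CalabiYau.pairChart_apply S.imm hp hy, hY]
    exact (S.lagrangian i).2 _ hfΛ _ hv₀.2 _ hd'
  have hζ₀0 : ζ₀ ≠ 0 := by
    intro h0
    rw [h0, map_zero] at hinv
    apply hv₀0
    have h1 := tangentCoordChange_symm_apply (I := 𝓡 (2 * n)) (mem_extChartAt_source (f p)) hy v₀
    rw [← hinv, map_zero] at h1
    exact Subtype.ext h1.symm
  obtain ⟨s, hsζ⟩ := isConormal_iff.1 hζ
  obtain ⟨s₀, hsζ₀⟩ := isConormal_iff.1 hcon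
  have hs₀ : s₀ ≠ 0 := by
    rintro rfl
    exact hζ₀0 (by rw [hsζ₀, zero_smul])
  have hζζ : ζ = (s / s₀) • ζ₀ := by
    rw [hsζ, hsζ₀, smul_smul, div_mul_cancel₀ _ hs₀]
  rw [hζζ, map_smul, map_smul, hinv]
  exact W.smul_mem _ hmem

end DeformationData

end LocalModel

end LagBdry

namespace LagBdry

section LocalModel

variable {n : ℕ} [NeZero n] {d : ℕ}
  {X : Type*} [TopologicalSpace X]
  [ChartedSpace (EuclideanSpace ℝ (Fin (2 * n))) X] [IsManifold (𝓡 (2 * n)) ∞ X]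
  {L : Type*} [TopologicalSpace L]
  [ChartedSpace (EuclideanHalfSpace n) L] [IsManifold (𝓡∂ n) ∞ L]

/-- The derivative of an immersion in charts. -/
noncomputable abbrev immDeriv (f : L → X) (p₀ : L) (x : Model n) : Model n →L[ℝ] Model (2 * n) :=
  fderivWithin ℝ (chartRep (𝓡∂ n) (𝓡 (2 * n)) p₀ (f p₀) f) (range (𝓡∂ n)) x

/-- A chart description of the deformation map: `F (x, ζ)` is the exponential of `Φ⁻¹ζ` at the
point with coordinates `x`. -/
structure LocalModel (K : CalabiYau n X) (C : Fin d → Set L) (Λ : Fin d → Set X)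
    (D : CovariantDerivative (𝓡 (2 * n)) (EuclideanSpace ℝ (Fin (2 * n)))
      (TangentSpace (𝓡 (2 * n)) : X → Type _)) (f : L → X) (a : L → ℝ) (p₀ : L)
    (F : Model n × CoModel n → Model (2 * n)) (A : (Model n × CoModel n) ≃L[ℝ] Model (2 * n))
    (R : ℝ) : Prop where
  pos : 0 < R
  subset : halfBall (extChartAt (𝓡∂ n) p₀ p₀) R ⊆ chartDom (𝓡∂ n) (𝓡 (2 * n)) p₀ (f p₀) f
  smooth : ∀ z ∈ modelDom (extChartAt (𝓡∂ n) p₀ p₀) R, ContDiffWithinAt ℝ ∞ F (halfProd n) z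
  target : ∀ z ∈ modelDom (extChartAt (𝓡∂ n) p₀ p₀) R, F z ∈ (extChartAt (𝓡 (2 * n)) (f p₀)).target
  zero : ∀ x ∈ halfBall (extChartAt (𝓡∂ n) p₀ p₀) R,
    F (x, 0) = chartRep (𝓡∂ n) (𝓡 (2 * n)) p₀ (f p₀) f x
  isExp : ∀ p ∈ (extChartAt (𝓡∂ n) p₀).source,
    extChartAt (𝓡∂ n) p₀ p ∈ halfBall (extChartAt (𝓡∂ n) p₀ p₀) R →
    ∀ ζ ∈ Metric.ball (0 : CoModel n) R,
      IsExp D (f p) (tangentCoordChange (𝓡 (2 * n)) (f p₀) (f p) (f p)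
        (K.invChart f a p₀ (extChartAt (𝓡∂ n) p₀ p) ζ))
        ((extChartAt (𝓡 (2 * n)) (f p₀)).symm (F (extChartAt (𝓡∂ n) p₀ p, ζ)))
  apply : ∀ z, A z = immDeriv f p₀ (extChartAt (𝓡∂ n) p₀ p₀) z.1 +
    K.invChart f a p₀ (extChartAt (𝓡∂ n) p₀ p₀) z.2
  hasDeriv : HasFDerivWithinAt F (A : Model n × CoModel n →L[ℝ] Model (2 * n)) (halfProd n)
    (extChartAt (𝓡∂ n) p₀ p₀, 0)
  deriv_near : ∀ z ∈ modelDom (extChartAt (𝓡∂ n) p₀ p₀) R,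
    ‖fderivWithin ℝ F (halfProd n) z - A‖ * ‖(A.symm : Model (2 * n) →L[ℝ] Model n × CoModel n)‖
      ≤ 1 / 16
  component : ∀ i, ∀ p ∈ C i, p ∈ (extChartAt (𝓡∂ n) p₀).source →
    extChartAt (𝓡∂ n) p₀ p ∈ halfBall (extChartAt (𝓡∂ n) p₀ p₀) R → p₀ ∈ C i
  boundary : ∀ i, ∀ p ∈ C i, p ∈ (extChartAt (𝓡∂ n) p₀).source →
    extChartAt (𝓡∂ n) p₀ p ∈ halfBall (extChartAt (𝓡∂ n) p₀ p₀) R →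
    ∀ ζ ∈ Metric.ball (0 : CoModel n) R, IsConormal ζ →
    (extChartAt (𝓡 (2 * n)) (f p₀)).symm (F (extChartAt (𝓡∂ n) p₀ p, ζ)) ∈ Λ i
  boundary_lift : ∃ r > 0, ∀ i, p₀ ∈ C i →
    ∀ y ∈ Metric.ball (extChartAt (𝓡 (2 * n)) (f p₀) (f p₀)) r,
    (extChartAt (𝓡 (2 * n)) (f p₀)).symm y ∈ Λ i →
    ∃ z ∈ modelDom (extChartAt (𝓡∂ n) p₀ p₀) R, z.1 0 = 0 ∧ IsConormal z.2 ∧ F z = y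

variable {K : CalabiYau n X} {C : Fin d → Set L} {Λ : Fin d → Set X}
    {D : CovariantDerivative (𝓡 (2 * n)) (EuclideanSpace ℝ (Fin (2 * n)))
      (TangentSpace (𝓡 (2 * n)) : X → Type _)} {f : L → X} {a : L → ℝ}

lemma finrank_coModel (n : ℕ) : Module.finrank ℝ (CoModel n) = n := by
  rw [← (LinearMap.toContinuousLinearMap :
      (EuclideanSpace ℝ (Fin n) →ₗ[ℝ] ℝ) ≃ₗ[ℝ] _).finrank_eq]
  exact (Subspace.dual_finrank_eq (K := ℝ) (V := EuclideanSpace ℝ (Fin n))).trans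
    finrank_euclideanSpace_fin

lemma immDeriv_lagrangian (hf : K.IsLagrangianImm f) {p₀ p : L}
    (hp : p ∈ (extChartAt (𝓡∂ n) p₀).source)
    (hy : f p ∈ (extChartAt (𝓡 (2 * n)) (f p₀)).source) (ξ η : Model n) :
    K.omegaChart (f p₀) (extChartAt (𝓡 (2 * n)) (f p₀) (f p))
      (immDeriv f p₀ (extChartAt (𝓡∂ n) p₀ p) ξ) (immDeriv f p₀ (extChartAt (𝓡∂ n) p₀ p) η) = 0 := by
  have h := fun v : Model n ↦ tangentCoordChange_symm_apply (I := 𝓡∂ n) hp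
    (mem_extChartAt_source p) v
  rw [← h ξ, ← h η, immDeriv,
    fderivWithin_chartRep_apply (CalabiYau.mdifferentiableAt_imm hf p) hp hy,
    fderivWithin_chartRep_apply (CalabiYau.mdifferentiableAt_imm hf p) hp hy,
    K.omegaChart_apply hy]
  exact hf.2 p _ _

lemma immDeriv_injective (hf : K.IsLagrangianImm f) {p₀ p : L}
    (hp : p ∈ (extChartAt (𝓡∂ n) p₀).source)
    (hy : f p ∈ (extChartAt (𝓡 (2 * n)) (f p₀)).source) {ξ : Model n}
    (h : immDeriv f p₀ (extChartAt (𝓡∂ n) p₀ p) ξ = 0) : ξ = 0 := by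
  have hξ := tangentCoordChange_symm_apply (I := 𝓡∂ n) hp (mem_extChartAt_source p) ξ
  rw [← hξ, immDeriv,
    fderivWithin_chartRep_apply (CalabiYau.mdifferentiableAt_imm hf p) hp hy] at h
  have h1 := tangentCoordChange_symm_apply (I := 𝓡 (2 * n)) (mem_extChartAt_source (f p)) hy
    (mfderivModel (𝓡∂ n) (𝓡 (2 * n)) f p (tangentCoordChange (𝓡∂ n) p₀ p p ξ))
  rw [h, map_zero] at h1
  have h2 : tangentCoordChange (𝓡∂ n) p₀ p p ξ = 0 :=
    hf.1.2 p (h1.symm.trans (map_zero (mfderivModel (𝓡∂ n) (𝓡 (2 * n)) f p)).symm)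
  rw [← hξ, h2, map_zero]

lemma exists_modelEquiv (hf : K.IsLagrangianImm f) (a : L → ℝ) (p₀ : L) :
    ∃ A : (Model n × CoModel n) ≃L[ℝ] Model (2 * n),
      ∀ z, A z = immDeriv f p₀ (extChartAt (𝓡∂ n) p₀ p₀) z.1 +
        K.invChart f a p₀ (extChartAt (𝓡∂ n) p₀ p₀) z.2 := by
  have hp := mem_extChartAt_source (I := 𝓡∂ n) p₀
  have hy := mem_extChartAt_source (I := 𝓡 (2 * n)) (f p₀)
  let T : Model n × CoModel n →L[ℝ] Model (2 * n) :=
    (immDeriv f p₀ (extChartAt (𝓡∂ n) p₀ p₀)).coprod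
      (K.invChart f a p₀ (extChartAt (𝓡∂ n) p₀ p₀))
  have hinj : Function.Injective T := by
    rw [injective_iff_map_eq_zero]
    rintro ⟨ξ, ζ⟩ h
    have h' : immDeriv f p₀ (extChartAt (𝓡∂ n) p₀ p₀) ξ +
      K.invChart f a p₀ (extChartAt (𝓡∂ n) p₀ p₀) ζ = 0 := h
    have hζ : ζ = 0 := by
      ext Z
      rw [← CalabiYau.omegaChart_invChart (a := a) hf hp hy ζ Z, eq_neg_of_add_eq_zero_right h',
        map_neg, neg_apply, zero_apply, neg_eq_zero]
      exact immDeriv_lagrangian hf hp hy ξ Z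
    rw [hζ, map_zero, add_zero] at h'
    rw [immDeriv_injective hf hp hy h', hζ]
    rfl
  have hdim : Module.finrank ℝ (Model n × CoModel n) = Module.finrank ℝ (Model (2 * n)) := by
    rw [Module.finrank_prod, finrank_coModel, finrank_euclideanSpace_fin,
      finrank_euclideanSpace_fin]
    ring
  exact ⟨(LinearEquiv.ofInjectiveOfFinrankEq (T : Model n × CoModel n →ₗ[ℝ] Model (2 * n)) hinj
    hdim).toContinuousLinearEquiv, fun z ↦ rfl⟩

/-- Points of `Λ i` near `f p₀` are deformations of boundary points by conormal covectors. -/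
lemma exists_boundary_lift {i : Fin d} {p₀ : L} {O σ W}
    (hs : IsSlice (m := 2 * n) (Λ i) (f p₀) O σ W) (hW : Module.finrank ℝ W = n)
    {F : Model n × CoModel n → Model (2 * n)} {A : (Model n × CoModel n) ≃L[ℝ] Model (2 * n)}
    {R : ℝ} (hR : 0 < R) (hx₀ : extChartAt (𝓡∂ n) p₀ p₀ 0 = 0)
    (hF : ContDiffWithinAt ℝ ∞ F (halfProd n) (extChartAt (𝓡∂ n) p₀ p₀, 0))
    (hF0 : F (extChartAt (𝓡∂ n) p₀ p₀, 0) = extChartAt (𝓡 (2 * n)) (f p₀) (f p₀))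
    (hFA : HasFDerivWithinAt F (A : Model n × CoModel n →L[ℝ] Model (2 * n)) (halfProd n)
      (extChartAt (𝓡∂ n) p₀ p₀, 0))
    (hΛ : ∀ z ∈ modelDom (extChartAt (𝓡∂ n) p₀ p₀) R, z.1 0 = 0 → IsConormal z.2 →
      (extChartAt (𝓡 (2 * n)) (f p₀)).symm (F z) ∈ Λ i) :
    ∃ r > 0, ∀ y ∈ Metric.ball (extChartAt (𝓡 (2 * n)) (f p₀) (f p₀)) r,
    (extChartAt (𝓡 (2 * n)) (f p₀)).symm y ∈ Λ i →
    ∃ z ∈ modelDom (extChartAt (𝓡∂ n) p₀ p₀) R, z.1 0 = 0 ∧ IsConormal z.2 ∧ F z = y := by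
  set x₀ := extChartAt (𝓡∂ n) p₀ p₀ with hx₀def
  set y₀ := extChartAt (𝓡 (2 * n)) (f p₀) (f p₀) with hy₀def
  let T := LinearMap.ker (normalCoord n : Model n →ₗ[ℝ] ℝ)
  let ι' : T × ℝ →L[ℝ] Model n × CoModel n :=
    (T.subtypeL.comp (ContinuousLinearMap.fst ℝ T ℝ)).prod
      ((ContinuousLinearMap.snd ℝ T ℝ).smulRight (normalCoord n))
  let ι : T × ℝ → Model n × CoModel n := fun u ↦ (x₀, 0) + ι' u
  have hι0 : ι 0 = (x₀, 0) := by simp [ι]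
  have hιd : HasFDerivAt ι ι' 0 := ι'.hasFDerivAt.const_add _
  have hιc : ContDiff ℝ ∞ ι := contDiff_const.add ι'.contDiff
  have hι1 : ∀ u, (ι u).1 0 = 0 := by
    intro u
    have h1 : (u.1 : Model n) 0 = 0 := u.1.2
    change (x₀ + (u.1 : Model n)) 0 = 0
    rw [PiLp.add_apply, hx₀, h1, add_zero]
  have hι2 : ∀ u, IsConormal (ι u).2 := by
    intro u
    refine isConormal_iff.2 ⟨u.2, ?_⟩
    change 0 + u.2 • normalCoord n = _
    rw [zero_add]
  have hιS : ∀ u, ι u ∈ halfProd n := fun u ↦ ⟨mem_range_halfSpace.2 (hι1 u).ge, mem_univ _⟩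
  have hFι : ContDiffAt ℝ ∞ (fun u ↦ F (ι u)) 0 := by
    rw [← hι0] at hF
    have := hF.comp (s := univ) 0 hιc.contDiffAt.contDiffWithinAt (fun u _ ↦ hιS u)
    exact contDiffWithinAt_univ.1 this
  have hFιd : HasFDerivAt (fun u ↦ F (ι u))
      ((A : Model n × CoModel n →L[ℝ] Model (2 * n)).comp ι') 0 := by
    rw [← hι0] at hFA
    have := hFA.comp (s := univ) 0 hιd.hasFDerivWithinAt (fun u _ ↦ hιS u)
    exact hasFDerivWithinAt_univ.1 this
  have hF0' : F (ι 0) = y₀ := by rw [hι0, hF0]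
  have hσc : ContDiffAt ℝ ∞ σ y₀ := hs.contDiffOn.contDiffAt (hs.isOpen.mem_nhds hs.mem)
  let g₁ : T × ℝ → Model (2 * n) := fun u ↦ σ (F (ι u))
  have hg₁c : ContDiffAt ℝ ∞ g₁ 0 := by
    rw [← hF0'] at hσc
    exact hσc.comp (0 : T × ℝ) hFι
  have hg₁d : HasFDerivAt g₁ ((fderiv ℝ σ y₀).comp
      ((A : Model n × CoModel n →L[ℝ] Model (2 * n)).comp ι')) 0 := by
    refine HasFDerivAt.comp (g := σ) (f := fun u ↦ F (ι u)) (0 : T × ℝ) ?_ hFιd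
    rw [hF0']
    exact hs.differentiableAt hs.mem
  have hdom : ∀ᶠ u in 𝓝 (0 : T × ℝ), ι u ∈ modelDom x₀ R ∧ F (ι u) ∈ O := by
    have h1 : ∀ᶠ u in 𝓝 (0 : T × ℝ), ι u ∈ Metric.ball (x₀, (0 : CoModel n)) R :=
      hιc.continuous.continuousAt.eventually (Metric.isOpen_ball.mem_nhds
        (by rw [hι0]; exact Metric.mem_ball_self hR))
    have h2 : ∀ᶠ u in 𝓝 (0 : T × ℝ), F (ι u) ∈ O :=
      hFι.continuousAt.eventually (hs.isOpen.mem_nhds (show F (ι 0) ∈ O by rw [hF0']; exact hs.mem))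
    filter_upwards [h1, h2] with u hu1 hu2
    exact ⟨by rw [modelDom_eq]; exact ⟨hιS u, hu1⟩, hu2⟩
  have hgW : ∀ᶠ u in 𝓝 (0 : T × ℝ), g₁ u ∈ W := by
    filter_upwards [hdom] with u hu
    exact (hs.mem_iff _ hu.2).1 (hΛ _ hu.1 (hι1 u) (hι2 u))
  let g' : T × ℝ →L[ℝ] Model (2 * n) :=
    (fderiv ℝ σ y₀).comp ((A : Model n × CoModel n →L[ℝ] Model (2 * n)).comp ι')
  have hg'W : ∀ u, g' u ∈ W := by
    intro u
    have h1 : HasDerivAt (fun t : ℝ ↦ t • u) u 0 := by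
      simpa using (hasDerivAt_id (0 : ℝ)).smul_const u
    have h2 : HasDerivAt (fun t : ℝ ↦ g₁ (t • u)) (g' u) 0 :=
      HasFDerivAt.comp_hasDerivAt (l := g₁) (f := fun t : ℝ ↦ t • u) (l' := g') 0
        (by rw [zero_smul]; exact hg₁d) h1
    refine deriv_mem_of_eventually_mem h2 ?_
    have h3 : Tendsto (fun t : ℝ ↦ t • u) (𝓝 0) (𝓝 0) := by
      have := h1.continuousAt.tendsto
      rwa [zero_smul] at this
    exact h3.eventually hgW
  obtain ⟨P₀, hP₀⟩ := Submodule.exists_isCompl W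
  let P : Model (2 * n) →L[ℝ] W := LinearMap.toContinuousLinearMap (W.projectionOnto P₀ hP₀)
  have hPW : ∀ w (hw : w ∈ W), P w = ⟨w, hw⟩ := fun w hw ↦
    Submodule.projectionOnto_apply_left hP₀ ⟨w, hw⟩
  let g : T × ℝ → W := fun u ↦ P (g₁ u)
  have hgd : HasStrictFDerivAt g (P.comp g') 0 :=
    P.hasStrictFDerivAt.comp (0 : T × ℝ) (hg₁c.hasStrictFDerivAt' hg₁d (by simp))
  have hinj : Function.Injective (P.comp g') := by
    rw [injective_iff_map_eq_zero]
    intro u hu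
    have h1 : g' u = 0 := by
      have h2 : P (g' u) = 0 := hu
      rw [hPW _ (hg'W u)] at h2
      exact congrArg Subtype.val h2
    obtain ⟨Sg, hSg⟩ := hs.invertible _ hs.mem
    have h2 : Sg (A (ι' u)) = 0 := by
      have : g' u = (fderiv ℝ σ y₀) (A (ι' u)) := rfl
      rw [this, ← hSg] at h1
      exact h1
    have h3 : ι' u = 0 := by
      rwa [Sg.map_eq_zero_iff, A.map_eq_zero_iff] at h2
    have h4 : (u.1 : Model n) = 0 := congrArg Prod.fst h3
    have h5 : u.2 • normalCoord n = 0 := congrArg Prod.snd h3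
    have h6 : u.2 = 0 := by
      have h7 := DFunLike.congr_fun h5 (EuclideanSpace.single 0 1)
      rw [smul_apply, normalCoord_apply] at h7
      simpa using h7
    exact Prod.ext (Subtype.ext h4) h6
  have hdim : Module.finrank ℝ (T × ℝ) = Module.finrank ℝ W := by
    rw [Module.finrank_prod, Module.finrank_self, hW]
    exact finrank_ker_normalCoord
  have hsurj : LinearMap.range (P.comp g' : T × ℝ →ₗ[ℝ] W) = ⊤ :=
    LinearMap.range_eq_top.2 ((LinearMap.injective_iff_surjective_of_finrank_eq_finrank hdim).1 hinj)
  have hmap := hgd.map_nhds_eq_of_surj hsurj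
  have himg : g '' {u | ι u ∈ modelDom x₀ R ∧ F (ι u) ∈ O} ∈ 𝓝 (g 0) := by
    rw [← hmap]
    exact image_mem_map hdom
  have hPσ : ContinuousAt (fun y ↦ P (σ y)) y₀ := P.continuous.continuousAt.comp hσc.continuousAt
  have hev : ∀ᶠ y in 𝓝 y₀, P (σ y) ∈ g '' {u | ι u ∈ modelDom x₀ R ∧ F (ι u) ∈ O} ∧ y ∈ O := by
    refine (hPσ.eventually ?_).and (hs.isOpen.mem_nhds hs.mem)
    have : P (σ y₀) = g 0 := by
      change _ = P (σ (F (ι 0)))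
      rw [hF0']
    change _ ∈ 𝓝 (P (σ y₀))
    rw [this]
    exact himg
  rw [Metric.eventually_nhds_iff_ball] at hev
  obtain ⟨r, hr, hev⟩ := hev
  refine ⟨r, hr, fun y hy hyΛ ↦ ?_⟩
  obtain ⟨⟨u, ⟨hu1, hu2⟩, hu3⟩, hyO⟩ := hev y hy
  refine ⟨ι u, hu1, hι1 u, hι2 u, hs.injOn hu2 hyO ?_⟩
  have hm1 : σ (F (ι u)) ∈ W := (hs.mem_iff _ hu2).1 (hΛ _ hu1 (hι1 u) (hι2 u))
  have hm2 : σ y ∈ W := (hs.mem_iff _ hyO).1 hyΛ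
  have h4 : P (σ (F (ι u))) = P (σ y) := hu3
  rw [hPW _ hm1, hPW _ hm2] at h4
  exact congrArg Subtype.val h4

lemma eventually_deriv_near {F : Model n × CoModel n → Model (2 * n)}
    {A : (Model n × CoModel n) ≃L[ℝ] Model (2 * n)} {x : Model n × CoModel n}
    (hF : ContDiffWithinAt ℝ ∞ F (halfProd n) x) (hx : x ∈ halfProd n)
    (hFA : HasFDerivWithinAt F (A : Model n × CoModel n →L[ℝ] Model (2 * n)) (halfProd n) x) :
    ∀ᶠ z in 𝓝[halfProd n] x, ‖fderivWithin ℝ F (halfProd n) z - A‖ *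
        ‖(A.symm : Model (2 * n) →L[ℝ] Model n × CoModel n)‖ ≤ 1 / 16 := by
  set B := ‖(A.symm : Model (2 * n) →L[ℝ] Model n × CoModel n)‖ with hBdef
  have hB : 0 ≤ B := norm_nonneg (A.symm : Model (2 * n) →L[ℝ] Model n × CoModel n)
  have h1 : ContinuousWithinAt (fderivWithin ℝ F (halfProd n)) (halfProd n) x :=
    (hF.fderivWithin_right (m := 0) uniqueDiffOn_halfProd (by simp) hx).continuousWithinAt
  have h2 := hFA.fderivWithin (uniqueDiffOn_halfProd _ hx)
  have h3 := h1.tendsto.eventually (Metric.ball_mem_nhds (fderivWithin ℝ F (halfProd n) x)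
    (show (0 : ℝ) < 1 / (16 * (B + 1)) by positivity))
  rw [h2] at h3
  filter_upwards [h3] with z hz
  have h4 : ‖fderivWithin ℝ F (halfProd n) z - A‖ < 1 / (16 * (B + 1)) := by
    exact (dist_eq_norm (fderivWithin ℝ F (halfProd n) z)
      (A : Model n × CoModel n →L[ℝ] Model (2 * n))).symm.trans_lt hz
  calc ‖fderivWithin ℝ F (halfProd n) z - A‖ * B ≤ 1 / (16 * (B + 1)) * (B + 1) :=
        mul_le_mul h4.le (by linarith) hB (by positivity)
    _ = 1 / 16 := by field_simp

set_option maxHeartbeats 800000 in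
theorem DeformationData.exists_localModel [T2Space X] (S : DeformationData K C Λ D f a) (p₀ : L) :
    ∃ F A, ∃ R₀ > 0, ∀ R, 0 < R → R ≤ R₀ → LocalModel K C Λ D f a p₀ F A R := by
  obtain ⟨A, hA⟩ := exists_modelEquiv S.imm a p₀
  obtain ⟨Ex, hE1, hE2, hE3, hE4⟩ := exists_chart_exp S.smooth (f p₀)
  set c := extChartAt (𝓡∂ n) p₀ with hc
  set χ := extChartAt (𝓡 (2 * n)) (f p₀) with hχ
  set fc := chartRep (𝓡∂ n) (𝓡 (2 * n)) p₀ (f p₀) f with hfc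
  have hp₀ : p₀ ∈ c.source := mem_extChartAt_source p₀
  have hfp₀ : f p₀ ∈ χ.source := mem_extChartAt_source (f p₀)
  have hx₀r : c p₀ ∈ range (𝓡∂ n) := mem_range_halfSpace.2 (extChartAt_zero_nonneg p₀ p₀)
  have hx₀S : (c p₀, (0 : CoModel n)) ∈ halfProd n := ⟨hx₀r, mem_univ _⟩
  have hdom₀ : c p₀ ∈ chartDom (𝓡∂ n) (𝓡 (2 * n)) p₀ (f p₀) f :=
    ⟨c.map_source hp₀, by rw [mem_preimage, mem_preimage, c.left_inv hp₀]; exact hfp₀⟩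
  have hfc₀ : fc (c p₀) = χ (f p₀) := chartRep_apply hp₀
  let G : Model n × CoModel n → Model (2 * n) × Model (2 * n) :=
    fun z ↦ (fc z.1, K.invChart f a p₀ z.1 z.2)
  have hfcW : ∀ x ∈ chartDom (𝓡∂ n) (𝓡 (2 * n)) p₀ (f p₀) f,
      ContDiffWithinAt ℝ ∞ fc (range (𝓡∂ n)) x := fun x hx ↦
    (contDiffOn_chartRep S.imm.1.1 x hx).mono_of_mem_nhdsWithin
      (chartDom_mem_nhdsWithin S.imm.1.1.continuous hx)
  have hBW : ∀ x ∈ chartDom (𝓡∂ n) (𝓡 (2 * n)) p₀ (f p₀) f,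
      ContDiffWithinAt ℝ ∞ (K.invChart f a p₀) (range (𝓡∂ n)) x := fun x hx ↦
    (CalabiYau.contDiffOn_invChart S.imm S.smooth_angle p₀ x hx).mono_of_mem_nhdsWithin
      (chartDom_mem_nhdsWithin S.imm.1.1.continuous hx)
  have hmf : MapsTo (Prod.fst : Model n × CoModel n → Model n) (halfProd n) (range (𝓡∂ n)) :=
    fun z hz ↦ hz.1
  have hG : ∀ z : Model n × CoModel n, z.1 ∈ chartDom (𝓡∂ n) (𝓡 (2 * n)) p₀ (f p₀) f →
      ContDiffWithinAt ℝ ∞ G (halfProd n) z := fun z hz ↦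
    ((hfcW z.1 hz).comp z contDiffWithinAt_fst hmf).prodMk
      (((hBW z.1 hz).comp z contDiffWithinAt_fst hmf).clm_apply contDiffWithinAt_snd)
  have hG0 : G (c p₀, 0) = (χ (f p₀), 0) := by
    simp only [G, hfc₀, map_zero]
  have hGt : Tendsto G (𝓝[halfProd n] (c p₀, 0)) (𝓝 (χ (f p₀), 0)) := by
    rw [← hG0]
    exact (hG _ hdom₀).continuousWithinAt
  let F : Model n × CoModel n → Model (2 * n) := fun z ↦ Ex (G z)
  have hdomev : ∀ᶠ z in 𝓝[halfProd n] (c p₀, (0 : CoModel n)),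
      z.1 ∈ chartDom (𝓡∂ n) (𝓡 (2 * n)) p₀ (f p₀) f := by
    have h1 : Tendsto (Prod.fst : Model n × CoModel n → Model n)
        (𝓝[halfProd n] (c p₀, (0 : CoModel n))) (𝓝[range (𝓡∂ n)] (c p₀)) :=
      continuousWithinAt_fst.tendsto_nhdsWithin hmf
    exact h1.eventually (chartDom_mem_nhdsWithin S.imm.1.1.continuous hdom₀)
  have hsm : ∀ᶠ z in 𝓝[halfProd n] (c p₀, (0 : CoModel n)), ContDiffWithinAt ℝ ∞ F (halfProd n) z := by
    filter_upwards [hdomev, hGt.eventually hE1] with z hz1 hz2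
    exact hz2.comp_contDiffWithinAt z (hG z hz1)
  have hfcd : HasFDerivWithinAt fc (immDeriv f p₀ (c p₀)) (range (𝓡∂ n)) (c p₀) :=
    ((hfcW _ hdom₀).differentiableWithinAt (by simp)).hasFDerivWithinAt
  have hBd := ((hBW _ hdom₀).differentiableWithinAt (by simp)).hasFDerivWithinAt
  have hGd : HasFDerivWithinAt G (((immDeriv f p₀ (c p₀)).comp (ContinuousLinearMap.fst ℝ _ _)).prod
      ((K.invChart f a p₀ (c p₀)).comp (ContinuousLinearMap.snd ℝ (Model n) (CoModel n))))
      (halfProd n) (c p₀, 0) := by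
    have h1 : HasFDerivWithinAt (fun z : Model n × CoModel n ↦ fc z.1)
        ((immDeriv f p₀ (c p₀)).comp (ContinuousLinearMap.fst ℝ _ _)) (halfProd n) (c p₀, 0) :=
      HasFDerivWithinAt.comp (g := fc) (f := Prod.fst) (c p₀, (0 : CoModel n)) hfcd
        hasFDerivWithinAt_fst hmf
    have h2 : HasFDerivWithinAt (fun z : Model n × CoModel n ↦ K.invChart f a p₀ z.1)
        ((fderivWithin ℝ (K.invChart f a p₀) (range (𝓡∂ n)) (c p₀)).comp
          (ContinuousLinearMap.fst ℝ _ _)) (halfProd n) (c p₀, 0) :=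
      HasFDerivWithinAt.comp (g := K.invChart f a p₀) (f := Prod.fst) (c p₀, (0 : CoModel n)) hBd
        hasFDerivWithinAt_fst hmf
    have h3 := h2.clm_apply (hasFDerivWithinAt_snd (p := (c p₀, (0 : CoModel n))))
    refine (h1.prodMk h3).congr_fderiv ?_
    ext z <;> simp
  have hFd : HasFDerivWithinAt F (A : Model n × CoModel n →L[ℝ] Model (2 * n)) (halfProd n)
      (c p₀, 0) := by
    rw [← hG0] at hE2
    refine (hE2.comp_hasFDerivWithinAt (c p₀, (0 : CoModel n)) hGd).congr_fderiv ?_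
    exact ContinuousLinearMap.ext fun z ↦ (hA z).symm
  have hF₀ := hsm.self_of_nhdsWithin hx₀S
  have hnear : ∀ᶠ z in 𝓝[halfProd n] (c p₀, (0 : CoModel n)),
      ‖fderivWithin ℝ F (halfProd n) z - A‖ *
        ‖(A.symm : Model (2 * n) →L[ℝ] Model n × CoModel n)‖ ≤ 1 / 16 := eventually_deriv_near hF₀ hx₀S hFd
  have hzero : ∀ᶠ z in 𝓝[halfProd n] (c p₀, (0 : CoModel n)), F (z.1, 0) = fc z.1 := by
    have h1 : Tendsto (fun z : Model n × CoModel n ↦ fc z.1)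
        (𝓝[halfProd n] (c p₀, (0 : CoModel n))) (𝓝 (χ (f p₀))) :=
      (continuous_fst.tendsto _).comp hGt
    filter_upwards [h1.eventually hE3] with z hz
    simp only [F, G, map_zero, hz]
  have hgeo : ∀ N ∈ 𝓝 (f p₀), ∀ᶠ z in 𝓝[halfProd n] (c p₀, (0 : CoModel n)),
      F z ∈ χ.target ∧ ∀ p ∈ c.source, c p = z.1 → ∃ γ : ℝ → X, IsGeodesicOn D γ (Ioo (-1) 2) ∧
          velocity (𝓡 (2 * n)) γ 0 = ⟨f p, tangentCoordChange (𝓡 (2 * n)) (f p₀) (f p) (f p)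
            (K.invChart f a p₀ (c p) z.2)⟩ ∧
          γ 1 = χ.symm (F z) ∧ ∀ t ∈ Ioo (-1 : ℝ) 2, γ t ∈ N := by
    intro N hN
    filter_upwards [hGt.eventually (hE4 N hN), hdomev] with z hz hzd
    obtain ⟨-, h2, γ, h3, h4, h5, h6⟩ := hz
    refine ⟨h2, fun p hp hpz ↦ ⟨γ, h3, ?_, h5, h6⟩⟩
    have hsrc : f p ∈ χ.source := by
      have := hzd.2
      rw [← hpz, mem_preimage, mem_preimage, c.left_inv hp] at this
      exact this
    have hfp : χ.symm (G z).1 = f p := by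
      change χ.symm (fc z.1) = f p
      rw [← hpz, hfc, chartRep_apply hp, χ.left_inv hsrc]
    rw [hfp] at h4
    rw [h4, hpz]
  obtain ⟨R₁, hR₁, hev⟩ := exists_modelDom_of_eventually
    (hdomev.and (hsm.and (hnear.and (hzero.and (hgeo univ univ_mem)))))
  obtain ⟨R₂, hR₂, hcomp⟩ := S.ordering.exists_component_radius p₀
  have hbd : ∃ R₃ > 0, ∀ R ≤ R₃, ∀ i, p₀ ∈ C i → (∃ O σ W, IsSlice (m := 2 * n) (Λ i) (f p₀) O σ W ∧
      Module.finrank ℝ W = n) ∧ ∀ p ∈ C i, p ∈ c.source → c p ∈ halfBall (c p₀) R →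
      ∀ ζ ∈ Metric.ball (0 : CoModel n) R, IsConormal ζ → χ.symm (F (c p, ζ)) ∈ Λ i := by
    by_cases hpb : p₀ ∈ (𝓡∂ n).boundary L
    · obtain ⟨i₀, hi₀⟩ := S.ordering.exists_mem hpb
      obtain ⟨O, σ, W, hs, hW⟩ := (S.lagrangian i₀).1.exists_isSlice (S.boundary.1 i₀ p₀ hi₀)
      have hN : χ.source ∩ χ ⁻¹' O ∈ 𝓝 (f p₀) :=
        inter_mem (extChartAt_source_mem_nhds (I := 𝓡 (2 * n)) (f p₀))
          ((continuousAt_extChartAt (I := 𝓡 (2 * n)) (f p₀)).preimage_mem_nhds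
            (hs.isOpen.mem_nhds hs.mem))
      have hO : ∀ᶠ z in 𝓝[halfProd n] (c p₀, (0 : CoModel n)), fc z.1 ∈ O := by
        have h1 : Tendsto (fun z : Model n × CoModel n ↦ fc z.1)
          (𝓝[halfProd n] (c p₀, (0 : CoModel n))) (𝓝 (χ (f p₀))) :=
          (continuous_fst.tendsto _).comp hGt
        exact h1.eventually (hs.isOpen.mem_nhds hs.mem)
      obtain ⟨R₃, hR₃, h3⟩ := exists_modelDom_of_eventually (hdomev.and (hO.and (hgeo _ hN)))
      refine ⟨R₃, hR₃, fun R hR i hi ↦ ?_⟩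
      have hii : i = i₀ := S.ordering.1
        ((S.ordering.eq_component hi).trans (S.ordering.eq_component hi₀).symm)
      subst hii
      refine ⟨⟨O, σ, W, hs, hW⟩, fun p hpC hp hpR ζ hζ hζc ↦ ?_⟩
      obtain ⟨hd, hOp, -, hγ⟩ := h3 R hR (c p, ζ) ⟨hpR, hζ⟩
      obtain ⟨γ, h3, h4, h5, h6⟩ := hγ p hp rfl
      have hsrc : f p ∈ χ.source := by
        have := hd.2
        rw [mem_preimage, mem_preimage, c.left_inv hp] at this
        exact this
      rw [hfc, chartRep_apply hp] at hOp
      have hfΛ := S.boundary.1 i p hpC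
      have hγ0 : γ 0 = f p := congrArg (fun w : TangentBundle (𝓡 (2 * n)) X ↦ w.1) h4
      rw [← h5]
      refine hs.geodesic_mem (S.geodesic i) h3 (b := 1) ?_ h6 (by rw [hγ0]; exact hfΛ) ?_ 1
        ⟨zero_le_one, le_rfl⟩
      · intro t ht
        exact ⟨by linarith [ht.1], by linarith [ht.2]⟩
      · rw [hγ0]
        refine ⟨_, ?_, h4⟩
        refine (hs.tangentOf_iff hsrc hOp hfΛ _).2 ?_
        rw [tangentCoordChange_symm_apply hsrc (mem_extChartAt_source _)]
        exact S.invChart_mem_tangentOf hs hpC hp hsrc hOp hζc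
    · exact ⟨1, one_pos, fun R _ i hi ↦ absurd (S.ordering.mem_boundary hi) hpb⟩
  obtain ⟨R₃, hR₃, hbd⟩ := hbd
  refine ⟨F, A, min R₁ (min R₂ R₃), lt_min hR₁ (lt_min hR₂ hR₃), fun R hR hRle ↦ ?_⟩
  have le1 : R ≤ R₁ := hRle.trans (min_le_left _ _)
  have le2 : R ≤ R₂ := hRle.trans ((min_le_right _ _).trans (min_le_left _ _))
  have le3 : R ≤ R₃ := hRle.trans ((min_le_right _ _).trans (min_le_right _ _))
  have h0R : (0 : CoModel n) ∈ Metric.ball (0 : CoModel n) R := Metric.mem_ball_self hR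
  have hboundary : ∀ i, ∀ p ∈ C i, p ∈ c.source → c p ∈ halfBall (c p₀) R →
      ∀ ζ ∈ Metric.ball (0 : CoModel n) R, IsConormal ζ → χ.symm (F (c p, ζ)) ∈ Λ i :=
    fun i p hpC hp hpR ↦ (hbd R le3 i (hcomp R le2 i p hpC hp hpR)).2 p hpC hp hpR
  refine
    { pos := hR
      subset := fun x hx ↦ (hev R le1 (x, 0) ⟨hx, h0R⟩).1
      smooth := fun z hz ↦ (hev R le1 z hz).2.1
      target := fun z hz ↦ (hev R le1 z hz).2.2.2.2.1
      zero := fun x hx ↦ (hev R le1 (x, 0) ⟨hx, h0R⟩).2.2.2.1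
      isExp := ?_
      apply := hA
      hasDeriv := hFd
      deriv_near := fun z hz ↦ (hev R le1 z hz).2.2.1
      component := hcomp R le2
      boundary := hboundary
      boundary_lift := ?_ }
  · intro p hp hpR ζ hζ
    obtain ⟨γ, h3, h4, h5, -⟩ := (hev R le1 (c p, ζ) ⟨hpR, hζ⟩).2.2.2.2.2 p hp rfl
    refine ⟨γ, Ioo (-1) 2, ?_, h3, h4, h5⟩
    intro t ht
    exact ⟨by linarith [ht.1], by linarith [ht.2]⟩
  · by_cases hpb : p₀ ∈ (𝓡∂ n).boundary L
    · obtain ⟨i₀, hi₀⟩ := S.ordering.exists_mem hpb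
      obtain ⟨⟨O, σ, W, hs, hW⟩, -⟩ := hbd R le3 i₀ hi₀
      have hF0 : F (c p₀, 0) = χ (f p₀) := by
        rw [← hfc₀]
        exact hzero.self_of_nhdsWithin hx₀S
      have hΛF : ∀ z ∈ modelDom (c p₀) R, z.1 0 = 0 → IsConormal z.2 → χ.symm (F z) ∈ Λ i₀ := by
        intro z hz hz0 hzc
        have hzt : z.1 ∈ c.target := ((hev R le1 z hz).1).1
        have hsrc := c.map_target hzt
        have hcz : c (c.symm z.1) = z.1 := c.right_inv hzt
        have hzb : c.symm z.1 ∈ (𝓡∂ n).boundary L := by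
          rw [mem_boundary_iff hsrc, ← hc, hcz]
          exact hz0
        obtain ⟨j, hj⟩ := S.ordering.exists_mem hzb
        have hz1 : c (c.symm z.1) ∈ halfBall (c p₀) R := by
          rw [hcz]
          exact hz.1
        have hji : j = i₀ := S.ordering.1 ((S.ordering.eq_component (hcomp R le2 j _ hj hsrc hz1)).trans
          (S.ordering.eq_component hi₀).symm)
        subst hji
        have := hboundary j _ hj hsrc hz1 z.2 hz.2 hzc
        rwa [hcz] at this
      obtain ⟨r, hr, h⟩ := exists_boundary_lift hs hW hR ((mem_boundary_iff hp₀).1 hpb) hF₀ hF0 hFd hΛF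
      refine ⟨r, hr, fun i hi ↦ ?_⟩
      have hii : i = i₀ := S.ordering.1
        ((S.ordering.eq_component hi).trans (S.ordering.eq_component hi₀).symm)
      subst hii
      exact h
    · exact ⟨1, one_pos, fun i hi ↦ absurd (S.ordering.mem_boundary hi) hpb⟩

end LocalModel

end LagBdry

namespace LagBdry

section Trivializations

variable {E : Type*} [NormedAddCommGroup E] [NormedSpace ℝ E]
  {H : Type*} [TopologicalSpace H] {I : ModelWithCorners ℝ E H}
  {M : Type*} [TopologicalSpace M] [ChartedSpace H M] [IsManifold I ∞ M]

lemma tangent_trivialization_symm {p₀ p : M} (hp : p ∈ (extChartAt I p₀).source) (v : E) :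
    (trivializationAt E (TangentSpace I : M → Type _) p₀).symm p v = tangentCoordChange I p₀ p p v := by
  rw [extChartAt_source] at hp
  have h := DFunLike.congr_fun (TangentBundle.symmL_trivializationAt_eq_core (I := I) hp) v
  exact ((trivializationAt E (TangentSpace I : M → Type _) p₀).symmL_apply (R := ℝ) hp v).symm.trans h

lemma tangent_trivialization_apply {p₀ p : M} (hp : p ∈ (extChartAt I p₀).source) (v : E) :
    ((trivializationAt E (TangentSpace I : M → Type _) p₀) ⟨p, v⟩).2 =
      tangentCoordChange I p p₀ p v := by
  rw [extChartAt_source] at hp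
  have h := DFunLike.congr_fun
    (TangentBundle.continuousLinearMapAt_trivializationAt_eq_core (I := I) hp) v
  exact ((trivializationAt E (TangentSpace I : M → Type _) p₀).continuousLinearMapAt_apply_of_mem
    (R := ℝ) hp v).symm.trans h

end Trivializations

section COne

variable {E : Type*} [NormedAddCommGroup E] [NormedSpace ℝ E] [FiniteDimensional ℝ E]
  {H : Type*} [TopologicalSpace H] {I : ModelWithCorners ℝ E H}
  {M : Type*} [TopologicalSpace M] [ChartedSpace H M] [IsManifold I ∞ M]
  {E' : Type*} [NormedAddCommGroup E'] [NormedSpace ℝ E']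
  {H' : Type*} [TopologicalSpace H'] {I' : ModelWithCorners ℝ E' H'}
  {N : Type*} [TopologicalSpace N] [ChartedSpace H' N] [IsManifold I' ∞ N]

/-- `g` is `ε`-close on `S`, in the charts at `p₀` and `y₀`, to the map `h` with derivative `h'`. -/
def C1Near (I : ModelWithCorners ℝ E H) (I' : ModelWithCorners ℝ E' H') (p₀ : M) (y₀ : N)
    (S : Set E) (h : E → E') (h' : E → E →L[ℝ] E') (ε : ℝ) (g : M → N) : Prop :=
  ∀ x ∈ S, g ((extChartAt I p₀).symm x) ∈ (extChartAt I' y₀).source ∧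
    ‖chartRep I I' p₀ y₀ g x - h x‖ < ε ∧ ∀ v : E, ‖v‖ ≤ 1 →
      ‖(fderivWithin ℝ (chartRep I I' p₀ y₀ g) (range I) x - h' x) v‖ < ε

theorem isOpen_c1Near {p₀ : M} {y₀ : N} {S : Set E} (hS : IsCompact S)
    (hSt : S ⊆ (extChartAt I p₀).target) {h : E → E'} (hh : ContinuousOn h S)
    {h' : E → E →L[ℝ] E'} (hh' : ContinuousOn h' S) (ε : ℝ) :
    IsOpen[c1Topology I M I' N] {g | C1Near I I' p₀ y₀ S h h' ε g} := by
  set e := trivializationAt E (TangentSpace I : M → Type _) p₀ with he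
  set e' := trivializationAt E' (TangentSpace I' : N → Type _) y₀ with he'
  have hbase : e.baseSet = (extChartAt I p₀).source := by
    rw [extChartAt_source]
    rfl
  have hbase' : e'.baseSet = (extChartAt I' y₀).source := by
    rw [extChartAt_source]
    rfl
  let Q : Set (E × E) := S ×ˢ Metric.closedBall 0 1
  have hQ : IsCompact Q := hS.prod (isCompact_closedBall 0 1)
  have : CompactSpace Q := isCompact_iff_compactSpace.1 hQ
  let Ξ₀ : Q → TangentBundle I M := fun z ↦
    ⟨(extChartAt I p₀).symm z.1.1, e.symm ((extChartAt I p₀).symm z.1.1) z.1.2⟩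
  have hsrc : ∀ z : Q, (extChartAt I p₀).symm z.1.1 ∈ (extChartAt I p₀).source := fun z ↦
    (extChartAt I p₀).map_target (hSt z.2.1)
  have hΞ : Continuous Ξ₀ := by
    have h1 : Continuous fun z : Q ↦ ((extChartAt I p₀).symm z.1.1, z.1.2) := by
      refine Continuous.prodMk ?_ (continuous_snd.comp continuous_subtype_val)
      exact ((continuousOn_extChartAt_symm p₀).mono hSt).comp_continuous
        (continuous_fst.comp continuous_subtype_val) fun z ↦ z.2.1
    exact e.continuousOn_symm.comp_continuous h1 fun z ↦ ⟨by rw [hbase]; exact hsrc z, mem_univ _⟩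
  let Ξ : C(Q, TangentBundle I M) := ⟨Ξ₀, hΞ⟩
  let W : Set (Q × TangentBundle I' N) := {z | z.2.1 ∈ (extChartAt I' y₀).source ∧
    ‖extChartAt I' y₀ z.2.1 - h z.1.1.1‖ < ε ∧ ‖(e' z.2).2 - h' z.1.1.1 z.1.1.2‖ < ε}
  have hW : IsOpen W := by
    let O : Set (Q × TangentBundle I' N) := {z | z.2.1 ∈ (extChartAt I' y₀).source}
    have hproj : Continuous (fun z : Q × TangentBundle I' N ↦ z.2.1) :=
      (FiberBundle.continuous_proj E' (TangentSpace I')).comp continuous_snd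
    have hO : IsOpen O := (isOpen_extChartAt_source (I := I') y₀).preimage hproj
    have hq1 : Continuous fun z : Q × TangentBundle I' N ↦ z.1.1.1 :=
      continuous_fst.comp (continuous_subtype_val.comp continuous_fst)
    have hq2 : Continuous fun z : Q × TangentBundle I' N ↦ z.1.1.2 :=
      continuous_snd.comp (continuous_subtype_val.comp continuous_fst)
    have c1 : ContinuousOn (fun z : Q × TangentBundle I' N ↦
        ‖extChartAt I' y₀ z.2.1 - h z.1.1.1‖) O :=
      (((continuousOn_extChartAt (I := I') y₀).comp hproj.continuousOn fun z hz ↦ hz).sub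
        (hh.comp_continuous hq1 fun z ↦ z.1.2.1).continuousOn).norm
    have c2 : ContinuousOn (fun z : Q × TangentBundle I' N ↦
        ‖(e' z.2).2 - h' z.1.1.1 z.1.1.2‖) O := by
      refine ContinuousOn.norm (ContinuousOn.sub ?_ ?_)
      · refine continuous_snd.comp_continuousOn (e'.continuousOn.comp continuous_snd.continuousOn ?_)
        intro z hz
        rw [e'.mem_source, hbase']
        exact hz
      · exact ((hh'.comp_continuous hq1 fun z ↦ z.1.2.1).clm_apply hq2).continuousOn
    have hset : W = O ∩ ((fun z ↦ (‖extChartAt I' y₀ z.2.1 - h z.1.1.1‖,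
        ‖(e' z.2).2 - h' z.1.1.1 z.1.1.2‖)) ⁻¹' (Iio ε ×ˢ Iio ε)) := by
      ext z
      rfl
    rw [hset]
    exact (c1.prodMk c2).isOpen_inter_preimage hO (isOpen_Iio.prod isOpen_Iio)
  have hopen : IsOpen {k : C(TangentBundle I M, TangentBundle I' N) |
      ∀ z : Q, (z, k (Ξ z)) ∈ W} := by
    have h1 : Continuous fun k : C(TangentBundle I M, TangentBundle I' N) ↦
        (ContinuousMap.id Q).prodMk (k.comp Ξ) := by
      have h0 : Continuous fun k : C(Q, TangentBundle I' N) ↦ (ContinuousMap.id Q).prodMk k :=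
        ContinuousMap.continuous_of_continuous_uncurry _
          (continuous_snd.prodMk (continuous_eval (F := C(Q, TangentBundle I' N))))
      exact h0.comp (ContinuousMap.continuous_precomp Ξ)
    have h2 := (ContinuousMap.isOpen_setOfPred_mapsTo (isCompact_univ (X := Q)) hW).preimage h1
    convert h2 using 1
    ext k
    exact ⟨fun h z _ ↦ h z, fun h z ↦ h (mem_univ z)⟩
  refine isOpen_induced_iff.2 ⟨_, hopen, ?_⟩
  ext g
  have hg : ∀ p, MDifferentiableAt I I' g p := g.contMDiff.mdifferentiable (by simp)
  have key : ∀ z : Q, g ((extChartAt I p₀).symm z.1.1) ∈ (extChartAt I' y₀).source →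
      (e' (tangentMap I I' g (Ξ z))).2 =
        fderivWithin ℝ (chartRep I I' p₀ y₀ g) (range I) z.1.1 z.1.2 := by
    intro z hz
    have h1 := tangent_trivialization_apply (I := I') (p₀ := y₀) hz
      (mfderivModel I I' g ((extChartAt I p₀).symm z.1.1)
        (tangentCoordChange I p₀ ((extChartAt I p₀).symm z.1.1) ((extChartAt I p₀).symm z.1.1) z.1.2))
    have h2 : tangentMap I I' g (Ξ z) = ⟨g ((extChartAt I p₀).symm z.1.1),
        mfderivModel I I' g ((extChartAt I p₀).symm z.1.1)
        (tangentCoordChange I p₀ ((extChartAt I p₀).symm z.1.1)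
          ((extChartAt I p₀).symm z.1.1) z.1.2)⟩ := by
      rw [← tangent_trivialization_symm (hsrc z)]
      rfl
    rw [h2]
    refine h1.trans ?_
    rw [← fderivWithin_chartRep_apply (hg _) (hsrc z) hz,
      tangentCoordChange_symm_apply (hsrc z) (mem_extChartAt_source _),
      (extChartAt I p₀).right_inv (hSt z.2.1)]
  constructor
  · intro hz x hx
    have h0 := hz ⟨(x, 0), hx, Metric.mem_closedBall_self zero_le_one⟩
    refine ⟨h0.1, h0.2.1, fun v hv ↦ ?_⟩
    have h1 := hz ⟨(x, v), hx, mem_closedBall_zero_iff.2 hv⟩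
    have h2 := h1.2.2
    rw [sub_apply, ← key ⟨(x, v), hx, mem_closedBall_zero_iff.2 hv⟩ h0.1]
    exact h2
  · intro hz z
    obtain ⟨h1, h2, h3⟩ := hz z.1.1 z.2.1
    refine ⟨h1, h2, ?_⟩
    have h4 := h3 z.1.2 (mem_closedBall_zero_iff.1 z.2.2)
    rw [sub_apply, ← key z h1] at h4
    exact h4

end COne

section Forms

variable {n : ℕ} [NeZero n] {L : Type*} [TopologicalSpace L]
  [ChartedSpace (EuclideanHalfSpace n) L] [IsManifold (𝓡∂ n) ∞ L]

/-- A one-form is `C¹`-small on `S` in the chart at `p₀`. -/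
def FormNear (p₀ : L) (S : Set (Model n)) (ε : ℝ) (θ : OneForm n L) : Prop :=
  ∀ x ∈ S, ‖formRep p₀ θ x‖ < ε ∧ ∀ v : Model n, ‖v‖ ≤ 1 →
    ‖fderivWithin ℝ (formRep p₀ θ) (range (𝓡∂ n)) x v‖ < ε

lemma formRep_contDiffWithinAt (p₀ : L) (θ : OneForm n L) {x : Model n}
    (hx : x ∈ (extChartAt (𝓡∂ n) p₀).target) :
    ContDiffWithinAt ℝ ∞ (formRep p₀ θ) (range (𝓡∂ n)) x := by
  have h1 := extChartAt_target_mem_nhdsWithin' ((extChartAt (𝓡∂ n) p₀).map_target hx)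
  rw [(extChartAt (𝓡∂ n) p₀).right_inv hx] at h1
  exact (contDiffOn_formRep p₀ θ x hx).mono_of_mem_nhdsWithin h1

theorem isOpen_formNear {p₀ : L} {S : Set (Model n)} (hS : IsCompact S)
    (hSt : S ⊆ (extChartAt (𝓡∂ n) p₀).target) (ε : ℝ) :
    IsOpen {θ : DirichletOneForm n L | FormNear p₀ S ε θ} := by
  let y₀ : TotalSpace (CoModel n) (fun p : L ↦ TangentSpace (𝓡∂ n) p →L[ℝ] ℝ) := ⟨p₀, 0⟩
  have h1 := isOpen_c1Near (I := 𝓡∂ n) (I' := (𝓡∂ n).prod 𝓘(ℝ, CoModel n)) (y₀ := y₀)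
    hS hSt (h := fun x ↦ (x, (0 : CoModel n))) (by fun_prop)
    (h' := fun _ ↦ ContinuousLinearMap.inl ℝ (Model n) (CoModel n)) continuousOn_const ε
  refine (@isOpen_induced_iff _ _ (c1Topology _ _ _ _) _ _).2 ⟨_, h1, ?_⟩
  ext θ
  set g : L → TotalSpace (CoModel n) (fun p : L ↦ TangentSpace (𝓡∂ n) p →L[ℝ] ℝ) :=
    fun p ↦ TotalSpace.mk' (CoModel n) p (θ.1 p) with hg
  have hsrc : ∀ x ∈ (extChartAt (𝓡∂ n) p₀).target, g ((extChartAt (𝓡∂ n) p₀).symm x) ∈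
      (extChartAt ((𝓡∂ n).prod 𝓘(ℝ, CoModel n)) y₀).source := by
    intro x hx
    have h2 := (extChartAt (𝓡∂ n) p₀).map_target hx
    rw [extChartAt_source] at h2
    rw [FiberBundle.extChartAt]
    simp only [mfld_simps]
    exact ⟨⟨h2, mem_univ _⟩, h2⟩
  have hrep : ∀ x ∈ (extChartAt (𝓡∂ n) p₀).target,
      chartRep (𝓡∂ n) ((𝓡∂ n).prod 𝓘(ℝ, CoModel n)) p₀ y₀ g x = (x, formRep p₀ θ.1 x) := by
    intro x hx
    have h2 := (extChartAt (𝓡∂ n) p₀).map_target hx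
    simp only [chartRep, Function.comp_apply]
    rw [FiberBundle.extChartAt]
    refine Prod.ext ?_ ?_
    · have h3 := (extChartAt (𝓡∂ n) p₀).right_inv hx
      refine Eq.trans ?_ h3
      change extChartAt (𝓡∂ n) p₀ ((trivializationAt (CoModel n)
        (fun p : L ↦ TangentSpace (𝓡∂ n) p →L[ℝ] ℝ) p₀ (g ((extChartAt (𝓡∂ n) p₀).symm x))).1) = _
      congr 1
    · exact covector_trivializationAt h2 (formModel θ.1 _)
  have hder : ∀ x ∈ (extChartAt (𝓡∂ n) p₀).target,
      fderivWithin ℝ (chartRep (𝓡∂ n) ((𝓡∂ n).prod 𝓘(ℝ, CoModel n)) p₀ y₀ g) (range (𝓡∂ n)) x =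
        (ContinuousLinearMap.id ℝ (Model n)).prod
          (fderivWithin ℝ (formRep p₀ θ.1) (range (𝓡∂ n)) x) := by
    intro x hx
    have hxr : x ∈ range (𝓡∂ n) := extChartAt_target_subset_range p₀ hx
    have h1 := extChartAt_target_mem_nhdsWithin' ((extChartAt (𝓡∂ n) p₀).map_target hx)
    rw [(extChartAt (𝓡∂ n) p₀).right_inv hx] at h1
    have h3 : HasFDerivWithinAt (fun x : Model n ↦ (x, formRep p₀ θ.1 x))
        ((ContinuousLinearMap.id ℝ (Model n)).prod
          (fderivWithin ℝ (formRep p₀ θ.1) (range (𝓡∂ n)) x)) (range (𝓡∂ n)) x :=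
      (hasFDerivWithinAt_id x _).prodMk
        (((formRep_contDiffWithinAt p₀ θ.1 hx).differentiableWithinAt (by simp)).hasFDerivWithinAt)
    refine (h3.congr_of_eventuallyEq ?_ (hrep x hx)).fderivWithin ((𝓡∂ n).uniqueDiffOn x hxr)
    filter_upwards [h1] with z hz using hrep z hz
  constructor
  · intro h x hx
    obtain ⟨h2, h3, h4⟩ := h x hx
    rw [show (fun p ↦ TotalSpace.mk' (CoModel n) p (θ.1 p)) = g from rfl] at *
    have h3' : ‖chartRep (𝓡∂ n) ((𝓡∂ n).prod 𝓘(ℝ, CoModel n)) p₀ y₀ g x - (x, 0)‖ < ε := h3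
    rw [hrep x (hSt hx), Prod.mk_sub_mk, sub_self, sub_zero] at h3'
    refine ⟨(norm_snd_le _).trans_lt h3', fun v hv ↦ ?_⟩
    have h4' : ‖(fderivWithin ℝ (chartRep (𝓡∂ n) ((𝓡∂ n).prod 𝓘(ℝ, CoModel n)) p₀ y₀ g)
      (range (𝓡∂ n)) x - ContinuousLinearMap.inl ℝ (Model n) (CoModel n)) v‖ < ε := h4 v hv
    rw [hder x (hSt hx)] at h4'
    have := (norm_snd_le _).trans_lt h4'
    simpa using this
  · intro h x hx
    obtain ⟨h3, h4⟩ := h x hx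
    refine ⟨hsrc x (hSt hx), ?_, fun v hv ↦ ?_⟩
    · change ‖chartRep (𝓡∂ n) ((𝓡∂ n).prod 𝓘(ℝ, CoModel n)) p₀ y₀ g x - (x, 0)‖ < ε
      rw [hrep x (hSt hx), Prod.mk_sub_mk, sub_self, sub_zero, Prod.norm_mk, norm_zero,
        max_eq_right (norm_nonneg _)]
      exact h3
    · change ‖(fderivWithin ℝ (chartRep (𝓡∂ n) ((𝓡∂ n).prod 𝓘(ℝ, CoModel n)) p₀ y₀ g)
        (range (𝓡∂ n)) x - ContinuousLinearMap.inl ℝ (Model n) (CoModel n)) v‖ < ε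
      rw [hder x (hSt hx)]
      have h5 : ((ContinuousLinearMap.id ℝ (Model n)).prod
          (fderivWithin ℝ (formRep p₀ θ.1) (range (𝓡∂ n)) x) -
          ContinuousLinearMap.inl ℝ (Model n) (CoModel n)) v =
          (0, fderivWithin ℝ (formRep p₀ θ.1) (range (𝓡∂ n)) x v) := by
        ext <;> simp
      rw [h5, Prod.norm_mk, norm_zero, max_eq_right (norm_nonneg _)]
      exact h4 v hv

end Forms

end LagBdry

namespace LagBdry

section CompactUniformity

variable {ι L T X : Type*} [TopologicalSpace L] {l : Filter ι}

lemma eventually_forall_mem_of_compact {K : Set L} (hK : IsCompact K) {P : ι → L → Prop}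
    (h : ∀ q ∈ K, ∀ᶠ z in l ×ˢ 𝓝 q, P z.1 z.2) : ∀ᶠ i in l, ∀ q ∈ K, P i q := by
  have h1 : {z : ι × L | P z.1 z.2} ∈ l ×ˢ 𝓝ˢ K := hK.mem_prod_nhdsSet_of_forall h
  obtain ⟨t, ht, U, hU, hsub⟩ := mem_prod_iff.1 h1
  filter_upwards [ht] with i hi q hq
  exact hsub (mk_mem_prod hi (subset_of_mem_nhdsSet hU hq))

lemma eventually_forall_of_compact [CompactSpace L] {P : ι → L → Prop}
    (h : ∀ q, ∀ᶠ z in l ×ˢ 𝓝 q, P z.1 z.2) : ∀ᶠ i in l, ∀ q, P i q :=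
  (eventually_forall_mem_of_compact isCompact_univ fun q _ ↦ h q).mono fun _ hi q ↦ hi q (mem_univ q)

/-- Existence of local solutions of `e t = G i q` near `z q`, together with their uniqueness, gives
global solutions. -/
theorem exists_uniform_selection [CompactSpace L] [T2Space L] [TopologicalSpace T]
    {z : L → T} (hz : Continuous z) {e : T → X} {G : ι → L → X} {Q : L → T → Prop}
    (huniq : ∀ q, ∃ W ∈ 𝓝 (z q), InjOn e W)
    (hex : ∀ q, ∀ W ∈ 𝓝 (z q), ∀ᶠ x in l ×ˢ 𝓝 q, ∃ t ∈ W, e t = G x.1 x.2 ∧ Q x.2 t) :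
    ∃ S : ι → L → T, (∀ᶠ i in l, ∀ q, e (S i q) = G i q ∧ Q q (S i q)) ∧
      ∀ q, Tendsto (fun x : ι × L ↦ S x.1 x.2) (l ×ˢ 𝓝 q) (𝓝 (z q)) := by
  classical
  choose W hW hinj using huniq
  have hN : ∀ q, ∃ N ∈ 𝓝 q, IsClosed N ∧ N ⊆ {q' | W q ∈ 𝓝 (z q')} := by
    intro q
    have h1 : {q' | W q ∈ 𝓝 (z q')} ∈ 𝓝 q := hz.continuousAt (eventually_mem_nhds_iff.2 (hW q))
    obtain ⟨N, hN, hcl, hsub⟩ := exists_mem_nhds_isClosed_subset h1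
    exact ⟨N, hN, hcl, hsub⟩
  choose N hN hNcl hNsub using hN
  obtain ⟨J, -, hJ⟩ := isCompact_univ.elim_nhds_subcover N fun q _ ↦ hN q
  have hk : ∀ q, ∃ k ∈ J, q ∈ N k := by
    intro q
    simpa using hJ (mem_univ q)
  choose k hkJ hkN using hk
  let S : ι → L → T := fun i q ↦
    if h : ∃ t ∈ W (k q), e t = G i q ∧ Q q t then h.choose else z q
  have hS : ∀ i q t, t ∈ W (k q) → e t = G i q → Q q t →
      S i q = t ∧ e (S i q) = G i q ∧ Q q (S i q) := by
    intro i q t ht het hQ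
    have h : ∃ t ∈ W (k q), e t = G i q ∧ Q q t := ⟨t, ht, het, hQ⟩
    have hSi : S i q = h.choose := dif_pos h
    rw [hSi]
    exact ⟨hinj _ h.choose_spec.1 ht (h.choose_spec.2.1.trans het.symm), h.choose_spec.2⟩
  have key : ∀ q, ∀ V ∈ 𝓝 (z q), ∀ᶠ x in l ×ˢ 𝓝 q,
      S x.1 x.2 ∈ V ∧ e (S x.1 x.2) = G x.1 x.2 ∧ Q x.2 (S x.1 x.2) := by
    intro q V hV
    have h1 : ∀ j ∈ J, ∀ᶠ x in l ×ˢ 𝓝 q, k x.2 = j →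
        S x.1 x.2 ∈ V ∧ e (S x.1 x.2) = G x.1 x.2 ∧ Q x.2 (S x.1 x.2) := by
      intro j _
      by_cases hqj : q ∈ N j
      · filter_upwards [hex q (V ∩ W j) (inter_mem hV (hNsub j hqj))] with x hx hkj
        obtain ⟨t, ⟨htV, htW⟩, het, hQ⟩ := hx
        have h2 := hS x.1 x.2 t (by rwa [hkj]) het hQ
        exact ⟨h2.1 ▸ htV, h2.2⟩
      · have h3 : ∀ᶠ x : ι × L in l ×ˢ 𝓝 q, x.2 ∈ (N j)ᶜ :=
          tendsto_snd.eventually ((hNcl j).isOpen_compl.mem_nhds hqj)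
        filter_upwards [h3] with x hx hkj
        exact absurd (hkj ▸ hkN x.2) hx
    have h4 := (eventually_all_finset J).2 h1
    filter_upwards [h4] with x hx
    exact hx _ (hkJ x.2) rfl
  refine ⟨S, eventually_forall_of_compact fun q ↦ ?_, fun q V hV ↦ ?_⟩
  · exact (key q univ univ_mem).mono fun x hx ↦ hx.2
  · exact (key q V hV).mono fun x hx ↦ hx.1

end CompactUniformity

section FormFilter

variable {n : ℕ} [NeZero n] {L : Type*} [TopologicalSpace L]
  [ChartedSpace (EuclideanHalfSpace n) L] [IsManifold (𝓡∂ n) ∞ L]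

/-- A closed half ball in the chart at `p₀`. -/
noncomputable def chartBall (p₀ : L) : Set (Model n) :=
  range (𝓡∂ n) ∩ Metric.closedBall (extChartAt (𝓡∂ n) p₀ p₀)
    ((eventually_halfBall_subset_target (n := n) p₀).choose / 2)

lemma isCompact_chartBall (p₀ : L) : IsCompact (chartBall (n := n) p₀) :=
  (isCompact_closedBall _ _).inter_left (𝓡∂ n).isClosed_range

lemma chartBall_subset (p₀ : L) : chartBall (n := n) p₀ ⊆ (extChartAt (𝓡∂ n) p₀).target := by
  obtain ⟨hR, h⟩ := (eventually_halfBall_subset_target (n := n) p₀).choose_spec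
  intro x hx
  exact h _ le_rfl ⟨hx.1, Metric.closedBall_subset_ball (half_lt_self hR) hx.2⟩

lemma chartBall_mem_nhdsWithin (p₀ : L) :
    chartBall (n := n) p₀ ∈ 𝓝[range (𝓡∂ n)] (extChartAt (𝓡∂ n) p₀ p₀) := by
  obtain ⟨hR, -⟩ := (eventually_halfBall_subset_target (n := n) p₀).choose_spec
  exact inter_mem self_mem_nhdsWithin
    (nhdsWithin_le_nhds (Metric.closedBall_mem_nhds _ (half_pos hR)))

variable (n L) in
/-- The filter of `C¹`-small one-forms. -/
noncomputable def formFilter : Filter (DirichletOneForm n L) :=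
  ⨅ j : L × {ε : ℝ // 0 < ε}, 𝓟 {θ | FormNear j.1 (chartBall j.1) j.2 θ.1}

lemma eventually_formNear (p₀ : L) {ε : ℝ} (hε : 0 < ε) :
    ∀ᶠ θ in formFilter n L, FormNear p₀ (chartBall p₀) ε θ.1 :=
  mem_iInf_of_mem (p₀, ⟨ε, hε⟩) (mem_principal_self _)

lemma exists_isOpen_of_eventually_formFilter {P : DirichletOneForm n L → Prop}
    (hP : ∀ᶠ θ in formFilter n L, P θ) :
    ∃ 𝒩 : Set (DirichletOneForm n L), IsOpen 𝒩 ∧ 0 ∈ 𝒩 ∧ (∀ θ ∈ 𝒩, P θ) ∧ 𝒩 ∈ formFilter n L := by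
  obtain ⟨t, ht, hsub⟩ := (hasBasis_iInf_principal_finite _).mem_iff.1 hP
  refine ⟨_, ?_, ?_, fun θ hθ ↦ hsub hθ, (hasBasis_iInf_principal_finite _).mem_of_mem ht⟩
  · exact ht.isOpen_biInter fun j _ ↦ isOpen_formNear (isCompact_chartBall _) (chartBall_subset _) _
  · refine mem_iInter₂.2 fun j _ x hx ↦ ?_
    have h0 : formRep j.1 (0 : DirichletOneForm n L).1 = fun _ ↦ 0 := by
      funext y
      ext v
      rfl
    have hpos : (0 : ℝ) < j.2 := j.2.2
    rw [h0]
    simpa using ⟨hpos, fun v _ ↦ hpos⟩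

lemma tendsto_formRep (p₀ : L) :
    Tendsto (fun z : DirichletOneForm n L × Model n ↦ formRep p₀ z.1.1 z.2)
      (formFilter n L ×ˢ 𝓝[range (𝓡∂ n)] (extChartAt (𝓡∂ n) p₀ p₀)) (𝓝 0) := by
  rw [Metric.tendsto_nhds]
  intro ε hε
  filter_upwards [(eventually_formNear p₀ hε).prod_mk (chartBall_mem_nhdsWithin p₀)] with z hz
  rw [dist_zero_right]
  exact (hz.1 _ hz.2).1

lemma tendsto_fderiv_formRep (p₀ : L) :
    Tendsto (fun z : DirichletOneForm n L × Model n ↦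
      fderivWithin ℝ (formRep p₀ z.1.1) (range (𝓡∂ n)) z.2)
      (formFilter n L ×ˢ 𝓝[range (𝓡∂ n)] (extChartAt (𝓡∂ n) p₀ p₀)) (𝓝 0) := by
  refine (Metric.tendsto_nhds (α := Model n →L[ℝ] CoModel n)).2 fun ε hε ↦ ?_
  filter_upwards [(eventually_formNear p₀ (half_pos hε)).prod_mk (chartBall_mem_nhdsWithin p₀)]
    with z hz
  refine (dist_zero_right (E := Model n →L[ℝ] CoModel n) _).trans_lt ?_
  refine (ContinuousLinearMap.opNorm_le_of_unit_norm (half_pos hε).le fun v hv ↦ ?_).trans_lt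
    (half_lt_self hε)
  exact ((hz.1 _ hz.2).2 v hv.le).le

end FormFilter

section COneConvergence

variable {ι : Type*} {n : ℕ} [NeZero n]
  {X : Type*} [TopologicalSpace X]
  [ChartedSpace (EuclideanSpace ℝ (Fin (2 * n))) X] [IsManifold (𝓡 (2 * n)) ∞ X]
  {L : Type*} [TopologicalSpace L]
  [ChartedSpace (EuclideanHalfSpace n) L] [IsManifold (𝓡∂ n) ∞ L]

/-- `G` converges to `f` in the `C¹` sense, locally uniformly. -/
structure C1Tendsto (G : ι → L → X) (l : Filter ι) (f : L → X) : Prop where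
  smooth : ∀ᶠ i in l, ContMDiff (𝓡∂ n) (𝓡 (2 * n)) ∞ (G i)
  tendsto : ∀ p₀, Tendsto (fun z : ι × L ↦ G z.1 z.2) (l ×ˢ 𝓝 p₀) (𝓝 (f p₀))
  tendsto_deriv : ∀ p₀, Tendsto (fun z : ι × Model n ↦
    fderivWithin ℝ (chartRep (𝓡∂ n) (𝓡 (2 * n)) p₀ (f p₀) (G z.1)) (range (𝓡∂ n)) z.2)
    (l ×ˢ 𝓝[range (𝓡∂ n)] (extChartAt (𝓡∂ n) p₀ p₀))
    (𝓝 (immDeriv f p₀ (extChartAt (𝓡∂ n) p₀ p₀)))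

lemma tendsto_extChartAt_symm (p₀ : L) : Tendsto (extChartAt (𝓡∂ n) p₀).symm
    (𝓝[range (𝓡∂ n)] (extChartAt (𝓡∂ n) p₀ p₀)) (𝓝 p₀) := by
  have h := (continuousAt_extChartAt_symm (I := 𝓡∂ n) p₀).tendsto
  rw [extChartAt_to_inv] at h
  exact h.mono_left nhdsWithin_le_nhds

lemma tendsto_extChartAt_nhdsWithin (p₀ : L) : Tendsto (extChartAt (𝓡∂ n) p₀) (𝓝 p₀)
    (𝓝[range (𝓡∂ n)] (extChartAt (𝓡∂ n) p₀ p₀)) := by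
  rw [← map_extChartAt_nhds]
  exact tendsto_map

lemma tendsto_prod_chart (l : Filter ι) (p₀ : L) :
    Tendsto (fun z : ι × L ↦ (z.1, extChartAt (𝓡∂ n) p₀ z.2)) (l ×ˢ 𝓝 p₀)
      (l ×ˢ 𝓝[range (𝓡∂ n)] (extChartAt (𝓡∂ n) p₀ p₀)) :=
  tendsto_fst.prodMk ((tendsto_extChartAt_nhdsWithin p₀).comp tendsto_snd)

lemma eventually_prod_chart (l : Filter ι) {p₀ : L} {V : Set (Model n)}
    (hV : V ∈ 𝓝[range (𝓡∂ n)] (extChartAt (𝓡∂ n) p₀ p₀)) :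
    ∀ᶠ z in l ×ˢ 𝓝 p₀, z.2 ∈ (extChartAt (𝓡∂ n) p₀).source ∧ extChartAt (𝓡∂ n) p₀ z.2 ∈ V := by
  have h : ∀ᶠ p in 𝓝 p₀, p ∈ (extChartAt (𝓡∂ n) p₀).source ∧ extChartAt (𝓡∂ n) p₀ p ∈ V :=
    Filter.Eventually.and (extChartAt_source_mem_nhds (I := 𝓡∂ n) p₀)
      ((tendsto_extChartAt_nhdsWithin p₀).eventually hV)
  exact tendsto_snd.eventually h

lemma mem_range_extChartAt (p : L) : extChartAt (𝓡∂ n) p p ∈ range (𝓡∂ n) :=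
  extChartAt_target_subset_range p (mem_extChartAt_target p)

lemma halfBall_mem_nhdsWithin (p₀ : L) {R : ℝ} (hR : 0 < R) :
    halfBall (extChartAt (𝓡∂ n) p₀ p₀) R ∈ 𝓝[range (𝓡∂ n)] (extChartAt (𝓡∂ n) p₀ p₀) :=
  inter_mem self_mem_nhdsWithin (nhdsWithin_le_nhds (Metric.ball_mem_nhds _ hR))

lemma C1Tendsto.mono {G : ι → L → X} {l l' : Filter ι} {f : L → X} (h : C1Tendsto (n := n) G l f)
    (hl : l' ≤ l) : C1Tendsto (n := n) G l' f :=
  ⟨hl h.smooth, fun p ↦ (h.tendsto p).mono_left (prod_mono hl le_rfl),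
    fun p ↦ (h.tendsto_deriv p).mono_left (prod_mono hl le_rfl)⟩

lemma C1Tendsto.tendsto_chartRep {G : ι → L → X} {l : Filter ι} {f : L → X} (h : C1Tendsto (n := n) G l f)
    (p₀ : L) : Tendsto (fun z : ι × Model n ↦ chartRep (𝓡∂ n) (𝓡 (2 * n)) p₀ (f p₀) (G z.1) z.2)
    (l ×ˢ 𝓝[range (𝓡∂ n)] (extChartAt (𝓡∂ n) p₀ p₀)) (𝓝 (extChartAt (𝓡 (2 * n)) (f p₀) (f p₀))) :=
  (continuousAt_extChartAt (I := 𝓡 (2 * n)) (f p₀)).tendsto.comp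
    ((h.tendsto p₀).comp (tendsto_fst.prodMk ((tendsto_extChartAt_symm p₀).comp tendsto_snd)))

theorem c1Tendsto_coe {f : L → X} (hf : ContMDiff (𝓡∂ n) (𝓡 (2 * n)) ∞ f) :
    C1Tendsto (n := n) (fun (g : C^∞⟮𝓡∂ n, L; 𝓡 (2 * n), X⟯) ↦ (g : L → X))
      (@nhds _ (c1Topology (𝓡∂ n) L (𝓡 (2 * n)) X) ⟨f, hf⟩) f := by
  set l := @nhds _ (c1Topology (𝓡∂ n) L (𝓡 (2 * n)) X) ⟨f, hf⟩ with hl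
  have hdom : ∀ p₀, ∃ S : Set (Model n), IsCompact S ∧
      S ∈ 𝓝[range (𝓡∂ n)] (extChartAt (𝓡∂ n) p₀ p₀) ∧
      S ⊆ chartDom (𝓡∂ n) (𝓡 (2 * n)) p₀ (f p₀) f := by
    intro p₀
    have hx : extChartAt (𝓡∂ n) p₀ p₀ ∈ chartDom (𝓡∂ n) (𝓡 (2 * n)) p₀ (f p₀) f := by
      refine ⟨mem_extChartAt_target p₀, ?_⟩
      rw [mem_preimage, extChartAt_to_inv]
      exact mem_extChartAt_source _
    have h1 := chartDom_mem_nhdsWithin hf.continuous hx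
    obtain ⟨r, hr, hsub⟩ := Metric.mem_nhdsWithin_iff.1 h1
    refine ⟨range (𝓡∂ n) ∩ Metric.closedBall (extChartAt (𝓡∂ n) p₀ p₀) (r / 2),
      (isCompact_closedBall _ _).inter_left (𝓡∂ n).isClosed_range,
      inter_mem self_mem_nhdsWithin
        (nhdsWithin_le_nhds (Metric.closedBall_mem_nhds _ (half_pos hr))), ?_⟩
    exact fun x hx ↦ hsub ⟨Metric.closedBall_subset_ball (half_lt_self hr) hx.2, hx.1⟩
  have hnear : ∀ p₀, ∀ S : Set (Model n), IsCompact S →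
      S ⊆ chartDom (𝓡∂ n) (𝓡 (2 * n)) p₀ (f p₀) f → ∀ ε > 0, ∀ᶠ g : C^∞⟮𝓡∂ n, L; 𝓡 (2 * n), X⟯ in l,
        C1Near (𝓡∂ n) (𝓡 (2 * n)) p₀ (f p₀) S (chartRep (𝓡∂ n) (𝓡 (2 * n)) p₀ (f p₀) f)
          (immDeriv f p₀) ε (g : L → X) := by
    intro p₀ S hS hSd ε hε
    have hop := isOpen_c1Near (I := 𝓡∂ n) (I' := 𝓡 (2 * n)) (y₀ := f p₀) hS
      (hSd.trans fun x hx ↦ hx.1) ((contDiffOn_chartRep hf).continuousOn.mono hSd)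
      ((contDiffOn_fderivWithin_chartRep hf).continuousOn.mono hSd) ε
    let _ := c1Topology (𝓡∂ n) L (𝓡 (2 * n)) X
    refine hop.mem_nhds ?_
    refine fun x hx ↦ ⟨(hSd hx).2, ?_, fun v hv ↦ ?_⟩
    · change ‖chartRep (𝓡∂ n) (𝓡 (2 * n)) p₀ (f p₀) f x -
        chartRep (𝓡∂ n) (𝓡 (2 * n)) p₀ (f p₀) f x‖ < ε
      rw [sub_self, norm_zero]
      exact hε
    · change ‖(immDeriv f p₀ x - immDeriv f p₀ x) v‖ < ε
      rw [sub_self, zero_apply, norm_zero]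
      exact hε
  refine ⟨Eventually.of_forall fun g ↦ g.contMDiff, fun p₀ ↦ ?_, fun p₀ ↦ ?_⟩
  · obtain ⟨S, hS, hSn, hSd⟩ := hdom p₀
    have h1 : Tendsto (fun z : C^∞⟮𝓡∂ n, L; 𝓡 (2 * n), X⟯ × L ↦
        extChartAt (𝓡 (2 * n)) (f p₀) (z.1 z.2)) (l ×ˢ 𝓝 p₀)
        (𝓝 (extChartAt (𝓡 (2 * n)) (f p₀) (f p₀))) := by
      have h2 : Tendsto (fun z : C^∞⟮𝓡∂ n, L; 𝓡 (2 * n), X⟯ × L ↦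
          extChartAt (𝓡 (2 * n)) (f p₀) (f z.2)) (l ×ˢ 𝓝 p₀)
          (𝓝 (extChartAt (𝓡 (2 * n)) (f p₀) (f p₀))) :=
        (continuousAt_extChartAt (I := 𝓡 (2 * n)) (f p₀)).tendsto.comp
          ((hf.continuous.tendsto p₀).comp tendsto_snd)
      have h3 : Tendsto (fun z : C^∞⟮𝓡∂ n, L; 𝓡 (2 * n), X⟯ × L ↦
          extChartAt (𝓡 (2 * n)) (f p₀) (z.1 z.2) - extChartAt (𝓡 (2 * n)) (f p₀) (f z.2))
          (l ×ˢ 𝓝 p₀) (𝓝 0) := by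
        rw [Metric.tendsto_nhds]
        intro ε hε
        filter_upwards [(hnear p₀ S hS hSd ε hε).prod_mk (inter_mem
          (tendsto_extChartAt_nhdsWithin p₀ hSn) (extChartAt_source_mem_nhds (I := 𝓡∂ n) p₀))]
          with z hz
        have h4 := (hz.1 _ hz.2.1).2.1
        rw [chartRep_apply hz.2.2, chartRep_apply hz.2.2] at h4
        rw [dist_zero_right]
        exact h4
      simpa using h3.add h2
    have h5 : Tendsto (fun z : C^∞⟮𝓡∂ n, L; 𝓡 (2 * n), X⟯ × L ↦
        (extChartAt (𝓡 (2 * n)) (f p₀)).symm (extChartAt (𝓡 (2 * n)) (f p₀) (z.1 z.2)))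
        (l ×ˢ 𝓝 p₀) (𝓝 (f p₀)) := by
      have := (continuousAt_extChartAt_symm (I := 𝓡 (2 * n)) (f p₀)).tendsto
      rw [extChartAt_to_inv] at this
      exact this.comp h1
    refine h5.congr' ?_
    filter_upwards [(hnear p₀ S hS hSd 1 one_pos).prod_mk (inter_mem
      (tendsto_extChartAt_nhdsWithin p₀ hSn) (extChartAt_source_mem_nhds (I := 𝓡∂ n) p₀))] with z hz
    have h4 := (hz.1 _ hz.2.1).1
    rw [(extChartAt (𝓡∂ n) p₀).left_inv hz.2.2] at h4
    exact (extChartAt (𝓡 (2 * n)) (f p₀)).left_inv h4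
  · obtain ⟨S, hS, hSn, hSd⟩ := hdom p₀
    have hx : extChartAt (𝓡∂ n) p₀ p₀ ∈ chartDom (𝓡∂ n) (𝓡 (2 * n)) p₀ (f p₀) f :=
      hSd (mem_of_mem_nhdsWithin (extChartAt_target_subset_range p₀ (mem_extChartAt_target p₀)) hSn)
    have h2 : Tendsto (fun z : C^∞⟮𝓡∂ n, L; 𝓡 (2 * n), X⟯ × Model n ↦ immDeriv f p₀ z.2)
        (l ×ˢ 𝓝[range (𝓡∂ n)] (extChartAt (𝓡∂ n) p₀ p₀))
        (𝓝 (immDeriv f p₀ (extChartAt (𝓡∂ n) p₀ p₀))) :=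
      Tendsto.comp (((contDiffOn_fderivWithin_chartRep hf).continuousOn _ hx).mono_of_mem_nhdsWithin
        (chartDom_mem_nhdsWithin hf.continuous hx)) tendsto_snd
    have h3 : Tendsto (fun z : C^∞⟮𝓡∂ n, L; 𝓡 (2 * n), X⟯ × Model n ↦
        fderivWithin ℝ (chartRep (𝓡∂ n) (𝓡 (2 * n)) p₀ (f p₀) z.1) (range (𝓡∂ n)) z.2 -
          immDeriv f p₀ z.2)
        (l ×ˢ 𝓝[range (𝓡∂ n)] (extChartAt (𝓡∂ n) p₀ p₀)) (𝓝 0) := by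
      rw [Metric.tendsto_nhds]
      intro ε hε
      filter_upwards [(hnear p₀ S hS hSd _ (half_pos hε)).prod_mk hSn] with z hz
      rw [dist_zero_right]
      refine (ContinuousLinearMap.opNorm_le_of_unit_norm (half_pos hε).le fun v hv ↦ ?_).trans_lt
        (half_lt_self hε)
      exact ((hz.1 _ hz.2).2.2 v hv.le).le
    simpa using h3.add h2

end COneConvergence

end LagBdry

namespace LagBdry

section Composition

variable {α E F G : Type*} [NormedAddCommGroup E] [NormedSpace ℝ E] [NormedAddCommGroup F]
  [NormedSpace ℝ F] [NormedAddCommGroup G] [NormedSpace ℝ G] {l : Filter α}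

lemma tendsto_clm_comp {u : α → F →L[ℝ] G} {v : α → E →L[ℝ] F} {u₀ : F →L[ℝ] G} {v₀ : E →L[ℝ] F}
    (hu : Tendsto u l (𝓝 u₀)) (hv : Tendsto v l (𝓝 v₀)) :
    Tendsto (fun x ↦ (u x).comp (v x)) l (𝓝 (u₀.comp v₀)) := by
  have h : Continuous fun p : (F →L[ℝ] G) × (E →L[ℝ] F) ↦ p.1.comp p.2 :=
    continuous_fst.clm_comp continuous_snd
  exact (h.tendsto (u₀, v₀)).comp (hu.prodMk_nhds hv)

lemma tendsto_comp_id_prod {u : α → E × F →L[ℝ] G} {v : α → E →L[ℝ] F} {u₀ : E × F →L[ℝ] G}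
    (hu : Tendsto u l (𝓝 u₀)) (hv : Tendsto v l (𝓝 0)) :
    Tendsto (fun x ↦ (u x).comp ((ContinuousLinearMap.id ℝ E).prod (v x))) l
      (𝓝 (u₀.comp (ContinuousLinearMap.inl ℝ E F))) := by
  refine tendsto_clm_comp hu ?_
  have h1 : Tendsto (fun x ↦ ContinuousLinearMap.inl ℝ E F +
      (ContinuousLinearMap.inr ℝ E F).comp (v x)) l
      (𝓝 (ContinuousLinearMap.inl ℝ E F + (ContinuousLinearMap.inr ℝ E F).comp 0)) :=
    tendsto_const_nhds.add (tendsto_clm_comp tendsto_const_nhds hv)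
  rw [ContinuousLinearMap.comp_zero, add_zero] at h1
  refine h1.congr fun x ↦ ?_
  ext y <;> simp

end Composition

section ChartSmoothness

variable {E : Type*} [NormedAddCommGroup E] [NormedSpace ℝ E]
  {H : Type*} [TopologicalSpace H] {I : ModelWithCorners ℝ E H}
  {M : Type*} [TopologicalSpace M] [ChartedSpace H M] [IsManifold I ∞ M]
  {E' : Type*} [NormedAddCommGroup E'] [NormedSpace ℝ E']
  {H' : Type*} [TopologicalSpace H'] {I' : ModelWithCorners ℝ E' H'}
  {N : Type*} [TopologicalSpace N] [ChartedSpace H' N] [IsManifold I' ∞ N]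

/-- A map is smooth when it is given by a smooth expression in charts. -/
lemma contMDiffAt_of_chart {p₀ p : M} {y₀ : N} {G : M → N} {h : E → E'}
    (hp : p ∈ (extChartAt I p₀).source)
    (hG : ∀ᶠ x in 𝓝[range I] (extChartAt I p₀ p), h x ∈ (extChartAt I' y₀).target ∧
      G ((extChartAt I p₀).symm x) = (extChartAt I' y₀).symm (h x))
    (hh : ContDiffWithinAt ℝ ∞ h (range I) (extChartAt I p₀ p)) : ContMDiffAt I I' ∞ G p := by
  have hmem : extChartAt I p₀ p ∈ range I :=
    extChartAt_target_subset_range p₀ ((extChartAt I p₀).map_source hp)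
  obtain ⟨ht, hGp⟩ := hG.self_of_nhdsWithin hmem
  rw [(extChartAt I p₀).left_inv hp] at hGp
  have hsrc : G p ∈ (extChartAt I' y₀).source := by
    rw [hGp]
    exact (extChartAt I' y₀).map_target ht
  have h1 : Tendsto h (𝓝[range I] (extChartAt I p₀ p))
      (𝓝[(extChartAt I' y₀).target] (h (extChartAt I p₀ p))) :=
    tendsto_nhdsWithin_iff.2 ⟨hh.continuousWithinAt, hG.mono fun x hx ↦ hx.1⟩
  have h2 : Tendsto (extChartAt I p₀) (𝓝 p) (𝓝[range I] (extChartAt I p₀ p)) := by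
    rw [← map_extChartAt_nhds' hp]
    exact tendsto_map
  have hcont : ContinuousAt G p := by
    have h3 := (((continuousOn_extChartAt_symm (I := I') y₀ _ ht).tendsto).comp h1).comp h2
    rw [← hGp] at h3
    refine Tendsto.congr' ?_ h3
    filter_upwards [h2.eventually hG, extChartAt_source_mem_nhds' (I := I) hp] with q hq hqs
    rw [(extChartAt I p₀).left_inv hqs] at hq
    exact hq.2.symm
  rw [extChartAt_source] at hp hsrc
  refine (contMDiffAt_iff_of_mem_source hp hsrc).2 ⟨hcont, ?_⟩
  refine hh.congr_of_eventuallyEq ?_ ?_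
  · filter_upwards [hG] with x hx
    simp only [Function.comp_apply]
    rw [hx.2, (extChartAt I' y₀).right_inv hx.1]
  · simp only [Function.comp_apply]
    rw [← extChartAt_source I] at hp
    rw [(extChartAt I p₀).left_inv hp, hGp, (extChartAt I' y₀).right_inv ht]

end ChartSmoothness

section Deformation

variable {n : ℕ} [NeZero n] {d : ℕ}
  {X : Type*} [TopologicalSpace X]
  [ChartedSpace (EuclideanSpace ℝ (Fin (2 * n))) X] [IsManifold (𝓡 (2 * n)) ∞ X]
  {K : CalabiYau n X}
  {L : Type*} [TopologicalSpace L]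
  [ChartedSpace (EuclideanHalfSpace n) L] [IsManifold (𝓡∂ n) ∞ L]

lemma isConormal_covectorChart_iff {p₀ p : L} (hp : p ∈ (extChartAt (𝓡∂ n) p₀).source)
    (hpb : p ∈ (𝓡∂ n).boundary L) (α : CoModel n) : IsConormal (covectorChart p₀ p α) ↔
      ∀ Y : Model n, (Y : TangentSpace (𝓡∂ n) p) ∈ tangentOf (𝓡∂ n) ((𝓡∂ n).boundary L) p →
        α Y = 0 := by
  constructor
  · intro h Y hY
    have h1 := h _ ((tangentOf_boundary_iff hp hpb Y).1 hY)
    have h2 := tangentCoordChange_symm_apply (I := 𝓡∂ n) (mem_extChartAt_source p) hp Y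
    have h3 : covectorChart p₀ p α (tangentCoordChange (𝓡∂ n) p p₀ p Y) =
      α (tangentCoordChange (𝓡∂ n) p₀ p p (tangentCoordChange (𝓡∂ n) p p₀ p Y)) := rfl
    rw [h2] at h3
    exact h3.symm.trans h1
  · intro h w hw
    refine h (tangentCoordChange (𝓡∂ n) p₀ p p w) ((tangentOf_boundary_iff hp hpb _).2 ?_)
    rw [tangentCoordChange_symm_apply (I := 𝓡∂ n) hp (mem_extChartAt_source p) w]
    exact hw

lemma isConormal_formRep {p₀ p : L} (hp : p ∈ (extChartAt (𝓡∂ n) p₀).source)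
    (hpb : p ∈ (𝓡∂ n).boundary L) (θ : DirichletOneForm n L) :
    IsConormal (formRep p₀ θ.1 (extChartAt (𝓡∂ n) p₀ p)) := by
  rw [formRep_apply hp]
  exact (isConormal_covectorChart_iff hp hpb _).2 fun Y hY ↦ θ.2 p hpb Y hY

lemma eventually_formRep_mem_ball (p₀ : L) {R : ℝ} (hR : 0 < R) :
    ∃ U ∈ 𝓝[range (𝓡∂ n)] (extChartAt (𝓡∂ n) p₀ p₀),
      ∀ᶠ θ in formFilter n L, ∀ x ∈ U, ∀ᶠ x' in 𝓝[range (𝓡∂ n)] x,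
        (x' ∈ (extChartAt (𝓡∂ n) p₀).target ∧ x' ∈ halfBall (extChartAt (𝓡∂ n) p₀ p₀) R) ∧
        formRep p₀ θ.1 x' ∈ Metric.ball 0 R := by
  have h1 : chartBall p₀ ∩ halfBall (extChartAt (𝓡∂ n) p₀ p₀) R ∈
    𝓝[range (𝓡∂ n)] (extChartAt (𝓡∂ n) p₀ p₀) :=
    inter_mem (chartBall_mem_nhdsWithin p₀) (halfBall_mem_nhdsWithin (n := n) p₀ hR)
  refine ⟨_, eventually_mem_nhdsWithin_iff.2 h1, ?_⟩
  filter_upwards [eventually_formNear p₀ hR] with θ hθ x hx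
  filter_upwards [hx] with x' hx'
  exact ⟨⟨chartBall_subset p₀ hx'.1, hx'.2⟩, mem_ball_zero_iff.2 (hθ x' hx'.1).1⟩
variable {C : Fin d → Set L} {Λ : Fin d → Set X}
    {D : CovariantDerivative (𝓡 (2 * n)) (EuclideanSpace ℝ (Fin (2 * n)))
      (TangentSpace (𝓡 (2 * n)) : X → Type _)} {f : L → X} {a : L → ℝ}

/-- The exponential of `Φ⁻¹α`. -/
noncomputable def covectorExp (D : CovariantDerivative (𝓡 (2 * n)) (EuclideanSpace ℝ (Fin (2 * n)))
      (TangentSpace (𝓡 (2 * n)) : X → Type _)) (hf : K.IsLagrangianImm f) (a : L → ℝ)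
    (t : TotalSpace (CoModel n) (fun p : L ↦ TangentSpace (𝓡∂ n) p →L[ℝ] ℝ)) : X :=
  expMap D (f t.1) (CalabiYau.covectorField hf a t.1 t.2)

namespace LocalModel

variable {p₀ : L} {F : Model n × CoModel n → Model (2 * n)}
  {A : (Model n × CoModel n) ≃L[ℝ] Model (2 * n)} {R : ℝ}
  (M : LocalModel K C Λ D f a p₀ F A R)
include M

lemma mem_source {p : L} (hp : p ∈ (extChartAt (𝓡∂ n) p₀).source)
    (hpR : extChartAt (𝓡∂ n) p₀ p ∈ halfBall (extChartAt (𝓡∂ n) p₀ p₀) R) :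
    f p ∈ (extChartAt (𝓡 (2 * n)) (f p₀)).source := by
  have h := (M.subset hpR).2
  rw [mem_preimage, (extChartAt (𝓡∂ n) p₀).left_inv hp] at h
  exact h

lemma isExp_covectorField (hf : K.IsLagrangianImm f) {p : L}
    (hp : p ∈ (extChartAt (𝓡∂ n) p₀).source)
    (hpR : extChartAt (𝓡∂ n) p₀ p ∈ halfBall (extChartAt (𝓡∂ n) p₀ p₀) R) {α : CoModel n}
    (hα : covectorChart p₀ p α ∈ Metric.ball 0 R) :
    IsExp D (f p) (CalabiYau.covectorField hf a p α) ((extChartAt (𝓡 (2 * n)) (f p₀)).symm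
      (F (extChartAt (𝓡∂ n) p₀ p, covectorChart p₀ p α))) := by
  have hy := M.mem_source hp hpR
  have h := M.isExp p hp hpR _ hα
  let V : Model (2 * n) := CalabiYau.covectorField hf a p α
  have hV : tangentCoordChange (𝓡 (2 * n)) (f p) (f p₀) (f p) V =
    K.invChart f a p₀ (extChartAt (𝓡∂ n) p₀ p) (covectorChart p₀ p α) :=
    CalabiYau.covectorField_chart hf hp hy α
  have h1 : tangentCoordChange (𝓡 (2 * n)) (f p₀) (f p) (f p)
      (K.invChart f a p₀ (extChartAt (𝓡∂ n) p₀ p) (covectorChart p₀ p α)) = V := by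
    rw [← hV]
    exact tangentCoordChange_symm_apply (mem_extChartAt_source (f p)) hy V
  have h2 : IsExp D (f p) V ((extChartAt (𝓡 (2 * n)) (f p₀)).symm
      (F (extChartAt (𝓡∂ n) p₀ p, covectorChart p₀ p α))) := h1 ▸ h
  exact h2

lemma deform_eq [T2Space X] (hD : D.ContMDiffCovariantDerivative ∞) (hf : K.IsLagrangianImm f)
    {p : L} (hp : p ∈ (extChartAt (𝓡∂ n) p₀).source)
    (hpR : extChartAt (𝓡∂ n) p₀ p ∈ halfBall (extChartAt (𝓡∂ n) p₀ p₀) R) {θ : OneForm n L}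
    (hθ : formRep p₀ θ (extChartAt (𝓡∂ n) p₀ p) ∈ Metric.ball 0 R) :
    IsExp D (f p) (K.field hf a θ p) (K.deform D hf a θ p) ∧
    K.deform D hf a θ p = (extChartAt (𝓡 (2 * n)) (f p₀)).symm
      (F (extChartAt (𝓡∂ n) p₀ p, formRep p₀ θ (extChartAt (𝓡∂ n) p₀ p))) := by
  rw [formRep_apply hp] at hθ ⊢
  have h := M.isExp_covectorField hf hp hpR hθ
  have h1 : K.deform D hf a θ p = _ := h.expMap_eq hD
  exact ⟨h1 ▸ h, h1⟩

lemma continuousWithinAt_fderiv : ContinuousWithinAt (fderivWithin ℝ F (halfProd n)) (halfProd n)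
    (extChartAt (𝓡∂ n) p₀ p₀, 0) := by
  have hmem : (extChartAt (𝓡∂ n) p₀ p₀, (0 : CoModel n)) ∈
      modelDom (extChartAt (𝓡∂ n) p₀ p₀) R :=
    ⟨⟨mem_range_extChartAt (n := n) p₀, Metric.mem_ball_self M.pos⟩,
      Metric.mem_ball_self M.pos⟩
  exact ((M.smooth _ hmem).fderivWithin_right (m := ∞) uniqueDiffOn_halfProd (by simp)
    ⟨hmem.1.1, mem_univ _⟩).continuousWithinAt

lemma fderivWithin_center : fderivWithin ℝ F (halfProd n) (extChartAt (𝓡∂ n) p₀ p₀, 0) = A :=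
  M.hasDeriv.fderivWithin (uniqueDiffOn_halfProd _
    ⟨mem_range_extChartAt (n := n) p₀, mem_univ _⟩)

end LocalModel

variable [T2Space X] (S : DeformationData K C Λ D f a)
include S

lemma DeformationData.deform_zero : K.deform D S.imm a 0 = f := by
  funext p
  obtain ⟨F, A, R, hR, hM⟩ := S.exists_localModel p
  have M := hM R hR le_rfl
  have hp : extChartAt (𝓡∂ n) p p ∈ halfBall (extChartAt (𝓡∂ n) p p) R :=
    ⟨mem_range_extChartAt p, Metric.mem_ball_self hR⟩
  have h0 : formRep p (0 : OneForm n L) (extChartAt (𝓡∂ n) p p) = 0 := by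
    ext v
    rfl
  have h1 := (M.deform_eq S.smooth S.imm (mem_extChartAt_source p) hp (θ := 0)
    (by rw [h0]; exact Metric.mem_ball_self hR)).2
  rw [h0, M.zero _ hp, chartRep_apply (mem_extChartAt_source p)] at h1
  rw [h1, extChartAt_to_inv]

lemma DeformationData.deriv_deform (θ : OneForm n L) (p : L) :
    MDifferentiableAt 𝓘(ℝ, ℝ) (𝓡 (2 * n)) (fun t : ℝ ↦ K.deform D S.imm a (t • θ) p) 0 ∧
    velocity (𝓡 (2 * n)) (fun t : ℝ ↦ K.deform D S.imm a (t • θ) p) 0 =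
      ⟨f p, CalabiYau.covectorField S.imm a p (θ p)⟩ := by
  obtain ⟨F, A, R, hR, hM⟩ := S.exists_localModel p
  have M := hM R hR le_rfl
  have hps := mem_extChartAt_source (I := 𝓡∂ n) p
  have hp : extChartAt (𝓡∂ n) p p ∈ halfBall (extChartAt (𝓡∂ n) p p) R :=
    ⟨mem_range_extChartAt p, Metric.mem_ball_self hR⟩
  set x := extChartAt (𝓡∂ n) p p with hx
  set ζ := formRep p θ x with hζ
  have hsmul : ∀ t : ℝ, formRep p (t • θ) x = t • ζ := fun t ↦ by
    ext v
    rfl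
  have hc : HasDerivAt (fun t : ℝ ↦ (x, t • ζ)) (0, ζ) 0 := by
    have h1 : HasDerivAt (fun t : ℝ ↦ t • ζ) ζ 0 := by
      simpa using (hasDerivAt_id (0 : ℝ)).smul_const ζ
    exact (hasDerivAt_const (0 : ℝ) x).prodMk h1
  have hu : HasDerivAt (fun t : ℝ ↦ F (x, t • ζ)) (K.invChart f a p x ζ) 0 := by
    have h1 : HasFDerivWithinAt F (A : Model n × CoModel n →L[ℝ] Model (2 * n)) (halfProd n)
        ((fun t : ℝ ↦ (x, t • ζ)) 0) := by
      simp only [zero_smul]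
      exact M.hasDeriv
    have h2 := h1.comp_hasDerivWithinAt (0 : ℝ) (hc.hasDerivWithinAt (s := univ))
      fun t _ ↦ mk_mem_prod hp.1 (mem_univ _)
    have h3 := hasDerivWithinAt_univ.1 h2
    have h4 : A (0, ζ) = K.invChart f a p x ζ := by
      rw [M.apply, map_zero, zero_add]
    exact h4 ▸ h3
  have hball : ∀ᶠ t : ℝ in 𝓝 0, t • ζ ∈ Metric.ball (0 : CoModel n) R := by
    have h1 : Tendsto (fun t : ℝ ↦ t • ζ) (𝓝 0) (𝓝 0) := by
      have : Continuous fun t : ℝ ↦ t • ζ := by fun_prop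
      simpa using this.tendsto 0
    exact h1 (Metric.ball_mem_nhds _ hR)
  have hev : ∀ᶠ t : ℝ in 𝓝 0, K.deform D S.imm a (t • θ) p =
      (extChartAt (𝓡 (2 * n)) (f p)).symm (F (x, t • ζ)) := by
    filter_upwards [hball] with t ht
    have := (M.deform_eq S.smooth S.imm hps hp (θ := t • θ) (by rw [hsmul]; exact ht)).2
    rwa [hsmul] at this
  have hF0 : F (x, (0 : ℝ) • ζ) = extChartAt (𝓡 (2 * n)) (f p) (f p) := by
    rw [zero_smul, M.zero _ hp, chartRep_apply hps]
  have hmd : MDifferentiableAt 𝓘(ℝ, ℝ) (𝓡 (2 * n))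
      (fun t : ℝ ↦ K.deform D S.imm a (t • θ) p) 0 := by
    have h1 : MDifferentiableAt 𝓘(ℝ, Model (2 * n)) (𝓡 (2 * n))
        (extChartAt (𝓡 (2 * n)) (f p)).symm (F (x, (0 : ℝ) • ζ)) := by
      rw [hF0]
      have h2 := (contMDiffOn_extChartAt_symm (I := 𝓡 (2 * n)) (n := ∞) (f p)).contMDiffAt
        (extChartAt_target_mem_nhds (I := 𝓡 (2 * n)) (f p))
      exact h2.mdifferentiableAt (by simp)
    have h3 : MDifferentiableAt 𝓘(ℝ, ℝ) 𝓘(ℝ, Model (2 * n)) (fun t : ℝ ↦ F (x, t • ζ)) 0 :=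
      hu.differentiableAt.mdifferentiableAt
    exact (h1.comp (0 : ℝ) h3).congr_of_eventuallyEq hev
  refine ⟨hmd, ?_⟩
  refine (velocity_eq_iff hmd (mem_extChartAt_source (f p)) _).2 ⟨?_, ?_⟩
  · rw [hev.self_of_nhds, hF0, extChartAt_to_inv]
  · have h1 : tangentCoordChange (𝓡 (2 * n)) (f p) (f p) (f p)
        (CalabiYau.covectorField S.imm a p (θ p)) = K.invChart f a p x ζ :=
      (CalabiYau.covectorField_chart S.imm hps (mem_extChartAt_source (f p)) (θ p)).trans
        (by rw [hζ, hx, formRep_apply hps]; rfl)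
    have h2 : HasDerivAt (fun s : ℝ ↦ extChartAt (𝓡 (2 * n)) (f p)
        (K.deform D S.imm a (s • θ) p)) (K.invChart f a p x ζ) 0 := by
      refine hu.congr_of_eventuallyEq ?_
      filter_upwards [hev, hball] with t ht htb
      have h3 := M.target (x, t • ζ) ⟨hp, htb⟩
      exact (congrArg (extChartAt (𝓡 (2 * n)) (f p)) ht).trans
        ((extChartAt (𝓡 (2 * n)) (f p)).right_inv h3)
    rw [← h1] at h2
    exact h2

lemma DeformationData.eventually_isExp [CompactSpace L] :
    ∀ᶠ θ in formFilter n L, ∀ p, IsExp D (f p) (K.field S.imm a θ.1 p) (K.deform D S.imm a θ.1 p) := by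
  refine eventually_forall_of_compact fun p₀ ↦ ?_
  obtain ⟨F, A, R, hR, hM⟩ := S.exists_localModel p₀
  have M := hM R hR le_rfl
  have h1 := (tendsto_formRep p₀).comp (tendsto_prod_chart (formFilter n L) p₀)
  filter_upwards [h1 (Metric.ball_mem_nhds _ hR), eventually_prod_chart (formFilter n L)
    (halfBall_mem_nhdsWithin (n := n) p₀ hR)] with z hz ⟨hzs, hzR⟩
  exact (M.deform_eq S.smooth S.imm hzs hzR hz).1

lemma DeformationData.eventually_deform_mem [CompactSpace L] :
    ∀ᶠ θ in formFilter n L, ∀ i, ∀ p ∈ C i, K.deform D S.imm a θ.1 p ∈ Λ i := by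
  have key : ∀ᶠ θ in formFilter n L, ∀ p, ∀ i, p ∈ C i → K.deform D S.imm a θ.1 p ∈ Λ i := by
    refine eventually_forall_of_compact fun p₀ ↦ ?_
    obtain ⟨F, A, R, hR, hM⟩ := S.exists_localModel p₀
    have M := hM R hR le_rfl
    have h1 := (tendsto_formRep p₀).comp (tendsto_prod_chart (formFilter n L) p₀)
    filter_upwards [h1 (Metric.ball_mem_nhds _ hR), eventually_prod_chart (formFilter n L)
      (halfBall_mem_nhdsWithin (n := n) p₀ hR)] with z hz ⟨hzs, hzR⟩ i hi
    rw [(M.deform_eq S.smooth S.imm hzs hzR hz).2]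
    exact M.boundary i _ hi hzs hzR _ hz
      (isConormal_formRep hzs (S.ordering.mem_boundary hi) z.1)
  exact key.mono fun θ h i p hi ↦ h p i hi

lemma DeformationData.eventually_contMDiff_deform [CompactSpace L] :
    ∀ᶠ θ in formFilter n L, ContMDiff (𝓡∂ n) (𝓡 (2 * n)) ∞ (K.deform D S.imm a θ.1) := by
  have key : ∀ᶠ θ in formFilter n L, ∀ p,
      ContMDiffAt (𝓡∂ n) (𝓡 (2 * n)) ∞ (K.deform D S.imm a θ.1) p := by
    refine eventually_forall_of_compact fun p₀ ↦ ?_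
    obtain ⟨F, A, R, hR, hM⟩ := S.exists_localModel p₀
    have M := hM R hR le_rfl
    obtain ⟨U, hU, hUθ⟩ := eventually_formRep_mem_ball (n := n) p₀ hR
    filter_upwards [tendsto_fst.eventually hUθ, eventually_prod_chart (formFilter n L) hU]
      with ⟨θ, p⟩ hz ⟨hps, hpU⟩
    have h3 := hz _ hpU
    have hpt := (extChartAt (𝓡∂ n) p₀).map_source hps
    refine contMDiffAt_of_chart (y₀ := f p₀)
      (h := fun x ↦ F (x, formRep p₀ θ.1 x)) hps ?_ ?_
    · filter_upwards [h3] with x hx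
      refine ⟨M.target _ ⟨hx.1.2, hx.2⟩, ?_⟩
      have h4 := (extChartAt (𝓡∂ n) p₀).right_inv hx.1.1
      have h5 := (M.deform_eq S.smooth S.imm ((extChartAt (𝓡∂ n) p₀).map_target hx.1.1)
        (by rw [h4]; exact hx.1.2) (θ := θ.1) (by rw [h4]; exact hx.2)).2
      rwa [h4] at h5
    · have h6 := h3.self_of_nhdsWithin (extChartAt_target_subset_range p₀ hpt)
      refine ContDiffWithinAt.comp (t := halfProd n) _ (M.smooth _ ⟨h6.1.2, h6.2⟩)
        (contDiffWithinAt_id.prodMk (formRep_contDiffWithinAt p₀ θ.1 hpt)) ?_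
      exact fun x hx ↦ ⟨hx, mem_univ _⟩
  exact key.mono fun θ h p ↦ h p

lemma DeformationData.tendsto_deform (p₀ : L) :
    Tendsto (fun z : DirichletOneForm n L × L ↦ K.deform D S.imm a z.1.1 z.2)
      (formFilter n L ×ˢ 𝓝 p₀) (𝓝 (f p₀)) := by
  obtain ⟨F, A, R, hR, hM⟩ := S.exists_localModel p₀
  have M := hM R hR le_rfl
  have hpr : extChartAt (𝓡∂ n) p₀ p₀ ∈ range (𝓡∂ n) :=
    mem_range_extChartAt p₀
  have h1 := (tendsto_formRep p₀).comp (tendsto_prod_chart (formFilter n L) p₀)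
  have h2 : Tendsto (fun z : DirichletOneForm n L × L ↦ (extChartAt (𝓡∂ n) p₀ z.2,
      formRep p₀ z.1.1 (extChartAt (𝓡∂ n) p₀ z.2))) (formFilter n L ×ˢ 𝓝 p₀)
      (𝓝[halfProd n] (extChartAt (𝓡∂ n) p₀ p₀, 0)) := by
    rw [halfProd, nhdsWithin_prod_eq, nhdsWithin_univ]
    exact ((tendsto_extChartAt_nhdsWithin p₀).comp tendsto_snd).prodMk h1
  have h3 := M.hasDeriv.continuousWithinAt.tendsto.comp h2
  rw [M.zero _ ⟨hpr, Metric.mem_ball_self hR⟩, chartRep_apply (mem_extChartAt_source p₀)] at h3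
  have h4 := (continuousAt_extChartAt_symm (I := 𝓡 (2 * n)) (f p₀)).tendsto.comp h3
  rw [extChartAt_to_inv] at h4
  refine h4.congr' ?_
  filter_upwards [h1 (Metric.ball_mem_nhds _ hR), eventually_prod_chart (formFilter n L)
    (halfBall_mem_nhdsWithin (n := n) p₀ hR)] with z hz ⟨hzs, hzR⟩
  exact (M.deform_eq S.smooth S.imm hzs hzR hz).2.symm

lemma DeformationData.tendsto_fderiv_deform (p₀ : L) :
    Tendsto (fun z : DirichletOneForm n L × Model n ↦ fderivWithin ℝ
      (chartRep (𝓡∂ n) (𝓡 (2 * n)) p₀ (f p₀) (K.deform D S.imm a z.1.1)) (range (𝓡∂ n)) z.2)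
      (formFilter n L ×ˢ 𝓝[range (𝓡∂ n)] (extChartAt (𝓡∂ n) p₀ p₀))
      (𝓝 (immDeriv f p₀ (extChartAt (𝓡∂ n) p₀ p₀))) := by
  obtain ⟨F, A, R, hR, hM⟩ := S.exists_localModel p₀
  have M := hM R hR le_rfl
  have hpr : extChartAt (𝓡∂ n) p₀ p₀ ∈ range (𝓡∂ n) :=
    mem_range_extChartAt p₀
  have hA : (A : Model n × CoModel n →L[ℝ] Model (2 * n)).comp
      (ContinuousLinearMap.inl ℝ (Model n) (CoModel n)) =
      immDeriv f p₀ (extChartAt (𝓡∂ n) p₀ p₀) := by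
    ext1 v
    have : A (v, 0) = _ := M.apply (v, 0)
    simpa using this
  have h1 : Tendsto (fun z : DirichletOneForm n L × Model n ↦ (z.2, formRep p₀ z.1.1 z.2))
      (formFilter n L ×ˢ 𝓝[range (𝓡∂ n)] (extChartAt (𝓡∂ n) p₀ p₀))
      (𝓝[halfProd n] (extChartAt (𝓡∂ n) p₀ p₀, 0)) := by
    rw [halfProd, nhdsWithin_prod_eq, nhdsWithin_univ]
    exact tendsto_snd.prodMk (tendsto_formRep p₀)
  have h2 := M.continuousWithinAt_fderiv.tendsto.comp h1
  rw [M.fderivWithin_center] at h2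
  have h5 : Tendsto (fun z : DirichletOneForm n L × Model n ↦
      (fderivWithin ℝ F (halfProd n) (z.2, formRep p₀ z.1.1 z.2)).comp
        ((ContinuousLinearMap.id ℝ (Model n)).prod
          (fderivWithin ℝ (formRep p₀ z.1.1) (range (𝓡∂ n)) z.2)))
      (formFilter n L ×ˢ 𝓝[range (𝓡∂ n)] (extChartAt (𝓡∂ n) p₀ p₀))
      (𝓝 ((A : Model n × CoModel n →L[ℝ] Model (2 * n)).comp
        (ContinuousLinearMap.inl ℝ (Model n) (CoModel n)))) :=
    tendsto_comp_id_prod h2 (tendsto_fderiv_formRep p₀)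
  rw [hA] at h5
  obtain ⟨U, hU, hUθ⟩ := eventually_formRep_mem_ball (n := n) p₀ hR
  have hev : ∀ᶠ z in formFilter n L ×ˢ 𝓝[range (𝓡∂ n)] (extChartAt (𝓡∂ n) p₀ p₀),
      (fderivWithin ℝ F (halfProd n) (z.2, formRep p₀ z.1.1 z.2)).comp
        ((ContinuousLinearMap.id ℝ (Model n)).prod
          (fderivWithin ℝ (formRep p₀ z.1.1) (range (𝓡∂ n)) z.2)) =
      fderivWithin ℝ (chartRep (𝓡∂ n) (𝓡 (2 * n)) p₀ (f p₀) (K.deform D S.imm a z.1.1))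
        (range (𝓡∂ n)) z.2 := by
    filter_upwards [hUθ.prod_mk (inter_mem hU self_mem_nhdsWithin)] with z hz
    obtain ⟨θ, x⟩ := z
    have h6 := hz.1 _ hz.2.1
    have hxr : x ∈ range (𝓡∂ n) := hz.2.2
    have h7 := h6.self_of_nhdsWithin hxr
    have h9 := ((formRep_contDiffWithinAt p₀ θ.1 h7.1.1).differentiableWithinAt
      (by simp)).hasFDerivWithinAt
    have h10 := (hasFDerivWithinAt_id x (range (𝓡∂ n))).prodMk h9
    have h11 := ((M.smooth (x, formRep p₀ θ.1 x) ⟨h7.1.2, h7.2⟩).differentiableWithinAt (by simp)).hasFDerivWithinAt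
    have h8 := HasFDerivWithinAt.comp (g := F) (f := fun x ↦ (x, formRep p₀ θ.1 x))
      (t := halfProd n) x h11 h10 fun x hx ↦ ⟨hx, mem_univ _⟩
    have hrep : ∀ x' ∈ (extChartAt (𝓡∂ n) p₀).target,
        x' ∈ halfBall (extChartAt (𝓡∂ n) p₀ p₀) R → formRep p₀ θ.1 x' ∈ Metric.ball 0 R →
        chartRep (𝓡∂ n) (𝓡 (2 * n)) p₀ (f p₀) (K.deform D S.imm a θ.1) x' =
          F (x', formRep p₀ θ.1 x') := by
      intro x' hx' hx'R hx'θ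
      have h4 := (extChartAt (𝓡∂ n) p₀).right_inv hx'
      have h5 := (M.deform_eq S.smooth S.imm ((extChartAt (𝓡∂ n) p₀).map_target hx')
        (by rw [h4]; exact hx'R) (θ := θ.1) (by rw [h4]; exact hx'θ)).2
      rw [h4] at h5
      simp only [chartRep, Function.comp_apply]
      exact (congrArg (extChartAt (𝓡 (2 * n)) (f p₀)) h5).trans
        ((extChartAt (𝓡 (2 * n)) (f p₀)).right_inv
          (M.target (x', formRep p₀ θ.1 x') ⟨hx'R, hx'θ⟩))
    have h12 := h8.congr_of_eventuallyEq
      (f₁ := chartRep (𝓡∂ n) (𝓡 (2 * n)) p₀ (f p₀) (K.deform D S.imm a θ.1))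
      (h6.mono fun x' hx' ↦ hrep x' hx'.1.1 hx'.1.2 hx'.2) (hrep x h7.1.1 h7.1.2 h7.2)
    exact (h12.fderivWithin ((𝓡∂ n).uniqueDiffOn x hxr)).symm
  exact h5.congr' hev

/-- `f_θ` converges to `f` in `C¹` as `θ` converges to zero. -/
theorem DeformationData.c1Tendsto_deform [CompactSpace L] :
    C1Tendsto (n := n) (fun θ : DirichletOneForm n L ↦ K.deform D S.imm a θ.1) (formFilter n L) f :=
  ⟨S.eventually_contMDiff_deform, S.tendsto_deform, S.tendsto_fderiv_deform⟩

end Deformation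

end LagBdry

namespace LagBdry

section NearInvertible

variable {E F : Type*} [NormedAddCommGroup E] [NormedSpace ℝ E] [FiniteDimensional ℝ E]
  [NormedAddCommGroup F] [NormedSpace ℝ F]

lemma isInvertible_of_near (A : E ≃L[ℝ] F) {T : E →L[ℝ] F}
    (h : ‖T - A‖ * ‖(A.symm : F →L[ℝ] E)‖ < 1) : T.IsInvertible := by
  have : FiniteDimensional ℝ F := A.toLinearEquiv.finiteDimensional
  have hinj : Function.Injective (T : E →ₗ[ℝ] F) := by
    rw [injective_iff_map_eq_zero]
    intro v hv
    have hv' : T v = 0 := hv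
    by_contra hne
    have h1 : ‖v‖ ≤ ‖(A.symm : F →L[ℝ] E)‖ * (‖T - A‖ * ‖v‖) := by
      have h2 : v = (A.symm : F →L[ℝ] E) (-((T - A) v)) := by
        simp [hv']
      calc ‖v‖ = ‖(A.symm : F →L[ℝ] E) (-((T - A) v))‖ := by rw [← h2]
        _ ≤ ‖(A.symm : F →L[ℝ] E)‖ * ‖-((T - A) v)‖ := ContinuousLinearMap.le_opNorm _ _
        _ ≤ _ := by
          rw [norm_neg]
          gcongr
          exact ContinuousLinearMap.le_opNorm _ _
    have h3 : 0 < ‖v‖ := norm_pos_iff.2 hne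
    nlinarith
  exact ⟨(LinearEquiv.ofInjectiveOfFinrankEq _ hinj
    A.toLinearEquiv.finrank_eq).toContinuousLinearEquiv, by ext; rfl⟩

end NearInvertible

section Eventual

variable {ι : Type*} {n : ℕ} [NeZero n] {d : ℕ}
  {X : Type*} [TopologicalSpace X]
  [ChartedSpace (EuclideanSpace ℝ (Fin (2 * n))) X] [IsManifold (𝓡 (2 * n)) ∞ X]
  {K : CalabiYau n X}
  {L : Type*} [TopologicalSpace L]
  [ChartedSpace (EuclideanHalfSpace n) L] [IsManifold (𝓡∂ n) ∞ L]
  {G : ι → L → X} {l : Filter ι} {f : L → X}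

lemma exists_halfBall_subset {p₀ : L} {V : Set (Model n)}
    (hV : V ∈ 𝓝[range (𝓡∂ n)] (extChartAt (𝓡∂ n) p₀ p₀)) :
    ∃ ρ > 0, halfBall (extChartAt (𝓡∂ n) p₀ p₀) ρ ⊆ V := by
  obtain ⟨r, hr, hsub⟩ := Metric.mem_nhdsWithin_iff.1 hV
  exact ⟨r, hr, fun x hx ↦ hsub ⟨hx.2, hx.1⟩⟩

/-- Eventually on a product filter means eventually uniformly on a half ball. -/
lemma exists_halfBall_eventually {p₀ : L} {P : ι → Model n → Prop}
    (h : ∀ᶠ z in l ×ˢ 𝓝[range (𝓡∂ n)] (extChartAt (𝓡∂ n) p₀ p₀), P z.1 z.2) :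
    ∃ ρ > 0, ∀ᶠ i in l, ∀ x ∈ halfBall (extChartAt (𝓡∂ n) p₀ p₀) ρ, P i x := by
  obtain ⟨t, ht, V, hV, hsub⟩ := mem_prod_iff.1 h
  obtain ⟨ρ, hρ, hρV⟩ := exists_halfBall_subset hV
  exact ⟨ρ, hρ, mem_of_superset ht fun i hi x hx ↦ hsub (mk_mem_prod hi (hρV hx))⟩

lemma halfBall_mono (x₀ : Model n) {r s : ℝ} (h : r ≤ s) : halfBall x₀ r ⊆ halfBall x₀ s :=
  inter_subset_inter_right _ (Metric.ball_subset_ball h)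

lemma C1Tendsto.exists_chartDom (h : C1Tendsto (n := n) G l f) (p₀ : L) : ∃ ρ > 0, ∀ᶠ i in l,
    ∀ x ∈ halfBall (extChartAt (𝓡∂ n) p₀ p₀) ρ,
      x ∈ chartDom (𝓡∂ n) (𝓡 (2 * n)) p₀ (f p₀) (G i) := by
  refine exists_halfBall_eventually ?_
  have h1 := (h.tendsto p₀).comp
    (tendsto_fst.prodMk ((tendsto_extChartAt_symm (n := n) p₀).comp tendsto_snd) :
      Tendsto (fun z : ι × Model n ↦ (z.1, (extChartAt (𝓡∂ n) p₀).symm z.2))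
        (l ×ˢ 𝓝[range (𝓡∂ n)] (extChartAt (𝓡∂ n) p₀ p₀)) (l ×ˢ 𝓝 p₀))
  have h2 : ∀ᶠ z : ι × Model n in l ×ˢ 𝓝[range (𝓡∂ n)] (extChartAt (𝓡∂ n) p₀ p₀),
      z.2 ∈ (extChartAt (𝓡∂ n) p₀).target :=
    tendsto_snd.eventually (extChartAt_target_mem_nhdsWithin (I := 𝓡∂ n) p₀)
  filter_upwards [h1 (extChartAt_source_mem_nhds (I := 𝓡 (2 * n)) (f p₀)), h2] with z hz hz2
  exact ⟨hz2, hz⟩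

lemma hasFDerivWithinAt_chartRep_of_mem {g : L → X} (hg : ContMDiff (𝓡∂ n) (𝓡 (2 * n)) ∞ g)
    {p₀ : L} {y₀ : X} {x : Model n} (hx : x ∈ chartDom (𝓡∂ n) (𝓡 (2 * n)) p₀ y₀ g) :
    HasFDerivWithinAt (chartRep (𝓡∂ n) (𝓡 (2 * n)) p₀ y₀ g)
      (fderivWithin ℝ (chartRep (𝓡∂ n) (𝓡 (2 * n)) p₀ y₀ g) (range (𝓡∂ n)) x) (range (𝓡∂ n)) x :=
  (((contDiffOn_chartRep hg x hx).mono_of_mem_nhdsWithin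
    (chartDom_mem_nhdsWithin hg.continuous hx)).differentiableWithinAt (by simp)).hasFDerivWithinAt

/-- In charts the maps `G i` are uniformly approximated by the derivative of `f`. -/
lemma C1Tendsto.exists_approx (h : C1Tendsto (n := n) G l f) (p₀ : L) {ε : ℝ} (hε : 0 < ε) :
    ∃ ρ > 0, ∀ᶠ i in l, ∀ x ∈ halfBall (extChartAt (𝓡∂ n) p₀ p₀) ρ,
      x ∈ chartDom (𝓡∂ n) (𝓡 (2 * n)) p₀ (f p₀) (G i) ∧
      ∀ x' ∈ halfBall (extChartAt (𝓡∂ n) p₀ p₀) ρ,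
        ‖chartRep (𝓡∂ n) (𝓡 (2 * n)) p₀ (f p₀) (G i) x -
          chartRep (𝓡∂ n) (𝓡 (2 * n)) p₀ (f p₀) (G i) x' -
          immDeriv f p₀ (extChartAt (𝓡∂ n) p₀ p₀) (x - x')‖ ≤ ε * ‖x - x'‖ := by
  obtain ⟨ρ₁, hρ₁, h1⟩ := h.exists_chartDom p₀
  have h2 : ∀ᶠ z in l ×ˢ 𝓝[range (𝓡∂ n)] (extChartAt (𝓡∂ n) p₀ p₀),
      ‖fderivWithin ℝ (chartRep (𝓡∂ n) (𝓡 (2 * n)) p₀ (f p₀) (G z.1)) (range (𝓡∂ n)) z.2 -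
        immDeriv f p₀ (extChartAt (𝓡∂ n) p₀ p₀)‖ < ε := by
    have := Metric.tendsto_nhds.1 (h.tendsto_deriv p₀) ε hε
    simpa only [dist_eq_norm] using this
  obtain ⟨ρ₂, hρ₂, h3⟩ := exists_halfBall_eventually (n := n) (p₀ := p₀) (l := l)
    (P := fun i x ↦ ‖fderivWithin ℝ (chartRep (𝓡∂ n) (𝓡 (2 * n)) p₀ (f p₀) (G i)) (range (𝓡∂ n)) x -
        immDeriv f p₀ (extChartAt (𝓡∂ n) p₀ p₀)‖ < ε) h2
  refine ⟨min ρ₁ ρ₂, lt_min hρ₁ hρ₂, ?_⟩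
  filter_upwards [h1, h3, h.smooth] with i hi1 hi3 his x hx
  refine ⟨hi1 x (halfBall_mono _ (min_le_left _ _) hx), fun x' hx' ↦ ?_⟩
  refine (convex_halfBall (n := n) _ _).norm_image_sub_le_of_norm_hasFDerivWithin_le'
    (s := halfBall (extChartAt (𝓡∂ n) p₀ p₀) (min ρ₁ ρ₂))
    (f' := fderivWithin ℝ (chartRep (𝓡∂ n) (𝓡 (2 * n)) p₀ (f p₀) (G i)) (range (𝓡∂ n)))
    (fun y hy ↦ ?_) (fun y hy ↦ ?_) hx' hx
  · exact (hasFDerivWithinAt_chartRep_of_mem his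
      (hi1 y (halfBall_mono _ (min_le_left _ _) hy))).mono inter_subset_left
  · exact (hi3 y (halfBall_mono _ (min_le_right _ _) hy)).le

lemma chart_preimage_mem_nhds {p₀ : L} {V : Set (Model n)}
    (hV : V ∈ 𝓝[range (𝓡∂ n)] (extChartAt (𝓡∂ n) p₀ p₀)) :
    (extChartAt (𝓡∂ n) p₀).source ∩ extChartAt (𝓡∂ n) p₀ ⁻¹' V ∈ 𝓝 p₀ :=
  inter_mem (extChartAt_source_mem_nhds (I := 𝓡∂ n) p₀) (tendsto_extChartAt_nhdsWithin p₀ hV)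

lemma C1Tendsto.exists_injOn (h : C1Tendsto (n := n) G l f) (hf : K.IsLagrangianImm f) (p₀ : L) :
    ∃ U ∈ 𝓝 p₀, ∀ᶠ i in l, InjOn (G i) U := by
  set B := immDeriv f p₀ (extChartAt (𝓡∂ n) p₀ p₀) with hB
  have hBinj : Function.Injective (B : Model n →ₗ[ℝ] Model (2 * n)) := by
    rw [injective_iff_map_eq_zero]
    exact fun v hv ↦ immDeriv_injective hf (mem_extChartAt_source p₀) (mem_extChartAt_source _) hv
  obtain ⟨κ, hκ, hanti⟩ := LinearMap.exists_antilipschitzWith _ (LinearMap.ker_eq_bot.2 hBinj)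
  have hκ' : (0 : ℝ) < κ := hκ
  have hBκ : ∀ v, ‖v‖ ≤ κ * ‖B v‖ := fun v ↦ ZeroHomClass.bound_of_antilipschitz _ hanti v
  obtain ⟨ρ, hρ, h1⟩ := h.exists_approx p₀ (ε := 1 / (2 * κ)) (by positivity)
  refine ⟨_, chart_preimage_mem_nhds (halfBall_mem_nhdsWithin (n := n) p₀ hρ), ?_⟩
  filter_upwards [h1] with i hi p hp q hq hpq
  have h2 := (hi _ hp.2).2 _ hq.2
  rw [chartRep_apply hp.1, chartRep_apply hq.1, hpq, sub_self, zero_sub, norm_neg] at h2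
  have h3 := hBκ (extChartAt (𝓡∂ n) p₀ p - extChartAt (𝓡∂ n) p₀ q)
  have h4 : κ * (1 / (2 * κ) * ‖extChartAt (𝓡∂ n) p₀ p - extChartAt (𝓡∂ n) p₀ q‖) =
      ‖extChartAt (𝓡∂ n) p₀ p - extChartAt (𝓡∂ n) p₀ q‖ / 2 := by
    field_simp
  have h5 := mul_le_mul_of_nonneg_left h2 hκ'.le
  have h6 : ‖extChartAt (𝓡∂ n) p₀ p - extChartAt (𝓡∂ n) p₀ q‖ ≤ 0 := by
    linarith
  exact (extChartAt (𝓡∂ n) p₀).injOn hp.1 hq.1 (sub_eq_zero.1 (norm_le_zero_iff.1 h6))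

lemma exists_injOn_of_imm (hf : K.IsLagrangianImm f) (p₀ : L) : ∃ U ∈ 𝓝 p₀, InjOn f U := by
  obtain ⟨U, hU, h⟩ := (c1Tendsto_coe hf.1.1).exists_injOn hf p₀
  exact ⟨U, hU, @mem_of_mem_nhds _ (c1Topology (𝓡∂ n) L (𝓡 (2 * n)) X) _ _ h⟩

lemma C1Tendsto.eventually_isImm [CompactSpace L] (h : C1Tendsto (n := n) G l f)
    (hf : K.IsLagrangianImm f) : ∀ᶠ i in l, IsImm n (G i) := by
  have key : ∀ᶠ i in l, ∀ p, ContMDiff (𝓡∂ n) (𝓡 (2 * n)) ∞ (G i) →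
      Function.Injective (diff n (G i) p) := by
    refine eventually_forall_of_compact fun p₀ ↦ ?_
    have hinj : Function.Injective (immDeriv f p₀ (extChartAt (𝓡∂ n) p₀ p₀)) := by
      rw [injective_iff_map_eq_zero]
      exact fun v hv ↦ immDeriv_injective hf (mem_extChartAt_source p₀) (mem_extChartAt_source _) hv
    filter_upwards [((h.tendsto_deriv p₀).comp (tendsto_prod_chart l p₀))
      (ContinuousLinearMap.isOpen_injective.mem_nhds hinj),
      h.tendsto p₀ (extChartAt_source_mem_nhds (I := 𝓡 (2 * n)) (f p₀)),
      eventually_prod_chart l (halfBall_mem_nhdsWithin (n := n) p₀ one_pos)] with z hz hzy hzs hsm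
    obtain ⟨i, p⟩ := z
    have hz' : Function.Injective (fderivWithin ℝ (chartRep (𝓡∂ n) (𝓡 (2 * n)) p₀ (f p₀) (G i))
      (range (𝓡∂ n)) (extChartAt (𝓡∂ n) p₀ p)) := hz
    have hmd : MDifferentiableAt (𝓡∂ n) (𝓡 (2 * n)) (G i) p := hsm.mdifferentiable (by simp) p
    have key : ∀ v : Model n, mfderivModel (𝓡∂ n) (𝓡 (2 * n)) (G i) p v = 0 → v = 0 := by
      intro v hv
      have h1 := fderivWithin_chartRep_apply hmd hzs.1 hzy v
      rw [hv, map_zero] at h1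
      have h2 : tangentCoordChange (𝓡∂ n) p p₀ p v = 0 := hz' (h1.trans (map_zero _).symm)
      have h3 := tangentCoordChange_symm_apply (I := 𝓡∂ n) (mem_extChartAt_source p) hzs.1 v
      rw [h2, map_zero] at h3
      exact h3.symm
    refine (injective_iff_map_eq_zero _).2 fun v hv ↦ key v hv
  filter_upwards [key, h.smooth] with i hi his
  exact ⟨his, fun p ↦ hi p his⟩

variable {C : Fin d → Set L} {Λ : Fin d → Set X}
    {D : CovariantDerivative (𝓡 (2 * n)) (EuclideanSpace ℝ (Fin (2 * n)))
      (TangentSpace (𝓡 (2 * n)) : X → Type _)} {a : L → ℝ}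

lemma C1Tendsto.eventually_not_tangent [CompactSpace L] (h : C1Tendsto (n := n) G l f)
    (S : DeformationData K C Λ D f a) : ∀ᶠ i in l, ∀ j, ∀ p ∈ C j, G i p ∈ Λ j →
      ¬ (diff n (G i) p).range ≤ tangentOf (𝓡 (2 * n)) (Λ j) (G i p) := by
  have key : ∀ᶠ i in l, ∀ p, ∀ j, p ∈ C j → G i p ∈ Λ j →
      ContMDiff (𝓡∂ n) (𝓡 (2 * n)) ∞ (G i) →
      ¬ (diff n (G i) p).range ≤ tangentOf (𝓡 (2 * n)) (Λ j) (G i p) := by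
    refine eventually_forall_of_compact fun p₀ ↦ ?_
    obtain ⟨R, hR, hcomp⟩ := S.ordering.exists_component_radius p₀
    refine eventually_all.2 fun j ↦ ?_
    have hchart := eventually_prod_chart l (halfBall_mem_nhdsWithin (n := n) p₀ hR)
    by_cases hj : p₀ ∈ C j
    swap
    · filter_upwards [hchart] with z hz hzj
      exact absurd (hcomp R le_rfl j z.2 hzj hz.1 hz.2) hj
    have hΛ := S.boundary.1 j p₀ hj
    obtain ⟨O, σ, W, hs, -⟩ := (S.lagrangian j).1.exists_isSlice hΛ
    have hps := mem_extChartAt_source (I := 𝓡∂ n) p₀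
    have hys := mem_extChartAt_source (I := 𝓡 (2 * n)) (f p₀)
    have hmdf : MDifferentiableAt (𝓡∂ n) (𝓡 (2 * n)) f p₀ := CalabiYau.mdifferentiableAt_imm S.imm p₀
    obtain ⟨v, hv⟩ : ∃ v : Model n, fderiv ℝ σ (extChartAt (𝓡 (2 * n)) (f p₀) (f p₀))
        (immDeriv f p₀ (extChartAt (𝓡∂ n) p₀ p₀) v) ∉ W := by
      by_contra! hcon
      refine S.boundary.2 j p₀ hj ?_
      rintro _ ⟨u, rfl⟩
      let u' : Model n := u
      refine (hs.tangentOf_iff hys hs.mem hΛ (mfderivModel (𝓡∂ n) (𝓡 (2 * n)) f p₀ u')).2 ?_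
      rw [← fderivWithin_chartRep_apply hmdf hps hys u']
      exact hcon _
    have hσ : ContinuousAt (fderiv ℝ σ) (extChartAt (𝓡 (2 * n)) (f p₀) (f p₀)) :=
      (hs.contDiffOn.continuousOn_fderiv_of_isOpen hs.isOpen (by simp)).continuousAt
        (hs.isOpen.mem_nhds hs.mem)
    have hχ := (continuousAt_extChartAt (I := 𝓡 (2 * n)) (f p₀)).tendsto.comp (h.tendsto p₀)
    have h1 := (hσ.tendsto.comp hχ)
    have h2 := (h.tendsto_deriv p₀).comp (tendsto_prod_chart l p₀)
    have h3 := tendsto_clm_comp h1 h2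
    have h4 : Tendsto (fun T : Model n →L[ℝ] Model (2 * n) ↦ T v)
        (𝓝 ((fderiv ℝ σ (extChartAt (𝓡 (2 * n)) (f p₀) (f p₀))).comp
          (immDeriv f p₀ (extChartAt (𝓡∂ n) p₀ p₀)))) (𝓝 _) :=
      (ContinuousLinearMap.apply ℝ (Model (2 * n)) v).continuous.tendsto _
    have h5 := (h4.comp h3) ((Submodule.closed_of_finiteDimensional W).isOpen_compl.mem_nhds hv)
    filter_upwards [h5, hchart, hχ (hs.isOpen.mem_nhds hs.mem),
      h.tendsto p₀ (extChartAt_source_mem_nhds (I := 𝓡 (2 * n)) (f p₀))] with z hz hzs hzO hzy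
      hzj hzΛ hsm hcon
    obtain ⟨i, p⟩ := z
    have hmd : MDifferentiableAt (𝓡∂ n) (𝓡 (2 * n)) (G i) p := hsm.mdifferentiable (by simp) p
    let w : Model n := tangentCoordChange (𝓡∂ n) p₀ p p v
    have hw : (mfderivModel (𝓡∂ n) (𝓡 (2 * n)) (G i) p w : TangentSpace (𝓡 (2 * n)) (G i p)) ∈
        tangentOf (𝓡 (2 * n)) (Λ j) (G i p) := hcon ⟨w, rfl⟩
    have h6 := (hs.tangentOf_iff hzy hzO hzΛ _).1 hw
    rw [← fderivWithin_chartRep_apply hmd hzs.1 hzy w,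
      tangentCoordChange_symm_apply (I := 𝓡∂ n) hzs.1 (mem_extChartAt_source p) v] at h6
    exact hz h6
  filter_upwards [key, h.smooth] with i hi his j p hp hΛ
  exact hi p j hp hΛ his

end Eventual

section Lift

variable {n : ℕ} [NeZero n] {d : ℕ}
  {X : Type*} [TopologicalSpace X]
  [ChartedSpace (EuclideanSpace ℝ (Fin (2 * n))) X] [IsManifold (𝓡 (2 * n)) ∞ X]
  {K : CalabiYau n X}
  {L : Type*} [TopologicalSpace L]
  [ChartedSpace (EuclideanHalfSpace n) L] [IsManifold (𝓡∂ n) ∞ L]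
  {f : L → X} {C : Fin d → Set L} {Λ : Fin d → Set X}
  {D : CovariantDerivative (𝓡 (2 * n)) (EuclideanSpace ℝ (Fin (2 * n)))
      (TangentSpace (𝓡 (2 * n)) : X → Type _)} {a : L → ℝ}
  {p₀ : L} {F : Model n × CoModel n → Model (2 * n)}
  {A : (Model n × CoModel n) ≃L[ℝ] Model (2 * n)} {R : ℝ}
  (M : LocalModel K C Λ D f a p₀ F A R)

namespace LocalModel

include M

lemma isInvertible_fderiv {z} (hz : z ∈ modelDom (extChartAt (𝓡∂ n) p₀ p₀) R) :
    (fderivWithin ℝ F (halfProd n) z).IsInvertible :=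
  isInvertible_of_near A ((M.deriv_near z hz).trans_lt (by norm_num))

/-- Regularity of lifts through a local model. -/
lemma contDiffOn_lift {E : Type*} [NormedAddCommGroup E] [NormedSpace ℝ E]
    {t : Set E} (ht : UniqueDiffOn ℝ t) {g : E → Model n × CoModel n} {h : E → Model (2 * n)}
    (hg : ContinuousOn g t) (hmaps : MapsTo g t (modelDom (extChartAt (𝓡∂ n) p₀ p₀) R))
    (hh : ContDiffOn ℝ ∞ h t) (hcomp : ∀ z ∈ t, F (g z) = h z) : ContDiffOn ℝ ∞ g t := by
  have hs : modelDom (extChartAt (𝓡∂ n) p₀ p₀) R =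
    halfProd n ∩ Metric.ball (extChartAt (𝓡∂ n) p₀ p₀, 0) R := modelDom_eq _ _
  refine contDiffOn_of_comp_eq (Φ := F) (s := modelDom (extChartAt (𝓡∂ n) p₀ p₀) R) ?_ ht ?_ ?_ hg
    hmaps hh hcomp
  · rw [hs]
    exact uniqueDiffOn_halfProd.inter Metric.isOpen_ball
  · intro z hz
    refine (M.smooth z hz).mono ?_
    rw [hs]
    exact inter_subset_left
  · intro z hz
    have h1 := M.isInvertible_fderiv hz
    rw [hs] at hz ⊢
    rwa [fderivWithin_inter (Metric.isOpen_ball.mem_nhds hz.2)]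

lemma norm_sub_sub_le {z z' : Model n × CoModel n}
    (hz : z ∈ modelDom (extChartAt (𝓡∂ n) p₀ p₀) R) (hz' : z' ∈ modelDom (extChartAt (𝓡∂ n) p₀ p₀) R) :
    ‖(A.symm : Model (2 * n) →L[ℝ] Model n × CoModel n)‖ * ‖F z - F z' - A (z - z')‖ ≤
      1 / 16 * ‖z - z'‖ := by
  set B := ‖(A.symm : Model (2 * n) →L[ℝ] Model n × CoModel n)‖ with hB
  have hB0 : 0 ≤ B := norm_nonneg (A.symm : Model (2 * n) →L[ℝ] Model n × CoModel n)
  rcases hB0.eq_or_lt with h0 | hpos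
  · rw [← h0, zero_mul]
    positivity
  have h1 := (convex_modelDom (extChartAt (𝓡∂ n) p₀ p₀) R).norm_image_sub_le_of_norm_hasFDerivWithin_le'
    (f := F) (f' := fderivWithin ℝ F (halfProd n))
    (φ := (A : Model n × CoModel n →L[ℝ] Model (2 * n))) (C := 1 / 16 / B) (x := z') (y := z)
    (fun y hy ↦ by
      refine (((M.smooth y hy).differentiableWithinAt (by simp)).hasFDerivWithinAt).mono ?_
      rw [modelDom_eq]
      exact inter_subset_left)
    (fun y hy ↦ by
      rw [le_div_iff₀ hpos]
      exact M.deriv_near y hy) hz' hz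
  calc B * ‖F z - F z' - A (z - z')‖ ≤ B * (1 / 16 / B * ‖z - z'‖) :=
        mul_le_mul_of_nonneg_left h1 hB0
    _ = 1 / 16 * ‖z - z'‖ := by field_simp

lemma injOn : InjOn F (modelDom (extChartAt (𝓡∂ n) p₀ p₀) R) := by
  intro z hz z' hz' h
  have h1 := M.norm_sub_sub_le hz hz'
  have h2 : ‖z - z'‖ ≤ ‖(A.symm : Model (2 * n) →L[ℝ] Model n × CoModel n)‖ * ‖A (z - z')‖ := by
    have := (A.symm : Model (2 * n) →L[ℝ] Model n × CoModel n).le_opNorm (A (z - z'))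
    simpa using this
  rw [h, sub_self, zero_sub, norm_neg] at h1
  have h3 : ‖z - z'‖ ≤ 0 := by linarith [norm_nonneg (z - z')]
  exact sub_eq_zero.1 (norm_le_zero_iff.1 h3)

end LocalModel

end Lift

end LagBdry

namespace LagBdry

section Reparametrization

variable {ι : Type*} {n : ℕ} [NeZero n] {d : ℕ}
  {X : Type*} [TopologicalSpace X] [T2Space X]
  [ChartedSpace (EuclideanSpace ℝ (Fin (2 * n))) X] [IsManifold (𝓡 (2 * n)) ∞ X]
  {K : CalabiYau n X}
  {L : Type*} [TopologicalSpace L] [T2Space L] [CompactSpace L]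
  [ChartedSpace (EuclideanHalfSpace n) L] [IsManifold (𝓡∂ n) ∞ L]
  {G : ι → L → X} {l : Filter ι} {f : L → X}

lemma exists_isPreconnected_nhds {p₀ : L} {V : Set L} (hV : V ∈ 𝓝 p₀) (n : ℕ) [NeZero n]
    [ChartedSpace (EuclideanHalfSpace n) L] [IsManifold (𝓡∂ n) ∞ L] :
    ∃ U ∈ 𝓝 p₀, IsPreconnected U ∧ U ⊆ V := by
  have h1 : (extChartAt (𝓡∂ n) p₀).target ∩ (extChartAt (𝓡∂ n) p₀).symm ⁻¹' V ∈
      𝓝[range (𝓡∂ n)] (extChartAt (𝓡∂ n) p₀ p₀) :=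
    inter_mem (extChartAt_target_mem_nhdsWithin p₀) (tendsto_extChartAt_symm p₀ hV)
  obtain ⟨ρ, hρ, hsub⟩ := exists_halfBall_subset h1
  refine ⟨(extChartAt (𝓡∂ n) p₀).symm '' halfBall (extChartAt (𝓡∂ n) p₀ p₀) ρ, ?_, ?_, ?_⟩
  · refine mem_of_superset (chart_preimage_mem_nhds (halfBall_mem_nhdsWithin (n := n) p₀ hρ)) ?_
    exact fun p hp ↦ ⟨_, hp.2, (extChartAt (𝓡∂ n) p₀).left_inv hp.1⟩
  · exact (convex_halfBall _ _).isPreconnected.image _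
      ((continuousOn_extChartAt_symm p₀).mono fun x hx ↦ (hsub hx).1)
  · rintro _ ⟨x, hx, rfl⟩
    exact (hsub hx).2

/-- Reparametrizations of converging maps converge locally uniformly as soon as they converge
pointwise. -/
lemma C1Tendsto.tendsto_reparametrization (h : C1Tendsto (n := n) G l f)
    (hf : K.IsLagrangianImm f) {ψ : ι → L → L} (hψ : ∀ i, Continuous (ψ i))
    (hG : ∀ i p, G i (ψ i p) = G i p) {p₀ q₀ : L} (hpq : f q₀ = f p₀)
    (hlim : Tendsto (fun i ↦ ψ i p₀) l (𝓝 q₀)) :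
    Tendsto (fun z : ι × L ↦ ψ z.1 z.2) (l ×ˢ 𝓝 p₀) (𝓝 q₀) := by
  intro U hU
  obtain ⟨U₁, hU₁, hinj⟩ := exists_injOn_of_imm hf q₀
  obtain ⟨N, hN, hNcl, hNsub⟩ := exists_mem_nhds_isClosed_subset (inter_mem hU hU₁)
  have hcl : closure (interior N) ⊆ N := closure_minimal interior_subset hNcl
  have hq₀ : q₀ ∈ interior N := mem_interior_iff_mem_nhds.2 hN
  have hFr : IsCompact (closure (interior N) \ interior N) :=
    (isClosed_closure.inter isOpen_interior.isClosed_compl).isCompact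
  have h1 : ∀ᶠ z in l ×ˢ 𝓝 p₀, ∀ q ∈ closure (interior N) \ interior N, G z.1 q ≠ G z.1 z.2 := by
    refine eventually_forall_mem_of_compact hFr fun q hq ↦ ?_
    have hne : f q ≠ f p₀ := by
      intro heq
      have := hinj (hNsub (hcl hq.1)).2 (mem_of_mem_nhds hU₁) (heq.trans hpq.symm)
      exact hq.2 (this ▸ hq₀)
    obtain ⟨V₁, V₂, hV₁, hV₂, hq1, hq2, hdisj⟩ := t2_separation hne
    have h2 : Tendsto (fun z : (ι × L) × L ↦ G z.1.1 z.2) ((l ×ˢ 𝓝 p₀) ×ˢ 𝓝 q) (𝓝 (f q)) :=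
      (h.tendsto q).comp ((tendsto_fst.comp tendsto_fst).prodMk tendsto_snd)
    have h3 : Tendsto (fun z : (ι × L) × L ↦ G z.1.1 z.1.2) ((l ×ˢ 𝓝 p₀) ×ˢ 𝓝 q) (𝓝 (f p₀)) :=
      (h.tendsto p₀).comp tendsto_fst
    filter_upwards [h2 (hV₁.mem_nhds hq1), h3 (hV₂.mem_nhds hq2)] with z hz1 hz2 heq
    have hz3 : G z.1.1 z.2 ∈ V₂ := by
      rw [heq]
      exact hz2
    exact disjoint_left.1 hdisj hz1 hz3
  obtain ⟨t, ht, V₀, hV₀, hsub⟩ := mem_prod_iff.1 h1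
  obtain ⟨V, hV, hVc, hVsub⟩ := exists_isPreconnected_nhds hV₀ n
  have h4 : ∀ᶠ i in l, ψ i p₀ ∈ interior N := hlim (isOpen_interior.mem_nhds hq₀)
  refine mem_map.2 (mem_of_superset (prod_mem_prod (inter_mem ht h4) hV) ?_)
  rintro ⟨i, p⟩ ⟨⟨hit, hi⟩, hp⟩
  have h5 : ψ i '' V ⊆ interior N := by
    refine (hVc.image _ (hψ i).continuousOn).subset_of_closure_inter_subset isOpen_interior
      ⟨ψ i p₀, mem_image_of_mem _ (mem_of_mem_nhds hV), hi⟩ ?_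
    rintro _ ⟨hc, p', hp', rfl⟩
    by_contra hcon
    exact hsub (mk_mem_prod hit (hVsub hp')) _ ⟨hc, hcon⟩ (hG i p')
  exact (hNsub (interior_subset (h5 (mem_image_of_mem _ hp)))).1

lemma continuous_of_tendsto_uniformly [l.NeBot] {ψ : ι → L → L} {ψ₀ : L → L}
    (h : ∀ p, Tendsto (fun z : ι × L ↦ ψ z.1 z.2) (l ×ˢ 𝓝 p) (𝓝 (ψ₀ p))) : Continuous ψ₀ := by
  refine continuous_iff_continuousAt.2 fun p₀ U hU ↦ ?_
  obtain ⟨N, hN, hNcl, hNsub⟩ := exists_mem_nhds_isClosed_subset hU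
  obtain ⟨t, ht, V, hV, hsub⟩ := mem_prod_iff.1 (h p₀ hN)
  refine mem_map.2 (mem_of_superset hV fun p hp ↦ hNsub ?_)
  have h1 : Tendsto (fun i ↦ ψ i p) l (𝓝 (ψ₀ p)) :=
    (h p).comp (tendsto_id.prodMk (tendsto_const_pure.mono_right (pure_le_nhds p)))
  exact hNcl.mem_of_tendsto h1 (mem_of_superset ht fun i hi ↦ hsub (mk_mem_prod hi hp))

lemma tendsto_eval_of_tendsto_uniformly {Y : Type*} [TopologicalSpace Y] {ψ : ι → L → Y} {ψ₀ : L → Y}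
    (h : ∀ p, Tendsto (fun z : ι × L ↦ ψ z.1 z.2) (l ×ˢ 𝓝 p) (𝓝 (ψ₀ p))) {u : ι → L} {p : L}
    (hu : Tendsto u l (𝓝 p)) : Tendsto (fun i ↦ ψ i (u i)) l (𝓝 (ψ₀ p)) :=
  (h p).comp (tendsto_id.prodMk hu)

/-- Limits along ultrafilters of reparametrizations. -/
lemma C1Tendsto.exists_limit_reparametrization {𝒱 : Ultrafilter ι}
    (h : C1Tendsto (n := n) G 𝒱 f) (hf : K.IsLagrangianImm f) {ψ : ι → L → L}
    (hψ : ∀ i, Continuous (ψ i)) (hG : ∀ i p, G i (ψ i p) = G i p) :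
    ∃ ψ₀ : L → L, (∀ p, f (ψ₀ p) = f p) ∧
      ∀ p, Tendsto (fun z : ι × L ↦ ψ z.1 z.2) ((𝒱 : Filter ι) ×ˢ 𝓝 p) (𝓝 (ψ₀ p)) := by
  have hlim : ∀ p, ∃ q, Tendsto (fun i ↦ ψ i p) 𝒱 (𝓝 q) := fun p ↦
    ⟨_, (𝒱.map fun i ↦ ψ i p).le_nhds_lim⟩
  choose ψ₀ hψ₀ using hlim
  have hfψ : ∀ p, f (ψ₀ p) = f p := by
    intro p
    have h1 := tendsto_eval_of_tendsto_uniformly h.tendsto (hψ₀ p)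
    have h2 : Tendsto (fun i ↦ G i p) 𝒱 (𝓝 (f p)) :=
      tendsto_eval_of_tendsto_uniformly h.tendsto tendsto_const_nhds
    exact tendsto_nhds_unique (h1.congr fun i ↦ hG i p) h2
  exact ⟨ψ₀, hfψ, fun p ↦ h.tendsto_reparametrization hf hψ hG (hfψ p) (hψ₀ p)⟩

variable {C : Fin d → Set L} {Λ : Fin d → Set X}
    {D : CovariantDerivative (𝓡 (2 * n)) (EuclideanSpace ℝ (Fin (2 * n)))
      (TangentSpace (𝓡 (2 * n)) : X → Type _)} {a : L → ℝ}

lemma DeformationData.contMDiff_reparametrization (S : DeformationData K C Λ D f a) {ψ : L → L}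
    (hψ : Continuous ψ) (hfψ : ∀ p, f (ψ p) = f p) : ContMDiff (𝓡∂ n) (𝓡∂ n) ∞ ψ := by
  intro p₀
  set q₀ := ψ p₀ with hq₀
  obtain ⟨F, A, R, hR, hM⟩ := S.exists_localModel q₀
  have M := hM R hR le_rfl
  have hp₀ : extChartAt (𝓡∂ n) p₀ p₀ ∈ chartDom (𝓡∂ n) (𝓡 (2 * n)) p₀ (f q₀) f := by
    refine ⟨mem_extChartAt_target p₀, ?_⟩
    rw [mem_preimage, extChartAt_to_inv, mem_preimage, ← hfψ p₀]
    exact mem_extChartAt_source _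
  have h1 : ∀ᶠ x in 𝓝[range (𝓡∂ n)] (extChartAt (𝓡∂ n) p₀ p₀),
      (x ∈ chartDom (𝓡∂ n) (𝓡 (2 * n)) p₀ (f q₀) f) ∧
      ψ ((extChartAt (𝓡∂ n) p₀).symm x) ∈ (extChartAt (𝓡∂ n) q₀).source ∩
        extChartAt (𝓡∂ n) q₀ ⁻¹' halfBall (extChartAt (𝓡∂ n) q₀ q₀) R := by
    refine Filter.Eventually.and (chartDom_mem_nhdsWithin S.imm.1.1.continuous hp₀) ?_
    exact ((hψ.tendsto p₀).comp (tendsto_extChartAt_symm p₀)).eventually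
      (chart_preimage_mem_nhds (halfBall_mem_nhdsWithin q₀ hR))
  obtain ⟨ρ, hρ, hsub⟩ := exists_halfBall_subset h1
  let g : Model n → Model n := fun x ↦ extChartAt (𝓡∂ n) q₀ (ψ ((extChartAt (𝓡∂ n) p₀).symm x))
  have hg : ContinuousOn g (halfBall (extChartAt (𝓡∂ n) p₀ p₀) ρ) := by
    refine (continuousOn_extChartAt q₀).comp (hψ.comp_continuousOn
      ((continuousOn_extChartAt_symm p₀).mono fun x hx ↦ (hsub hx).1.1)) ?_
    exact fun x hx ↦ (hsub hx).2.1
  have hud : UniqueDiffOn ℝ (halfBall (extChartAt (𝓡∂ n) p₀ p₀) ρ) :=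
    (𝓡∂ n).uniqueDiffOn.inter Metric.isOpen_ball
  have hsm : ContDiffOn ℝ ∞ (fun x ↦ (g x, (0 : CoModel n)))
      (halfBall (extChartAt (𝓡∂ n) p₀ p₀) ρ) := by
    refine M.contDiffOn_lift hud (hg.prodMk continuousOn_const) ?_
      ((contDiffOn_chartRep S.imm.1.1).mono fun x hx ↦ (hsub hx).1) ?_
    · exact fun x hx ↦ ⟨(hsub hx).2.2, Metric.mem_ball_self hR⟩
    · intro x hx
      rw [M.zero _ (hsub hx).2.2]
      change chartRep _ _ _ _ _ (extChartAt (𝓡∂ n) q₀ _) = _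
      exact (chartRep_apply (hsub hx).2.1).trans (congrArg (extChartAt _ (f q₀)) (hfψ _))
  refine contMDiffAt_of_chart (y₀ := q₀) (h := g) (mem_extChartAt_source p₀) ?_ ?_
  · filter_upwards [halfBall_mem_nhdsWithin p₀ hρ] with x hx
    exact ⟨(extChartAt (𝓡∂ n) q₀).map_source (hsub hx).2.1,
      ((extChartAt (𝓡∂ n) q₀).left_inv (hsub hx).2.1).symm⟩
  · exact (contDiff_fst.contDiffOn.comp hsm (mapsTo_univ _ _) _
      ⟨mem_range_extChartAt p₀, Metric.mem_ball_self hρ⟩).mono_of_mem_nhdsWithin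
      (halfBall_mem_nhdsWithin p₀ hρ)

lemma isClosed_boundary_component (p : L) :
    IsClosed (connectedComponentIn ((𝓡∂ n).boundary L) p) := by
  by_cases hp : p ∈ (𝓡∂ n).boundary L
  · rw [connectedComponentIn_eq_image hp]
    have hcl : IsClosed ((𝓡∂ n).boundary L) :=
      ModelWithCorners.isClosed_boundary (I := 𝓡∂ n) (n := ∞) (by simp)
    exact hcl.isClosedEmbedding_subtypeVal.isClosedMap _ isClosed_connectedComponent
  · rw [connectedComponentIn_eq_empty hp]
    exact isClosed_empty

lemma isFree_symm {g : L → X} {ψ : L ≃ₘ^∞⟮𝓡∂ n, 𝓡∂ n⟯ L} (h : g ∘ ψ = g) (p : L) :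
    g (ψ.symm p) = g p := by
  have := congrFun h (ψ.symm p)
  rw [Function.comp_apply, ψ.apply_symm_apply] at this
  exact this.symm

/-- Freeness is an open condition. -/
theorem C1Tendsto.eventually_isFree (h : C1Tendsto (n := n) G l f)
    (S : DeformationData K C Λ D f a) : ∀ᶠ i in l, IsFree n (G i) := by
  by_contra hcon
  have hne : (l ⊓ 𝓟 {i | ¬ IsFree n (G i)}).NeBot :=
    frequently_iff_neBot.1 (not_eventually.1 hcon)
  set 𝒱 := Ultrafilter.of (l ⊓ 𝓟 {i | ¬ IsFree n (G i)}) with h𝒱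
  have hle : (𝒱 : Filter ι) ≤ l ⊓ 𝓟 {i | ¬ IsFree n (G i)} := Ultrafilter.of_le _
  have hbad : ∀ᶠ i in (𝒱 : Filter ι), ¬ IsFree n (G i) := (le_principal_iff.1 (hle.trans inf_le_right))
  have h' := h.mono (hle.trans inf_le_left)
  have hex : ∀ i, ∃ ψ ∈ Diff n L, G i ∘ ψ = G i ∧ (¬ IsFree n (G i) → ∃ p, ψ p ≠ p) := by
    intro i
    by_cases hi : IsFree n (G i)
    · exact ⟨Diffeomorph.refl _ _ _, fun p _ x hx ↦ hx, rfl, fun h ↦ absurd hi h⟩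
    · rw [IsFree] at hi
      push Not at hi
      obtain ⟨ψ, hψ, hG, p, hp⟩ := hi
      exact ⟨ψ, hψ, hG, fun _ ↦ ⟨p, hp⟩⟩
  choose ψ hψ hGψ hψne using hex
  obtain ⟨ψ₀, hfψ₀, hlim⟩ := h'.exists_limit_reparametrization S.imm (ψ := fun i ↦ ψ i)
    (fun i ↦ (ψ i).continuous) fun i p ↦ congrFun (hGψ i) p
  obtain ⟨ψ₁, hfψ₁, hlim₁⟩ := h'.exists_limit_reparametrization S.imm (ψ := fun i ↦ (ψ i).symm)
    (fun i ↦ (ψ i).symm.continuous) fun i p ↦ isFree_symm (hGψ i) p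
  have hpt : ∀ p, Tendsto (fun i ↦ ψ i p) 𝒱 (𝓝 (ψ₀ p)) := fun p ↦
    tendsto_eval_of_tendsto_uniformly hlim tendsto_const_nhds
  have hpt₁ : ∀ p, Tendsto (fun i ↦ (ψ i).symm p) 𝒱 (𝓝 (ψ₁ p)) := fun p ↦
    tendsto_eval_of_tendsto_uniformly hlim₁ tendsto_const_nhds
  let Ψ : L ≃ₘ^∞⟮𝓡∂ n, 𝓡∂ n⟯ L :=
    { toFun := ψ₀
      invFun := ψ₁
      left_inv := fun p ↦ by
        have h1 := tendsto_eval_of_tendsto_uniformly (ψ := fun i ↦ ⇑(ψ i).symm) hlim₁ (hpt p)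
        simp only [Diffeomorph.symm_apply_apply] at h1
        exact tendsto_nhds_unique h1 tendsto_const_nhds
      right_inv := fun p ↦ by
        have h1 := tendsto_eval_of_tendsto_uniformly (ψ := fun i ↦ ⇑(ψ i)) hlim (hpt₁ p)
        simp only [Diffeomorph.apply_symm_apply] at h1
        exact tendsto_nhds_unique h1 tendsto_const_nhds
      contMDiff_toFun := S.contMDiff_reparametrization (ψ := ψ₀)
        (continuous_of_tendsto_uniformly (ψ := fun i ↦ ⇑(ψ i)) hlim) hfψ₀
      contMDiff_invFun := S.contMDiff_reparametrization (ψ := ψ₁)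
        (continuous_of_tendsto_uniformly (ψ := fun i ↦ ⇑(ψ i).symm) hlim₁) hfψ₁ }
  have hΨ : Ψ ∈ Diff n L := by
    intro p hp x hx
    exact (isClosed_boundary_component p).mem_of_tendsto (hpt x)
      (Eventually.of_forall fun i ↦ hψ i p hp hx)
  have hid : ∀ p, ψ₀ p = p := S.free Ψ hΨ (funext hfψ₀)
  have hev : ∀ᶠ i in (𝒱 : Filter ι), ∀ p, ψ i p = p := by
    refine eventually_forall_of_compact fun p₀ ↦ ?_
    obtain ⟨U, hU, hinj⟩ := h'.exists_injOn S.imm p₀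
    have h1 := hlim p₀
    rw [hid p₀] at h1
    filter_upwards [h1 hU, hinj.prod_mk hU] with z hz1 hz2
    exact hz2.1 hz1 hz2.2 (congrFun (hGψ z.1) z.2)
  obtain ⟨i, hi1, hi2⟩ := (hev.and hbad).exists
  obtain ⟨p, hp⟩ := hψne i hi2
  exact hp (hi1 p)

end Reparametrization

end LagBdry

namespace LagBdry

section HalfSpaceSolution

variable {n : ℕ} [NeZero n]

/-- The nearest point retraction onto the half space. -/
noncomputable def halfRetract (x : Model n) : Model n :=
  x + (max (x 0) 0 - x 0) • EuclideanSpace.single 0 1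

lemma halfRetract_zero (x : Model n) : halfRetract x 0 = max (x 0) 0 := by
  simp [halfRetract]

lemma halfRetract_of_ne (x : Model n) {j : Fin n} (hj : j ≠ 0) : halfRetract x j = x j := by
  simp [halfRetract, hj]

lemma halfRetract_mem (x : Model n) : halfRetract x ∈ range (𝓡∂ n) := by
  rw [mem_range_halfSpace, halfRetract_zero]
  exact le_max_right _ _

lemma halfRetract_of_mem {x : Model n} (hx : x ∈ range (𝓡∂ n)) : halfRetract x = x := by
  rw [mem_range_halfSpace] at hx
  simp [halfRetract, hx]

lemma norm_le_of_forall_abs_le {x y : Model n} (h : ∀ j, |x j| ≤ |y j|) : ‖x‖ ≤ ‖y‖ := by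
  rw [EuclideanSpace.norm_eq, EuclideanSpace.norm_eq]
  refine Real.sqrt_le_sqrt (Finset.sum_le_sum fun j _ ↦ ?_)
  exact pow_le_pow_left₀ (norm_nonneg _) (h j) 2

lemma abs_apply_le (x : Model n) (j : Fin n) : |x j| ≤ ‖x‖ := PiLp.norm_apply_le x j

lemma norm_halfRetract_sub_le (x y : Model n) : ‖halfRetract x - halfRetract y‖ ≤ ‖x - y‖ := by
  refine norm_le_of_forall_abs_le fun j ↦ ?_
  rw [PiLp.sub_apply, PiLp.sub_apply]
  by_cases hj : j = 0
  · subst hj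
    rw [halfRetract_zero, halfRetract_zero]
    exact abs_max_sub_max_le_abs _ _ _
  · rw [halfRetract_of_ne x hj, halfRetract_of_ne y hj]

variable {Z : Type*} [NormedAddCommGroup Z] [NormedSpace ℝ Z]

/-- The extension of a map from a half space to the whole space, by a translation of the normal
coordinate. -/
noncomputable def halfExtend (H : Model n × Z → Model n × Z) (z : Model n × Z) : Model n × Z :=
  H (halfRetract z.1, z.2) + (z.1 - halfRetract z.1, 0)

lemma halfExtend_of_mem (H : Model n × Z → Model n × Z) {z : Model n × Z}
    (hz : z.1 ∈ range (𝓡∂ n)) : halfExtend H z = H z := by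
  rw [halfExtend, halfRetract_of_mem hz, sub_self, Prod.mk_zero_zero, add_zero]

variable {H : Model n × Z → Model n × Z} {x₀ : Model n} {R : ℝ} {c : ℝ}

lemma norm_halfExtend_sub_sub_le (hc : 0 ≤ c) (hx₀ : x₀ ∈ range (𝓡∂ n))
    (hH : ∀ z ∈ halfBall x₀ R ×ˢ Metric.ball (0 : Z) R,
      ∀ z' ∈ halfBall x₀ R ×ˢ Metric.ball (0 : Z) R, ‖H z - H z' - (z - z')‖ ≤ c * ‖z - z'‖)
    {z z' : Model n × Z} (hz : z ∈ Metric.ball (x₀, 0) R) (hz' : z' ∈ Metric.ball (x₀, 0) R) :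
    ‖halfExtend H z - halfExtend H z' - (z - z')‖ ≤ c * ‖z - z'‖ := by
  have hmem : ∀ w : Model n × Z, w ∈ Metric.ball (x₀, 0) R →
      (halfRetract w.1, w.2) ∈ halfBall x₀ R ×ˢ Metric.ball (0 : Z) R := by
    intro w hw
    rw [← ball_prod_same] at hw
    refine ⟨⟨halfRetract_mem _, ?_⟩, hw.2⟩
    rw [mem_ball_iff_norm]
    have h1 := norm_halfRetract_sub_le w.1 x₀
    rw [halfRetract_of_mem hx₀] at h1
    exact h1.trans_lt (mem_ball_iff_norm.1 hw.1)
  have h1 := hH _ (hmem z hz) _ (hmem z' hz')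
  have h2 : halfExtend H z - halfExtend H z' - (z - z') =
      H (halfRetract z.1, z.2) - H (halfRetract z'.1, z'.2) -
        ((halfRetract z.1, z.2) - (halfRetract z'.1, z'.2)) := by
    obtain ⟨x, ζ⟩ := z
    obtain ⟨x', ζ'⟩ := z'
    simp only [halfExtend]
    ext1
    · simp
      abel
    · simp
  rw [h2]
  refine h1.trans (mul_le_mul_of_nonneg_left ?_ hc)
  rw [Prod.norm_def, Prod.norm_def]
  exact max_le_max (norm_halfRetract_sub_le _ _) le_rfl

lemma halfExtend_injOn (hx₀ : x₀ ∈ range (𝓡∂ n))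
    (hH : ∀ z ∈ halfBall x₀ R ×ˢ Metric.ball (0 : Z) R,
      ∀ z' ∈ halfBall x₀ R ×ˢ Metric.ball (0 : Z) R, ‖H z - H z' - (z - z')‖ ≤ 1 / 2 * ‖z - z'‖) :
    InjOn (halfExtend H) (Metric.ball (x₀, 0) R) := by
  intro z hz z' hz' h
  have h1 := norm_halfExtend_sub_sub_le (by norm_num) hx₀ hH hz hz'
  rw [h, sub_self, zero_sub, norm_neg] at h1
  have h2 : ‖z - z'‖ ≤ 0 := by linarith [norm_nonneg (z - z')]
  exact sub_eq_zero.1 (norm_le_zero_iff.1 h2)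

lemma exists_halfExtend_eq [CompleteSpace Z] (hx₀ : x₀ ∈ range (𝓡∂ n))
    (hH : ∀ z ∈ halfBall x₀ R ×ˢ Metric.ball (0 : Z) R,
      ∀ z' ∈ halfBall x₀ R ×ˢ Metric.ball (0 : Z) R, ‖H z - H z' - (z - z')‖ ≤ 1 / 2 * ‖z - z'‖)
    {η : ℝ} (hη : 0 ≤ η) (hηR : η < R) {y : Model n × Z} (hy : ‖y - H (x₀, 0)‖ ≤ 1 / 2 * η) :
    ∃ z ∈ Metric.closedBall (x₀, (0 : Z)) η, halfExtend H z = y := by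
  have happ : ApproximatesLinearOn (halfExtend H) (ContinuousLinearMap.id ℝ (Model n × Z))
      (Metric.closedBall (x₀, 0) η) (1 / 2) := by
    intro z hz z' hz'
    have h1 := norm_halfExtend_sub_sub_le (by norm_num) hx₀ hH
      (Metric.closedBall_subset_ball hηR hz) (Metric.closedBall_subset_ball hηR hz')
    simpa using h1
  let N : (ContinuousLinearMap.id ℝ (Model n × Z)).NonlinearRightInverse :=
    ⟨id, 1, fun y ↦ by simp, fun y ↦ rfl⟩
  have h2 := happ.surjOn_closedBall_of_nonlinearRightInverse N hη subset_rfl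
  have h3 : y ∈ Metric.closedBall (halfExtend H (x₀, 0))
      ((((N.nnnorm : ℝ))⁻¹ - ((1 / 2 : NNReal) : ℝ)) * η) := by
    rw [halfExtend_of_mem H hx₀, mem_closedBall_iff_norm]
    refine hy.trans (le_of_eq ?_)
    change 1 / 2 * η = (((1 : NNReal) : ℝ)⁻¹ - ((1 / 2 : NNReal) : ℝ)) * η
    norm_num
  obtain ⟨z, hz, hzy⟩ := h2 h3
  exact ⟨z, hz, hzy⟩

/-- Comparison of two approximate linearizations. -/
lemma norm_sub_le_of_approx {V W : Type*} [NormedAddCommGroup V] [NormedAddCommGroup W]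
    {u h w : V} {v : W} (h1 : ‖h - u‖ ≤ 1 / 16 * ‖u‖) (h2 : ‖h - w‖ ≤ 1 / 16 * ‖v‖)
    (hw : ‖w‖ = ‖v‖) : ‖u - w‖ ≤ 1 / 4 * ‖v‖ := by
  have h3 : ‖u - w‖ ≤ ‖h - u‖ + ‖h - w‖ := by
    have : u - w = (h - w) - (h - u) := by abel
    rw [this, add_comm]
    exact norm_sub_le _ _
  have h4 : ‖u‖ ≤ ‖u - w‖ + ‖w‖ := by
    have := norm_add_le (u - w) w
    rwa [sub_add_cancel] at this
  have := norm_nonneg v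
  linarith

end HalfSpaceSolution

section LiftExistence

variable {ι : Type*} {n : ℕ} [NeZero n] {d : ℕ}
  {X : Type*} [TopologicalSpace X]
  [ChartedSpace (EuclideanSpace ℝ (Fin (2 * n))) X] [IsManifold (𝓡 (2 * n)) ∞ X]
  {K : CalabiYau n X}
  {L : Type*} [TopologicalSpace L]
  [ChartedSpace (EuclideanHalfSpace n) L] [IsManifold (𝓡∂ n) ∞ L]
  {G : ι → L → X} {l : Filter ι}
  {f : L → X} {C : Fin d → Set L} {Λ : Fin d → Set X}
  {D : CovariantDerivative (𝓡 (2 * n)) (EuclideanSpace ℝ (Fin (2 * n)))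
      (TangentSpace (𝓡 (2 * n)) : X → Type _)} {a : L → ℝ}
  {p₀ : L} {F : Model n × CoModel n → Model (2 * n)}
  {A : (Model n × CoModel n) ≃L[ℝ] Model (2 * n)} {R : ℝ}

namespace LocalModel

lemma norm_symm_sub_sub_le (M : LocalModel K C Λ D f a p₀ F A R) {z z' : Model n × CoModel n}
    (hz : z ∈ modelDom (extChartAt (𝓡∂ n) p₀ p₀) R)
    (hz' : z' ∈ modelDom (extChartAt (𝓡∂ n) p₀ p₀) R) :
    ‖A.symm (F z) - A.symm (F z') - (z - z')‖ ≤ 1 / 16 * ‖z - z'‖ := by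
  refine le_trans ?_ (M.norm_sub_sub_le hz hz')
  have h1 : A.symm (F z) - A.symm (F z') - (z - z') = A.symm (F z - F z' - A (z - z')) := by
    rw [map_sub, map_sub, A.symm_apply_apply]
  rw [h1]
  exact (A.symm : Model (2 * n) →L[ℝ] Model n × CoModel n).le_opNorm _

lemma exists_approx (M : LocalModel K C Λ D f a p₀ F A R) (h : C1Tendsto (n := n) G l f) :
    ∃ ρ > 0, ∀ᶠ i in l, ∀ x ∈ halfBall (extChartAt (𝓡∂ n) p₀ p₀) ρ,
      x ∈ chartDom (𝓡∂ n) (𝓡 (2 * n)) p₀ (f p₀) (G i) ∧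
      ∀ x' ∈ halfBall (extChartAt (𝓡∂ n) p₀ p₀) ρ,
        ‖A.symm (chartRep (𝓡∂ n) (𝓡 (2 * n)) p₀ (f p₀) (G i) x) -
          A.symm (chartRep (𝓡∂ n) (𝓡 (2 * n)) p₀ (f p₀) (G i) x') -
          (x - x', (0 : CoModel n))‖ ≤ 1 / 16 * ‖x - x'‖ := by
  set B := ‖(A.symm : Model (2 * n) →L[ℝ] Model n × CoModel n)‖ with hB
  have hB0 : 0 ≤ B := norm_nonneg (A.symm : Model (2 * n) →L[ℝ] Model n × CoModel n)
  obtain ⟨ρ, hρ, h1⟩ := h.exists_approx p₀ (ε := 1 / (16 * (B + 1))) (by positivity)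
  refine ⟨ρ, hρ, h1.mono fun i hi x hx ↦ ⟨(hi x hx).1, fun x' hx' ↦ ?_⟩⟩
  have h2 := (hi x hx).2 x' hx'
  have h3 : A (x - x', 0) = immDeriv f p₀ (extChartAt (𝓡∂ n) p₀ p₀) (x - x') := by
    rw [M.apply, map_zero, add_zero]
  rw [← h3] at h2
  rw [← map_sub, ← A.symm_apply_apply (x - x', 0), ← map_sub]
  refine ((A.symm : Model (2 * n) →L[ℝ] Model n × CoModel n).le_opNorm _).trans ?_
  refine (mul_le_mul_of_nonneg_left h2 hB0).trans ?_
  rw [← mul_assoc]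
  refine mul_le_mul_of_nonneg_right ?_ (norm_nonneg _)
  rw [mul_one_div, div_le_div_iff₀ (by positivity) (by norm_num)]
  linarith

/-- Solutions `z` of `F z = g x` depend on `x` almost as the inclusion. -/
lemma exists_lift_approx (M : LocalModel K C Λ D f a p₀ F A R) (h : C1Tendsto (n := n) G l f) :
    ∃ ρ > 0, ∀ᶠ i in l, ∀ x ∈ halfBall (extChartAt (𝓡∂ n) p₀ p₀) ρ,
      x ∈ chartDom (𝓡∂ n) (𝓡 (2 * n)) p₀ (f p₀) (G i) ∧
      ∀ x' ∈ halfBall (extChartAt (𝓡∂ n) p₀ p₀) ρ,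
      ∀ z ∈ Metric.ball (extChartAt (𝓡∂ n) p₀ p₀, (0 : CoModel n)) R,
      ∀ z' ∈ Metric.ball (extChartAt (𝓡∂ n) p₀ p₀, (0 : CoModel n)) R,
        halfExtend (A.symm ∘ F) z = A.symm (chartRep (𝓡∂ n) (𝓡 (2 * n)) p₀ (f p₀) (G i) x) →
        halfExtend (A.symm ∘ F) z' = A.symm (chartRep (𝓡∂ n) (𝓡 (2 * n)) p₀ (f p₀) (G i) x') →
        ‖z - z' - (x - x', (0 : CoModel n))‖ ≤ 1 / 4 * ‖x - x'‖ := by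
  obtain ⟨ρ, hρ, h1⟩ := M.exists_approx h
  refine ⟨ρ, hρ, h1.mono fun i hi x hx ↦ ⟨(hi x hx).1, fun x' hx' z hz z' hz' hzx hzx' ↦ ?_⟩⟩
  have h2 := (hi x hx).2 x' hx'
  rw [← hzx, ← hzx'] at h2
  refine norm_sub_le_of_approx ?_ h2 ?_
  · exact norm_halfExtend_sub_sub_le (by norm_num) (mem_range_extChartAt p₀)
      (fun w hw w' hw' ↦ M.norm_symm_sub_sub_le hw hw') hz hz'
  · rw [Prod.norm_def, norm_zero]
    exact max_eq_left (norm_nonneg _)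

lemma halfExtend_injOn (M : LocalModel K C Λ D f a p₀ F A R) :
    InjOn (halfExtend (A.symm ∘ F)) (Metric.ball (extChartAt (𝓡∂ n) p₀ p₀, (0 : CoModel n)) R) := by
  refine LagBdry.halfExtend_injOn (mem_range_extChartAt p₀) fun w hw w' hw' ↦ ?_
  refine (M.norm_symm_sub_sub_le hw hw').trans ?_
  exact mul_le_mul_of_nonneg_right (by norm_num) (norm_nonneg _)

lemma eventually_exists_halfExtend (M : LocalModel K C Λ D f a p₀ F A R)
    (h : C1Tendsto (n := n) G l f) {η : ℝ} (hη : 0 < η) (hηR : η < R) :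
    ∀ᶠ w in l ×ˢ 𝓝[range (𝓡∂ n)] (extChartAt (𝓡∂ n) p₀ p₀),
      ∃ z ∈ Metric.closedBall (extChartAt (𝓡∂ n) p₀ p₀, (0 : CoModel n)) η,
        halfExtend (A.symm ∘ F) z =
          A.symm (chartRep (𝓡∂ n) (𝓡 (2 * n)) p₀ (f p₀) (G w.1) w.2) := by
  have hx₀ : extChartAt (𝓡∂ n) p₀ p₀ ∈ halfBall (extChartAt (𝓡∂ n) p₀ p₀) R :=
    ⟨mem_range_extChartAt p₀, Metric.mem_ball_self M.pos⟩
  have h1 := (A.symm.continuous.tendsto _).comp (h.tendsto_chartRep p₀)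
  have h2 : F (extChartAt (𝓡∂ n) p₀ p₀, 0) = extChartAt (𝓡 (2 * n)) (f p₀) (f p₀) := by
    rw [M.zero _ hx₀]
    exact chartRep_apply (mem_extChartAt_source p₀)
  rw [← h2] at h1
  filter_upwards [h1 (Metric.ball_mem_nhds _ (half_pos hη))] with w hw
  refine exists_halfExtend_eq (mem_range_extChartAt p₀) (fun w hw w' hw' ↦ ?_) hη.le hηR ?_
  · refine (M.norm_symm_sub_sub_le hw hw').trans ?_
    exact mul_le_mul_of_nonneg_right (by norm_num) (norm_nonneg _)
  · have := (mem_ball_iff_norm.1 hw).le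
    refine this.trans (le_of_eq (by ring))

/-- The projection to the boundary hyperplane. -/
lemma tendsto_boundary_projection (hp₀ : extChartAt (𝓡∂ n) p₀ p₀ 0 = 0) :
    Tendsto (fun x : Model n ↦ x - x 0 • EuclideanSpace.single 0 1)
      (𝓝[range (𝓡∂ n)] (extChartAt (𝓡∂ n) p₀ p₀))
      (𝓝[range (𝓡∂ n)] (extChartAt (𝓡∂ n) p₀ p₀)) := by
  refine tendsto_nhdsWithin_iff.2 ⟨?_, Eventually.of_forall fun x ↦ ?_⟩
  · have h1 : Continuous fun x : Model n ↦ x - x 0 • (EuclideanSpace.single 0 1 : Model n) := by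
      fun_prop
    have h2 := h1.tendsto (extChartAt (𝓡∂ n) p₀ p₀)
    rw [hp₀, zero_smul, sub_zero] at h2
    exact h2.mono_left nhdsWithin_le_nhds
  · rw [mem_range_halfSpace]
    simp

lemma eventually_boundary_lift (M : LocalModel K C Λ D f a p₀ F A R) (hC : IsBoundaryOrdering n C)
    (h : C1Tendsto (n := n) G l f)
    (hG : ∀ᶠ i in l, ∀ j, ∀ p ∈ C j, G i p ∈ Λ j) :
    ∀ᶠ w in l ×ˢ 𝓝[range (𝓡∂ n)] (extChartAt (𝓡∂ n) p₀ p₀), w.2 0 = 0 →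
      ∃ z ∈ modelDom (extChartAt (𝓡∂ n) p₀ p₀) R, z.1 0 = 0 ∧ IsConormal z.2 ∧
        F z = chartRep (𝓡∂ n) (𝓡 (2 * n)) p₀ (f p₀) (G w.1) w.2 := by
  obtain ⟨r, hr, hlift⟩ := M.boundary_lift
  have hdom : ∀ᶠ x in 𝓝[range (𝓡∂ n)] (extChartAt (𝓡∂ n) p₀ p₀),
      x ∈ (extChartAt (𝓡∂ n) p₀).target ∧ x ∈ halfBall (extChartAt (𝓡∂ n) p₀ p₀) R :=
    Filter.Eventually.and (extChartAt_target_mem_nhdsWithin p₀)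
      (halfBall_mem_nhdsWithin (n := n) p₀ M.pos)
  have hmem : Tendsto (fun w : ι × Model n ↦ G w.1 ((extChartAt (𝓡∂ n) p₀).symm w.2))
      (l ×ˢ 𝓝[range (𝓡∂ n)] (extChartAt (𝓡∂ n) p₀ p₀)) (𝓝 (f p₀)) :=
    (h.tendsto p₀).comp (tendsto_fst.prodMk ((tendsto_extChartAt_symm (n := n) p₀).comp tendsto_snd))
  filter_upwards [h.tendsto_chartRep p₀ (Metric.ball_mem_nhds _ hr), hG.prod_mk hdom,
    hmem (extChartAt_source_mem_nhds (I := 𝓡 (2 * n)) (f p₀))]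
    with ⟨i, x⟩ hx1 hx2 hx3 hx0
  obtain ⟨hi, hxt, hxR⟩ := hx2
  have hps := (extChartAt (𝓡∂ n) p₀).map_target hxt
  have hcx := (extChartAt (𝓡∂ n) p₀).right_inv hxt
  have hpb : (extChartAt (𝓡∂ n) p₀).symm x ∈ (𝓡∂ n).boundary L := by
    rw [mem_boundary_iff hps, hcx]
    exact hx0
  obtain ⟨j, hj⟩ := hC.exists_mem hpb
  have hj₀ := M.component j _ hj hps (by rw [hcx]; exact hxR)
  refine hlift j hj₀ _ hx1 ?_
  have h1 : (extChartAt (𝓡 (2 * n)) (f p₀)).symm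
      (chartRep (𝓡∂ n) (𝓡 (2 * n)) p₀ (f p₀) (G i) x) = G i ((extChartAt (𝓡∂ n) p₀).symm x) :=
    (extChartAt (𝓡 (2 * n)) (f p₀)).left_inv hx3
  have h2 := hi j _ hj
  rw [← h1] at h2
  exact h2

lemma eventually_exists_lift_of_interior (M : LocalModel K C Λ D f a p₀ F A R)
    (h : C1Tendsto (n := n) G l f) (hp₀ : 0 < extChartAt (𝓡∂ n) p₀ p₀ 0) {η : ℝ} (hη : 0 < η)
    (hηR : η ≤ R) :
    ∀ᶠ w in l ×ˢ 𝓝[range (𝓡∂ n)] (extChartAt (𝓡∂ n) p₀ p₀),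
      0 < w.2 0 ∧ ∃ z ∈ modelDom (extChartAt (𝓡∂ n) p₀ p₀) η,
        F z = chartRep (𝓡∂ n) (𝓡 (2 * n)) p₀ (f p₀) (G w.1) w.2 ∧ 0 < z.1 0 := by
  have hδ : 0 < min η (extChartAt (𝓡∂ n) p₀ p₀ 0) := lt_min hη hp₀
  have h1 := M.eventually_exists_halfExtend h (half_pos hδ)
    ((half_lt_self hδ).trans_le ((min_le_left _ _).trans hηR))
  have h2 : ∀ᶠ x in 𝓝[range (𝓡∂ n)] (extChartAt (𝓡∂ n) p₀ p₀), 0 < x 0 := by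
    have hc : Continuous fun x : Model n ↦ x 0 := by fun_prop
    exact nhdsWithin_le_nhds ((hc.tendsto _).eventually (lt_mem_nhds hp₀))
  filter_upwards [h1, tendsto_snd.eventually h2] with w ⟨z, hz, hzw⟩ hw0
  have hz' := Metric.closedBall_subset_ball (half_lt_self hδ) hz
  rw [← ball_prod_same] at hz'
  have hz0 : 0 < z.1 0 := by
    have h3 := (abs_apply_le (z.1 - extChartAt (𝓡∂ n) p₀ p₀) 0).trans_lt (mem_ball_iff_norm.1 hz'.1)
    rw [PiLp.sub_apply] at h3
    have h4 := (abs_lt.1 (h3.trans_le (min_le_right _ _))).1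
    linarith
  have hzr : z.1 ∈ range (𝓡∂ n) := mem_range_halfSpace.2 hz0.le
  rw [halfExtend_of_mem _ hzr] at hzw
  refine ⟨hw0, z, ⟨⟨hzr, Metric.ball_subset_ball (min_le_left _ _) hz'.1⟩,
    Metric.ball_subset_ball (min_le_left _ _) hz'.2⟩, A.symm.injective hzw, hz0⟩

lemma eventually_exists_lift_of_boundary (M : LocalModel K C Λ D f a p₀ F A R)
    (hC : IsBoundaryOrdering n C) (h : C1Tendsto (n := n) G l f)
    (hG : ∀ᶠ i in l, ∀ j, ∀ p ∈ C j, G i p ∈ Λ j) (hp₀ : extChartAt (𝓡∂ n) p₀ p₀ 0 = 0)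
    {η : ℝ} (hη : 0 < η) (hηR : η ≤ R) :
    ∀ᶠ w in l ×ˢ 𝓝[range (𝓡∂ n)] (extChartAt (𝓡∂ n) p₀ p₀),
      ∃ z ∈ modelDom (extChartAt (𝓡∂ n) p₀ p₀) η,
        F z = chartRep (𝓡∂ n) (𝓡 (2 * n)) p₀ (f p₀) (G w.1) w.2 ∧
        (w.2 0 = 0 → z.1 0 = 0 ∧ IsConormal z.2) ∧ (0 < w.2 0 → 0 < z.1 0) := by
  have h1 := M.eventually_exists_halfExtend h (half_pos hη) ((half_lt_self hη).trans_le hηR)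
  have h2 := M.eventually_boundary_lift hC h hG
  have h3 : Tendsto (fun w : ι × Model n ↦ (w.1, w.2 - w.2 0 • (EuclideanSpace.single 0 1 : Model n)))
      (l ×ˢ 𝓝[range (𝓡∂ n)] (extChartAt (𝓡∂ n) p₀ p₀))
      (l ×ˢ 𝓝[range (𝓡∂ n)] (extChartAt (𝓡∂ n) p₀ p₀)) :=
    tendsto_fst.prodMk ((tendsto_boundary_projection hp₀).comp tendsto_snd)
  obtain ⟨ρ, hρ, h4⟩ := M.exists_lift_approx h
  have h5 : ∀ᶠ w in l ×ˢ 𝓝[range (𝓡∂ n)] (extChartAt (𝓡∂ n) p₀ p₀),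
      w.2 ∈ halfBall (extChartAt (𝓡∂ n) p₀ p₀) ρ :=
    tendsto_snd.eventually (halfBall_mem_nhdsWithin (n := n) p₀ hρ)
  filter_upwards [h1, h2, h3.eventually h2, h5, h3.eventually h5, tendsto_fst.eventually h4,
    tendsto_snd.eventually (self_mem_nhdsWithin (s := range (𝓡∂ n)))]
    with ⟨i, x⟩ ⟨z, hz, hzx⟩ hb hb' hxρ hxρ' hi hxr
  have hzη := Metric.closedBall_subset_ball (half_lt_self hη) hz
  have hzR := Metric.ball_subset_ball hηR hzη
  have hfin : z.1 ∈ range (𝓡∂ n) → z ∈ modelDom (extChartAt (𝓡∂ n) p₀ p₀) η ∧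
      F z = chartRep (𝓡∂ n) (𝓡 (2 * n)) p₀ (f p₀) (G i) x := by
    intro hzr
    rw [halfExtend_of_mem _ hzr] at hzx
    refine ⟨?_, A.symm.injective hzx⟩
    rw [modelDom_eq]
    exact ⟨⟨hzr, mem_univ _⟩, hzη⟩
  have hlift : ∀ z' ∈ modelDom (extChartAt (𝓡∂ n) p₀ p₀) R, ∀ x',
      F z' = chartRep (𝓡∂ n) (𝓡 (2 * n)) p₀ (f p₀) (G i) x' →
      z' ∈ Metric.ball (extChartAt (𝓡∂ n) p₀ p₀, (0 : CoModel n)) R ∧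
      halfExtend (A.symm ∘ F) z' = A.symm (chartRep (𝓡∂ n) (𝓡 (2 * n)) p₀ (f p₀) (G i) x') := by
    intro z' hz' x' hx'
    refine ⟨?_, ?_⟩
    · rw [modelDom_eq] at hz'
      exact hz'.2
    · rw [halfExtend_of_mem _ hz'.1.1, Function.comp_apply, hx']
  rcases (mem_range_halfSpace.1 hxr).eq_or_lt with hx0 | hx0
  · obtain ⟨z', hz', hz'0, hz'c, hz'x⟩ := hb hx0.symm
    have h6 := hlift z' hz' x hz'x
    have h7 : z = z' := M.halfExtend_injOn hzR h6.1 (hzx.trans h6.2.symm)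
    subst h7
    obtain ⟨h8, h9⟩ := hfin hz'.1.1
    exact ⟨z, h8, h9, fun _ ↦ ⟨hz'0, hz'c⟩, fun h ↦ absurd hx0 h.ne⟩
  · obtain ⟨z', hz', hz'0, -, hz'x⟩ := hb' (by simp)
    have h6 := hlift z' hz' _ hz'x
    have h7 := (hi x hxρ).2 _ hxρ' z hzR z' h6.1 hzx h6.2
    have h8 : x - (x - x 0 • (EuclideanSpace.single 0 1 : Model n)) =
      x 0 • (EuclideanSpace.single 0 1 : Model n) := by abel
    rw [h8, norm_smul, PiLp.norm_single, norm_one, mul_one, Real.norm_of_nonneg hx0.le] at h7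
    have h9 := ((abs_apply_le _ 0).trans (norm_fst_le _)).trans h7
    have h10 : z.1 0 - 0 - x 0 = (z - z' - (x 0 • (EuclideanSpace.single 0 1 : Model n),
        (0 : CoModel n))).1 0 := by
      simp [hz'0]
    rw [← h10] at h9
    have hz0 : 0 < z.1 0 := by
      have := (abs_le.1 h9).1
      linarith
    obtain ⟨h11, h12⟩ := hfin (mem_range_halfSpace.2 hz0.le)
    exact ⟨z, h11, h12, fun h ↦ absurd h hx0.ne', fun _ ↦ hz0⟩

/-- Maps close to `f` with boundary conditions factor locally through the local model. -/
theorem eventually_exists_lift (M : LocalModel K C Λ D f a p₀ F A R)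
    (hC : IsBoundaryOrdering n C) (h : C1Tendsto (n := n) G l f)
    (hG : ∀ᶠ i in l, ∀ j, ∀ p ∈ C j, G i p ∈ Λ j) {η : ℝ} (hη : 0 < η) (hηR : η ≤ R) :
    ∀ᶠ w in l ×ˢ 𝓝[range (𝓡∂ n)] (extChartAt (𝓡∂ n) p₀ p₀),
      ∃ z ∈ modelDom (extChartAt (𝓡∂ n) p₀ p₀) η,
        F z = chartRep (𝓡∂ n) (𝓡 (2 * n)) p₀ (f p₀) (G w.1) w.2 ∧
        (w.2 0 = 0 → z.1 0 = 0 ∧ IsConormal z.2) ∧ (0 < w.2 0 → 0 < z.1 0) := by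
  rcases (mem_range_halfSpace.1 (mem_range_extChartAt (n := n) p₀)).eq_or_lt with h0 | h0
  · exact M.eventually_exists_lift_of_boundary hC h hG h0.symm hη hηR
  · filter_upwards [M.eventually_exists_lift_of_interior h h0 hη hηR] with w ⟨hw, z, hz, hzw, hz0⟩
    exact ⟨z, hz, hzw, fun h ↦ absurd h hw.ne', fun _ ↦ hz0⟩

end LocalModel

end LiftExistence

end LagBdry

namespace LagBdry

section TangentMapConvergence

variable {ι : Type*} {l : Filter ι}
  {E : Type*} [NormedAddCommGroup E] [NormedSpace ℝ E]
  {H : Type*} [TopologicalSpace H] {I : ModelWithCorners ℝ E H}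
  {M : Type*} [TopologicalSpace M] [ChartedSpace H M] [IsManifold I ∞ M]
  {E' : Type*} [NormedAddCommGroup E'] [NormedSpace ℝ E']
  {H' : Type*} [TopologicalSpace H'] {I' : ModelWithCorners ℝ E' H'}
  {N : Type*} [TopologicalSpace N] [ChartedSpace H' N] [IsManifold I' ∞ N]

lemma tendsto_clm_apply {α : Type*} {l : Filter α} {u : α → E →L[ℝ] E'} {v : α → E}
    {u₀ : E →L[ℝ] E'} {v₀ : E} (hu : Tendsto u l (𝓝 u₀)) (hv : Tendsto v l (𝓝 v₀)) :
    Tendsto (fun x ↦ u x (v x)) l (𝓝 (u₀ v₀)) := by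
  have h : Continuous fun p : (E →L[ℝ] E') × E ↦ p.1 p.2 := continuous_fst.clm_apply continuous_snd
  exact (h.tendsto (u₀, v₀)).comp (hu.prodMk_nhds hv)

lemma trivializationAt_tangentMap {g : M → N} {p₀ : M} {y₀ : N} {w : TangentBundle I M}
    (hg : MDifferentiableAt I I' g w.1) (hp : w.1 ∈ (extChartAt I p₀).source)
    (hy : g w.1 ∈ (extChartAt I' y₀).source) :
    (trivializationAt E' (TangentSpace I' : N → Type _) y₀ (tangentMap I I' g w)).2 =
      fderivWithin ℝ (chartRep I I' p₀ y₀ g) (range I) (extChartAt I p₀ w.1)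
        (trivializationAt E (TangentSpace I : M → Type _) p₀ w).2 := by
  obtain ⟨p, v⟩ := w
  let v' : E := v
  have h1 := tangent_trivialization_apply (I := I') (p₀ := y₀) hy (mfderivModel I I' g p v')
  have h2 := tangent_trivialization_apply (I := I) hp v'
  refine h1.trans ((fderivWithin_chartRep_apply hg hp hy v').symm.trans ?_)
  exact congrArg _ h2.symm

/-- Joint convergence of tangent maps is checked on derivatives in charts. -/
lemma tendsto_tangentMap {G : ι → M → N} {g : M → N} (hG : ∀ᶠ i in l, MDifferentiable I I' (G i))
    (hg : MDifferentiable I I' g) {w₀ : TangentBundle I M}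
    (h0 : Tendsto (fun z : ι × M ↦ G z.1 z.2) (l ×ˢ 𝓝 w₀.1) (𝓝 (g w₀.1)))
    (h1 : Tendsto (fun z : ι × E ↦ fderivWithin ℝ (chartRep I I' w₀.1 (g w₀.1) (G z.1)) (range I) z.2)
      (l ×ˢ 𝓝[range I] (extChartAt I w₀.1 w₀.1))
      (𝓝 (fderivWithin ℝ (chartRep I I' w₀.1 (g w₀.1) g) (range I) (extChartAt I w₀.1 w₀.1)))) :
    Tendsto (fun z : ι × TangentBundle I M ↦ tangentMap I I' (G z.1) z.2) (l ×ˢ 𝓝 w₀)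
      (𝓝 (tangentMap I I' g w₀)) := by
  have hproj : Tendsto (fun z : ι × TangentBundle I M ↦ (z.1, z.2.1)) (l ×ˢ 𝓝 w₀) (l ×ˢ 𝓝 w₀.1) :=
    tendsto_fst.prodMk (((FiberBundle.continuous_proj E (TangentSpace I)).tendsto w₀).comp tendsto_snd)
  set e := trivializationAt E (TangentSpace I : M → Type _) w₀.1 with he
  set e' := trivializationAt E' (TangentSpace I' : N → Type _) (g w₀.1) with he'
  have hw₀ : w₀ ∈ e.source := by
    rw [e.mem_source]
    exact FiberBundle.mem_baseSet_trivializationAt' w₀.1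
  have hgw₀ : tangentMap I I' g w₀ ∈ e'.source := by
    rw [e'.mem_source]
    exact FiberBundle.mem_baseSet_trivializationAt' (g w₀.1)
  refine (e'.tendsto_nhds_iff hgw₀).2 ⟨h0.comp hproj, ?_⟩
  have h2 : Tendsto (fun z : ι × TangentBundle I M ↦ (e z.2).2) (l ×ˢ 𝓝 w₀) (𝓝 (e w₀).2) :=
    ((continuous_snd.tendsto _).comp (e.continuousAt hw₀).tendsto).comp tendsto_snd
  have h3 : Tendsto (fun z : ι × TangentBundle I M ↦ (z.1, extChartAt I w₀.1 z.2.1)) (l ×ˢ 𝓝 w₀)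
      (l ×ˢ 𝓝[range I] (extChartAt I w₀.1 w₀.1)) := by
    have h4 : Tendsto (fun z : ι × M ↦ (z.1, extChartAt I w₀.1 z.2)) (l ×ˢ 𝓝 w₀.1)
        (l ×ˢ 𝓝[range I] (extChartAt I w₀.1 w₀.1)) := by
      refine tendsto_fst.prodMk (Tendsto.comp ?_ tendsto_snd)
      rw [← map_extChartAt_nhds]
      exact tendsto_map
    exact h4.comp hproj
  have h5 := tendsto_clm_apply (h1.comp h3) h2
  have h6 := trivializationAt_tangentMap (hg w₀.1) (mem_extChartAt_source (I := I) w₀.1)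
    (mem_extChartAt_source (I := I') (g w₀.1))
  rw [h6]
  refine h5.congr' ?_
  filter_upwards [(h0.comp hproj) (extChartAt_source_mem_nhds (I := I') (g w₀.1)),
    hproj.eventually (tendsto_snd.eventually (extChartAt_source_mem_nhds (I := I) w₀.1)),
    tendsto_fst.eventually hG] with z hz1 hz2 hz3
  exact (trivializationAt_tangentMap (hz3 z.2.1) hz2 hz1).symm

lemma tendsto_c1Topology {G : ι → C^∞⟮I, M; I', N⟯} {g : C^∞⟮I, M; I', N⟯}
    (h : ∀ w : TangentBundle I M, Tendsto (fun z : ι × TangentBundle I M ↦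
      tangentMap I I' (G z.1) z.2) (l ×ˢ 𝓝 w) (𝓝 (tangentMap I I' g w))) :
    Tendsto G l (@nhds _ (c1Topology I M I' N) g) := by
  rw [nhds_induced, tendsto_comap_iff, ContinuousMap.tendsto_nhds_compactOpen]
  intro K hK U hU hmaps
  exact eventually_forall_mem_of_compact hK fun w hw ↦ h w (hU.mem_nhds (hmaps hw))

end TangentMapConvergence

section CotangentCharts

variable {n : ℕ} [NeZero n] {L : Type*} [TopologicalSpace L]
  [ChartedSpace (EuclideanHalfSpace n) L] [IsManifold (𝓡∂ n) ∞ L]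

variable (n L) in
/-- The cotangent bundle. -/
noncomputable abbrev Cotangent : Type _ := TotalSpace (CoModel n) (fun p : L ↦ TangentSpace (𝓡∂ n) p →L[ℝ] ℝ)

variable (n) in
/-- The zero section of the cotangent bundle. -/
noncomputable abbrev zeroCovector (p : L) : Cotangent n L := ⟨p, 0⟩

variable (n) in
/-- The model with corners of the cotangent bundle. -/
noncomputable abbrev coModelWithCorners : ModelWithCorners ℝ (Model n × CoModel n)
    (ModelProd (EuclideanHalfSpace n) (CoModel n)) := (𝓡∂ n).prod 𝓘(ℝ, CoModel n)

lemma range_coModelWithCorners : range (coModelWithCorners n) = halfProd n := by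
  rw [coModelWithCorners, ModelWithCorners.range_prod, halfProd]
  congr 1
  exact range_id

lemma continuous_zeroCovector : Continuous (zeroCovector n : L → Cotangent n L) :=
  (contMDiff_zeroSection (n := ∞) (IB := 𝓡∂ n) ℝ
    (fun p : L ↦ TangentSpace (𝓡∂ n) p →L[ℝ] ℝ)).continuous

lemma cotangentChart_mem_source {p₀ : L} {t : Cotangent n L} :
    t ∈ (extChartAt (coModelWithCorners n) (zeroCovector n p₀)).source ↔
      t.1 ∈ (extChartAt (𝓡∂ n) p₀).source := by
  rw [FiberBundle.extChartAt, extChartAt_source (𝓡∂ n)]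
  simp only [mfld_simps]
  constructor
  · exact fun h ↦ h.1.1
  · exact fun h ↦ ⟨⟨h, mem_univ _⟩, h⟩

lemma cotangentChart_apply {p₀ : L} {t : Cotangent n L}
    (ht : t.1 ∈ (extChartAt (𝓡∂ n) p₀).source) :
    extChartAt (coModelWithCorners n) (zeroCovector n p₀) t =
      (extChartAt (𝓡∂ n) p₀ t.1, covectorChart p₀ t.1 t.2) := by
  rw [FiberBundle.extChartAt]
  refine Prod.ext ?_ (covector_trivializationAt ht _)
  change extChartAt (𝓡∂ n) p₀ ((trivializationAt (CoModel n)
        (fun p : L ↦ TangentSpace (𝓡∂ n) p →L[ℝ] ℝ) p₀ t).1) = _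
  congr 1

lemma cotangentChart_zero (p₀ : L) :
    extChartAt (coModelWithCorners n) (zeroCovector n p₀) (zeroCovector n p₀) =
      (extChartAt (𝓡∂ n) p₀ p₀, 0) := by
  refine (cotangentChart_apply (mem_extChartAt_source p₀)).trans (Prod.ext rfl ?_)
  ext v
  rfl

lemma eventually_cotangentChart (p₀ : L) {R : ℝ} (hR : 0 < R) :
    ∀ᶠ t in 𝓝 (zeroCovector n p₀),
      t ∈ (extChartAt (coModelWithCorners n) (zeroCovector n p₀)).source ∧
      extChartAt (coModelWithCorners n) (zeroCovector n p₀) t ∈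
        modelDom (extChartAt (𝓡∂ n) p₀ p₀) R := by
  have h1 := (continuousAt_extChartAt (I := coModelWithCorners n) (zeroCovector n p₀)).tendsto
  rw [cotangentChart_zero] at h1
  filter_upwards [extChartAt_source_mem_nhds (I := coModelWithCorners n) (zeroCovector n p₀),
    h1 (Metric.ball_mem_nhds _ hR)] with t ht htR
  refine ⟨ht, ?_⟩
  rw [modelDom_eq]
  refine ⟨⟨?_, mem_univ _⟩, htR⟩
  rw [cotangentChart_apply (cotangentChart_mem_source.1 ht)]
  exact extChartAt_target_subset_range p₀
    ((extChartAt (𝓡∂ n) p₀).map_source (cotangentChart_mem_source.1 ht))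

lemma exists_modelDom_cotangentChart {p₀ : L} {W : Set (Cotangent n L)}
    (hW : W ∈ 𝓝 (zeroCovector n p₀)) :
    ∃ η > 0, ∀ r ≤ η, ∀ z ∈ modelDom (extChartAt (𝓡∂ n) p₀ p₀) r,
      z ∈ (extChartAt (coModelWithCorners n) (zeroCovector n p₀)).target ∧
      (extChartAt (coModelWithCorners n) (zeroCovector n p₀)).symm z ∈ W := by
  refine exists_modelDom_of_eventually ?_
  rw [← cotangentChart_zero p₀, ← range_coModelWithCorners]
  refine Filter.Eventually.and (extChartAt_target_mem_nhdsWithin _) ?_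
  have h := (continuousAt_extChartAt_symm (I := coModelWithCorners n) (zeroCovector n p₀)).tendsto
  rw [extChartAt_to_inv] at h
  exact (h.mono_left nhdsWithin_le_nhds) hW

end CotangentCharts

section Selection

variable {ι : Type*} {n : ℕ} [NeZero n] {d : ℕ}
  {X : Type*} [TopologicalSpace X] [T2Space X]
  [ChartedSpace (EuclideanSpace ℝ (Fin (2 * n))) X] [IsManifold (𝓡 (2 * n)) ∞ X]
  {K : CalabiYau n X}
  {L : Type*} [TopologicalSpace L]
  [ChartedSpace (EuclideanHalfSpace n) L] [IsManifold (𝓡∂ n) ∞ L]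
  {G : ι → L → X} {l : Filter ι}
  {f : L → X} {C : Fin d → Set L} {Λ : Fin d → Set X}
  {D : CovariantDerivative (𝓡 (2 * n)) (EuclideanSpace ℝ (Fin (2 * n)))
      (TangentSpace (𝓡 (2 * n)) : X → Type _)} {a : L → ℝ}
  {p₀ : L} {F : Model n × CoModel n → Model (2 * n)}
  {A : (Model n × CoModel n) ≃L[ℝ] Model (2 * n)} {R : ℝ}

lemma LocalModel.covectorExp_chart (M : LocalModel K C Λ D f a p₀ F A R)
    (hD : D.ContMDiffCovariantDerivative ∞) (hf : K.IsLagrangianImm f) {t : Cotangent n L}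
    (ht : t ∈ (extChartAt (coModelWithCorners n) (zeroCovector n p₀)).source)
    (htR : extChartAt (coModelWithCorners n) (zeroCovector n p₀) t ∈
      modelDom (extChartAt (𝓡∂ n) p₀ p₀) R) :
    covectorExp D hf a t ∈ (extChartAt (𝓡 (2 * n)) (f p₀)).source ∧
      extChartAt (𝓡 (2 * n)) (f p₀) (covectorExp D hf a t) =
        F (extChartAt (coModelWithCorners n) (zeroCovector n p₀) t) := by
  have hs := cotangentChart_mem_source.1 ht
  have htarget := M.target _ htR
  have hap : extChartAt (coModelWithCorners n) (zeroCovector n p₀) t =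
      (extChartAt (𝓡∂ n) p₀ t.1, covectorChart p₀ t.1 t.2) := cotangentChart_apply hs
  rw [hap] at htR htarget ⊢
  have h1 := (M.isExp_covectorField hf hs htR.1 htR.2).expMap_eq hD
  have h2 : covectorExp D hf a t = (extChartAt (𝓡 (2 * n)) (f p₀)).symm
      (F (extChartAt (𝓡∂ n) p₀ t.1, covectorChart p₀ t.1 t.2)) := h1
  rw [h2]
  exact ⟨(extChartAt (𝓡 (2 * n)) (f p₀)).map_target htarget,
    (extChartAt (𝓡 (2 * n)) (f p₀)).right_inv htarget⟩

/-- A covector at a point matching the boundary conditions at `q`. -/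
def MatchesBoundary (q : L) (t : Cotangent n L) : Prop :=
  (q ∈ (𝓡∂ n).boundary L ↔ t.1 ∈ (𝓡∂ n).boundary L) ∧
    (t.1 ∈ (𝓡∂ n).boundary L → ∀ Y ∈ tangentOf (𝓡∂ n) ((𝓡∂ n).boundary L) t.1, t.2 Y = 0)

lemma matchesBoundary_of_chart {q : L} {t : Cotangent n L}
    (hq : q ∈ (extChartAt (𝓡∂ n) p₀).source) (ht : t.1 ∈ (extChartAt (𝓡∂ n) p₀).source)
    (h0 : extChartAt (𝓡∂ n) p₀ q 0 = 0 →
      extChartAt (𝓡∂ n) p₀ t.1 0 = 0 ∧ IsConormal (covectorChart p₀ t.1 t.2))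
    (h1 : 0 < extChartAt (𝓡∂ n) p₀ q 0 → 0 < extChartAt (𝓡∂ n) p₀ t.1 0) :
    MatchesBoundary q t := by
  have hq0 : 0 ≤ extChartAt (𝓡∂ n) p₀ q 0 := mem_range_halfSpace.1
    (extChartAt_target_subset_range p₀ ((extChartAt (𝓡∂ n) p₀).map_source hq))
  have hiff : extChartAt (𝓡∂ n) p₀ q 0 = 0 ↔ extChartAt (𝓡∂ n) p₀ t.1 0 = 0 := by
    refine ⟨fun h ↦ (h0 h).1, fun h ↦ ?_⟩
    by_contra hne
    exact (h1 (lt_of_le_of_ne hq0 (Ne.symm hne))).ne' h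
  refine ⟨?_, fun htb Y hY ↦ ?_⟩
  · rw [mem_boundary_iff hq, mem_boundary_iff ht]
    exact hiff
  · exact (isConormal_covectorChart_iff ht htb _).1
      (h0 (hiff.2 ((mem_boundary_iff ht).1 htb))).2 Y hY

/-- Maps close to `f` with boundary conditions factor through the exponential map. -/
theorem DeformationData.exists_selection [CompactSpace L] [T2Space L]
    (S : DeformationData K C Λ D f a) (h : C1Tendsto (n := n) G l f)
    (hG : ∀ᶠ i in l, ∀ j, ∀ p ∈ C j, G i p ∈ Λ j) :
    ∃ s : ι → L → Cotangent n L,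
      (∀ᶠ i in l, ∀ q, covectorExp D S.imm a (s i q) = G i q ∧ MatchesBoundary q (s i q)) ∧
      ∀ q, Tendsto (fun x : ι × L ↦ s x.1 x.2) (l ×ˢ 𝓝 q) (𝓝 (zeroCovector n q)) := by
  refine exists_uniform_selection continuous_zeroCovector (fun p₀ ↦ ?_) fun p₀ W hW ↦ ?_
  · obtain ⟨F, A, R, hR, hM⟩ := S.exists_localModel p₀
    have M := hM R hR le_rfl
    refine ⟨_, eventually_cotangentChart p₀ hR, fun t ht t' ht' heq ↦ ?_⟩
    have h1 := (M.covectorExp_chart S.smooth S.imm ht.1 ht.2).2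
    have h2 := (M.covectorExp_chart S.smooth S.imm ht'.1 ht'.2).2
    rw [heq] at h1
    exact (extChartAt (coModelWithCorners n) (zeroCovector n p₀)).injOn ht.1 ht'.1
      (M.injOn ht.2 ht'.2 (h1.symm.trans h2))
  · obtain ⟨F, A, R, hR, hM⟩ := S.exists_localModel p₀
    have M := hM R hR le_rfl
    obtain ⟨η, hη, hηW⟩ := exists_modelDom_cotangentChart hW
    have h1 := M.eventually_exists_lift S.ordering h hG (lt_min hη hR) (min_le_right η R)
    filter_upwards [(tendsto_prod_chart l p₀).eventually h1,
      h.tendsto p₀ (extChartAt_source_mem_nhds (I := 𝓡 (2 * n)) (f p₀)),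
      eventually_prod_chart l (halfBall_mem_nhdsWithin (n := n) p₀ hR)]
      with ⟨i, q⟩ ⟨z, hz, hzF, hz0, hz1⟩ hqX ⟨hq, hqR⟩
    obtain ⟨hzt, hzW⟩ := hηW _ (min_le_left _ _) z hz
    have hzR : z ∈ modelDom (extChartAt (𝓡∂ n) p₀ p₀) R := by
      rw [modelDom_eq] at hz ⊢
      exact ⟨hz.1, Metric.ball_subset_ball (min_le_right _ _) hz.2⟩
    obtain ⟨t, ht⟩ : ∃ t, t = (extChartAt (coModelWithCorners n) (zeroCovector n p₀)).symm z :=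
      ⟨_, rfl⟩
    rw [← ht] at hzW
    have hts : t ∈ (extChartAt (coModelWithCorners n) (zeroCovector n p₀)).source := by
      rw [ht]
      exact (extChartAt (coModelWithCorners n) (zeroCovector n p₀)).map_target hzt
    have htz : extChartAt (coModelWithCorners n) (zeroCovector n p₀) t = z := by
      rw [ht]
      exact (extChartAt (coModelWithCorners n) (zeroCovector n p₀)).right_inv hzt
    have hts' := cotangentChart_mem_source.1 hts
    refine ⟨t, hzW, ?_, ?_⟩
    · obtain ⟨h2, h3⟩ := M.covectorExp_chart S.smooth S.imm hts (by rw [htz]; exact hzR)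
      refine (extChartAt (𝓡 (2 * n)) (f p₀)).injOn h2 hqX (h3.trans ?_)
      rw [htz, hzF]
      exact chartRep_apply hq
    · rw [cotangentChart_apply hts'] at htz
      rw [← htz] at hz0 hz1
      exact matchesBoundary_of_chart hq hts' hz0 hz1

end Selection

end LagBdry

namespace LagBdry

section SelectionRegularity

variable {ι : Type*} {n : ℕ} [NeZero n] {d : ℕ}
  {X : Type*} [TopologicalSpace X] [T2Space X]
  [ChartedSpace (EuclideanSpace ℝ (Fin (2 * n))) X] [IsManifold (𝓡 (2 * n)) ∞ X]
  {K : CalabiYau n X}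
  {L : Type*} [TopologicalSpace L]
  [ChartedSpace (EuclideanHalfSpace n) L] [IsManifold (𝓡∂ n) ∞ L]
  {G : ι → L → X} {l : Filter ι}
  {f : L → X} {C : Fin d → Set L} {Λ : Fin d → Set X}
  {D : CovariantDerivative (𝓡 (2 * n)) (EuclideanSpace ℝ (Fin (2 * n)))
      (TangentSpace (𝓡 (2 * n)) : X → Type _)} {a : L → ℝ}
  {p₀ : L} {F : Model n × CoModel n → Model (2 * n)}
  {A : (Model n × CoModel n) ≃L[ℝ] Model (2 * n)} {R : ℝ}

/-- A map from `L` to its cotangent bundle, read in charts. -/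
noncomputable abbrev coRep (p₀ : L) (s : L → Cotangent n L) : Model n → Model n × CoModel n :=
  chartRep (𝓡∂ n) (coModelWithCorners n) p₀ (zeroCovector n p₀) s

/-- The domain of the representation in charts of a map to the cotangent bundle. -/
noncomputable abbrev coDom (p₀ : L) (s : L → Cotangent n L) : Set (Model n) :=
  chartDom (𝓡∂ n) (coModelWithCorners n) p₀ (zeroCovector n p₀) s

/-- Maps converging to the zero section of the cotangent bundle in the `C¹` sense. -/
structure TendstoZeroSection (s : ι → L → Cotangent n L) (l : Filter ι) : Prop where
  smooth : ∀ᶠ i in l, ContMDiff (𝓡∂ n) (coModelWithCorners n) ∞ (s i)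
  tendsto : ∀ p₀, Tendsto (fun z : ι × L ↦ s z.1 z.2) (l ×ˢ 𝓝 p₀) (𝓝 (zeroCovector n p₀))
  approx : ∀ p₀ : L, ∃ ρ > 0, ∀ᶠ i in l, ∀ x ∈ halfBall (extChartAt (𝓡∂ n) p₀ p₀) ρ,
    x ∈ coDom p₀ (s i) ∧ ∀ x' ∈ halfBall (extChartAt (𝓡∂ n) p₀ p₀) ρ,
      ‖coRep p₀ (s i) x - coRep p₀ (s i) x' - (x - x', (0 : CoModel n))‖ ≤ 1 / 4 * ‖x - x'‖
  tendsto_deriv : ∀ p₀, Tendsto (fun z : ι × Model n ↦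
      fderivWithin ℝ (coRep p₀ (s z.1)) (range (𝓡∂ n)) z.2)
    (l ×ˢ 𝓝[range (𝓡∂ n)] (extChartAt (𝓡∂ n) p₀ p₀))
    (𝓝 (ContinuousLinearMap.inl ℝ (Model n) (CoModel n)))

variable {s : ι → L → Cotangent n L}

lemma LocalModel.exists_selection_approx (M : LocalModel K C Λ D f a p₀ F A R)
    (hD : D.ContMDiffCovariantDerivative ∞) (hf : K.IsLagrangianImm f)
    (h : C1Tendsto (n := n) G l f) (hs : ∀ᶠ i in l, ∀ q, covectorExp D hf a (s i q) = G i q)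
    (hlim : Tendsto (fun z : ι × L ↦ s z.1 z.2) (l ×ˢ 𝓝 p₀) (𝓝 (zeroCovector n p₀))) :
    ∃ ρ > 0, ∀ᶠ i in l, ∀ x ∈ halfBall (extChartAt (𝓡∂ n) p₀ p₀) ρ,
      x ∈ chartDom (𝓡∂ n) (𝓡 (2 * n)) p₀ (f p₀) (G i) ∧ x ∈ coDom p₀ (s i) ∧
      coRep p₀ (s i) x ∈ modelDom (extChartAt (𝓡∂ n) p₀ p₀) R ∧
      F (coRep p₀ (s i) x) = chartRep (𝓡∂ n) (𝓡 (2 * n)) p₀ (f p₀) (G i) x ∧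
      ∀ x' ∈ halfBall (extChartAt (𝓡∂ n) p₀ p₀) ρ,
      ‖coRep p₀ (s i) x - coRep p₀ (s i) x' - (x - x', (0 : CoModel n))‖ ≤ 1 / 4 * ‖x - x'‖ := by
  have h1 : Tendsto (fun w : ι × Model n ↦ s w.1 ((extChartAt (𝓡∂ n) p₀).symm w.2))
      (l ×ˢ 𝓝[range (𝓡∂ n)] (extChartAt (𝓡∂ n) p₀ p₀)) (𝓝 (zeroCovector n p₀)) :=
    hlim.comp (tendsto_fst.prodMk ((tendsto_extChartAt_symm (n := n) p₀).comp tendsto_snd))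
  obtain ⟨ρ₁, hρ₁, h2⟩ := exists_halfBall_eventually
    (P := fun i x ↦ s i ((extChartAt (𝓡∂ n) p₀).symm x) ∈
        (extChartAt (coModelWithCorners n) (zeroCovector n p₀)).source ∧
      coRep p₀ (s i) x ∈ modelDom (extChartAt (𝓡∂ n) p₀ p₀) R)
    (h1.eventually (eventually_cotangentChart p₀ M.pos))
  obtain ⟨ρ₂, hρ₂, h3⟩ := M.exists_lift_approx h
  refine ⟨min ρ₁ ρ₂, lt_min hρ₁ hρ₂, ?_⟩
  filter_upwards [h2, h3, hs] with i hi2 hi3 his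
  have key : ∀ x ∈ halfBall (extChartAt (𝓡∂ n) p₀ p₀) (min ρ₁ ρ₂),
      coRep p₀ (s i) x ∈ modelDom (extChartAt (𝓡∂ n) p₀ p₀) R ∧
      F (coRep p₀ (s i) x) = chartRep (𝓡∂ n) (𝓡 (2 * n)) p₀ (f p₀) (G i) x := by
    intro x hx
    obtain ⟨hx1, hx2⟩ := hi2 x (halfBall_mono _ (min_le_left _ _) hx)
    refine ⟨hx2, ?_⟩
    have h4 := (M.covectorExp_chart hD hf hx1 hx2).2
    rw [his] at h4
    exact h4.symm
  have key2 : ∀ x ∈ halfBall (extChartAt (𝓡∂ n) p₀ p₀) (min ρ₁ ρ₂),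
      coRep p₀ (s i) x ∈ Metric.ball (extChartAt (𝓡∂ n) p₀ p₀, (0 : CoModel n)) R ∧
      halfExtend (A.symm ∘ F) (coRep p₀ (s i) x) =
        A.symm (chartRep (𝓡∂ n) (𝓡 (2 * n)) p₀ (f p₀) (G i) x) := by
    intro x hx
    obtain ⟨hx1, hx2⟩ := key x hx
    refine ⟨?_, ?_⟩
    · rw [modelDom_eq] at hx1
      exact hx1.2
    · rw [halfExtend_of_mem _ hx1.1.1, Function.comp_apply, hx2]
  intro x hx
  have hx3 := hi3 x (halfBall_mono _ (min_le_right _ _) hx)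
  refine ⟨hx3.1, ⟨hx3.1.1, (hi2 x (halfBall_mono _ (min_le_left _ _) hx)).1⟩, (key x hx).1,
    (key x hx).2, fun x' hx' ↦ ?_⟩
  exact hx3.2 x' (halfBall_mono _ (min_le_right _ _) hx') _ (key2 x hx).1 _ (key2 x' hx').1
    (key2 x hx).2 (key2 x' hx').2

lemma uniqueDiffOn_halfBall (x₀ : Model n) (ρ : ℝ) : UniqueDiffOn ℝ (halfBall x₀ ρ) :=
  (𝓡∂ n).uniqueDiffOn.inter Metric.isOpen_ball

lemma halfBall_mem_nhdsWithin_of_mem {x₀ x : Model n} {ρ : ℝ} (hx : x ∈ halfBall x₀ ρ) :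
    halfBall x₀ ρ ∈ 𝓝[range (𝓡∂ n)] x :=
  inter_mem self_mem_nhdsWithin (nhdsWithin_le_nhds (Metric.isOpen_ball.mem_nhds hx.2))

lemma LocalModel.contDiffOn_coRep (M : LocalModel K C Λ D f a p₀ F A R) {g : L → X}
    (hg : ContMDiff (𝓡∂ n) (𝓡 (2 * n)) ∞ g) {t : L → Cotangent n L} {ρ : ℝ}
    (h : ∀ x ∈ halfBall (extChartAt (𝓡∂ n) p₀ p₀) ρ,
      x ∈ chartDom (𝓡∂ n) (𝓡 (2 * n)) p₀ (f p₀) g ∧ x ∈ coDom p₀ t ∧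
      coRep p₀ t x ∈ modelDom (extChartAt (𝓡∂ n) p₀ p₀) R ∧
      F (coRep p₀ t x) = chartRep (𝓡∂ n) (𝓡 (2 * n)) p₀ (f p₀) g x ∧
      ∀ x' ∈ halfBall (extChartAt (𝓡∂ n) p₀ p₀) ρ,
      ‖coRep p₀ t x - coRep p₀ t x' - (x - x', (0 : CoModel n))‖ ≤ 1 / 4 * ‖x - x'‖) :
    ContDiffOn ℝ ∞ (coRep p₀ t) (halfBall (extChartAt (𝓡∂ n) p₀ p₀) ρ) := by
  have happ : ApproximatesLinearOn (coRep p₀ t) (ContinuousLinearMap.inl ℝ (Model n) (CoModel n))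
      (halfBall (extChartAt (𝓡∂ n) p₀ p₀) ρ) (1 / 4) := by
    intro x hx x' hx'
    have := (h x hx).2.2.2.2 x' hx'
    simpa using this
  exact M.contDiffOn_lift (uniqueDiffOn_halfBall _ _) happ.continuousOn
    (fun x hx ↦ (h x hx).2.2.1) ((contDiffOn_chartRep hg).mono fun x hx ↦ (h x hx).1)
    fun x hx ↦ (h x hx).2.2.2.1

lemma eventually_contMDiffAt_selection (S : DeformationData K C Λ D f a)
    (h : C1Tendsto (n := n) G l f)
    (hs : ∀ᶠ i in l, ∀ q, covectorExp D S.imm a (s i q) = G i q)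
    (hlim : Tendsto (fun z : ι × L ↦ s z.1 z.2) (l ×ˢ 𝓝 p₀) (𝓝 (zeroCovector n p₀))) :
    ∀ᶠ z in l ×ˢ 𝓝 p₀, ContMDiffAt (𝓡∂ n) (coModelWithCorners n) ∞ (s z.1) z.2 := by
  obtain ⟨F, A, R, hR, hM⟩ := S.exists_localModel p₀
  have M := hM R hR le_rfl
  obtain ⟨ρ, hρ, h1⟩ := M.exists_selection_approx S.smooth S.imm h hs hlim
  filter_upwards [tendsto_fst.eventually h1, tendsto_fst.eventually h.smooth,
    eventually_prod_chart l (halfBall_mem_nhdsWithin (n := n) p₀ hρ)] with ⟨i, p⟩ hi hg ⟨hp, hpρ⟩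
  refine contMDiffAt_of_chart (y₀ := zeroCovector n p₀) (h := coRep p₀ (s i)) hp ?_ ?_
  · filter_upwards [halfBall_mem_nhdsWithin_of_mem hpρ] with x hx
    have h2 := (hi x hx).2.1.2
    exact ⟨(extChartAt (coModelWithCorners n) (zeroCovector n p₀)).map_source h2,
      ((extChartAt (coModelWithCorners n) (zeroCovector n p₀)).left_inv h2).symm⟩
  · exact (M.contDiffOn_coRep hg hi _ hpρ).mono_of_mem_nhdsWithin
      (halfBall_mem_nhdsWithin_of_mem hpρ)

lemma tendsto_clm_inverse {α E E' : Type*} [NormedAddCommGroup E] [NormedSpace ℝ E] [CompleteSpace E]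
    [NormedAddCommGroup E'] [NormedSpace ℝ E'] {m : Filter α} {u : α → E →L[ℝ] E'} (e : E ≃L[ℝ] E')
    (hu : Tendsto u m (𝓝 (e : E →L[ℝ] E'))) :
    Tendsto (fun x ↦ (u x).inverse) m (𝓝 (e.symm : E' →L[ℝ] E)) := by
  have h := (contDiffAt_map_inverse (𝕜 := ℝ) (n := 0) e).continuousAt.tendsto.comp hu
  rw [ContinuousLinearMap.inverse_equiv] at h
  exact h

lemma eq_inverse_comp {E E' E'' : Type*} [NormedAddCommGroup E] [NormedSpace ℝ E]
    [NormedAddCommGroup E'] [NormedSpace ℝ E'] [NormedAddCommGroup E''] [NormedSpace ℝ E'']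
    {T : E' →L[ℝ] E''} (hT : T.IsInvertible) {B : E →L[ℝ] E'} {B' : E →L[ℝ] E''}
    (h : T.comp B = B') : B = T.inverse.comp B' := by
  obtain ⟨e, rfl⟩ := hT
  rw [ContinuousLinearMap.inverse_equiv, ← h]
  ext v
  simp

lemma LocalModel.fderivWithin_coRep (M : LocalModel K C Λ D f a p₀ F A R) {g : L → X}
    (hg : ContMDiff (𝓡∂ n) (𝓡 (2 * n)) ∞ g) {t : L → Cotangent n L} {ρ : ℝ}
    (h : ∀ x ∈ halfBall (extChartAt (𝓡∂ n) p₀ p₀) ρ,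
      x ∈ chartDom (𝓡∂ n) (𝓡 (2 * n)) p₀ (f p₀) g ∧ x ∈ coDom p₀ t ∧
      coRep p₀ t x ∈ modelDom (extChartAt (𝓡∂ n) p₀ p₀) R ∧
      F (coRep p₀ t x) = chartRep (𝓡∂ n) (𝓡 (2 * n)) p₀ (f p₀) g x ∧
      ∀ x' ∈ halfBall (extChartAt (𝓡∂ n) p₀ p₀) ρ,
      ‖coRep p₀ t x - coRep p₀ t x' - (x - x', (0 : CoModel n))‖ ≤ 1 / 4 * ‖x - x'‖)
    {x : Model n} (hx : x ∈ halfBall (extChartAt (𝓡∂ n) p₀ p₀) ρ) :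
    fderivWithin ℝ (coRep p₀ t) (range (𝓡∂ n)) x =
      (fderivWithin ℝ F (halfProd n) (coRep p₀ t x)).inverse.comp
        (fderivWithin ℝ (chartRep (𝓡∂ n) (𝓡 (2 * n)) p₀ (f p₀) g) (range (𝓡∂ n)) x) := by
  have hnhds := halfBall_mem_nhdsWithin_of_mem hx
  obtain ⟨hxg, hxt, hxR, hxF, -⟩ := h x hx
  refine eq_inverse_comp (M.isInvertible_fderiv hxR) ?_
  have h1 : HasFDerivWithinAt (coRep p₀ t) (fderivWithin ℝ (coRep p₀ t) (range (𝓡∂ n)) x)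
      (halfBall (extChartAt (𝓡∂ n) p₀ p₀) ρ) x :=
    ((((M.contDiffOn_coRep hg h x hx).differentiableWithinAt (by simp)).mono_of_mem_nhdsWithin
      hnhds).hasFDerivWithinAt).mono inter_subset_left
  have h2 := ((M.smooth _ hxR).differentiableWithinAt (by simp)).hasFDerivWithinAt
  have h3 := h2.comp x h1 fun x' hx' ↦ ⟨(h x' hx').2.2.1.1.1, mem_univ _⟩
  have h4 := (hasFDerivWithinAt_chartRep_of_mem hg hxg).mono
    (inter_subset_left : halfBall (extChartAt (𝓡∂ n) p₀ p₀) ρ ⊆ _)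
  have h5 := h4.congr (f₁ := F ∘ coRep p₀ t) (fun x' hx' ↦ (h x' hx').2.2.2.1) hxF
  exact (uniqueDiffOn_halfBall _ _ x hx).eq h3 h5

lemma tendsto_fderiv_selection (S : DeformationData K C Λ D f a)
    (h : C1Tendsto (n := n) G l f)
    (hs : ∀ᶠ i in l, ∀ q, covectorExp D S.imm a (s i q) = G i q)
    (hlim : Tendsto (fun z : ι × L ↦ s z.1 z.2) (l ×ˢ 𝓝 p₀) (𝓝 (zeroCovector n p₀))) :
    Tendsto (fun z : ι × Model n ↦ fderivWithin ℝ (coRep p₀ (s z.1)) (range (𝓡∂ n)) z.2)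
    (l ×ˢ 𝓝[range (𝓡∂ n)] (extChartAt (𝓡∂ n) p₀ p₀))
    (𝓝 (ContinuousLinearMap.inl ℝ (Model n) (CoModel n))) := by
  obtain ⟨F, A, R, hR, hM⟩ := S.exists_localModel p₀
  have M := hM R hR le_rfl
  obtain ⟨ρ, hρ, h1⟩ := M.exists_selection_approx S.smooth S.imm h hs hlim
  have hball : ∀ᶠ z : ι × Model n in l ×ˢ 𝓝[range (𝓡∂ n)] (extChartAt (𝓡∂ n) p₀ p₀),
      z.2 ∈ halfBall (extChartAt (𝓡∂ n) p₀ p₀) ρ :=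
    tendsto_snd.eventually (halfBall_mem_nhdsWithin (n := n) p₀ hρ)
  have h2 : Tendsto (fun w : ι × Model n ↦ coRep p₀ (s w.1) w.2)
      (l ×ˢ 𝓝[range (𝓡∂ n)] (extChartAt (𝓡∂ n) p₀ p₀))
      (𝓝[halfProd n] (extChartAt (𝓡∂ n) p₀ p₀, 0)) := by
    refine tendsto_nhdsWithin_iff.2 ⟨?_, ?_⟩
    · rw [← cotangentChart_zero p₀]
      exact (continuousAt_extChartAt (I := coModelWithCorners n) (zeroCovector n p₀)).tendsto.comp
        (hlim.comp (tendsto_fst.prodMk ((tendsto_extChartAt_symm (n := n) p₀).comp tendsto_snd)))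
    · filter_upwards [tendsto_fst.eventually h1, hball] with z hz1 hz2
      exact ⟨(hz1 z.2 hz2).2.2.1.1.1, mem_univ _⟩
  have h3 := M.continuousWithinAt_fderiv.tendsto.comp h2
  rw [M.fderivWithin_center] at h3
  have h4 := tendsto_clm_comp (tendsto_clm_inverse A h3) (h.tendsto_deriv p₀)
  have h5 : (A.symm : Model (2 * n) →L[ℝ] Model n × CoModel n).comp
      (immDeriv f p₀ (extChartAt (𝓡∂ n) p₀ p₀)) = ContinuousLinearMap.inl ℝ (Model n) (CoModel n) := by
    refine ContinuousLinearMap.ext fun v ↦ ?_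
    have h6 : A (v, 0) = immDeriv f p₀ (extChartAt (𝓡∂ n) p₀ p₀) v := by
      rw [M.apply, map_zero, add_zero]
    change A.symm (immDeriv f p₀ (extChartAt (𝓡∂ n) p₀ p₀) v) = (v, 0)
    rw [← h6, A.symm_apply_apply]
  rw [h5] at h4
  refine h4.congr' ?_
  filter_upwards [tendsto_fst.eventually h1, hball, tendsto_fst.eventually h.smooth]
    with z hz1 hz2 hz3
  exact (M.fderivWithin_coRep hz3 hz1 hz2).symm

/-- The solution of `covectorExp (s i q) = G i q` converges to the zero section in `C¹`. -/
theorem tendstoZeroSection_selection [CompactSpace L] (S : DeformationData K C Λ D f a)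
    (h : C1Tendsto (n := n) G l f)
    (hs : ∀ᶠ i in l, ∀ q, covectorExp D S.imm a (s i q) = G i q)
    (hlim : ∀ p₀, Tendsto (fun z : ι × L ↦ s z.1 z.2) (l ×ˢ 𝓝 p₀) (𝓝 (zeroCovector n p₀))) :
    TendstoZeroSection s l := by
  refine ⟨?_, hlim, fun p₀ ↦ ?_, fun p₀ ↦ tendsto_fderiv_selection S h hs (hlim p₀)⟩
  · exact (eventually_forall_of_compact fun p₀ ↦
      eventually_contMDiffAt_selection S h hs (hlim p₀)).mono fun i hi p ↦ hi p
  · obtain ⟨F, A, R, hR, hM⟩ := S.exists_localModel p₀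
    have M := hM R hR le_rfl
    obtain ⟨ρ, hρ, h1⟩ := M.exists_selection_approx S.smooth S.imm h hs (hlim p₀)
    exact ⟨ρ, hρ, h1.mono fun i hi x hx ↦ ⟨(hi x hx).2.1, (hi x hx).2.2.2.2⟩⟩

end SelectionRegularity

end LagBdry

namespace LagBdry

section NearIdentity

variable {ι : Type*} {n : ℕ} [NeZero n] {l : Filter ι}
  {L : Type*} [TopologicalSpace L]
  [ChartedSpace (EuclideanHalfSpace n) L] [IsManifold (𝓡∂ n) ∞ L]

/-- A self-map of `L`, read in charts. -/
noncomputable abbrev selfRep (p₀ : L) (φ : L → L) : Model n → Model n :=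
  chartRep (𝓡∂ n) (𝓡∂ n) p₀ p₀ φ

/-- The domain of the representation in charts of a self-map of `L`. -/
noncomputable abbrev selfDom (p₀ : L) (φ : L → L) : Set (Model n) :=
  chartDom (𝓡∂ n) (𝓡∂ n) p₀ p₀ φ

variable (n) in
/-- Self-maps of `L` converging to the identity in the `C¹` sense, preserving interior and
boundary. -/
structure TendstoIdentity (φ : ι → L → L) (l : Filter ι) : Prop where
  smooth : ∀ᶠ i in l, ContMDiff (𝓡∂ n) (𝓡∂ n) ∞ (φ i)
  tendsto : ∀ p₀, Tendsto (fun z : ι × L ↦ φ z.1 z.2) (l ×ˢ 𝓝 p₀) (𝓝 p₀)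
  approx : ∀ p₀ : L, ∃ ρ > 0, ∀ᶠ i in l, ∀ x ∈ halfBall (extChartAt (𝓡∂ n) p₀ p₀) ρ,
    x ∈ selfDom p₀ (φ i) ∧ ∀ x' ∈ halfBall (extChartAt (𝓡∂ n) p₀ p₀) ρ,
      ‖selfRep p₀ (φ i) x - selfRep p₀ (φ i) x' - (x - x')‖ ≤ 1 / 4 * ‖x - x'‖
  tendsto_deriv : ∀ p₀, Tendsto (fun z : ι × Model n ↦
      fderivWithin ℝ (selfRep p₀ (φ z.1)) (range (𝓡∂ n)) z.2)
    (l ×ˢ 𝓝[range (𝓡∂ n)] (extChartAt (𝓡∂ n) p₀ p₀))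
    (𝓝 (ContinuousLinearMap.id ℝ (Model n)))
  boundary : ∀ᶠ i in l, ∀ q, q ∈ (𝓡∂ n).boundary L ↔ φ i q ∈ (𝓡∂ n).boundary L

lemma selfRep_proj {p₀ : L} {s : L → Cotangent n L} {x : Model n} (hx : x ∈ coDom p₀ s) :
    x ∈ selfDom p₀ (fun p ↦ (s p).1) ∧
      selfRep p₀ (fun p ↦ (s p).1) x = (coRep p₀ s x).1 := by
  have h := cotangentChart_mem_source.1 hx.2
  refine ⟨⟨hx.1, h⟩, ?_⟩
  exact (congrArg Prod.fst (cotangentChart_apply (n := n) h)).symm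

/-- The base points of sections converging to zero. -/
lemma TendstoZeroSection.tendstoIdentity {s : ι → L → Cotangent n L} (h : TendstoZeroSection s l)
    (hb : ∀ᶠ i in l, ∀ q, q ∈ (𝓡∂ n).boundary L ↔ (s i q).1 ∈ (𝓡∂ n).boundary L) :
    TendstoIdentity n (fun i p ↦ (s i p).1) l := by
  refine ⟨?_, fun p₀ ↦ ?_, fun p₀ ↦ ?_, fun p₀ ↦ ?_, hb⟩
  · filter_upwards [h.smooth] with i hi
    exact (Bundle.contMDiff_proj (fun p : L ↦ TangentSpace (𝓡∂ n) p →L[ℝ] ℝ)).comp hi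
  · exact ((FiberBundle.continuous_proj (CoModel n)
      (fun p : L ↦ TangentSpace (𝓡∂ n) p →L[ℝ] ℝ)).tendsto _).comp (h.tendsto p₀)
  · obtain ⟨ρ, hρ, h1⟩ := h.approx p₀
    refine ⟨ρ, hρ, h1.mono fun i hi x hx ↦ ⟨(selfRep_proj (hi x hx).1).1, fun x' hx' ↦ ?_⟩⟩
    rw [(selfRep_proj (hi x hx).1).2, (selfRep_proj (hi x' hx').1).2]
    exact (norm_fst_le _).trans ((hi x hx).2 x' hx')
  · obtain ⟨ρ, hρ, h1⟩ := h.approx p₀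
    have h2 := tendsto_clm_comp (tendsto_const_nhds
      (x := ContinuousLinearMap.fst ℝ (Model n) (CoModel n))) (h.tendsto_deriv p₀)
    rw [ContinuousLinearMap.fst_comp_inl] at h2
    refine h2.congr' ?_
    filter_upwards [h1.prod_mk (halfBall_mem_nhdsWithin (n := n) p₀ hρ),
      tendsto_fst.eventually h.smooth] with ⟨i, x⟩ ⟨hi, hx⟩ hsm
    have hnhds := halfBall_mem_nhdsWithin_of_mem hx
    have h3 : DifferentiableWithinAt ℝ (coRep p₀ (s i)) (range (𝓡∂ n)) x :=
      ((contDiffOn_chartRep hsm x (hi x hx).1).mono_of_mem_nhdsWithin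
        (chartDom_mem_nhdsWithin hsm.continuous (hi x hx).1)).differentiableWithinAt (by simp)
    have h4 := (ContinuousLinearMap.fst ℝ (Model n) (CoModel n)).hasFDerivAt.comp_hasFDerivWithinAt x
      h3.hasFDerivWithinAt
    refine ((h4.congr_of_eventuallyEq ?_ (selfRep_proj (hi x hx).1).2).fderivWithin
      ((𝓡∂ n).uniqueDiffOn x hx.1)).symm
    filter_upwards [hnhds] with x' hx'
    exact (selfRep_proj (hi x' hx').1).2

namespace TendstoIdentity

variable {φ : ι → L → L}

lemma eventually_injective [CompactSpace L] [T2Space L] (h : TendstoIdentity n φ l) :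
    ∀ᶠ i in l, Function.Injective (φ i) := by
  have key : ∀ᶠ i in l, ∀ z : L × L, φ i z.1 = φ i z.2 → z.1 = z.2 := by
    refine eventually_forall_of_compact fun z₀ ↦ ?_
    obtain ⟨p₀, q₀⟩ := z₀
    have h1 : Tendsto (fun z : ι × (L × L) ↦ (z.1, z.2.1)) (l ×ˢ 𝓝 (p₀, q₀)) (l ×ˢ 𝓝 p₀) :=
      tendsto_fst.prodMk ((continuous_fst.tendsto _).comp tendsto_snd)
    have h2 : Tendsto (fun z : ι × (L × L) ↦ (z.1, z.2.2)) (l ×ˢ 𝓝 (p₀, q₀)) (l ×ˢ 𝓝 q₀) :=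
      tendsto_fst.prodMk ((continuous_snd.tendsto _).comp tendsto_snd)
    by_cases hpq : p₀ = q₀
    · subst hpq
      obtain ⟨ρ, hρ, h3⟩ := h.approx p₀
      have h4 := eventually_prod_chart l (halfBall_mem_nhdsWithin (n := n) p₀ hρ)
      filter_upwards [tendsto_fst.eventually h3, h1.eventually h4, h2.eventually h4]
        with ⟨i, p, q⟩ hi ⟨hp, hpρ⟩ ⟨hq, hqρ⟩ heq
      have h5 := (hi _ hpρ).2 _ hqρ
      rw [selfRep, chartRep_apply hp, chartRep_apply hq, heq, sub_self, zero_sub, norm_neg] at h5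
      have h6 : ‖extChartAt (𝓡∂ n) p₀ p - extChartAt (𝓡∂ n) p₀ q‖ ≤ 0 := by
        linarith [norm_nonneg (extChartAt (𝓡∂ n) p₀ p - extChartAt (𝓡∂ n) p₀ q)]
      exact (extChartAt (𝓡∂ n) p₀).injOn hp hq (sub_eq_zero.1 (norm_le_zero_iff.1 h6))
    · obtain ⟨V₁, V₂, hV₁, hV₂, hp, hq, hdisj⟩ := t2_separation hpq
      filter_upwards [((h.tendsto p₀).comp h1) (hV₁.mem_nhds hp),
        ((h.tendsto q₀).comp h2) (hV₂.mem_nhds hq)] with z hz1 hz2 heq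
      have hz3 : φ z.1 z.2.1 ∈ V₂ := by
        rw [heq]
        exact hz2
      exact absurd hz3 (disjoint_left.1 hdisj hz1)
  exact key.mono fun i hi p q hpq ↦ hi (p, q) hpq

lemma exists_preimage_chart {p₀ : L} {φ : L → L} {ρ : ℝ} (hρ : 0 < ρ)
    (happ : ∀ x ∈ halfBall (extChartAt (𝓡∂ n) p₀ p₀) ρ,
      x ∈ selfDom p₀ φ ∧ ∀ x' ∈ halfBall (extChartAt (𝓡∂ n) p₀ p₀) ρ,
      ‖selfRep p₀ φ x - selfRep p₀ φ x' - (x - x')‖ ≤ 1 / 4 * ‖x - x'‖)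
    (hb : ∀ q, q ∈ (𝓡∂ n).boundary L ↔ φ q ∈ (𝓡∂ n).boundary L) {p : L}
    (hp : p ∈ (extChartAt (𝓡∂ n) p₀).source)
    (hclose : ‖extChartAt (𝓡∂ n) p₀ p - selfRep p₀ φ (extChartAt (𝓡∂ n) p₀ p₀)‖ ≤ 1 / 2 * (ρ / 2)) :
    ∃ q, φ q = p := by
  have hx₀ := mem_range_extChartAt (n := n) p₀
  have hbx : ∀ x ∈ halfBall (extChartAt (𝓡∂ n) p₀ p₀) ρ, x 0 = 0 → selfRep p₀ φ x 0 = 0 := by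
    intro x hx hx0
    obtain ⟨hxt, hxs⟩ := (happ x hx).1
    refine (mem_boundary_iff hxs).1 ((hb _).1 ?_)
    rw [mem_boundary_iff ((extChartAt (𝓡∂ n) p₀).map_target hxt),
      (extChartAt (𝓡∂ n) p₀).right_inv hxt]
    exact hx0
  let H : Model n × ℝ → Model n × ℝ := fun z ↦ (selfRep p₀ φ z.1, z.2)
  have hH : ∀ z ∈ halfBall (extChartAt (𝓡∂ n) p₀ p₀) ρ ×ˢ Metric.ball (0 : ℝ) ρ,
      ∀ z' ∈ halfBall (extChartAt (𝓡∂ n) p₀ p₀) ρ ×ˢ Metric.ball (0 : ℝ) ρ,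
      ‖H z - H z' - (z - z')‖ ≤ 1 / 2 * ‖z - z'‖ := by
    intro z hz z' hz'
    have h1 := (happ z.1 hz.1).2 z'.1 hz'.1
    have h2 : H z - H z' - (z - z') =
        (selfRep p₀ φ z.1 - selfRep p₀ φ z'.1 - (z.1 - z'.1), 0) :=
      Prod.ext rfl (sub_self _)
    rw [h2, Prod.norm_def, norm_zero, max_eq_left (norm_nonneg _)]
    have h3 := norm_fst_le (z - z')
    rw [Prod.fst_sub] at h3
    linarith [norm_nonneg (z.1 - z'.1)]
  obtain ⟨⟨x, c⟩, hz, hzy⟩ := exists_halfExtend_eq hx₀ hH (half_pos hρ).le (half_lt_self hρ)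
    (y := (extChartAt (𝓡∂ n) p₀ p, 0)) (by
      refine le_trans (le_of_eq ?_) hclose
      change ‖(extChartAt (𝓡∂ n) p₀ p - selfRep p₀ φ (extChartAt (𝓡∂ n) p₀ p₀), (0 : ℝ) - 0)‖ = _
      rw [Prod.norm_def, sub_zero, norm_zero, max_eq_left (norm_nonneg _)])
  have hxball : x ∈ Metric.ball (extChartAt (𝓡∂ n) p₀ p₀) ρ := by
    have := Metric.closedBall_subset_ball (half_lt_self hρ) hz
    rw [← ball_prod_same] at this
    exact this.1
  have hfst : selfRep p₀ φ (halfRetract x) + (x - halfRetract x) = extChartAt (𝓡∂ n) p₀ p :=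
    congrArg Prod.fst hzy
  have hret : halfRetract x ∈ halfBall (extChartAt (𝓡∂ n) p₀ p₀) ρ := by
    refine ⟨halfRetract_mem x, ?_⟩
    rw [mem_ball_iff_norm]
    have h1 := norm_halfRetract_sub_le x (extChartAt (𝓡∂ n) p₀ p₀)
    rw [halfRetract_of_mem hx₀] at h1
    exact h1.trans_lt (mem_ball_iff_norm.1 hxball)
  have hx0 : 0 ≤ x 0 := by
    by_contra! hneg
    have h1 : halfRetract x 0 = 0 := by
      rw [halfRetract_zero, max_eq_right hneg.le]
    have h2 := hbx _ hret h1
    have h3 := congrArg (fun v : Model n ↦ v 0) hfst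
    simp only [PiLp.add_apply, PiLp.sub_apply] at h3
    rw [h2, h1] at h3
    have h4 := mem_range_halfSpace.1
      (extChartAt_target_subset_range p₀ ((extChartAt (𝓡∂ n) p₀).map_source hp))
    linarith
  rw [halfRetract_of_mem (mem_range_halfSpace.2 hx0)] at hfst hret
  rw [sub_self, add_zero] at hfst
  exact ⟨(extChartAt (𝓡∂ n) p₀).symm x, (extChartAt (𝓡∂ n) p₀).injOn (happ x hret).1.2 hp hfst⟩

lemma eventually_surjective [CompactSpace L] [T2Space L] (h : TendstoIdentity n φ l) :
    ∀ᶠ i in l, Function.Surjective (φ i) := by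
  have key : ∀ᶠ i in l, ∀ p, ∃ q, φ i q = p := by
    refine eventually_forall_of_compact fun p₀ ↦ ?_
    obtain ⟨ρ, hρ, happ⟩ := h.approx p₀
    have h1 : Tendsto (fun z : ι × L ↦ extChartAt (𝓡∂ n) p₀ z.2) (l ×ˢ 𝓝 p₀)
        (𝓝 (extChartAt (𝓡∂ n) p₀ p₀)) :=
      (continuousAt_extChartAt (I := 𝓡∂ n) p₀).tendsto.comp tendsto_snd
    have h2 : Tendsto (fun z : ι × L ↦ φ z.1 p₀) (l ×ˢ 𝓝 p₀) (𝓝 p₀) :=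
      (tendsto_eval_of_tendsto_uniformly (ψ₀ := id) h.tendsto tendsto_const_nhds).comp tendsto_fst
    have h3 := (continuousAt_extChartAt (I := 𝓡∂ n) p₀).tendsto.comp h2
    have h4 := h1.sub h3
    rw [sub_self] at h4
    filter_upwards [tendsto_fst.eventually happ, tendsto_fst.eventually h.boundary,
      h4 (Metric.ball_mem_nhds _ (by positivity : 0 < 1 / 2 * (ρ / 2))),
      tendsto_snd.eventually (extChartAt_source_mem_nhds (I := 𝓡∂ n) p₀)] with z hz1 hz2 hz3 hz4
    refine exists_preimage_chart hρ hz1 hz2 hz4 ?_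
    rw [selfRep, chartRep_apply (mem_extChartAt_source p₀)]
    exact (mem_ball_zero_iff.1 hz3).le
  exact key.mono fun i hi p ↦ hi p

lemma eventually_component [CompactSpace L] (h : TendstoIdentity n φ l) :
    ∀ᶠ i in l, ∀ p ∈ (𝓡∂ n).boundary L, φ i p ∈ connectedComponentIn ((𝓡∂ n).boundary L) p := by
  refine eventually_forall_of_compact fun p₀ ↦ ?_
  obtain ⟨ρ, hρ, hsub⟩ := exists_halfBall_subset (extChartAt_target_mem_nhdsWithin (I := 𝓡∂ n) p₀)
  have h1 := chart_preimage_mem_nhds (halfBall_mem_nhdsWithin (n := n) p₀ hρ)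
  filter_upwards [tendsto_snd.eventually h1, h.tendsto p₀ h1, tendsto_fst.eventually h.boundary]
    with z hz1 hz2 hz3 hzb
  exact mem_component_of_halfBall hsub hz1.1 hz2.1 hz1.2 hz2.2 hzb ((hz3 _).1 hzb)

lemma exists_approx_invertible (h : TendstoIdentity n φ l) (p₀ : L) :
    ∃ ρ > 0, ∀ᶠ i in l, ∀ x ∈ halfBall (extChartAt (𝓡∂ n) p₀ p₀) ρ, x ∈ selfDom p₀ (φ i) ∧
      (fderivWithin ℝ (selfRep p₀ (φ i)) (range (𝓡∂ n)) x).IsInvertible := by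
  obtain ⟨ρ₁, hρ₁, h1⟩ := h.approx p₀
  have h2 := (h.tendsto_deriv p₀).eventually
    (ContinuousLinearEquiv.nhds (ContinuousLinearEquiv.refl ℝ (Model n)))
  obtain ⟨ρ₂, hρ₂, h3⟩ := exists_halfBall_eventually (p₀ := p₀)
    (P := fun i x ↦ (fderivWithin ℝ (selfRep p₀ (φ i)) (range (𝓡∂ n)) x).IsInvertible) h2
  refine ⟨min ρ₁ ρ₂, lt_min hρ₁ hρ₂, ?_⟩
  filter_upwards [h1, h3] with i hi1 hi3 x hx
  exact ⟨(hi1 x (halfBall_mono _ (min_le_left _ _) hx)).1,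
    hi3 x (halfBall_mono _ (min_le_right _ _) hx)⟩

/-- Continuous inverses of smooth maps with invertible derivative are smooth. -/
lemma contMDiffAt_inverse {p₀ : L} {φ χ : L → L} {ρ : ℝ} (hφ : ContMDiff (𝓡∂ n) (𝓡∂ n) ∞ φ)
    (hχ : Continuous χ) (hφχ : ∀ p, φ (χ p) = p)
    (hinv : ∀ x ∈ halfBall (extChartAt (𝓡∂ n) p₀ p₀) ρ, x ∈ selfDom p₀ φ ∧
      (fderivWithin ℝ (selfRep p₀ φ) (range (𝓡∂ n)) x).IsInvertible) {p : L}
    (hp : p ∈ (extChartAt (𝓡∂ n) p₀).source) (hχp : χ p ∈ (extChartAt (𝓡∂ n) p₀).source)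
    (hχρ : extChartAt (𝓡∂ n) p₀ (χ p) ∈ halfBall (extChartAt (𝓡∂ n) p₀ p₀) ρ) :
    ContMDiffAt (𝓡∂ n) (𝓡∂ n) ∞ χ p := by
  have hpt := (extChartAt (𝓡∂ n) p₀).map_source hp
  have hpr := extChartAt_target_subset_range p₀ hpt
  have hsymm : Tendsto (fun x ↦ χ ((extChartAt (𝓡∂ n) p₀).symm x))
      (𝓝[range (𝓡∂ n)] (extChartAt (𝓡∂ n) p₀ p)) (𝓝 (χ p)) := by
    have h1 := (continuousAt_extChartAt_symm' (I := 𝓡∂ n) hp).tendsto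
    rw [(extChartAt (𝓡∂ n) p₀).left_inv hp] at h1
    exact ((hχ.tendsto p).comp h1).mono_left nhdsWithin_le_nhds
  have hV : (extChartAt (𝓡∂ n) p₀).source ∩
      extChartAt (𝓡∂ n) p₀ ⁻¹' halfBall (extChartAt (𝓡∂ n) p₀ p₀) ρ ∈ 𝓝 (χ p) := by
    refine inter_mem (extChartAt_source_mem_nhds' hχp) ?_
    have h1 : Tendsto (extChartAt (𝓡∂ n) p₀) (𝓝 (χ p))
        (𝓝[range (𝓡∂ n)] (extChartAt (𝓡∂ n) p₀ (χ p))) := by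
      rw [← map_extChartAt_nhds' hχp]
      exact tendsto_map
    exact h1 (halfBall_mem_nhdsWithin_of_mem hχρ)
  have ht := extChartAt_target_mem_nhdsWithin' hp
  obtain ⟨δ, hδ, hsub⟩ := Metric.mem_nhdsWithin_iff.1 (inter_mem ht (hsymm hV))
  have hsub' : ∀ x ∈ halfBall (extChartAt (𝓡∂ n) p₀ p) δ, x ∈ (extChartAt (𝓡∂ n) p₀).target ∧
      χ ((extChartAt (𝓡∂ n) p₀).symm x) ∈ (extChartAt (𝓡∂ n) p₀).source ∧
      selfRep p₀ χ x ∈ halfBall (extChartAt (𝓡∂ n) p₀ p₀) ρ := fun x hx ↦ hsub ⟨hx.2, hx.1⟩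
  have hpδ : extChartAt (𝓡∂ n) p₀ p ∈ halfBall (extChartAt (𝓡∂ n) p₀ p) δ :=
    ⟨hpr, Metric.mem_ball_self hδ⟩
  have hcont : ContinuousOn (selfRep p₀ χ) (halfBall (extChartAt (𝓡∂ n) p₀ p) δ) :=
    (continuousOn_extChartAt p₀).comp (hχ.comp_continuousOn
      ((continuousOn_extChartAt_symm p₀).mono fun x hx ↦ (hsub' x hx).1)) fun x hx ↦ (hsub' x hx).2.1
  have hsm : ContDiffOn ℝ ∞ (selfRep p₀ χ) (halfBall (extChartAt (𝓡∂ n) p₀ p) δ) := by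
    refine contDiffOn_of_comp_eq (Φ := selfRep p₀ φ) (h := id)
      (uniqueDiffOn_halfBall (extChartAt (𝓡∂ n) p₀ p₀) ρ) (uniqueDiffOn_halfBall _ _)
      ((contDiffOn_chartRep hφ).mono fun x hx ↦ (hinv x hx).1) ?_ hcont
      (fun x hx ↦ (hsub' x hx).2.2) contDiffOn_id ?_
    · intro x hx
      rw [halfBall, fderivWithin_inter (Metric.isOpen_ball.mem_nhds hx.2)]
      exact (hinv x hx).2
    · intro x hx
      obtain ⟨h1, h2, -⟩ := hsub' x hx
      refine (chartRep_apply h2).trans ?_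
      rw [hφχ]
      exact (extChartAt (𝓡∂ n) p₀).right_inv h1
  refine contMDiffAt_of_chart (y₀ := p₀) (h := selfRep p₀ χ) hp ?_
    ((hsm _ hpδ).mono_of_mem_nhdsWithin (halfBall_mem_nhdsWithin_of_mem hpδ))
  filter_upwards [halfBall_mem_nhdsWithin_of_mem hpδ] with x hx
  exact ⟨(extChartAt (𝓡∂ n) p₀).map_source (hsub' x hx).2.1,
    ((extChartAt (𝓡∂ n) p₀).left_inv (hsub' x hx).2.1).symm⟩

/-- Maps close to the identity are diffeomorphisms. -/
theorem eventually_exists_diff [CompactSpace L] [T2Space L] (h : TendstoIdentity n φ l) :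
    ∀ᶠ i in l, ∃ Φ ∈ Diff n L, ⇑Φ = φ i := by
  have hloc : ∀ᶠ i in l, ∀ q, ∃ p₀ : L, ∃ ρ : ℝ,
      (∀ x ∈ halfBall (extChartAt (𝓡∂ n) p₀ p₀) ρ, x ∈ selfDom p₀ (φ i) ∧
        (fderivWithin ℝ (selfRep p₀ (φ i)) (range (𝓡∂ n)) x).IsInvertible) ∧
      φ i q ∈ (extChartAt (𝓡∂ n) p₀).source ∧ q ∈ (extChartAt (𝓡∂ n) p₀).source ∧
      extChartAt (𝓡∂ n) p₀ q ∈ halfBall (extChartAt (𝓡∂ n) p₀ p₀) ρ := by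
    refine eventually_forall_of_compact fun p₀ ↦ ?_
    obtain ⟨ρ, hρ, h1⟩ := h.exists_approx_invertible p₀
    filter_upwards [tendsto_fst.eventually h1,
      h.tendsto p₀ (extChartAt_source_mem_nhds (I := 𝓡∂ n) p₀),
      eventually_prod_chart l (halfBall_mem_nhdsWithin (n := n) p₀ hρ)] with z hz1 hz2 hz3
    exact ⟨p₀, ρ, hz1, hz2, hz3⟩
  filter_upwards [h.smooth, h.eventually_injective, h.eventually_surjective,
    h.eventually_component, hloc] with i hsm hinj hsurj hcomp hi
  let e : L ≃ L := Equiv.ofBijective (φ i) ⟨hinj, hsurj⟩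
  have hcont : Continuous e.symm := Continuous.continuous_symm_of_equiv_compact_to_t2
    (f := e) hsm.continuous
  have happly : ∀ p, φ i (e.symm p) = p := fun p ↦ e.apply_symm_apply p
  refine ⟨⟨e, hsm, fun p ↦ ?_⟩, fun p hp x hx ↦ ?_, rfl⟩
  · obtain ⟨p₀, ρ, h1, h2, h3, h4⟩ := hi (e.symm p)
    rw [happly] at h2
    exact contMDiffAt_inverse hsm hcont happly h1 h2 h3 h4
  · rw [connectedComponentIn_eq hx]
    exact hcomp x (connectedComponentIn_subset _ _ hx)

lemma tendsto_inverse [CompactSpace L] [T2Space L] (h : TendstoIdentity n φ l) {χ : ι → L → L}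
    (hχ : ∀ᶠ i in l, ∀ p, φ i (χ i p) = p) (p₀ : L) :
    Tendsto (fun z : ι × L ↦ χ z.1 z.2) (l ×ˢ 𝓝 p₀) (𝓝 p₀) := by
  intro U hU
  have h1 : ∀ᶠ z in l ×ˢ 𝓝 p₀, ∀ q ∈ (interior U)ᶜ, φ z.1 q ≠ z.2 := by
    refine eventually_forall_mem_of_compact isOpen_interior.isClosed_compl.isCompact fun q hq ↦ ?_
    have hne : q ≠ p₀ := fun heq ↦ hq (heq ▸ mem_interior_iff_mem_nhds.2 hU)
    obtain ⟨V₁, V₂, hV₁, hV₂, hq1, hp1, hdisj⟩ := t2_separation hne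
    have h2 : Tendsto (fun z : (ι × L) × L ↦ φ z.1.1 z.2) ((l ×ˢ 𝓝 p₀) ×ˢ 𝓝 q) (𝓝 q) :=
      (h.tendsto q).comp ((tendsto_fst.comp tendsto_fst).prodMk tendsto_snd)
    have h3 : Tendsto (fun z : (ι × L) × L ↦ z.1.2) ((l ×ˢ 𝓝 p₀) ×ˢ 𝓝 q) (𝓝 p₀) :=
      tendsto_snd.comp tendsto_fst
    filter_upwards [h2 (hV₁.mem_nhds hq1), h3 (hV₂.mem_nhds hp1)] with z hz1 hz2 heq
    have hz3 : φ z.1.1 z.2 ∈ V₂ := by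
      rw [heq]
      exact hz2
    exact disjoint_left.1 hdisj hz1 hz3
  refine mem_map.2 ?_
  filter_upwards [h1, tendsto_fst.eventually hχ] with z hz1 hz2
  by_contra hcon
  exact hz1 _ (fun hmem ↦ hcon (interior_subset (s := U) hmem)) (hz2 z.2)

lemma inverse_apply_of_eq {E E' : Type*} [NormedAddCommGroup E] [NormedSpace ℝ E]
    [NormedAddCommGroup E'] [NormedSpace ℝ E'] {T : E →L[ℝ] E'} (hT : T.IsInvertible) {u : E} {v : E'}
    (h : v = T u) : T.inverse v = u := by
  obtain ⟨B, rfl⟩ := hT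
  rw [h, ContinuousLinearMap.inverse_equiv]
  exact B.symm_apply_apply u

/-- Inverses of diffeomorphisms converging to the identity converge together with their
derivatives. -/
lemma tendsto_tangentMap_symm [CompactSpace L] [T2Space L] (h : TendstoIdentity n φ l)
    {Φ : ι → L ≃ₘ^∞⟮𝓡∂ n, 𝓡∂ n⟯ L} (hΦ : ∀ᶠ i in l, ⇑(Φ i) = φ i) (w₀ : TangentBundle (𝓡∂ n) L) :
    Tendsto (fun z : ι × TangentBundle (𝓡∂ n) L ↦ tangentMap (𝓡∂ n) (𝓡∂ n) (Φ z.1).symm z.2)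
      (l ×ˢ 𝓝 w₀) (𝓝 w₀) := by
  have hproj : Tendsto (fun z : ι × TangentBundle (𝓡∂ n) L ↦ (z.1, z.2.1)) (l ×ˢ 𝓝 w₀)
      (l ×ˢ 𝓝 w₀.1) :=
    tendsto_fst.prodMk
      (((FiberBundle.continuous_proj (Model n) (TangentSpace (𝓡∂ n))).tendsto w₀).comp tendsto_snd)
  have hbase : Tendsto (fun z : ι × TangentBundle (𝓡∂ n) L ↦ (Φ z.1).symm z.2.1) (l ×ˢ 𝓝 w₀)
      (𝓝 w₀.1) := by
    refine (h.tendsto_inverse (χ := fun i ↦ (Φ i).symm) ?_ w₀.1).comp hproj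
    filter_upwards [hΦ] with i hi p
    rw [← hi, Diffeomorph.apply_symm_apply]
  set e := trivializationAt (Model n) (TangentSpace (𝓡∂ n) : L → Type _) w₀.1 with he
  have hw₀ : w₀ ∈ e.source := by
    rw [e.mem_source]
    exact FiberBundle.mem_baseSet_trivializationAt' w₀.1
  refine (e.tendsto_nhds_iff hw₀).2 ⟨hbase, ?_⟩
  have h2 : Tendsto (fun z : ι × TangentBundle (𝓡∂ n) L ↦ (e z.2).2) (l ×ˢ 𝓝 w₀)
      (𝓝 (e w₀).2) :=
    ((continuous_snd.tendsto _).comp (e.continuousAt hw₀).tendsto).comp tendsto_snd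
  have h3 := (h.tendsto_deriv w₀.1).comp
    ((tendsto_prod_chart l w₀.1).comp (tendsto_fst.prodMk hbase))
  have h4 := tendsto_clm_apply
    (tendsto_clm_inverse (ContinuousLinearEquiv.refl ℝ (Model n)) h3) h2
  obtain ⟨ρ, hρ, hinv⟩ := h.exists_approx_invertible w₀.1
  refine h4.congr' ?_
  filter_upwards [tendsto_fst.eventually hinv, tendsto_fst.eventually hΦ,
    hbase (chart_preimage_mem_nhds (halfBall_mem_nhdsWithin (n := n) w₀.1 hρ)),
    (tendsto_snd.comp hproj) (extChartAt_source_mem_nhds (I := 𝓡∂ n) w₀.1)]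
    with ⟨i, w⟩ hz1 hz2 ⟨hz3, hz3ρ⟩ hz4
  have hcomp : tangentMap (𝓡∂ n) (𝓡∂ n) (Φ i) (tangentMap (𝓡∂ n) (𝓡∂ n) (Φ i).symm w) = w := by
    have h5 := tangentMap_comp_at w (I := 𝓡∂ n) (I' := 𝓡∂ n) (I'' := 𝓡∂ n) (f := (Φ i).symm)
      (g := Φ i) ((Φ i).contMDiff.mdifferentiable (by simp) _)
      ((Φ i).symm.contMDiff.mdifferentiable (by simp) _)
    rw [← h5]
    have h6 : ⇑(Φ i) ∘ ⇑(Φ i).symm = id := funext fun p ↦ (Φ i).apply_symm_apply p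
    rw [h6, tangentMap_id]
    rfl
  have h7 := trivializationAt_tangentMap (I := 𝓡∂ n) (I' := 𝓡∂ n) (g := Φ i) (p₀ := w₀.1)
    (y₀ := w₀.1) (w := tangentMap (𝓡∂ n) (𝓡∂ n) (Φ i).symm w)
    ((Φ i).contMDiff.mdifferentiable (by simp) _) hz3 (by
      change Φ i ((Φ i).symm w.1) ∈ _
      rw [Diffeomorph.apply_symm_apply]
      exact hz4)
  rw [hcomp, hz2] at h7
  exact inverse_apply_of_eq (hz1 _ hz3ρ).2 h7

end TendstoIdentity

end NearIdentity

end LagBdry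

namespace LagBdry

section Sections

variable {ι : Type*} {n : ℕ} [NeZero n] {l : Filter ι}
  {L : Type*} [TopologicalSpace L]
  [ChartedSpace (EuclideanHalfSpace n) L] [IsManifold (𝓡∂ n) ∞ L]

/-- A one-form as a map to the cotangent bundle. -/
noncomputable def formSection (θ : DirichletOneForm n L) :
    C^∞⟮𝓡∂ n, L; coModelWithCorners n, Cotangent n L⟯ :=
  ⟨fun p : L ↦ TotalSpace.mk' (EuclideanSpace ℝ (Fin n) →L[ℝ] ℝ) p (θ.1 p), θ.1.contMDiff⟩

lemma mk_eq_of_proj_eq {t : Cotangent n L} {p : L} (h : t.1 = p) :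
    (⟨p, (t.2 : CoModel n)⟩ : Cotangent n L) = t := by
  subst h
  rfl

lemma exists_dirichletOneForm {t : L → Cotangent n L}
    (ht : ContMDiff (𝓡∂ n) (coModelWithCorners n) ∞ t) (hp : ∀ p, (t p).1 = p)
    (hb : ∀ p ∈ (𝓡∂ n).boundary L, ∃ q, MatchesBoundary q (t p)) :
    ∃ θ : DirichletOneForm n L, ⇑(formSection θ) = t := by
  have heq : (fun p ↦ (⟨p, ((t p).2 : CoModel n)⟩ : Cotangent n L)) = t :=
    funext fun p ↦ mk_eq_of_proj_eq (hp p)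
  let θ : OneForm n L := ⟨fun p ↦ ((t p).2 : CoModel n), by
    refine Eq.mp (congrArg (ContMDiff (𝓡∂ n) (coModelWithCorners n) ∞) heq.symm) ht⟩
  refine ⟨⟨θ, fun p hpb Y hY ↦ ?_⟩, heq⟩
  obtain ⟨q, -, hq⟩ := hb p hpb
  rw [← congrFun heq p] at hq
  exact hq hpb Y hY

lemma fderivWithin_zeroCovector (p₀ : L) :
    fderivWithin ℝ (coRep p₀ (zeroCovector n)) (range (𝓡∂ n)) (extChartAt (𝓡∂ n) p₀ p₀) =
      ContinuousLinearMap.inl ℝ (Model n) (CoModel n) := by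
  have h1 : ∀ x ∈ (extChartAt (𝓡∂ n) p₀).target,
      coRep p₀ (zeroCovector n) x = ContinuousLinearMap.inl ℝ (Model n) (CoModel n) x := by
    intro x hx
    have h2 := (extChartAt (𝓡∂ n) p₀).map_target hx
    have h3 : coRep p₀ (zeroCovector n) x = (extChartAt (𝓡∂ n) p₀ ((extChartAt (𝓡∂ n) p₀).symm x),
      covectorChart p₀ ((extChartAt (𝓡∂ n) p₀).symm x) 0) := cotangentChart_apply h2
    rw [h3, (extChartAt (𝓡∂ n) p₀).right_inv hx]
    rfl
  have h4 := (ContinuousLinearMap.inl ℝ (Model n) (CoModel n)).hasFDerivWithinAt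
    (s := range (𝓡∂ n)) (x := extChartAt (𝓡∂ n) p₀ p₀)
  refine (h4.congr_of_eventuallyEq ?_ (h1 _ (mem_extChartAt_target p₀))).fderivWithin
    ((𝓡∂ n).uniqueDiffOn _ (mem_range_extChartAt p₀))
  filter_upwards [extChartAt_target_mem_nhdsWithin (I := 𝓡∂ n) p₀] with x hx using h1 x hx

lemma TendstoZeroSection.tendsto_tangentMap {s : ι → L → Cotangent n L}
    (h : TendstoZeroSection s l) (w : TangentBundle (𝓡∂ n) L) :
    Tendsto (fun z : ι × TangentBundle (𝓡∂ n) L ↦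
      tangentMap (𝓡∂ n) (coModelWithCorners n) (s z.1) z.2) (l ×ˢ 𝓝 w)
      (𝓝 (tangentMap (𝓡∂ n) (coModelWithCorners n) (zeroCovector n) w)) := by
  have hz : ContMDiff (𝓡∂ n) (coModelWithCorners n) ∞ (zeroCovector n : L → Cotangent n L) :=
    contMDiff_zeroSection (n := ∞) (IB := 𝓡∂ n) ℝ (fun p : L ↦ TangentSpace (𝓡∂ n) p →L[ℝ] ℝ)
  refine LagBdry.tendsto_tangentMap (h.smooth.mono fun i hi ↦ hi.mdifferentiable (by simp))
    (hz.mdifferentiable (by simp)) (h.tendsto w.1) ?_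
  have h1 := fderivWithin_zeroCovector (n := n) w.1
  have h2 := h.tendsto_deriv w.1
  rw [← h1] at h2
  exact h2

lemma TendstoZeroSection.tendsto_forms [CompactSpace L] [T2Space L] {s : ι → L → Cotangent n L}
    (h : TendstoZeroSection s l)
    (hb : ∀ᶠ i in l, ∀ q, q ∈ (𝓡∂ n).boundary L ↔ (s i q).1 ∈ (𝓡∂ n).boundary L)
    {Φ : ι → L ≃ₘ^∞⟮𝓡∂ n, 𝓡∂ n⟯ L} (hΦ : ∀ᶠ i in l, ⇑(Φ i) = fun p ↦ (s i p).1)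
    {θ : ι → DirichletOneForm n L} (hθ : ∀ᶠ i in l, ⇑(formSection (θ i)) = s i ∘ (Φ i).symm) :
    Tendsto θ l (𝓝 0) := by
  refine (@nhds_induced _ _ (c1Topology _ _ _ _) formSection (0 : DirichletOneForm n L)).symm ▸
    tendsto_comap_iff.2 (tendsto_c1Topology fun w ↦ ?_)
  have h1 := (h.tendsto_tangentMap w).comp
    (tendsto_fst.prodMk ((h.tendstoIdentity hb).tendsto_tangentMap_symm hΦ w))
  refine h1.congr' ?_
  filter_upwards [tendsto_fst.eventually hθ, tendsto_fst.eventually h.smooth] with ⟨i, v⟩ hi hsm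
  have h2 := tangentMap_comp_at v (I := 𝓡∂ n) (I' := 𝓡∂ n) (I'' := coModelWithCorners n)
    (f := (Φ i).symm) (g := s i) (hsm.mdifferentiable (by simp) _)
    ((Φ i).symm.contMDiff.mdifferentiable (by simp) _)
  rw [← hi] at h2
  exact h2.symm

end Sections

section Factorization

variable {ι : Type*} {n : ℕ} [NeZero n] {d : ℕ}
  {X : Type*} [TopologicalSpace X] [T2Space X]
  [ChartedSpace (EuclideanSpace ℝ (Fin (2 * n))) X] [IsManifold (𝓡 (2 * n)) ∞ X]
  {K : CalabiYau n X}
  {L : Type*} [TopologicalSpace L] [CompactSpace L] [T2Space L]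
  [ChartedSpace (EuclideanHalfSpace n) L] [IsManifold (𝓡∂ n) ∞ L]
  {G : ι → L → X} {l : Filter ι}
  {f : L → X} {C : Fin d → Set L} {Λ : Fin d → Set X}
  {D : CovariantDerivative (𝓡 (2 * n)) (EuclideanSpace ℝ (Fin (2 * n)))
      (TangentSpace (𝓡 (2 * n)) : X → Type _)} {a : L → ℝ}

/-- Maps close to `f` with boundary conditions are reparametrizations of deformations of `f`. -/
theorem DeformationData.exists_factorization (S : DeformationData K C Λ D f a)
    (h : C1Tendsto (n := n) G l f) (hG : ∀ᶠ i in l, ∀ j, ∀ p ∈ C j, G i p ∈ Λ j) :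
    ∃ (θ : ι → DirichletOneForm n L) (Φ : ι → L ≃ₘ^∞⟮𝓡∂ n, 𝓡∂ n⟯ L), Tendsto θ l (𝓝 0) ∧
      ∀ᶠ i in l, Φ i ∈ Diff n L ∧ G i = K.deform D S.imm a (θ i).1 ∘ Φ i := by
  obtain ⟨s, hs, hlim⟩ := S.exists_selection h hG
  have hz := tendstoZeroSection_selection S h (hs.mono fun i hi q ↦ (hi q).1) hlim
  have hb : ∀ᶠ i in l, ∀ q, q ∈ (𝓡∂ n).boundary L ↔ (s i q).1 ∈ (𝓡∂ n).boundary L :=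
    hs.mono fun i hi q ↦ (hi q).2.1
  have hex : ∀ᶠ i in l, ∃ x : DirichletOneForm n L × (L ≃ₘ^∞⟮𝓡∂ n, 𝓡∂ n⟯ L), x.2 ∈ Diff n L ∧
      (⇑x.2 = fun p ↦ (s i p).1) ∧ ⇑(formSection x.1) = s i ∘ x.2.symm := by
    filter_upwards [(hz.tendstoIdentity hb).eventually_exists_diff, hs, hz.smooth]
      with i ⟨Φ, hΦ, hΦs⟩ hi hsm
    have hproj : ∀ p, (s i (Φ.symm p)).1 = p := fun p ↦
      (congrFun hΦs (Φ.symm p)).symm.trans (Φ.apply_symm_apply p)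
    obtain ⟨θ, hθ⟩ := exists_dirichletOneForm (t := s i ∘ Φ.symm) (hsm.comp Φ.symm.contMDiff)
      hproj fun p _ ↦ ⟨Φ.symm p, (hi (Φ.symm p)).2⟩
    exact ⟨(θ, Φ), hΦ, hΦs, hθ⟩
  classical
  have hch : ∀ i, ∃ x : DirichletOneForm n L × (L ≃ₘ^∞⟮𝓡∂ n, 𝓡∂ n⟯ L),
      (∃ x : DirichletOneForm n L × (L ≃ₘ^∞⟮𝓡∂ n, 𝓡∂ n⟯ L), x.2 ∈ Diff n L ∧
      (⇑x.2 = fun p ↦ (s i p).1) ∧ ⇑(formSection x.1) = s i ∘ x.2.symm) → x.2 ∈ Diff n L ∧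
      (⇑x.2 = fun p ↦ (s i p).1) ∧ ⇑(formSection x.1) = s i ∘ x.2.symm := by
    intro i
    by_cases hi : ∃ x : DirichletOneForm n L × (L ≃ₘ^∞⟮𝓡∂ n, 𝓡∂ n⟯ L), x.2 ∈ Diff n L ∧
      (⇑x.2 = fun p ↦ (s i p).1) ∧ ⇑(formSection x.1) = s i ∘ x.2.symm
    · exact ⟨hi.choose, fun _ ↦ hi.choose_spec⟩
    · exact ⟨(0, Diffeomorph.refl _ _ _), fun h ↦ absurd h hi⟩
  choose x hx using hch
  have hx' := hex.mono hx
  refine ⟨fun i ↦ (x i).1, fun i ↦ (x i).2, ?_, ?_⟩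
  · exact hz.tendsto_forms hb (hx'.mono fun i hi ↦ hi.2.1) (hx'.mono fun i hi ↦ hi.2.2)
  · filter_upwards [hx', hs] with i hi hsi
    refine ⟨hi.1, funext fun q ↦ ?_⟩
    have h1 : formSection (x i).1 ((x i).2 q) = s i q := by
      rw [hi.2.2, Function.comp_apply, Diffeomorph.symm_apply_apply]
    have h2 : covectorExp D S.imm a (formSection (x i).1 ((x i).2 q)) = G i q := by
      rw [h1]
      exact (hsi q).1
    exact h2.symm

/-- The deformations `f_θ`, for `θ` small, are free immersions with boundary conditions. -/
theorem DeformationData.eventually_deform (S : DeformationData K C Λ D f a) :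
    ∀ᶠ θ in formFilter n L, (∀ p, ∃ y, IsExp D (f p) (K.field S.imm a θ.1 p) y) ∧
      IsImm n (K.deform D S.imm a θ.1) ∧ IsFree n (K.deform D S.imm a θ.1) ∧
      HasBoundaryCondition n C Λ (K.deform D S.imm a θ.1) := by
  filter_upwards [S.eventually_isExp, S.c1Tendsto_deform.eventually_isImm S.imm,
    S.c1Tendsto_deform.eventually_isFree S, S.eventually_deform_mem,
    S.c1Tendsto_deform.eventually_not_tangent S] with θ h1 h2 h3 h4 h5
  exact ⟨fun p ↦ ⟨_, h1 p⟩, h2, h3, h4, fun i p hp ↦ h5 i p hp (h4 i p hp)⟩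

theorem DeformationData.exists_nhds_factorization (S : DeformationData K C Λ D f a)
    {𝒩 : Set (DirichletOneForm n L)} (h𝒩 : 𝒩 ∈ 𝓝 0) :
    ∃ 𝒰 : Set C^∞⟮𝓡∂ n, L; 𝓡 (2 * n), X⟯, IsOpen[c1Topology (𝓡∂ n) L (𝓡 (2 * n)) X] 𝒰 ∧
      (⟨f, S.imm.1.1⟩ : C^∞⟮𝓡∂ n, L; 𝓡 (2 * n), X⟯) ∈ 𝒰 ∧
      ∀ f₁ ∈ 𝒰, HasBoundaryCondition n C Λ f₁ →
        ∃ θ ∈ 𝒩, ∃ φ ∈ Diff n L, (f₁ : L → X) = K.deform D S.imm a θ ∘ φ := by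
  let t := c1Topology (𝓡∂ n) L (𝓡 (2 * n)) X
  obtain ⟨θ, Φ, hθ, hΦ⟩ := S.exists_factorization
    (l := @nhds _ t ⟨f, S.imm.1.1⟩ ⊓ 𝓟 {f₁ | HasBoundaryCondition n C Λ f₁})
    ((c1Tendsto_coe S.imm.1.1).mono inf_le_left)
    (eventually_inf_principal.2 (Eventually.of_forall fun f₁ hf₁ ↦ hf₁.1))
  obtain ⟨𝒰, hsub, hop, hmem⟩ := (@eventually_nhds_iff _ t _ _).1
    (eventually_inf_principal.1 (Filter.Eventually.and (hθ.eventually h𝒩) hΦ))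
  exact ⟨𝒰, hop, hmem, fun f₁ hf₁ hb ↦ ⟨θ f₁, (hsub f₁ hf₁ hb).1, Φ f₁, (hsub f₁ hf₁ hb).2⟩⟩

end Factorization

end LagBdry

theorem mainTheorem4 {n d : ℕ} [NeZero n]
    {X : Type*} [TopologicalSpace X] [T2Space X] [SecondCountableTopology X]
    [ChartedSpace (EuclideanSpace ℝ (Fin (2 * n))) X] [IsManifold (𝓡 (2 * n)) ∞ X]
    (K : LagBdry.CalabiYau n X)
    {L : Type*} [TopologicalSpace L] [T2Space L] [CompactSpace L]
    [ChartedSpace (EuclideanHalfSpace n) L] [IsManifold (𝓡∂ n) ∞ L]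
    (C : Fin d → Set L) (hC : LagBdry.IsBoundaryOrdering n C)
    (Λ : Fin d → Set X) (hΛ : ∀ i, K.IsLagrangianSubmanifold (Λ i))
    (hΛdisj : Pairwise (Function.onFun Disjoint Λ))
    (D : CovariantDerivative (𝓡 (2 * n)) (EuclideanSpace ℝ (Fin (2 * n)))
      (TangentSpace (𝓡 (2 * n)) : X → Type _))
    (hD : D.ContMDiffCovariantDerivative ∞)
    (hDΛ : ∀ i, LagBdry.IsGeodesicSubmanifold D (Λ i))
    (f : L → X) (hf : K.IsLagrangianImm f) (hfree : LagBdry.IsFree n f)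
    (hbdry : LagBdry.HasBoundaryCondition n C Λ f)
    (a : L → ℝ) (ha : ContMDiff (𝓡∂ n) 𝓘(ℝ, ℝ) ∞ a)
    (haE : ∀ i, ∀ p ∈ C i, Module.finrank ℝ
      (K.E f a p ⊓ LagBdry.tangentOf (𝓡 (2 * n)) (Λ i) (f p) :
        Submodule ℝ (TangentSpace (𝓡 (2 * n)) (f p))) = 1) :
    ∃ 𝒩 : Set (LagBdry.DirichletOneForm n L), IsOpen 𝒩 ∧ 0 ∈ 𝒩 ∧
      (∀ θ ∈ 𝒩,
        (∀ p, ∃ y, LagBdry.IsExp D (f p) (K.field hf a θ p) y) ∧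
        LagBdry.IsImm n (K.deform D hf a θ) ∧
        LagBdry.IsFree n (K.deform D hf a θ) ∧
        LagBdry.HasBoundaryCondition n C Λ (K.deform D hf a θ)) ∧
      K.deform D hf a 0 = f ∧
      (∀ θ : LagBdry.DirichletOneForm n L, ∀ p : L,
        MDifferentiableAt 𝓘(ℝ, ℝ) (𝓡 (2 * n))
          (fun t : ℝ ↦ K.deform D hf a (t • (θ : LagBdry.OneForm n L)) p) 0 ∧
        ∃ V : TangentSpace (𝓡 (2 * n)) (f p),
          LagBdry.velocity (𝓡 (2 * n))
            (fun t : ℝ ↦ K.deform D hf a (t • (θ : LagBdry.OneForm n L)) p) 0 = ⟨f p, V⟩ ∧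
          ∀ Y : TangentSpace (𝓡∂ n) p,
            K.omega (f p) ![V, LagBdry.diff n f p Y] = (θ : LagBdry.OneForm n L) p Y) ∧
      ∃ 𝒰 : Set C^∞⟮𝓡∂ n, L; 𝓡 (2 * n), X⟯,
        IsOpen[LagBdry.c1Topology (𝓡∂ n) L (𝓡 (2 * n)) X] 𝒰 ∧
        (⟨f, hf.1.1⟩ : C^∞⟮𝓡∂ n, L; 𝓡 (2 * n), X⟯) ∈ 𝒰 ∧
        ∀ f₁ ∈ 𝒰, LagBdry.HasBoundaryCondition n C Λ f₁ →
          ∃ θ ∈ 𝒩, ∃ φ ∈ LagBdry.Diff n L, (f₁ : L → X) = K.deform D hf a θ ∘ φ := by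
  have S : LagBdry.DeformationData K C Λ D f a :=
    ⟨hC, hΛ, hD, hDΛ, hf, hfree, hbdry, ha, haE⟩
  obtain ⟨𝒩, hop, h0, h𝒩, -⟩ :=
    LagBdry.exists_isOpen_of_eventually_formFilter S.eventually_deform
  refine ⟨𝒩, hop, h0, h𝒩, S.deform_zero, fun θ p ↦ ?_,
    S.exists_nhds_factorization (hop.mem_nhds h0)⟩
  obtain ⟨h1, h2⟩ := S.deriv_deform θ.1 p
  exact ⟨h1, _, h2, fun Y ↦ LagBdry.CalabiYau.omega_covectorField hf p (θ.1 p) Y⟩
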